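/- Let $G$ be a compact matrix quantum group with Hopf $*$-algebra $\mathcal A$ (coproduct, counit $\epsilon$, antipode $\kappa$), with a bicovariant graded-differential $*$-calculus $\Gamma^\star$, $\Gamma^0=\mathcal A$ (for instance the universal envelope of a first-order one). Put $\pi(a)=\kappa(a^{(1)})\,da^{(2)}$, $\Gamma_{inv}=\pi(\mathcal A)$, $\pi(a)\circ c=\pi(ac-\epsilon(a)c)$, and $\varpi\pi=(\pi\otimes\mathrm{id})\mathrm{ad}$. Let $P=(\mathcal B,i,F)$ be a quantum principal $G$-bundle over a quantum space $M$ with algebra $\mathcal V$, and let $\Omega(P)$ be a graded-differential $*$-algebra generated by $\Omega^0(P)=\mathcal B$, to which $F$ extends as a homomorphism $\widehat F\colon\Omega(P)\to\Omega(P)\widehat\otimes\Gamma^\star$ of graded-differential $*$-algebras. Let $\mathfrak{hor}(P)=\widehat F^{-1}(\Omega(P)\otimes\mathcal A)$, let $F^\wedge$ be the induced coaction of $\mathcal A$ on $\Omega(P)$, let $\Omega(M)$ be the algebra of $\widehat F$-invariant forms, $Z(M)$ its graded centre, and $HZ(M)$ the cohomology of $(Z(M),d)$; elements of $Z(M)$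 and of $HZ(M)$ are understood as formal (possibly infinite) series of homogeneous elements. A connection is a hermitian linear map $\omega\colon\Gamma_{inv}\to\Omega^1(P)$ with $\widehat F\omega(\vartheta)=(\omega\otimes\mathrm{id})\varpi(\vartheta)+1\otimes\vartheta$. It is regular if $\omega(\vartheta)\varphi=(-1)^{\partial\varphi}\sum_k\varphi_k\,\omega(\vartheta\circ c_k)$ for every horizontal $\varphi$, where $F^\wedge(\varphi)=\sum_k\varphi_k\otimes c_k$. Assume that a regular connection exists. For a finite-dimensional unitary representation $u$ of $G$ on $H_u$ with orthonormal basis $(e_i)$ let $\mathcal F_u=\mathrm{Mor}(u,F^\wedge)$ (intertwiners with values in $\mathfrak{hor}(P)$), with degree $0$ part $\mathcal E_u=\mathrm{Mor}(u,F)$, and $\mathcal F_u^*=\mathrm{Mor}(u^c,F^\wedge)$ for the contragredient $u^c$. Let $C_u$ be the canonical strictly positive intertwiner from $u$ to $u^{cc}$, normalized by $\mathrm{tr}(C_uf)=\mathrm{tr}(C_u^{-1}f)$ for $f\in\mathrm{Mor}(u,u)$; put $\langle\varphi,\psi\rangle_u^+=\sum_i\varphi(e_i)\psi(e_i^*)$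 and $\langle\psi,\varphi\rangle_u^-=\sum_{ij}(C_u^{-1})_{ji}\psi(e_i^*)\varphi(e_j)$. There are $\nu_k\in\mathcal E_u^*$, $\mu_k\in\mathcal E_u$ (finitely many) with $\sum_k\nu_k(e_i^*)\mu_k(e_j)=\delta_{ij}$, and for left $\mathcal V$-linear $T\colon\mathcal E_u\to\mathcal F_u$ the trace $\mathrm{tr}_M(T)=\sum_k\langle\nu_k,T\mu_k\rangle_u^-$ does not depend on their choice. For a regular connection $\omega$ let $D_\omega(\varphi)$ be the horizontal component of $d\varphi$ ($\varphi$ horizontal; this component is well defined modulo $\mathfrak{hor}(P)\,\omega(\Gamma_{inv})$, and equals $d\varphi-(-1)^{\partial\varphi}\sum_k\varphi_k\,\omega\pi(c_k)$), and let $D_{\omega,u}$ be composition with $D_\omega$ on $\mathcal F_u$. Define $$\mathfrak{ch}^u(A)=\sum_{k\ge0}\frac{1}{(2\pi i)^k\,k!}\,\mathrm{tr}_M\bigl(A\,D_{\omega,u}^{2k}\bigr)$$ for $A\in Z(M)$ acting on $\mathcal F_u$ by left multiplication, and by the same formula for operators $A$ on $\mathcal F_u$. Then: (i) For every regular $\omega$,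 $\mathfrak{ch}^u$ maps $Z(M)$ to $Z(M)$, $\mathfrak{ch}^{u\oplus v}(A)=\mathfrak{ch}^u(A)+\mathfrak{ch}^v(A)$, and $\mathfrak{ch}^{u\times v}(A\otimes B)=\mathfrak{ch}^v(\mathfrak{ch}^u(A)B)$ for $A,B\in Z(M)$, where $A\otimes B$ is the (existing) operator $\varphi\otimes\psi\mapsto(-1)^{\partial B\,\partial\varphi}A\varphi\otimes B\psi$ on $\mathcal F_{u\times v}$, $(\varphi\otimes\psi)(x\otimes y)=\varphi(x)\psi(y)$. (ii) $d\,\mathfrak{ch}^u(A)=\mathfrak{ch}^u(dA)$, and the induced map $\mathfrak{ch}^u\colon HZ(M)\to HZ(M)$ does not depend on the regular connection $\omega$. (iii) Write $\mathcal F_u\sim\mathcal F_v$ if there is an isomorphism $J\colon\mathcal F_u\to\mathcal F_v$ of graded $\Omega(M)$-bimodules that is transposable, i.e. there is $J'\colon\mathcal F_v^*\to\mathcal F_u^*$ with $\langle\varphi,Jx\rangle_v^-=\langle J'\varphi,x\rangle_u^-$ and $\langle Jx,\varphi\rangle_v^+=\langle x,J'\varphi\rangle_u^+$ for all $x\in\mathcal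 F_u$, $\varphi\in\mathcal F_v^*$. This is an equivalence relation, compatible with sums and products of representations, and equivalent representations give equivalent bimodules. Let $K(G)$ and $K(M,P)$ be the $K$-rings (universal rings) of the semirings of representations modulo equivalence of representations and modulo $\sim$, respectively. There is a surjective ring homomorphism $p_M\colon K(G)\to K(M,P)$, $[u]\mapsto[\mathcal F_u]$. The maps $\mathfrak{ch}^u$ define a right $K(G)$-module structure $\mathfrak{ch}\colon HZ(M)\times K(G)\to HZ(M)$, $(x,[u])\mapsto\mathfrak{ch}^u(x)$, and there is a unique map $\mathfrak{ch}_M\colon HZ(M)\times K(M,P)\to HZ(M)$ with $\mathfrak{ch}_M(x,p_M(k))=\mathfrak{ch}(x,k)$ for all $x,k$; it makes $HZ(M)$ a right $K(M,P)$-module (the quantum Chern character). -/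

import Mathlib

open scoped TensorProduct Matrix ComplexOrder

noncomputable section

namespace QPB

/-! ### Graded-differential `*`-algebras -/

/-- A graded-differential `*`-algebra over `ℂ`, graded by `ℕ`, with the graded conventions
`d(ab) = d(a) b + (-1)^∂a a d(b)`, `(ab)* = (-1)^(∂a ∂b) b* a*`, `d(a*) = d(a)*`. -/
class DGStarAlgebra (Ω : Type*) [Ring Ω] [Algebra ℂ Ω] where
  /-- the homogeneous components -/
  gr : ℕ → Submodule ℂ Ω
  [gradedAlgebra : GradedAlgebra gr]
  /-- the differential -/
  d : Ω →ₗ[ℂ] Ω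
  /-- the antilinear involution -/
  conj : Ω →ₛₗ[starRingEnd ℂ] Ω
  d_mem : ∀ {n : ℕ} {a : Ω}, a ∈ gr n → d a ∈ gr (n + 1)
  d_d : ∀ a, d (d a) = 0
  leibniz : ∀ {n : ℕ} {a : Ω}, a ∈ gr n → ∀ b, d (a * b) = d a * b + (-1 : ℂ) ^ n • (a * d b)
  conj_mem : ∀ {n : ℕ} {a : Ω}, a ∈ gr n → conj a ∈ gr n
  conj_conj : ∀ a, conj (conj a) = a
  conj_mul : ∀ {m n : ℕ} {a b : Ω}, a ∈ gr m → b ∈ gr n →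
    conj (a * b) = (-1 : ℂ) ^ (m * n) • (conj b * conj a)
  conj_d : ∀ a, conj (d a) = d (conj a)

attribute [reducible, instance] DGStarAlgebra.gradedAlgebra

section DG

variable (Ω : Type*) [Ring Ω] [Algebra ℂ Ω] [DGStarAlgebra Ω]

/-- The homogeneous component of degree `n`. -/
abbrev gr (n : ℕ) : Submodule ℂ Ω := DGStarAlgebra.gr n

variable {Ω}

/-- The differential. -/
abbrev dif : Ω →ₗ[ℂ] Ω := DGStarAlgebra.d

/-- The antilinear involution. -/
abbrev conj : Ω →ₛₗ[starRingEnd ℂ] Ω := DGStarAlgebra.conj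

/-- The parity operator `w ↦ (-1)^∂w w`. -/
def parity : Ω →ₗ[ℂ] Ω :=
  DirectSum.toModule ℂ ℕ Ω (fun n => (-1 : ℂ) ^ n • (gr Ω n).subtype) ∘ₗ
    (DirectSum.decomposeLinearEquiv (gr Ω)).toLinearMap

variable {Ω' : Type*} [Ring Ω'] [Algebra ℂ Ω'] [DGStarAlgebra Ω']

/-- The differential `d(w ⊗ ϑ) = d(w) ⊗ ϑ + (-1)^∂w w ⊗ d(ϑ)` of the graded tensor product
of two graded-differential algebras. -/
def tensorDif : Ω ⊗[ℂ] Ω' →ₗ[ℂ] Ω ⊗[ℂ] Ω' :=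
  TensorProduct.map dif LinearMap.id + TensorProduct.map parity dif

/-- The underlying linear map of an algebra homomorphism into a graded tensor product
(whose product is `(w ⊗ ϑ)(w' ⊗ ϑ') = (-1)^(∂ϑ ∂w') ww' ⊗ ϑϑ'`). -/
def toTensor {Ω'' : Type*} [Ring Ω''] [Algebra ℂ Ω'']
    (f : Ω'' →ₐ[ℂ] GradedTensorProduct ℂ (gr Ω) (gr Ω')) : Ω'' →ₗ[ℂ] Ω ⊗[ℂ] Ω' :=
  (GradedTensorProduct.of ℂ (gr Ω) (gr Ω')).symm.toLinearMap ∘ₗ f.toLinearMap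

end DG

/-! ### Compact matrix quantum groups and their unitary representations -/

section UnitaryRep

variable (A : Type*) [Ring A] [StarRing A] [HopfAlgebra ℂ A]

/-- A finite-dimensional unitary representation `u` of the quantum group, written in an orthonormal
basis `(e_i)` of its carrier space: `u(e_j) = ∑ i, e_i ⊗ u i j`. -/
structure UnitaryRep where
  ι : Type
  [fintype : Fintype ι]
  [decidableEq : DecidableEq ι]
  /-- the matrix of coefficients -/
  mat : Matrix ι ι A
  comul_mat : ∀ i j, Coalgebra.comul (R := ℂ) (mat i j) = ∑ k, mat i k ⊗ₜ[ℂ] mat k j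
  counit_mat : ∀ i j, Coalgebra.counit (R := ℂ) (mat i j) = if i = j then 1 else 0
  unitary_left : matᴴ * mat = 1
  unitary_right : mat * matᴴ = 1

attribute [instance] UnitaryRep.fintype UnitaryRep.decidableEq

/-- `A` is the Hopf `*`-algebra of polynomial functions on a compact matrix quantum group:
it is finitely generated, and spanned by the matrix coefficients of its finite-dimensional
unitary representations. -/
structure IsCompactMatrixQuantumGroup [StarModule ℂ A] : Prop where
  comul_star : ∀ a : A, Coalgebra.comul (R := ℂ) (star a) = star (Coalgebra.comul (R := ℂ) a)
  finiteType : Algebra.FiniteType ℂ A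
  span_coeff : Submodule.span ℂ {a : A | ∃ (u : UnitaryRep A) (i j : u.ι), a = u.mat i j} = ⊤

variable {A}

namespace UnitaryRep

/-- The trivial representation `∅` in `ℂ`. -/
def trivial : UnitaryRep A where
  ι := Unit
  mat := 1
  comul_mat i j := by simp [Algebra.TensorProduct.one_def]
  counit_mat i j := by simp
  unitary_left := by simp
  unitary_right := by simp

/-- The direct sum `u ⊕ v`. -/
def sum (u v : UnitaryRep A) : UnitaryRep A where
  ι := u.ι ⊕ v.ι
  mat := Matrix.fromBlocks u.mat 0 0 v.mat
  comul_mat i j := by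
    rcases i with i | i <;> rcases j with j | j <;> simp [u.comul_mat, v.comul_mat]
  counit_mat i j := by
    rcases i with i | i <;> rcases j with j | j <;> simp [u.counit_mat, v.counit_mat]
  unitary_left := by
    simp [Matrix.fromBlocks_conjTranspose, Matrix.fromBlocks_multiply, u.unitary_left,
      v.unitary_left]
  unitary_right := by
    simp [Matrix.fromBlocks_conjTranspose, Matrix.fromBlocks_multiply, u.unitary_right,
      v.unitary_right]

/-- The product `u × v`, acting in the tensor product of the carrier spaces. -/
def prod (u v : UnitaryRep A) : UnitaryRep A where
  ι := u.ι × v.ι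
  mat := Matrix.of fun i j => u.mat i.1 j.1 * v.mat i.2 j.2
  comul_mat i j := by
    simp [Bialgebra.comul_mul, u.comul_mat, v.comul_mat, Finset.sum_mul_sum,
      Fintype.sum_prod_type]
  counit_mat i j := by
    rcases i with ⟨i, k⟩
    rcases j with ⟨j, l⟩
    simp only [Matrix.of_apply, Bialgebra.counit_mul, u.counit_mat, v.counit_mat, Prod.mk.injEq]
    split_ifs <;> simp_all
  unitary_left := by
    ext ⟨i, k⟩ ⟨j, l⟩
    have hu := congrFun (congrFun u.unitary_left i) j
    have hv := congrFun (congrFun v.unitary_left k) l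
    simp only [Matrix.mul_apply, Matrix.conjTranspose_apply, Matrix.one_apply] at hu hv
    simp only [Matrix.mul_apply, Matrix.conjTranspose_apply, Matrix.of_apply, star_mul,
      Fintype.sum_prod_type_right, Matrix.one_apply, Prod.mk.injEq]
    have : ∀ y x, star (v.mat y k) * star (u.mat x i) * (u.mat x j * v.mat y l)
        = star (v.mat y k) * (star (u.mat x i) * u.mat x j) * v.mat y l := by
      intros; simp only [mul_assoc]
    simp only [this, ← Finset.sum_mul, ← Finset.mul_sum, hu]
    by_cases h : i = j <;> simp [h, hv]
  unitary_right := by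
    ext ⟨i, k⟩ ⟨j, l⟩
    have hu := congrFun (congrFun u.unitary_right i) j
    have hv := congrFun (congrFun v.unitary_right k) l
    simp only [Matrix.mul_apply, Matrix.conjTranspose_apply, Matrix.one_apply] at hu hv
    simp only [Matrix.mul_apply, Matrix.conjTranspose_apply, Matrix.of_apply, star_mul,
      Fintype.sum_prod_type, Matrix.one_apply, Prod.mk.injEq]
    have : ∀ x y, u.mat i x * v.mat k y * (star (v.mat l y) * star (u.mat j x))
        = u.mat i x * (v.mat k y * star (v.mat l y)) * star (u.mat j x) := by
      intros; simp only [mul_assoc]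
    simp only [this, ← Finset.sum_mul, ← Finset.mul_sum, hv]
    by_cases h : k = l <;> simp [h, hu]

/-- Equivalence of representations: there is an invertible intertwiner. -/
def Equivalent (u v : UnitaryRep A) : Prop :=
  ∃ (f : Matrix v.ι u.ι ℂ) (g : Matrix u.ι v.ι ℂ), f * g = 1 ∧ g * f = 1 ∧
    f.map (algebraMap ℂ A) * u.mat = v.mat * f.map (algebraMap ℂ A)

end UnitaryRep

/-- The matrix of the contragredient representation in the dual basis `(e_i*)`:
`u^c(e_j*) = ∑ i, e_i* ⊗ κ(u j i)`. -/
def contra {ι : Type} (w : Matrix ι ι A) : Matrix ι ι A :=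
  (w.map (HopfAlgebra.antipode ℂ))ᵀ

/-- `C` is the canonical intertwiner between `u` and `u^cc`: strictly positive, and normalized by
`tr(C f) = tr(C⁻¹ f)` for all `f ∈ Mor(u,u)` (for irreducible `u` this is `tr(C) = tr(C⁻¹)`). -/
structure IsCanonicalIntertwiner (u : UnitaryRep A) (C : Matrix u.ι u.ι ℂ) : Prop where
  posDef : C.PosDef
  intertwines : C.map (algebraMap ℂ A) * u.mat = contra (contra u.mat) * C.map (algebraMap ℂ A)
  normalized : ∀ f : Matrix u.ι u.ι ℂ,
    f.map (algebraMap ℂ A) * u.mat = u.mat * f.map (algebraMap ℂ A) →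
      (C * f).trace = (C⁻¹ * f).trace

open Classical in
/-- The canonical intertwiner `C_u`. -/
def canonicalC (u : UnitaryRep A) : Matrix u.ι u.ι ℂ :=
  if h : ∃ C, IsCanonicalIntertwiner u C then h.choose else 1

end UnitaryRep

/-! ### Differential calculus on the quantum group -/

/-- A (higher-order) bicovariant `*`-calculus on the quantum group: a graded-differential
`*`-algebra `Γ` with `Γ⁰ = A`, generated by `A` as a differential algebra, to which the coproduct
extends as a homomorphism of graded-differential algebras. The extension is unique, and it
automatically preserves degrees and the involutions. The universal differential envelope `Γ^∧` of
a bicovariant first-order `*`-calculus and the braided exterior algebra `Γ^∨` are examples. -/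
structure GroupCalculus (A : Type*) [Ring A] [StarRing A] [HopfAlgebra ℂ A] (Γ : Type*) [Ring Γ]
    [Algebra ℂ Γ] [DGStarAlgebra Γ] where
  /-- the identification of `A` with the algebra of elements of degree `0` -/
  incl : A →ₐ[ℂ] Γ
  incl_injective : Function.Injective incl
  range_incl : LinearMap.range incl.toLinearMap = gr Γ 0
  incl_star : ∀ a, incl (star a) = conj (incl a)
  generates : Algebra.adjoin ℂ (Set.range incl ∪ Set.range fun a => dif (incl a)) = ⊤
  /-- the extended coproduct -/
  comulHat : Γ →ₐ[ℂ] GradedTensorProduct ℂ (gr Γ) (gr Γ)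
  comulHat_incl : ∀ a, toTensor comulHat (incl a) =
    TensorProduct.map incl.toLinearMap incl.toLinearMap (Coalgebra.comul (R := ℂ) a)
  comulHat_d : ∀ ϑ, toTensor comulHat (dif ϑ) = tensorDif (toTensor comulHat ϑ)

namespace GroupCalculus

variable {A : Type*} [Ring A] [StarRing A] [HopfAlgebra ℂ A] {Γ : Type*} [Ring Γ]
  [Algebra ℂ Γ] [DGStarAlgebra Γ] (G : GroupCalculus A Γ)

/-- `A` is identified with `Γ⁰`. -/
def inclEquiv : A ≃ₗ[ℂ] gr Γ 0 :=
  (LinearEquiv.ofInjective G.incl.toLinearMap G.incl_injective).trans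
    (LinearEquiv.ofEq _ _ G.range_incl)

/-- The projection map `p_* : Γ → A` onto the component of degree `0`. -/
def proj : Γ →ₗ[ℂ] A :=
  G.inclEquiv.symm.toLinearMap ∘ₗ DirectSum.component ℂ ℕ (fun n => gr Γ n) 0 ∘ₗ
    (DirectSum.decomposeLinearEquiv (gr Γ)).toLinearMap

/-- The map `π(a) = κ(a⁽¹⁾) d(a⁽²⁾)`. -/
def piMap : A →ₗ[ℂ] Γ :=
  LinearMap.mul' ℂ Γ ∘ₗ TensorProduct.map (G.incl.toLinearMap ∘ₗ HopfAlgebra.antipode ℂ)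
    (dif ∘ₗ G.incl.toLinearMap) ∘ₗ Coalgebra.comul

/-- The space `Γ_inv = π(A)` of left-invariant first-order forms. -/
def inv : Submodule ℂ Γ := LinearMap.range G.piMap

/-- The surjection `π : A → Γ_inv`. -/
def piInv : A →ₗ[ℂ] G.inv := G.piMap.rangeRestrict

end GroupCalculus

/-- The adjoint action `ad(a) = a⁽²⁾ ⊗ κ(a⁽¹⁾) a⁽³⁾`. -/
def ad (A : Type*) [Ring A] [HopfAlgebra ℂ A] : A →ₗ[ℂ] A ⊗[ℂ] A :=
  TensorProduct.map LinearMap.id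
      (LinearMap.mul' ℂ A ∘ₗ TensorProduct.map (HopfAlgebra.antipode ℂ) LinearMap.id) ∘ₗ
    (TensorProduct.leftComm ℂ A A A).toLinearMap ∘ₗ
    TensorProduct.map LinearMap.id Coalgebra.comul ∘ₗ Coalgebra.comul

/-! ### Quantum principal bundles -/

/-- A quantum principal bundle `P = (B, i, F)` over the quantum space `M` represented by `V`. -/
structure Bundle (A : Type*) [Ring A] [StarRing A] [HopfAlgebra ℂ A] [StarModule ℂ A]
    (V : Type*) [Ring V] [StarRing V] [Algebra ℂ V] [StarModule ℂ V]
    (B : Type*) [Ring B] [StarRing B] [Algebra ℂ B] [StarModule ℂ B] where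
  /-- the dualized projection of `P` on `M` -/
  i : V →⋆ₐ[ℂ] B
  /-- the dualized right action of the group on `P` -/
  F : B →⋆ₐ[ℂ] B ⊗[ℂ] A
  i_injective : Function.Injective i
  range_i : ∀ b : B, b ∈ Set.range i ↔ F b = b ⊗ₜ 1
  coassoc : ∀ b, TensorProduct.assoc ℂ B A A
      (TensorProduct.map (F : B →ₗ[ℂ] B ⊗[ℂ] A) LinearMap.id (F b)) =
    TensorProduct.map LinearMap.id Coalgebra.comul (F b)
  counit : ∀ b, TensorProduct.rid ℂ B (TensorProduct.map LinearMap.id Coalgebra.counit (F b)) = b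
  /-- freeness of the action: `B ⊗ B → B ⊗ A`, `q ⊗ b ↦ q F(b)`, is surjective -/
  free : Submodule.span ℂ {x : B ⊗[ℂ] A | ∃ q b : B, x = (q ⊗ₜ 1) * F b} = ⊤

/-- A differential calculus `Ω = Ω(P)` on the bundle: a graded-differential `*`-algebra with
`Ω⁰ = B`, generated by `B` as a differential algebra, to which the right action `F` extends as a
homomorphism `F^ : Ω → Ω ⊗^ Γ` of graded-differential algebras. The extension is unique, and it
automatically preserves degrees and the involutions. -/
structure BundleCalculus {A : Type*} [Ring A] [StarRing A] [HopfAlgebra ℂ A] [StarModule ℂ A]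
    {Γ : Type*} [Ring Γ] [Algebra ℂ Γ] [DGStarAlgebra Γ] (G : GroupCalculus A Γ)
    {V : Type*} [Ring V] [StarRing V] [Algebra ℂ V] [StarModule ℂ V]
    {B : Type*} [Ring B] [StarRing B] [Algebra ℂ B] [StarModule ℂ B] (P : Bundle A V B)
    (Ω : Type*) [Ring Ω] [Algebra ℂ Ω] [DGStarAlgebra Ω] where
  /-- the identification of `B` with the algebra of elements of degree `0` -/
  incl : B →ₐ[ℂ] Ω
  incl_injective : Function.Injective incl
  range_incl : LinearMap.range incl.toLinearMap = gr Ω 0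
  incl_star : ∀ b, incl (star b) = conj (incl b)
  generates : Algebra.adjoin ℂ (Set.range incl ∪ Set.range fun b => dif (incl b)) = ⊤
  /-- the extended right action -/
  FHat : Ω →ₐ[ℂ] GradedTensorProduct ℂ (gr Ω) (gr Γ)
  FHat_incl : ∀ b, toTensor FHat (incl b) =
    TensorProduct.map incl.toLinearMap G.incl.toLinearMap (P.F b)
  FHat_d : ∀ w, toTensor FHat (dif w) = tensorDif (toTensor FHat w)

namespace BundleCalculus

variable {A : Type*} [Ring A] [StarRing A] [HopfAlgebra ℂ A] [StarModule ℂ A]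
  {Γ : Type*} [Ring Γ] [Algebra ℂ Γ] [DGStarAlgebra Γ] {G : GroupCalculus A Γ}
  {V : Type*} [Ring V] [StarRing V] [Algebra ℂ V] [StarModule ℂ V]
  {B : Type*} [Ring B] [StarRing B] [Algebra ℂ B] [StarModule ℂ B] {P : Bundle A V B}
  {Ω : Type*} [Ring Ω] [Algebra ℂ Ω] [DGStarAlgebra Ω] (S : BundleCalculus G P Ω)

/-- The right action `F^∧ = (id ⊗ p_*) F^` of the quantum group on `Ω(P)`. -/
def Fwedge : Ω →ₗ[ℂ] Ω ⊗[ℂ] A :=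
  TensorProduct.map LinearMap.id G.proj ∘ₗ toTensor S.FHat

/-- The space of horizontal forms, `hor(P) = F^⁻¹(Ω(P) ⊗ A)`. -/
def hor : Submodule ℂ Ω :=
  (LinearMap.range (TensorProduct.map (LinearMap.id : Ω →ₗ[ℂ] Ω) G.incl.toLinearMap)).comap
    (toTensor S.FHat)

/-- The space `Ω(M)` of differential forms on the base: the `F^`-invariant forms. -/
def base : Submodule ℂ Ω where
  carrier := {w | toTensor S.FHat w = w ⊗ₜ 1}
  add_mem' := by
    intro a b ha hb
    simp only [Set.mem_ofPred_eq] at *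
    rw [map_add, ha, hb, TensorProduct.add_tmul]
  zero_mem' := by simp
  smul_mem' := by
    intro c a ha
    simp only [Set.mem_ofPred_eq] at *
    rw [map_smul, ha, TensorProduct.smul_tmul']

/-- The component `Zⁿ(M)` of the graded centre of `Ω(M)`. -/
def center (n : ℕ) : Submodule ℂ Ω where
  carrier := {z | z ∈ gr Ω n ∧ z ∈ S.base ∧
    ∀ (m : ℕ) (α : Ω), α ∈ gr Ω m → α ∈ S.base → z * α = (-1 : ℂ) ^ (n * m) • (α * z)}
  add_mem' := by
    rintro a b ⟨ha, ha', ha''⟩ ⟨hb, hb', hb''⟩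
    refine ⟨add_mem ha hb, add_mem ha' hb', fun m α h h' => ?_⟩
    rw [add_mul, mul_add, smul_add, ha'' m α h h', hb'' m α h h']
  zero_mem' := ⟨zero_mem _, zero_mem _, by simp⟩
  smul_mem' := by
    rintro c a ⟨ha, ha', ha''⟩
    refine ⟨Submodule.smul_mem _ c ha, Submodule.smul_mem _ c ha', fun m α h h' => ?_⟩
    rw [smul_mul_assoc, mul_smul_comm, smul_comm, ha'' m α h h']

/-- `Mor(w, F^∧)`: the intertwiners between the representation with matrix `w` and `F^∧`, with
values in horizontal forms; `φ` is given by its values `φ j = φ(e_j)` on the basis. -/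
def intertwiners {ι : Type} [Fintype ι] (w : Matrix ι ι A) : Submodule ℂ (ι → Ω) where
  carrier := {φ | ∀ j, φ j ∈ S.hor ∧ S.Fwedge (φ j) = ∑ i, φ i ⊗ₜ w i j}
  add_mem' := by
    intro a b ha hb j
    refine ⟨add_mem (ha j).1 (hb j).1, ?_⟩
    simp [(ha j).2, (hb j).2, TensorProduct.add_tmul, Finset.sum_add_distrib]
  zero_mem' := by intro j; simp
  smul_mem' := by
    intro c a ha j
    refine ⟨Submodule.smul_mem _ c (ha j).1, ?_⟩
    simp [(ha j).2, TensorProduct.smul_tmul', Finset.smul_sum]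

/-- The `Ω(M)`-bimodule `H_u = Mor(u, F^∧)` of vector bundle valued forms. -/
abbrev H (u : UnitaryRep A) : Submodule ℂ (u.ι → Ω) := S.intertwiners u.mat

/-- The bimodule `H_u^* = Mor(u^c, F^∧)`. -/
abbrev HDual (u : UnitaryRep A) : Submodule ℂ (u.ι → Ω) := S.intertwiners (contra u.mat)

/-- The pairing `⟨φ, ψ⟩⁺ = ∑ i, φ(e_i) ψ(e_i*)`, for `φ ∈ H_u` and `ψ ∈ H_u^*`. -/
def pairPlus (u : UnitaryRep A) (φ ψ : u.ι → Ω) : Ω := ∑ i, φ i * ψ i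

/-- The pairing `⟨ψ, φ⟩⁻ = ∑ i j, (C_u⁻¹)_{ji} ψ(e_i*) φ(e_j)`, for `φ ∈ H_u`, `ψ ∈ H_u^*`. -/
def pairMinus (u : UnitaryRep A) (ψ φ : u.ι → Ω) : Ω :=
  ∑ i, ∑ j, (canonicalC u)⁻¹ j i • (ψ i * φ j)

/-! ### The canonical trace -/

/-- The finite family `(ν_k, μ_k)` represents the element `γ(1) = ∑ k, ν_k ⊗ μ_k` of
`E_u^* ⊗_M E_u` induced by the contraction map: `∑ k, ν_k(e_i*) μ_k(e_j) = δ_ij`.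
Here `E_u = Mor(u, F)` is the part of degree `0` of `H_u`, and similarly for `E_u^*`. -/
def IsDualFamily (u : UnitaryRep A) (L : List ((u.ι → Ω) × (u.ι → Ω))) : Prop :=
  (∀ p ∈ L, p.1 ∈ S.HDual u ∧ (∀ i, p.1 i ∈ gr Ω 0) ∧ p.2 ∈ S.H u ∧ ∀ i, p.2 i ∈ gr Ω 0) ∧
    ∀ i j, (L.map fun p => p.1 i * p.2 j).sum = if i = j then 1 else 0

/-- `∑ k, ⟨ν_k, T(μ_k)⟩⁻`. -/
def traceAlong (u : UnitaryRep A) (L : List ((u.ι → Ω) × (u.ι → Ω)))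
    (T : (u.ι → Ω) → (u.ι → Ω)) : Ω :=
  (L.map fun p => pairMinus u p.1 (T p.2)).sum

/-- `T` is additive and left `V`-linear on `E_u`. -/
def IsLeftLinear (u : UnitaryRep A) (T : (u.ι → Ω) → (u.ι → Ω)) : Prop :=
  (∀ μ μ' : u.ι → Ω, μ ∈ S.H u → (∀ i, μ i ∈ gr Ω 0) → μ' ∈ S.H u → (∀ i, μ' i ∈ gr Ω 0) →
    T (μ + μ') = T μ + T μ') ∧
  ∀ (f : V) (μ : u.ι → Ω), μ ∈ S.H u → (∀ i, μ i ∈ gr Ω 0) →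
    T (fun i => S.incl (P.i f) * μ i) = fun i => S.incl (P.i f) * T μ i

open Classical in
/-- The canonical trace `tr_M(T) = ∑ k, ⟨ν_k, T(μ_k)⟩⁻`, for a left `V`-linear
`T : E_u → H_u`. -/
def trM (u : UnitaryRep A) (T : (u.ι → Ω) → (u.ι → Ω)) : Ω :=
  if h : ∃ L, S.IsDualFamily u L then traceAlong u h.choose T else 0

/-! ### Connections and covariant derivatives -/

/-- A connection: a hermitian first-order linear map `ω : Γ_inv → Ω(P)` satisfying
`F^ω(ϑ) = (ω ⊗ id)ϖ(ϑ) + 1 ⊗ ϑ`, where `ϖ π = (π ⊗ id) ad`. -/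
structure Connection where
  ω : G.inv →ₗ[ℂ] Ω
  mem_gr : ∀ ϑ, ω ϑ ∈ gr Ω 1
  hermitian : ∀ ϑ η : G.inv, (η : Γ) = conj (ϑ : Γ) → ω η = conj (ω ϑ)
  FHat_ω : ∀ a : A, toTensor S.FHat (ω (G.piInv a)) =
    TensorProduct.map (ω ∘ₗ G.piInv) G.incl.toLinearMap (ad A a) + 1 ⊗ₜ (G.piInv a : Γ)

/-- The map `∑ k, φ_k ⊗ c_k ↦ ∑ k, φ_k g(c_k)`. -/
def mulRight (g : A →ₗ[ℂ] Ω) : Ω ⊗[ℂ] A →ₗ[ℂ] Ω :=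
  LinearMap.mul' ℂ Ω ∘ₗ TensorProduct.map LinearMap.id g

namespace Connection

variable {S} (ω : S.Connection)

/-- `ω` is regular: `ω(ϑ) φ = (-1)^∂φ ∑ k, φ_k ω(ϑ ∘ c_k)` for every horizontal `φ`, where
`F^∧(φ) = ∑ k, φ_k ⊗ c_k` and `π(a) ∘ c = π(a c - ε(a) c)`. -/
def IsRegular : Prop :=
  ∀ (a : A) (n : ℕ) (φ : Ω), φ ∈ S.hor → φ ∈ gr Ω n →
    ω.ω (G.piInv a) * φ = (-1 : ℂ) ^ n • mulRight
      (ω.ω ∘ₗ G.piInv ∘ₗ (LinearMap.mulLeft ℂ a -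
        Coalgebra.counit (R := ℂ) a • LinearMap.id)) (S.Fwedge φ)

/-- The covariant derivative on horizontal forms, `D_ω(φ) = d(φ) - (-1)^∂φ ∑ k, φ_k ω(π(c_k))`
with `F^∧(φ) = ∑ k, φ_k ⊗ c_k`: the horizontal component of `d(φ)`. -/
def D : Ω →ₗ[ℂ] Ω :=
  dif - mulRight (ω.ω ∘ₗ G.piInv) ∘ₗ S.Fwedge ∘ₗ parity

/-- The space `hor(P) ω(Γ_inv)`. -/
def vertOne : Submodule ℂ Ω := S.hor * LinearMap.range ω.ω

/-- The map `D_{ω,u}`: composition of intertwiners with `D_ω`. -/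
def Drep (u : UnitaryRep A) : Module.End ℂ (u.ι → Ω) :=
  LinearMap.pi fun i => ω.D ∘ₗ LinearMap.proj i

end Connection

/-! ### Formal series of forms, and the cohomology of the graded centre -/

/-- The formal series `∑ n, z n` with `z n ∈ Zⁿ(M)`. -/
def Z : Submodule ℂ (ℕ → Ω) := Submodule.pi Set.univ S.center

/-- The differential of formal series. -/
def dSeries : (ℕ → Ω) →ₗ[ℂ] (ℕ → Ω) :=
  LinearMap.pi fun n => Nat.casesOn n 0 fun m => dif ∘ₗ LinearMap.proj m

/-- The product of formal series. -/
def mulSeries (a b : ℕ → Ω) : ℕ → Ω :=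
  fun n => ∑ p ∈ Finset.HasAntidiagonal.antidiagonal n, a p.1 * b p.2

/-- Closed elements of `Z(M)`. -/
def cocycles : Submodule ℂ (ℕ → Ω) := S.Z ⊓ LinearMap.ker dSeries

/-- The coboundaries `d(Z(M))`. -/
def coboundaries : Submodule ℂ (ℕ → Ω) := S.Z.map dSeries

/-- The cohomology `HZ(M)` of the complex `Z(M)`. -/
abbrev HZ : Type _ := S.cocycles ⧸ S.coboundaries.comap S.cocycles.subtype

/-- The class in `HZ(M)` of a closed element. -/
def cls (z : S.cocycles) : S.HZ := Submodule.Quotient.mk z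

/-! ### The maps `ch^u` -/

namespace Connection

variable {S} (ω : S.Connection)

/-- For a formal series `T = ∑ n, T n` of operators on `H_u`, where `T n` raises degrees by `n`,
the formal series `∑ k, (2πi)^(-k) (k!)⁻¹ tr_M(T D_{ω,u}^(2k))`. -/
def chSeries (u : UnitaryRep A) (T : ℕ → (u.ι → Ω) → (u.ι → Ω)) : ℕ → Ω := fun n =>
  ∑ k ∈ Finset.range (n / 2 + 1),
    ((2 * (Real.pi : ℂ) * Complex.I) ^ k * (k.factorial : ℂ))⁻¹ •
      S.trM u fun μ => T (n - 2 * k) ((ω.Drep u ^ (2 * k)) μ)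

/-- `ch^u(z) = ∑ k, (2πi)^(-k) (k!)⁻¹ tr_M(z D_{ω,u}^(2k))`, where `z` acts by left
multiplication. -/
def ch (u : UnitaryRep A) (z : ℕ → Ω) : ℕ → Ω :=
  ω.chSeries u fun n φ i => z n * φ i

end Connection

/-- The product `φ ⊗ ψ : e_i ⊗ e_j ↦ φ(e_i) ψ(e_j)` in `H_{u×v}` of `φ ∈ H_u` and `ψ ∈ H_v`. -/
def tensor {u v : UnitaryRep A} (φ : u.ι → Ω) (ψ : v.ι → Ω) : (u.prod v).ι → Ω :=
  fun i : u.ι × v.ι => φ i.1 * ψ i.2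

/-- `T` is (the series of homogeneous components of) the operator `a ⊗ b` on
`H_{u×v} = H_u ⊗_M H_v`, `(a ⊗ b)(φ ⊗ ψ) = (-1)^(∂b ∂φ) aφ ⊗ bψ`. -/
def IsTensorOperator (u v : UnitaryRep A) (a b : ℕ → Ω)
    (T : ℕ → ((u.prod v).ι → Ω) →ₗ[ℂ] ((u.prod v).ι → Ω)) : Prop :=
  ∀ (m p : ℕ) (φ : u.ι → Ω) (ψ : v.ι → Ω), φ ∈ S.H u → (∀ i, φ i ∈ gr Ω p) → ψ ∈ S.H v →
    T m (tensor φ ψ) = ∑ q ∈ Finset.HasAntidiagonal.antidiagonal m, (-1 : ℂ) ^ (q.2 * p) •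
      tensor (fun i => a q.1 * φ i) (fun j => b q.2 * ψ j)

/-! ### Equivalence of vector bundles and `K`-rings -/

/-- `J` is a transposable isomorphism of graded `Ω(M)`-bimodules `H_u → H_v`: it has one map
`J'` as its transposed operator with respect to both pairings. -/
structure IsTransposableIso {u v : UnitaryRep A} (J : S.H u ≃ₗ[ℂ] S.H v) : Prop where
  degree : ∀ (n : ℕ) (x : S.H u), (∀ i, x.1 i ∈ gr Ω n) → ∀ j, (J x).1 j ∈ gr Ω n
  left : ∀ α ∈ S.base, ∀ x y : S.H u,
    (∀ i, y.1 i = α * x.1 i) → ∀ j, (J y).1 j = α * (J x).1 j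
  right : ∀ α ∈ S.base, ∀ x y : S.H u,
    (∀ i, y.1 i = x.1 i * α) → ∀ j, (J y).1 j = (J x).1 j * α
  transposable : ∃ J' : S.HDual v → S.HDual u, ∀ (φ : S.HDual v) (x : S.H u),
    pairMinus v φ.1 (J x).1 = pairMinus u (J' φ).1 x.1 ∧
      pairPlus v (J x).1 φ.1 = pairPlus u x.1 (J' φ).1

/-- The relation `H_u ∼ H_v`: there is a transposable isomorphism. -/
def BundleEquiv (u v : UnitaryRep A) : Prop := ∃ J : S.H u ≃ₗ[ℂ] S.H v, S.IsTransposableIso J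

end BundleCalculus

section KRing

variable {A : Type*} [Ring A] [StarRing A] [HopfAlgebra ℂ A]

/-- The defining relations of the `K`-ring of representations modulo a relation `r`. -/
inductive KRel (r : UnitaryRep A → UnitaryRep A → Prop) : FreeAlgebra ℤ (UnitaryRep A) → FreeAlgebra ℤ (UnitaryRep A) → Prop
  | rel (u v : UnitaryRep A) : r u v → KRel r (FreeAlgebra.ι ℤ u) (FreeAlgebra.ι ℤ v)
  | sum (u v : UnitaryRep A) :
      KRel r (FreeAlgebra.ι ℤ (u.sum v)) (FreeAlgebra.ι ℤ u + FreeAlgebra.ι ℤ v)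
  | prod (u v : UnitaryRep A) :
      KRel r (FreeAlgebra.ι ℤ (u.prod v)) (FreeAlgebra.ι ℤ u * FreeAlgebra.ι ℤ v)
  | one : KRel r (FreeAlgebra.ι ℤ UnitaryRep.trivial) 1

/-- The `K`-ring (universal ring) of the semiring of classes of representations modulo an
equivalence relation `r` compatible with sums and products. -/
abbrev KRing (r : UnitaryRep A → UnitaryRep A → Prop) : Type _ := RingQuot (KRel r)

/-- The class of a representation in the `K`-ring. -/
def KRing.mk (r : UnitaryRep A → UnitaryRep A → Prop) (u : UnitaryRep A) : KRing r :=
  RingQuot.mkRingHom (KRel r) (FreeAlgebra.ι ℤ u)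

variable (A) in
/-- The ring `K(G)`. -/
abbrev KG : Type _ := KRing (UnitaryRep.Equivalent (A := A))

/-- The ring `K(M,P)`. -/
abbrev BundleCalculus.KMP [StarModule ℂ A]
    {Γ : Type*} [Ring Γ] [Algebra ℂ Γ] [DGStarAlgebra Γ] {G : GroupCalculus A Γ}
    {V : Type*} [Ring V] [StarRing V] [Algebra ℂ V] [StarModule ℂ V]
    {B : Type*} [Ring B] [StarRing B] [Algebra ℂ B] [StarModule ℂ B] {P : Bundle A V B}
    {Ω : Type*} [Ring Ω] [Algebra ℂ Ω] [DGStarAlgebra Ω] (S : BundleCalculus G P Ω) : Type _ :=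
  KRing S.BundleEquiv

end KRing

end QPB

end

/-! The construction is Chern–Weil theory. The covariant derivative of a regular connection acts on
`H u = Mor(u, F^∧)` like a connection on a vector bundle, and contraction against a finite dual
family plays the role of the fibre trace. Two facts carry it: the elements of `H u` expand over
finitely many intertwiners of degree 0, and `D_ω` is a graded derivation on horizontal forms.

Representation theory comes first. A canonical intertwiner is a minimum of `tr C + tr C⁻¹` over the
positive definite intertwiners between `u` and `u^cc`; such intertwiners exist because every
corepresentation embeds into a unitary one, and stationarity at the minimum is the normalization
(`exists_isCanonicalIntertwiner`). Positivity of traces gives uniqueness and commutation with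
`Mor(u, u)`. Applied to `u ⊕ v` this gives naturality, and partial traces give `C_{u×v} = C_u ⊗
C_v`. Hence `⟨ , ⟩⁻` takes values in the base and respects sums, products and intertwiners.

Unitarity also yields an invariant functional (`exists_haar`). Averaging with it turns freeness of
the action into a dual family (`exists_dualFamily`), and shows that the values of intertwiners span
the horizontal forms (`hor_le_span`). Identities between linear maps on horizontal forms may
therefore be checked on matrix coefficients, which is how regularity becomes the Leibniz rule
(`Connection.D_mul`).

The trace of a bimodule endomorphism lies in the graded centre (`trH_mem_center`). Differentiating
`∑ ν_k μ_k = δ` gives `d tr T = tr(D T) - (-1)^∂T tr(T D)` (`isTraceConnection`), and since `D`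
commutes with its powers, `d ch(z) = ch(dz)`. For two connections on one bimodule, the derivative of
`(D + t(D' - D))^(2k)` in `t` is an anticommutator with an odd polynomial whose coefficients are
bimodule endomorphisms. Against a closed central form its trace is exact, and integration over `[0,
1]` gives the transgression form (`exists_transgression`).

Multiplicativity holds because `D²` is an ungraded derivation: `D^(2k)` obeys the binomial formula,
the weights `1/k!` turn it into a product of series, and the pairings of `u × v` nest
(`IsTensorOperator.chSeries`).

A transposable isomorphism preserves traces (`trH_conj`), so it carries the covariant derivative of
`H v` to some trace connection on `H u`. This need not be the covariant derivative of `H u`, but the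
transgression compares any two trace connections. Equivalent bundles thus act equally on cohomology,
the action descends to `K(M,P)`, and surjectivity of `K(G) → K(M,P)` gives uniqueness. -/

open scoped TensorProduct Matrix ComplexOrder

noncomputable section

namespace QPB

set_option linter.unusedSectionVars false

/-! ### Matrix corepresentations -/

section Corep

variable {A : Type*} [Ring A] [HopfAlgebra ℂ A]

/-- The matrix `w` is a finite-dimensional corepresentation of `A`. -/
structure IsCorep {ι : Type} [Fintype ι] [DecidableEq ι] (w : Matrix ι ι A) : Prop where
  comul : ∀ i j, Coalgebra.comul (R := ℂ) (w i j) = ∑ k, w i k ⊗ₜ[ℂ] w k j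
  counit : ∀ i j, Coalgebra.counit (R := ℂ) (w i j) = if i = j then 1 else 0

namespace IsCorep

variable {ι : Type} [Fintype ι] [DecidableEq ι] {w : Matrix ι ι A}

theorem antipode_mul (hw : IsCorep w) : w.map (HopfAlgebra.antipode ℂ) * w = 1 := by
  ext i j
  have := HopfAlgebra.mul_antipode_rTensor_comul_apply (R := ℂ) (w i j)
  rw [hw.comul, hw.counit] at this
  simpa [Matrix.mul_apply, Matrix.one_apply, apply_ite] using this

theorem mul_antipode (hw : IsCorep w) : w * w.map (HopfAlgebra.antipode ℂ) = 1 := by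
  ext i j
  have := HopfAlgebra.mul_antipode_lTensor_comul_apply (R := ℂ) (w i j)
  rw [hw.comul, hw.counit] at this
  simpa [Matrix.mul_apply, Matrix.one_apply, apply_ite] using this

theorem sum_antipode_mul (hw : IsCorep w) (i j : ι) :
    ∑ k, HopfAlgebra.antipode ℂ (w i k) * w k j = if i = j then 1 else 0 := by
  simpa [Matrix.mul_apply, Matrix.one_apply] using congrFun (congrFun hw.antipode_mul i) j

theorem sum_mul_antipode (hw : IsCorep w) (i j : ι) :
    ∑ k, w i k * HopfAlgebra.antipode ℂ (w k j) = if i = j then 1 else 0 := by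
  simpa [Matrix.mul_apply, Matrix.one_apply] using congrFun (congrFun hw.mul_antipode i) j

end IsCorep

end Corep

/-! ### Unitary representations, the antipode and contragredients -/

section Unitary

variable {A : Type*} [Ring A] [StarRing A] [HopfAlgebra ℂ A]

namespace UnitaryRep

theorem isCorep (u : UnitaryRep A) : IsCorep u.mat := ⟨u.comul_mat, u.counit_mat⟩

/-- Both matrices are inverse to `u.mat`. -/
theorem antipode_mat (u : UnitaryRep A) : u.mat.map (HopfAlgebra.antipode ℂ) = u.matᴴ := by
  calc _ = u.mat.map (HopfAlgebra.antipode ℂ) * (u.mat * u.matᴴ) := by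
        rw [u.unitary_right, Matrix.mul_one]
    _ = _ := by rw [← Matrix.mul_assoc, u.isCorep.antipode_mul, Matrix.one_mul]

theorem antipode_apply (u : UnitaryRep A) (i j : u.ι) :
    HopfAlgebra.antipode ℂ (u.mat i j) = star (u.mat j i) :=
  congrFun (congrFun u.antipode_mat i) j

end UnitaryRep

@[simp] theorem contra_apply {ι : Type} (w : Matrix ι ι A) (i j : ι) :
    contra w i j = HopfAlgebra.antipode ℂ (w j i) := rfl

/-- By unitarity the contragredient is the entrywise adjoint of `u`, so compatibility of the
coproduct with the involution suffices. -/
theorem isCorep_contra [StarModule ℂ A]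
    (hA : ∀ a : A, Coalgebra.comul (R := ℂ) (star a) = star (Coalgebra.comul (R := ℂ) a))
    (u : UnitaryRep A) : IsCorep (contra u.mat) where
  comul i j := by
    simp only [contra_apply, u.antipode_apply, hA, u.comul_mat, star_sum, TensorProduct.star_tmul]
  counit i j := by
    rw [contra_apply, HopfAlgebra.counit_antipode, u.counit_mat]
    simp [eq_comm]

/-- The involution reverses products. This reversal is the reason why dual intertwiners are
multiplied in the opposite order later on. -/
theorem contra_prod (u v : UnitaryRep A) (i j : u.ι × v.ι) :
    contra (u.prod v).mat i j = contra v.mat i.2 j.2 * contra u.mat i.1 j.1 := by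
  refine ((u.prod v).antipode_apply j i).trans ?_
  rw [contra_apply, contra_apply, u.antipode_apply, v.antipode_apply]
  exact star_mul (u.mat i.1 j.1) (v.mat i.2 j.2)

/-! ### The commutant of a representation and the canonical intertwiner -/

/-- `f ∈ Mor(u, v)`. -/
def IsMor (u v : UnitaryRep A) (f : Matrix v.ι u.ι ℂ) : Prop :=
  f.map (algebraMap ℂ A) * u.mat = v.mat * f.map (algebraMap ℂ A)

variable {u v : UnitaryRep A}

/-- The second contragredient. -/
theorem contra_contra {ι : Type} (w : Matrix ι ι A) :
    contra (contra w) = (w.map (HopfAlgebra.antipode ℂ)).map (HopfAlgebra.antipode ℂ) := rfl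

theorem map_antipode_scalar_mul {l m n : Type*} [Fintype m] (f : Matrix l m ℂ) (w : Matrix m n A) :
    (f.map (algebraMap ℂ A) * w).map (HopfAlgebra.antipode ℂ) =
      f.map (algebraMap ℂ A) * w.map (HopfAlgebra.antipode ℂ) := by
  ext i j
  simp [Matrix.mul_apply, ← Algebra.smul_def]

theorem map_antipode_mul_scalar {l m n : Type*} [Fintype m] (f : Matrix m n ℂ) (w : Matrix l m A) :
    (w * f.map (algebraMap ℂ A)).map (HopfAlgebra.antipode ℂ) =
      w.map (HopfAlgebra.antipode ℂ) * f.map (algebraMap ℂ A) := by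
  ext i j
  simp [Matrix.mul_apply, ← Algebra.commutes, ← Algebra.smul_def]

theorem IsMor.contra_contra {f : Matrix v.ι u.ι ℂ} (hf : IsMor u v f) :
    f.map (algebraMap ℂ A) * contra (contra u.mat) =
      contra (contra v.mat) * f.map (algebraMap ℂ A) := by
  rw [QPB.contra_contra, QPB.contra_contra, ← map_antipode_scalar_mul, ← map_antipode_scalar_mul,
    hf, map_antipode_mul_scalar, map_antipode_mul_scalar]

theorem IsMor.mul {w : UnitaryRep A} {f : Matrix v.ι u.ι ℂ} {g : Matrix w.ι v.ι ℂ}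
    (hg : IsMor v w g) (hf : IsMor u v f) : IsMor u w (g * f) := by
  unfold IsMor at *
  rw [Matrix.map_mul, Matrix.mul_assoc, hf, ← Matrix.mul_assoc, hg, Matrix.mul_assoc]

theorem isMor_one : IsMor u u (1 : Matrix u.ι u.ι ℂ) := by
  simp [IsMor, Matrix.map_one]

theorem IsMor.add {f g : Matrix v.ι u.ι ℂ} (hf : IsMor u v f) (hg : IsMor u v g) :
    IsMor u v (f + g) := by
  unfold IsMor at *
  rw [Matrix.map_add _ (map_add _), Matrix.add_mul, Matrix.mul_add, hf, hg]

theorem IsMor.sub {f g : Matrix v.ι u.ι ℂ} (hf : IsMor u v f) (hg : IsMor u v g) :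
    IsMor u v (f - g) := by
  unfold IsMor at *
  rw [Matrix.map_sub _ (map_sub _), Matrix.sub_mul, Matrix.mul_sub, hf, hg]

theorem map_algebraMap_conjTranspose [StarModule ℂ A] {m n : Type*} (f : Matrix m n ℂ) :
    (f.map (algebraMap ℂ A))ᴴ = fᴴ.map (algebraMap ℂ A) := by
  ext i j
  simpa using (algebraMap_star_comm (R := ℂ) (A := A) (f j i)).symm

/-- Taking adjoints reverses the intertwining relation, and multiplying by `u` and `v` on the two
sides restores it. Hence `Mor(u, u)` is a `*`-algebra, which the positivity arguments below need. -/
theorem IsMor.conjTranspose [StarModule ℂ A] {f : Matrix v.ι u.ι ℂ} (hf : IsMor u v f) :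
    IsMor v u fᴴ := by
  unfold IsMor at *
  have := congrArg Matrix.conjTranspose hf
  rw [Matrix.conjTranspose_mul, Matrix.conjTranspose_mul, map_algebraMap_conjTranspose] at this
  calc _ = u.mat * (u.matᴴ * fᴴ.map (algebraMap ℂ A)) * v.mat := by
        rw [← Matrix.mul_assoc, u.unitary_right, Matrix.one_mul]
    _ = _ := by rw [this, Matrix.mul_assoc, Matrix.mul_assoc, v.unitary_left, Matrix.mul_one]

/-- `C` intertwines `u` and its second contragredient. -/
def IsContraMor (u : UnitaryRep A) (C : Matrix u.ι u.ι ℂ) : Prop :=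
  C.map (algebraMap ℂ A) * u.mat = contra (contra u.mat) * C.map (algebraMap ℂ A)

theorem isUnit_map_algebraMap {ι : Type} [Fintype ι] [DecidableEq ι] {C : Matrix ι ι ℂ}
    (hC : IsUnit C) : C⁻¹.map (algebraMap ℂ A) * C.map (algebraMap ℂ A) = 1 ∧
      C.map (algebraMap ℂ A) * C⁻¹.map (algebraMap ℂ A) = 1 := by
  have hd := (Matrix.isUnit_iff_isUnit_det _).1 hC
  rw [← Matrix.map_mul, ← Matrix.map_mul, Matrix.nonsing_inv_mul _ hd, Matrix.mul_nonsing_inv _ hd]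
  simp

theorem IsContraMor.inv {C : Matrix u.ι u.ι ℂ} (hC : IsContraMor u C) (h : IsUnit C) :
    u.mat * C⁻¹.map (algebraMap ℂ A) = C⁻¹.map (algebraMap ℂ A) * contra (contra u.mat) := by
  obtain ⟨h1, h2⟩ := isUnit_map_algebraMap (A := A) h
  unfold IsContraMor at hC
  calc _ = C⁻¹.map (algebraMap ℂ A) * (C.map (algebraMap ℂ A) * u.mat) *
        C⁻¹.map (algebraMap ℂ A) := by rw [← Matrix.mul_assoc, h1, Matrix.one_mul]
    _ = _ := by rw [hC, Matrix.mul_assoc, Matrix.mul_assoc, h2, Matrix.mul_one]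

/-- Two intertwiners from `u` to `u^cc` differ by an element of the commutant, to which the
normalization can be applied. -/
theorem IsContraMor.inv_mul {C D : Matrix u.ι u.ι ℂ} (hC : IsContraMor u C) (h : IsUnit C)
    (hD : IsContraMor u D) : IsMor u u (C⁻¹ * D) := by
  have hi := hC.inv h
  unfold IsMor IsContraMor at *
  rw [Matrix.map_mul, Matrix.mul_assoc, hD, ← Matrix.mul_assoc, ← hi, Matrix.mul_assoc]

theorem IsContraMor.mul_isMor {C f : Matrix u.ι u.ι ℂ} (hC : IsContraMor u C) (hf : IsMor u u f) :
    IsContraMor u (C * f) := by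
  unfold IsMor IsContraMor at *
  rw [Matrix.map_mul, Matrix.mul_assoc, hf, ← Matrix.mul_assoc, hC, Matrix.mul_assoc]

theorem IsMor.mul_isContraMor {C f : Matrix u.ι u.ι ℂ} (hf : IsMor u u f) (hC : IsContraMor u C) :
    IsContraMor u (f * C) := by
  have := hf.contra_contra
  unfold IsContraMor at *
  rw [Matrix.map_mul, Matrix.mul_assoc, hC, ← Matrix.mul_assoc, this, Matrix.mul_assoc]

/-- A positive semidefinite matrix of trace zero vanishes, and definiteness of `P` then kills `K x`
for every `x`. This device turns the trace identities below into matrix identities. -/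
theorem eq_zero_of_trace_conj {m n : Type*} [Fintype m] [Fintype n] [DecidableEq m] [DecidableEq n]
    {P : Matrix m m ℂ} (hP : P.PosDef) {K : Matrix m n ℂ} (h : (Kᴴ * P * K).trace = 0) :
    K = 0 := by
  have h1 : (Kᴴ * P * K).PosSemidef := hP.posSemidef.conjTranspose_mul_mul_same K
  have h2 := h1.trace_eq_zero_iff.1 h
  rw [← Matrix.mulVec_injective.eq_iff]
  ext1 x
  by_contra hx
  rw [Matrix.zero_mulVec] at hx
  have := hP.dotProduct_mulVec_pos hx
  have h3 : star (K *ᵥ x) ⬝ᵥ (P *ᵥ (K *ᵥ x)) = star x ⬝ᵥ ((Kᴴ * P * K) *ᵥ x) := by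
    rw [Matrix.star_mulVec, ← Matrix.dotProduct_mulVec, Matrix.mulVec_mulVec, Matrix.mulVec_mulVec,
      Matrix.mul_assoc]
  rw [h3, h2] at this
  simp at this

namespace IsCanonicalIntertwiner

variable {C C' : Matrix u.ι u.ι ℂ}

/-- Test the normalization of `C` on `C⁻¹ C' - 1` and that of `C'` on `C'⁻¹ C - 1`. Adding the two
identities gives `tr(K (C + C') K) = 0` for the hermitian matrix `K = C'⁻¹ - C⁻¹`. -/
theorem unique (h : IsCanonicalIntertwiner u C) (h' : IsCanonicalIntertwiner u C') : C = C' := by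
  have hu := h.posDef.isUnit
  have hu' := h'.posDef.isUnit
  have hd := (Matrix.isUnit_iff_isUnit_det _).1 hu
  have hd' := (Matrix.isUnit_iff_isUnit_det _).1 hu'
  have e1 := h.normalized _ ((IsContraMor.inv_mul h.intertwines hu h'.intertwines).sub isMor_one)
  have e2 := h'.normalized _ ((IsContraMor.inv_mul h'.intertwines hu' h.intertwines).sub isMor_one)
  simp only [Matrix.mul_sub, ← Matrix.mul_assoc, Matrix.mul_nonsing_inv _ hd, Matrix.mul_nonsing_inv _ hd',
    Matrix.one_mul, Matrix.mul_one, Matrix.trace_sub] at e1 e2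
  have hK : C'⁻¹ - C⁻¹ = 0 := by
    refine eq_zero_of_trace_conj (h.posDef.add h'.posDef) ?_
    rw [Matrix.conjTranspose_sub, h.posDef.inv.isHermitian.eq, h'.posDef.inv.isHermitian.eq]
    have : (C'⁻¹ - C⁻¹) * (C + C') * (C'⁻¹ - C⁻¹) =
        (C'⁻¹ * C * C'⁻¹ - C'⁻¹ * (C * C⁻¹) - (C⁻¹ * C) * C'⁻¹ + C⁻¹ * C * C⁻¹) +
          (C'⁻¹ * C' * C'⁻¹ - C'⁻¹ * C' * C⁻¹ - C⁻¹ * (C' * C'⁻¹) + C⁻¹ * C' * C⁻¹) := by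
      noncomm_ring
    rw [this]
    simp only [Matrix.mul_nonsing_inv _ hd, Matrix.mul_nonsing_inv _ hd',
      Matrix.nonsing_inv_mul _ hd, Matrix.nonsing_inv_mul _ hd', Matrix.one_mul, Matrix.mul_one, Matrix.trace_sub,
      Matrix.trace_add]
    have t1 : (C'⁻¹ * C * C'⁻¹).trace = (C'⁻¹ * C'⁻¹ * C).trace := by
      rw [Matrix.trace_mul_comm, Matrix.mul_assoc]
    have t2 : (C⁻¹ * C' * C⁻¹).trace = (C⁻¹ * C⁻¹ * C').trace := by
      rw [Matrix.trace_mul_comm, Matrix.mul_assoc]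
    rw [t1, t2]
    linear_combination - e1 - e2
  rw [← Matrix.nonsing_inv_nonsing_inv _ hd, ← Matrix.nonsing_inv_nonsing_inv _ hd',
    sub_eq_zero.1 hK]

/-- The canonical intertwiner commutes with the commutant of the representation. -/
theorem commute [StarModule ℂ A] (h : IsCanonicalIntertwiner u C) {f : Matrix u.ι u.ι ℂ}
    (hf : IsMor u u f) : C * f = f * C := by
  have hu := h.posDef.isUnit
  have hd := (Matrix.isUnit_iff_isUnit_det _).1 hu
  have hC : IsContraMor u C := h.intertwines
  have m1 : IsMor u u (C⁻¹ * f * C) := by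
    have := hC.inv_mul hu (hf.mul_isContraMor hC)
    rwa [← Matrix.mul_assoc] at this
  have m2 : IsMor u u (C⁻¹ * (C⁻¹ * f * C) * C) := by
    have := hC.inv_mul hu (m1.mul_isContraMor hC)
    rwa [← Matrix.mul_assoc] at this
  -- The normalization, used for `f g` and for `g C⁻¹ f C`, makes `tr(C Y g)` vanish for every `g`
  -- in the commutant. The choice `g = Yᴴ` gives `Y = 0`, that is, `C² f = f C²`.
  set Y := C⁻¹ * (C⁻¹ * f * C) * C - f with hY
  have key : ∀ g, IsMor u u g → (C * (Y * g)).trace = 0 := by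
    intro g hg
    have e := h.normalized _ (hf.mul hg)
    have e' := h.normalized _ (hg.mul m1)
    have a1 : (C * (C⁻¹ * (C⁻¹ * f * C) * C * g)).trace = (C * (g * (C⁻¹ * f * C))).trace := by
      rw [show C * (C⁻¹ * (C⁻¹ * f * C) * C * g) = (C * C⁻¹) * ((C⁻¹ * f * C) * (C * g)) by
          noncomm_ring, Matrix.mul_nonsing_inv _ hd, Matrix.one_mul, Matrix.trace_mul_comm,
        Matrix.mul_assoc]
    have a2 : (C⁻¹ * (g * (C⁻¹ * f * C))).trace = (C⁻¹ * (f * g)).trace := by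
      rw [show C⁻¹ * (g * (C⁻¹ * f * C)) = (C⁻¹ * g * C⁻¹ * f) * C by noncomm_ring,
        Matrix.trace_mul_comm, ← Matrix.mul_assoc, ← Matrix.mul_assoc, ← Matrix.mul_assoc,
        Matrix.mul_nonsing_inv _ hd, Matrix.one_mul, Matrix.mul_assoc, Matrix.trace_mul_comm,
        Matrix.mul_assoc]
    rw [hY, Matrix.sub_mul, Matrix.mul_sub, Matrix.trace_sub, a1, e', a2, e, sub_self]
  have hY0 : Y = 0 := by
    refine eq_zero_of_trace_conj h.posDef ?_
    rw [Matrix.mul_assoc, Matrix.trace_mul_comm, Matrix.mul_assoc, key _ (m2.sub hf).conjTranspose]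
  -- Since `C²` commutes with `f`, the commutator `[C, f]` anticommutes with `C`.
  have hX : C * (C * f - f * C) + (C * f - f * C) * C = 0 := by
    have e : C⁻¹ * (C⁻¹ * f * C) * C = f := sub_eq_zero.1 hY0
    have e3 : f * C * C = C * C * f := by
      conv_rhs => rw [← e]
      rw [show C * C * (C⁻¹ * (C⁻¹ * f * C) * C) = C * (C * C⁻¹) * C⁻¹ * (f * C * C) by
        noncomm_ring, Matrix.mul_nonsing_inv _ hd, Matrix.mul_one, Matrix.mul_nonsing_inv _ hd, Matrix.one_mul]
    rw [Matrix.mul_sub, Matrix.sub_mul, ← Matrix.mul_assoc, ← e3, ← Matrix.mul_assoc]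
    abel
  set X := C * f - f * C with hXdef
  -- Pairing the anticommutator with `Xᴴ` writes zero as a sum of two nonnegative traces.
  have t : (Xᴴ * C * X).trace + (Xᴴᴴ * C * Xᴴ).trace = 0 := by
    have := congrArg (fun M => (Xᴴ * M).trace) hX
    simp only [Matrix.mul_add, Matrix.trace_add, mul_zero, Matrix.trace_zero] at this
    rw [Matrix.conjTranspose_conjTranspose, Matrix.mul_assoc, Matrix.trace_mul_comm (X * C)]
    exact this
  have n1 := (h.posDef.posSemidef.conjTranspose_mul_mul_same X).trace_nonneg
  have n2 := (h.posDef.posSemidef.conjTranspose_mul_mul_same Xᴴ).trace_nonneg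
  have := eq_zero_of_trace_conj h.posDef (le_antisymm (by
    rw [← t]; exact le_add_of_nonneg_right n2) n1)
  exact sub_eq_zero.1 this

end IsCanonicalIntertwiner

end Unitary

/-! ### Canonical intertwiners of sums and products; naturality -/

section Canonical

variable {A : Type*} [Ring A] [StarRing A] [HopfAlgebra ℂ A] [StarModule ℂ A]
variable {u v : UnitaryRep A}

theorem posDef_fromBlocks {m n : Type*} [Fintype m] [Fintype n] [DecidableEq m] [DecidableEq n]
    {C : Matrix m m ℂ} {D : Matrix n n ℂ} (hC : C.PosDef) (hD : D.PosDef) :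
    (Matrix.fromBlocks C 0 0 D).PosDef := by
  refine Matrix.PosDef.of_dotProduct_mulVec_pos ?_ fun x hx => ?_
  · simpa [Matrix.IsHermitian, Matrix.fromBlocks_conjTranspose] using
      ⟨hC.isHermitian.eq, hD.isHermitian.eq⟩
  · have e : star x ⬝ᵥ (Matrix.fromBlocks C 0 0 D *ᵥ x) =
        star (x ∘ Sum.inl) ⬝ᵥ (C *ᵥ (x ∘ Sum.inl)) + star (x ∘ Sum.inr) ⬝ᵥ (D *ᵥ (x ∘ Sum.inr)) := by
      rw [Matrix.fromBlocks_mulVec]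
      simp [dotProduct]
    rw [e]
    have p1 := hC.posSemidef.dotProduct_mulVec_nonneg (x ∘ Sum.inl)
    have p2 := hD.posSemidef.dotProduct_mulVec_nonneg (x ∘ Sum.inr)
    by_cases h : x ∘ Sum.inl = 0
    · refine add_pos_of_nonneg_of_pos p1 (hD.dotProduct_mulVec_pos fun h' => hx ?_)
      ext (i | i)
      · exact congrFun h i
      · exact congrFun h' i
    · exact add_pos_of_pos_of_nonneg (hC.dotProduct_mulVec_pos h) p2

theorem trace_fromBlocks_eq {m n : Type*} [Fintype m] [Fintype n] (a : Matrix m m ℂ)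
    (b : Matrix m n ℂ) (c : Matrix n m ℂ) (d : Matrix n n ℂ) :
    (Matrix.fromBlocks a b c d).trace = a.trace + d.trace := by
  simp [Matrix.trace]

theorem fromBlocks_diag_inv {m n : Type*} [Fintype m] [Fintype n] [DecidableEq m] [DecidableEq n]
    {C : Matrix m m ℂ} {D : Matrix n n ℂ} (hC : IsUnit C) (hD : IsUnit D) :
    (Matrix.fromBlocks C 0 0 D)⁻¹ = Matrix.fromBlocks C⁻¹ 0 0 D⁻¹ := by
  apply Matrix.inv_eq_right_inv
  rw [Matrix.isUnit_iff_isUnit_det] at hC hD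
  rw [Matrix.fromBlocks_multiply, Matrix.mul_nonsing_inv _ hC, Matrix.mul_nonsing_inv _ hD]
  simp

theorem contra_contra_fromBlocks {m n : Type} (a : Matrix m m A) (b : Matrix n n A) :
    contra (contra (Matrix.fromBlocks a 0 0 b)) =
      Matrix.fromBlocks (contra (contra a)) 0 0 (contra (contra b)) := by
  ext (i | i) (j | j) <;> simp [contra]

theorem fromBlocks_intertwines {C : Matrix u.ι u.ι ℂ} {D : Matrix v.ι v.ι ℂ}
    (hC : IsContraMor u C) (hD : IsContraMor v D) :
    (Matrix.fromBlocks C 0 0 D).map (algebraMap ℂ A) * Matrix.fromBlocks u.mat 0 0 v.mat =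
      contra (contra (Matrix.fromBlocks u.mat 0 0 v.mat)) *
        (Matrix.fromBlocks C 0 0 D).map (algebraMap ℂ A) := by
  rw [contra_contra_fromBlocks]
  unfold IsContraMor at hC hD
  simp [Matrix.fromBlocks_map, Matrix.fromBlocks_multiply, hC, hD]

/-- Only the diagonal blocks of `f` enter the traces, and they lie in the commutants of `u` and `v`.
-/
theorem fromBlocks_normalized {C : Matrix u.ι u.ι ℂ} {D : Matrix v.ι v.ι ℂ}
    (hC : IsCanonicalIntertwiner u C) (hD : IsCanonicalIntertwiner v D)
    (f : Matrix (u.ι ⊕ v.ι) (u.ι ⊕ v.ι) ℂ)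
    (hf : f.map (algebraMap ℂ A) * Matrix.fromBlocks u.mat 0 0 v.mat =
      Matrix.fromBlocks u.mat 0 0 v.mat * f.map (algebraMap ℂ A)) :
    (Matrix.fromBlocks C 0 0 D * f).trace = ((Matrix.fromBlocks C 0 0 D)⁻¹ * f).trace := by
  rw [← Matrix.fromBlocks_toBlocks f] at hf ⊢
  simp only [Matrix.fromBlocks_map, Matrix.fromBlocks_multiply, Matrix.mul_zero, Matrix.zero_mul,
    add_zero, zero_add] at hf
  have e1 := (Matrix.fromBlocks_inj.1 hf).1
  have e2 := (Matrix.fromBlocks_inj.1 hf).2.2.2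
  rw [fromBlocks_diag_inv hC.posDef.isUnit hD.posDef.isUnit]
  simp only [Matrix.fromBlocks_multiply, trace_fromBlocks_eq, Matrix.zero_mul, add_zero,
    zero_add]
  rw [hC.normalized _ e1, hD.normalized _ e2]

theorem IsCanonicalIntertwiner.sum {C : Matrix u.ι u.ι ℂ} {D : Matrix v.ι v.ι ℂ}
    (hC : IsCanonicalIntertwiner u C) (hD : IsCanonicalIntertwiner v D) :
    IsCanonicalIntertwiner (u.sum v) (Matrix.fromBlocks C 0 0 D) where
  posDef := posDef_fromBlocks hC.posDef hD.posDef
  intertwines := fromBlocks_intertwines hC.intertwines hD.intertwines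
  normalized f hf := fromBlocks_normalized hC hD f hf

theorem isCanonicalIntertwiner_trivial :
    IsCanonicalIntertwiner (UnitaryRep.trivial : UnitaryRep A) 1 where
  posDef := Matrix.PosDef.one
  intertwines := by
    have : contra (contra (1 : Matrix Unit Unit A)) = 1 := by
      ext i j
      simp [HopfAlgebra.antipode_one]
    have h : (1 : Matrix Unit Unit ℂ).map (algebraMap ℂ A) * 1 =
      contra (contra (1 : Matrix Unit Unit A)) * (1 : Matrix Unit Unit ℂ).map (algebraMap ℂ A) := by
      simp [this]
    exact h
  normalized f hf := by simp

/-- The canonical intertwiners are natural. -/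
theorem IsCanonicalIntertwiner.naturality {C : Matrix u.ι u.ι ℂ} {D : Matrix v.ι v.ι ℂ}
    (hC : IsCanonicalIntertwiner u C) (hD : IsCanonicalIntertwiner v D) {f : Matrix v.ι u.ι ℂ}
    (hf : IsMor u v f) : D * f = f * C := by
  -- As an off-diagonal block, `f` becomes an element of the commutant of `u ⊕ v`, with which the
  -- block diagonal canonical intertwiner commutes.
  have h : (Matrix.fromBlocks 0 0 f 0).map (algebraMap ℂ A) * Matrix.fromBlocks u.mat 0 0 v.mat =
      Matrix.fromBlocks u.mat 0 0 v.mat * (Matrix.fromBlocks 0 0 f 0).map (algebraMap ℂ A) := by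
    unfold IsMor at hf
    simp [Matrix.fromBlocks_map, Matrix.fromBlocks_multiply, hf]
  have : Matrix.fromBlocks C 0 0 D * Matrix.fromBlocks 0 0 f 0 =
    Matrix.fromBlocks 0 0 f 0 * Matrix.fromBlocks C 0 0 D := (hC.sum hD).commute h
  simp only [Matrix.fromBlocks_multiply, Matrix.mul_zero, Matrix.zero_mul, add_zero,
      zero_add] at this
  exact (Matrix.fromBlocks_inj.1 this).2.2.1

/-- The matrix of a product of representations. -/
def prodMat {m n : Type} (a : Matrix m m A) (b : Matrix n n A) : Matrix (m × n) (m × n) A :=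
  Matrix.of fun i j => a i.1 j.1 * b i.2 j.2

section Prod

variable {C : Matrix u.ι u.ι ℂ}

/-- The second contragredient is the inverse transpose of the contragredient. -/
theorem sum_contra_contra_mul
    (hA : ∀ a : A, Coalgebra.comul (R := ℂ) (star a) = star (Coalgebra.comul (R := ℂ) a))
    (u : UnitaryRep A) (i j : u.ι) :
    ∑ k, contra (contra u.mat) k i * HopfAlgebra.antipode ℂ (u.mat j k) = if i = j then 1 else 0 :=
  (isCorep_contra hA u).sum_antipode_mul i j

theorem sum_mul_contra_contra
    (hA : ∀ a : A, Coalgebra.comul (R := ℂ) (star a) = star (Coalgebra.comul (R := ℂ) a))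
    (u : UnitaryRep A) (i j : u.ι) :
    ∑ k, HopfAlgebra.antipode ℂ (u.mat k i) * contra (contra u.mat) j k = if i = j then 1 else 0 :=
  (isCorep_contra hA u).sum_mul_antipode i j

theorem IsContraMor.apply (hC : IsContraMor u C) (i j : u.ι) :
    ∑ k, C i k • u.mat k j = ∑ k, C k j • contra (contra u.mat) i k := by
  have := congrFun (congrFun hC i) j
  simpa [Matrix.mul_apply, ← Algebra.smul_def, ← Algebra.commutes, -contra_apply] using this

theorem IsContraMor.inv_apply (hC : IsContraMor u C) (h : IsUnit C) (i j : u.ι) :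
    ∑ k, C⁻¹ k j • u.mat i k = ∑ k, C⁻¹ i k • contra (contra u.mat) k j := by
  have := congrFun (congrFun (hC.inv h) i) j
  simpa [Matrix.mul_apply, ← Algebra.smul_def, ← Algebra.commutes, -contra_apply] using this

/-- Invariance of the weight defining the pairing `⟨ , ⟩⁻`. -/
theorem IsContraMor.sum_antipode_mul
    (hA : ∀ a : A, Coalgebra.comul (R := ℂ) (star a) = star (Coalgebra.comul (R := ℂ) a))
    (hC : IsContraMor u C) (h : IsUnit C) (k l : u.ι) :
    ∑ i, ∑ j, C⁻¹ j i • (HopfAlgebra.antipode ℂ (u.mat i k) * u.mat l j) =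
      algebraMap ℂ A (C⁻¹ l k) := by
  calc _ = ∑ i, HopfAlgebra.antipode ℂ (u.mat i k) * ∑ j, C⁻¹ j i • u.mat l j := by
        simp [Finset.mul_sum]
    _ = ∑ j, C⁻¹ l j • ∑ i, HopfAlgebra.antipode ℂ (u.mat i k) * contra (contra u.mat) j i := by
        simp_rw [hC.inv_apply h, Finset.mul_sum, mul_smul_comm, Finset.smul_sum]
        exact Finset.sum_comm
    _ = _ := by
        simp [sum_mul_contra_contra hA, Algebra.algebraMap_eq_smul_one, -contra_apply]

/-- In the order `u · κ(u)` the invariant weight is `C` rather than `C⁻¹`. Consequently partial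
traces over the second factor carry the weight `C` and those over the first factor `C⁻¹`. -/
theorem IsContraMor.sum_mul_antipode
    (hA : ∀ a : A, Coalgebra.comul (R := ℂ) (star a) = star (Coalgebra.comul (R := ℂ) a))
    (hC : IsContraMor u C) (k l : u.ι) :
    ∑ i, ∑ j, C j i • (u.mat i k * HopfAlgebra.antipode ℂ (u.mat l j)) =
      algebraMap ℂ A (C l k) := by
  calc _ = ∑ j, (∑ i, C j i • u.mat i k) * HopfAlgebra.antipode ℂ (u.mat l j) := by
        rw [Finset.sum_comm]
        simp [Finset.sum_mul]
    _ = ∑ i, C i k • ∑ j, contra (contra u.mat) j i * HopfAlgebra.antipode ℂ (u.mat l j) := by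
        simp_rw [hC.apply, Finset.sum_mul, smul_mul_assoc, Finset.smul_sum]
        exact Finset.sum_comm
    _ = _ := by
        simp [sum_contra_contra_mul hA, Algebra.algebraMap_eq_smul_one, -contra_apply]

theorem contra_prodMat (u v : UnitaryRep A) (i j : u.ι × v.ι) :
    contra (prodMat u.mat v.mat) i j = contra v.mat i.2 j.2 * contra u.mat i.1 j.1 :=
  contra_prod u v i j

theorem isCorep_contra_prodMat
    (hA : ∀ a : A, Coalgebra.comul (R := ℂ) (star a) = star (Coalgebra.comul (R := ℂ) a))
    (u v : UnitaryRep A) : IsCorep (contra (prodMat u.mat v.mat)) :=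
  isCorep_contra hA (u.prod v)

/-- The transpose of the right-hand side is a right inverse of the contragredient of the product.
Its entrywise antipode is a left inverse, so the two agree. -/
theorem contra_contra_prodMat
    (hA : ∀ a : A, Coalgebra.comul (R := ℂ) (star a) = star (Coalgebra.comul (R := ℂ) a))
    (u v : UnitaryRep A) : contra (contra (prodMat u.mat v.mat)) =
      prodMat (contra (contra u.mat)) (contra (contra v.mat)) := by
  set z := contra (prodMat u.mat v.mat) with hz
  have hu := isCorep_contra hA u
  have hv := isCorep_contra hA v
  have h1 := (isCorep_contra_prodMat hA u v).antipode_mul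
  have h2 : z * (prodMat (contra (contra u.mat)) (contra (contra v.mat)))ᵀ = 1 := by
    ext ⟨i, k⟩ ⟨j, l⟩
    have hz' : ∀ i j, z i j = contra v.mat i.2 j.2 * contra u.mat i.1 j.1 := contra_prodMat u v
    clear_value z
    simp only [Matrix.mul_apply, Fintype.sum_prod_type_right, Matrix.transpose_apply, hz',
      prodMat, Matrix.of_apply]
    have : ∀ q p, contra v.mat k q * contra u.mat i p *
        (contra (contra u.mat) j p * contra (contra v.mat) l q) =
        contra v.mat k q * (contra u.mat i p * HopfAlgebra.antipode ℂ (contra u.mat p j)) *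
          HopfAlgebra.antipode ℂ (contra v.mat q l) := by
      intro q p
      simp only [mul_assoc]
      rfl
    simp only [this, ← Finset.sum_mul, ← Finset.mul_sum, hu.sum_mul_antipode]
    by_cases h : i = j
    · simp [h, hv.sum_mul_antipode, Matrix.one_apply, -contra_apply]
    · simp [h]
  have h3 : z.map (HopfAlgebra.antipode ℂ) =
      (prodMat (contra (contra u.mat)) (contra (contra v.mat)))ᵀ := by
    calc _ = z.map (HopfAlgebra.antipode ℂ) *
          (z * (prodMat (contra (contra u.mat)) (contra (contra v.mat)))ᵀ) := by
          rw [h2, Matrix.mul_one]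
      _ = _ := by rw [← Matrix.mul_assoc, h1, Matrix.one_mul]
  rw [← Matrix.transpose_transpose (prodMat _ _), ← h3]
  rfl

open scoped Kronecker

theorem kronecker_intertwines
    (hA : ∀ a : A, Coalgebra.comul (R := ℂ) (star a) = star (Coalgebra.comul (R := ℂ) a))
    {D : Matrix v.ι v.ι ℂ} (hC : IsContraMor u C) (hD : IsContraMor v D) :
    (C ⊗ₖ D).map (algebraMap ℂ A) * prodMat u.mat v.mat =
      contra (contra (prodMat u.mat v.mat)) * (C ⊗ₖ D).map (algebraMap ℂ A) := by
  rw [contra_contra_prodMat hA]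
  ext ⟨i, k⟩ ⟨j, l⟩
  have e1 : ∀ a b, algebraMap ℂ A (C i a * D k b) * (u.mat a j * v.mat b l) =
      (C i a • u.mat a j) * (D k b • v.mat b l) := by
    intro a b
    rw [← Algebra.smul_def, smul_mul_smul_comm]
  have e2 : ∀ a b, contra (contra u.mat) i a * contra (contra v.mat) k b *
      algebraMap ℂ A (C a j * D b l) =
      (C a j • contra (contra u.mat) i a) * (D b l • contra (contra v.mat) k b) := by
    intro a b
    rw [← Algebra.commutes, ← Algebra.smul_def, smul_mul_smul_comm]
  simp only [Matrix.mul_apply, Matrix.map_apply, Matrix.kroneckerMap_apply, prodMat,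
    Matrix.of_apply, Fintype.sum_prod_type, e1, e2]
  rw [← Finset.sum_mul_sum, ← Finset.sum_mul_sum, hC.apply, hD.apply]

/-- The weighted partial trace over the second factor. -/
def partialTraceRight {m n : Type} [Fintype n] (X : Matrix n n ℂ)
    (f : Matrix (m × n) (m × n) ℂ) : Matrix m m ℂ :=
  Matrix.of fun i j => ∑ k, ∑ l, X l k * f (i, k) (j, l)

/-- The weighted partial trace over the first factor. -/
def partialTraceLeft {m n : Type} [Fintype m] (X : Matrix m m ℂ)
    (f : Matrix (m × n) (m × n) ℂ) : Matrix n n ℂ :=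
  Matrix.of fun k l => ∑ i, ∑ j, X j i * f (i, k) (j, l)

theorem trace_kronecker_mul_right {m n : Type} [Fintype m] [Fintype n] (X : Matrix m m ℂ)
    (Y : Matrix n n ℂ) (f : Matrix (m × n) (m × n) ℂ) :
    ((X ⊗ₖ Y) * f).trace = (X * partialTraceRight Y f).trace := by
  simp only [Matrix.trace, Matrix.diag_apply, Matrix.mul_apply, Matrix.kroneckerMap_apply,
    Fintype.sum_prod_type, partialTraceRight, Matrix.of_apply, Finset.mul_sum]
  refine Finset.sum_congr rfl fun i _ => ?_
  rw [Finset.sum_comm]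
  refine Finset.sum_congr rfl fun j _ => ?_
  rw [Finset.sum_comm]
  simp only [mul_assoc]

theorem trace_kronecker_mul_left {m n : Type} [Fintype m] [Fintype n] (X : Matrix m m ℂ)
    (Y : Matrix n n ℂ) (f : Matrix (m × n) (m × n) ℂ) :
    ((X ⊗ₖ Y) * f).trace = (Y * partialTraceLeft X f).trace := by
  simp only [Matrix.trace, Matrix.diag_apply, Matrix.mul_apply, Matrix.kroneckerMap_apply,
    Fintype.sum_prod_type_right, partialTraceLeft, Matrix.of_apply, Finset.mul_sum]
  refine Finset.sum_congr rfl fun i _ => ?_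
  rw [Finset.sum_comm]
  refine Finset.sum_congr rfl fun j _ => ?_
  rw [Finset.sum_comm]
  refine Finset.sum_congr rfl fun a _ => Finset.sum_congr rfl fun b _ => ?_
  ring

/-- `Mor(u × v, u × v)`, in terms of the matrix of the product. -/
theorem prodMat_mor_apply {f : Matrix (u.ι × v.ι) (u.ι × v.ι) ℂ}
    (hf : f.map (algebraMap ℂ A) * prodMat u.mat v.mat =
      prodMat u.mat v.mat * f.map (algebraMap ℂ A)) (i : u.ι) (k : v.ι) (m : u.ι) (n : v.ι) :
    ∑ j, ∑ l, f (i, k) (j, l) • (u.mat j m * v.mat l n) =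
      ∑ j, ∑ l, f (j, l) (m, n) • (u.mat i j * v.mat k l) := by
  have := congrFun (congrFun hf (i, k)) (m, n)
  simpa [Matrix.mul_apply, prodMat, ← Algebra.smul_def, ← Algebra.commutes,
    Fintype.sum_prod_type] using this

/-- Multiplying the intertwining relation for `f` by `κ(v)` on the right removes `v` from one side.
On the other side the weighted sum of the products `v κ(v)` collapses by
`IsContraMor.sum_mul_antipode`. -/
theorem isMor_partialTraceRight
    (hA : ∀ a : A, Coalgebra.comul (R := ℂ) (star a) = star (Coalgebra.comul (R := ℂ) a))
    {D : Matrix v.ι v.ι ℂ} (hD : IsContraMor v D) {f : Matrix (u.ι × v.ι) (u.ι × v.ι) ℂ}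
    (hf : f.map (algebraMap ℂ A) * prodMat u.mat v.mat =
      prodMat u.mat v.mat * f.map (algebraMap ℂ A)) : IsMor u u (partialTraceRight D f) := by
  have h1 : ∀ i k m p, ∑ j, f (i, k) (j, p) • u.mat j m =
      ∑ j, ∑ l, ∑ n, f (j, l) (m, n) • (u.mat i j * v.mat k l *
        HopfAlgebra.antipode ℂ (v.mat n p)) := by
    intro i k m p
    have := congrArg (fun g : v.ι → A => ∑ n, g n * HopfAlgebra.antipode ℂ (v.mat n p))
      (funext fun n => prodMat_mor_apply hf i k m n)
    simp only [Finset.sum_mul, smul_mul_assoc] at this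
    refine Eq.trans ?_ (this.trans ?_)
    · rw [Finset.sum_comm]
      refine Finset.sum_congr rfl fun j _ => ?_
      rw [Finset.sum_comm]
      simp_rw [mul_assoc, ← Finset.smul_sum, ← Finset.mul_sum, v.isCorep.sum_mul_antipode]
      simp
    · rw [Finset.sum_comm]
      refine Finset.sum_congr rfl fun j _ => ?_
      rw [Finset.sum_comm]
  unfold IsMor
  ext i m
  simp only [Matrix.mul_apply, Matrix.map_apply, partialTraceRight, Matrix.of_apply,
    ← Algebra.smul_def, ← Algebra.commutes]
  calc _ = ∑ k, ∑ p, D p k • ∑ j, f (i, k) (j, p) • u.mat j m := by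
        simp_rw [Finset.sum_smul, Finset.smul_sum, mul_smul]
        rw [Finset.sum_comm]
        refine Finset.sum_congr rfl fun k _ => ?_
        rw [Finset.sum_comm]
    _ = ∑ j, ∑ l, ∑ n, f (j, l) (m, n) • (u.mat i j *
          ∑ k, ∑ p, D p k • (v.mat k l * HopfAlgebra.antipode ℂ (v.mat n p))) := by
        simp_rw [h1, Finset.mul_sum, Finset.smul_sum, mul_assoc, mul_smul_comm]
        have : ∀ (k p : v.ι) (j : u.ι) (l n : v.ι), D p k • f (j, l) (m, n) • (u.mat i j * (v.mat k l *
          HopfAlgebra.antipode ℂ (v.mat n p))) = f (j, l) (m, n) • D p k • (u.mat i j * (v.mat k l *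
          HopfAlgebra.antipode ℂ (v.mat n p))) := fun _ _ _ _ _ => smul_comm _ _ _
        simp_rw [this]
        simp only [← Fintype.sum_prod_type']
        refine Fintype.sum_equiv ⟨fun x => ⟨x.2.2.1, x.2.2.2.1, x.2.2.2.2, x.1, x.2.1⟩,
          fun x => ⟨x.2.2.2.1, x.2.2.2.2, x.1, x.2.1, x.2.2.1⟩, fun _ => rfl, fun _ => rfl⟩ _ _
          fun x => rfl
    _ = _ := by
        simp_rw [hD.sum_mul_antipode hA, ← Algebra.commutes, ← Algebra.smul_def, Finset.sum_smul,
          smul_smul]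
        refine Finset.sum_congr rfl fun j _ => Finset.sum_congr rfl fun l _ =>
          Finset.sum_congr rfl fun n _ => ?_
        rw [mul_comm]

theorem isMor_partialTraceLeft
    (hA : ∀ a : A, Coalgebra.comul (R := ℂ) (star a) = star (Coalgebra.comul (R := ℂ) a))
    (hC : IsContraMor u C) (hCu : IsUnit C) {f : Matrix (u.ι × v.ι) (u.ι × v.ι) ℂ}
    (hf : f.map (algebraMap ℂ A) * prodMat u.mat v.mat =
      prodMat u.mat v.mat * f.map (algebraMap ℂ A)) : IsMor v v (partialTraceLeft C⁻¹ f) := by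
  have h1 : ∀ p k m n, ∑ i, ∑ j, ∑ l, f (i, k) (j, l) • (HopfAlgebra.antipode ℂ (u.mat p i) *
      u.mat j m * v.mat l n) = ∑ l, f (p, l) (m, n) • v.mat k l := by
    intro p k m n
    have := congrArg (fun g : u.ι → A => ∑ i, HopfAlgebra.antipode ℂ (u.mat p i) * g i)
      (funext fun i => prodMat_mor_apply hf i k m n)
    simp only [Finset.mul_sum, mul_smul_comm, ← mul_assoc] at this
    refine this.trans ?_
    rw [Finset.sum_comm]
    simp_rw [Finset.sum_comm (s := (Finset.univ : Finset u.ι)) (t := (Finset.univ : Finset v.ι)),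
      ← Finset.smul_sum, ← Finset.sum_mul, u.isCorep.sum_antipode_mul]
    rw [Finset.sum_comm]
    simp
  unfold IsMor
  ext k n
  simp only [Matrix.mul_apply, Matrix.map_apply, partialTraceLeft, Matrix.of_apply,
    ← Algebra.smul_def, ← Algebra.commutes]
  symm
  calc _ = ∑ p, ∑ m, C⁻¹ m p • ∑ l, f (p, l) (m, n) • v.mat k l := by
        simp_rw [Finset.sum_smul, Finset.smul_sum, mul_smul]
        rw [Finset.sum_comm]
        refine Finset.sum_congr rfl fun k _ => ?_
        rw [Finset.sum_comm]
    _ = ∑ l, ∑ i, ∑ j, f (i, k) (j, l) • ((∑ p, ∑ m, C⁻¹ m p •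
          (HopfAlgebra.antipode ℂ (u.mat p i) * u.mat j m)) * v.mat l n) := by
        simp_rw [← h1, Finset.sum_mul, Finset.smul_sum, smul_mul_assoc]
        have : ∀ (p m i j : u.ι) (l : v.ι), C⁻¹ m p • f (i, k) (j, l) • (HopfAlgebra.antipode ℂ (u.mat p i) *
          u.mat j m * v.mat l n) = f (i, k) (j, l) • C⁻¹ m p • (HopfAlgebra.antipode ℂ (u.mat p i) *
          u.mat j m * v.mat l n) := fun _ _ _ _ _ => smul_comm _ _ _
        simp_rw [this]
        simp only [← Fintype.sum_prod_type']
        refine Fintype.sum_equiv ⟨fun x => ⟨x.2.2.2.2, x.2.2.1, x.2.2.2.1, x.1, x.2.1⟩,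
          fun x => ⟨x.2.2.2.1, x.2.2.2.2, x.2.1, x.2.2.1, x.1⟩, fun _ => rfl, fun _ => rfl⟩ _ _
          fun x => rfl
    _ = _ := by
        simp_rw [hC.sum_antipode_mul hA hCu, ← Algebra.smul_def, Finset.sum_smul,
          smul_smul]
        refine Finset.sum_congr rfl fun j _ => Finset.sum_congr rfl fun l _ =>
          Finset.sum_congr rfl fun n _ => ?_
        rw [mul_comm]

theorem IsCanonicalIntertwiner.prod
    (hA : ∀ a : A, Coalgebra.comul (R := ℂ) (star a) = star (Coalgebra.comul (R := ℂ) a))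
    {D : Matrix v.ι v.ι ℂ} (hC : IsCanonicalIntertwiner u C) (hD : IsCanonicalIntertwiner v D) :
    IsCanonicalIntertwiner (u.prod v) (C ⊗ₖ D) where
  posDef := hC.posDef.kronecker hD.posDef
  intertwines := kronecker_intertwines hA hC.intertwines hD.intertwines
  normalized f hf := by
    have key : ∀ f : Matrix (u.ι × v.ι) (u.ι × v.ι) ℂ, f.map (algebraMap ℂ A) *
        prodMat u.mat v.mat = prodMat u.mat v.mat * f.map (algebraMap ℂ A) →
        ((C ⊗ₖ D) * f).trace = ((C ⊗ₖ D)⁻¹ * f).trace := by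
      intro f hf
      -- The weight is inverted one factor at a time, from `C ⊗ D` through `C⁻¹ ⊗ D` to `C⁻¹ ⊗ D⁻¹`.
      -- The order matters: the partial trace over the second factor is an intertwiner for the
      -- weight `D`, the one over the first factor for `C⁻¹`.
      rw [Matrix.inv_kronecker, trace_kronecker_mul_right,
        hC.normalized _ (isMor_partialTraceRight hA hD.intertwines hf), ← trace_kronecker_mul_right,
        trace_kronecker_mul_left,
        hD.normalized _ (isMor_partialTraceLeft hA hC.intertwines hC.posDef.isUnit hf),
        ← trace_kronecker_mul_left]
    exact key f hf

end Prod

end Canonical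

/-! ### Invariant functional -/

theorem exists_orthogonal_decomposition {ι : Type*} [Fintype ι] (N : Submodule ℂ (ι → ℂ))
    (x : ι → ℂ) : ∃ n ∈ N, ∀ m ∈ N, star m ⬝ᵥ (x - n) = 0 := by
  let e := WithLp.linearEquiv 2 ℂ (ι → ℂ)
  let K : Submodule ℂ (EuclideanSpace ℂ ι) := N.comap e.toLinearMap
  refine ⟨e (K.starProjection (e.symm x)), (K.starProjection_apply_mem (e.symm x)), fun m hm => ?_⟩
  have h := K.sub_starProjection_mem_orthogonal (e.symm x)
  have := (Submodule.mem_orthogonal K _).1 h (e.symm m) (by simpa [K] using hm)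
  rw [EuclideanSpace.inner_eq_star_dotProduct, dotProduct_comm] at this
  exact this

section Haar

variable {A : Type*} [Ring A] [StarRing A] [HopfAlgebra ℂ A] [StarModule ℂ A]

/-- The action `a ↦ a⁽¹⁾ f(a⁽²⁾)` of a functional. -/
def dualAct (f : A →ₗ[ℂ] ℂ) : A →ₗ[ℂ] A :=
  (TensorProduct.rid ℂ A).toLinearMap ∘ₗ TensorProduct.map LinearMap.id f ∘ₗ Coalgebra.comul

theorem dualAct_one (f : A →ₗ[ℂ] ℂ) : dualAct f 1 = f 1 • 1 := by
  simp [dualAct, Algebra.TensorProduct.one_def]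

/-- The functional `a ↦ conj f(κ(a)*)`. -/
def dualStar (f : A →ₗ[ℂ] ℂ) : A →ₗ[ℂ] ℂ where
  toFun a := star (f (star (HopfAlgebra.antipode ℂ a)))
  map_add' a b := by simp
  map_smul' c a := by simp

theorem dualStar_one (f : A →ₗ[ℂ] ℂ) : dualStar f 1 = star (f 1) := by
  simp [dualStar, HopfAlgebra.antipode_one]

/-- The operator by which a functional acts in the carrier space of a representation. -/
def opMat (W : UnitaryRep A) (f : A →ₗ[ℂ] ℂ) : Matrix W.ι W.ι ℂ := W.mat.map f

/-- Unitarity makes the operators given by functionals closed under adjoints. This is what lets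
orthogonal complements replace complete reducibility in the sequel. -/
theorem opMat_dualStar (W : UnitaryRep A) (f : A →ₗ[ℂ] ℂ) :
    opMat W (dualStar f) = (opMat W f)ᴴ := by
  ext i j
  simp [opMat, dualStar, W.antipode_apply]

theorem star_dotProduct_opMat (W : UnitaryRep A) (f : A →ₗ[ℂ] ℂ) (x y : W.ι → ℂ) :
    star x ⬝ᵥ (opMat W f *ᵥ y) = star (opMat W (dualStar f) *ᵥ x) ⬝ᵥ y := by
  rw [opMat_dualStar, Matrix.star_mulVec, Matrix.conjTranspose_conjTranspose,
    Matrix.dotProduct_mulVec]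

/-- The family `P l` spans an image of the comodule of `W`. -/
def IsRow (W : UnitaryRep A) {κ : Type} (P : W.ι → κ → A) : Prop :=
  ∀ l i, Coalgebra.comul (R := ℂ) (P l i) = ∑ m, P m i ⊗ₜ[ℂ] W.mat m l

theorem IsRow.dualAct {W : UnitaryRep A} {κ : Type} {P : W.ι → κ → A} (hP : IsRow W P)
    (f : A →ₗ[ℂ] ℂ) (x : W.ι → ℂ) (i : κ) :
    QPB.dualAct f (∑ l, x l • P l i) = ∑ l, (opMat W f *ᵥ x) l • P l i := by
  simp only [map_sum, map_smul, QPB.dualAct, LinearMap.comp_apply, hP _ i, Matrix.mulVec,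
    dotProduct, opMat, Finset.sum_smul, Finset.smul_sum]
  rw [Finset.sum_comm]
  refine Finset.sum_congr rfl fun l _ => Finset.sum_congr rfl fun m _ => ?_
  simp [smul_smul, mul_comm]

theorem IsRow.sum {W W' : UnitaryRep A} {κ : Type} {P : W.ι → κ → A} {P' : W'.ι → κ → A}
    (hP : IsRow W P) (hP' : IsRow W' P') : IsRow (W.sum W') (Sum.elim P P') := by
  have : ∀ (l : W.ι ⊕ W'.ι) i, Coalgebra.comul (R := ℂ) (Sum.elim P P' l i) =
      ∑ m, Sum.elim P P' m i ⊗ₜ[ℂ] Matrix.fromBlocks W.mat 0 0 W'.mat m l := by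
    rintro (l | l) i
    · simp [hP l i]
    · simp [hP' l i]
  exact this

/-- The kernel of the comodule map given by `P`. -/
def rowKer (W : UnitaryRep A) {κ : Type} (P : W.ι → κ → A) : Submodule ℂ (W.ι → ℂ) where
  carrier := {x | ∀ i, ∑ l, x l • P l i = 0}
  add_mem' {x y} hx hy i := by simp [add_smul, Finset.sum_add_distrib, hx i, hy i]
  zero_mem' i := by simp
  smul_mem' c x hx i := by simp [mul_smul, ← Finset.smul_sum, hx i]

theorem IsRow.opMat_mem_rowKer {W : UnitaryRep A} {κ : Type} {P : W.ι → κ → A} (hP : IsRow W P)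
    (f : A →ₗ[ℂ] ℂ) {x : W.ι → ℂ} (hx : x ∈ rowKer W P) : opMat W f *ᵥ x ∈ rowKer W P := by
  intro i
  rw [← hP.dualAct, hx i, map_zero]

/-- The span of the vectors `f x - f(1) x`. -/
def augmentation (W : UnitaryRep A) : Submodule ℂ (W.ι → ℂ) :=
  Submodule.span ℂ {y | ∃ (f : A →ₗ[ℂ] ℂ) (x : W.ι → ℂ), y = opMat W f *ᵥ x - f 1 • x}

theorem elim_mem_augmentation {W W' : UnitaryRep A} {x : W.ι → ℂ} {x' : W'.ι → ℂ}
    (hx : x ∈ augmentation W) (hx' : x' ∈ augmentation W') :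
    (Sum.elim x x' : W.ι ⊕ W'.ι → ℂ) ∈ augmentation (W.sum W') := by
  let e := (LinearEquiv.sumArrowLequivProdArrow W.ι W'.ι ℂ ℂ).symm.toLinearMap
  have h1 : augmentation W ≤ (augmentation (W.sum W')).comap (e ∘ₗ LinearMap.inl _ _ _) := by
    refine Submodule.span_le.2 ?_
    rintro _ ⟨f, y, rfl⟩
    refine Submodule.subset_span ⟨f, (Sum.elim y (fun _ => 0) : W.ι ⊕ W'.ι → ℂ), ?_⟩
    have : (Sum.elim (opMat W f *ᵥ y - f 1 • y) (fun _ => 0) : W.ι ⊕ W'.ι → ℂ) =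
        (Matrix.fromBlocks W.mat 0 0 W'.mat).map f *ᵥ Sum.elim y (fun _ => 0) -
          f 1 • Sum.elim y (fun _ => 0) := by
      rw [Matrix.fromBlocks_map, Matrix.fromBlocks_mulVec]
      ext (i | i) <;> simp [opMat, Matrix.mulVec, dotProduct]
    exact this
  have h2 : augmentation W' ≤ (augmentation (W.sum W')).comap (e ∘ₗ LinearMap.inr _ _ _) := by
    refine Submodule.span_le.2 ?_
    rintro _ ⟨f, y, rfl⟩
    refine Submodule.subset_span ⟨f, (Sum.elim (fun _ => 0) y : W.ι ⊕ W'.ι → ℂ), ?_⟩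
    have : (Sum.elim (fun _ => 0) (opMat W' f *ᵥ y - f 1 • y) : W.ι ⊕ W'.ι → ℂ) =
        (Matrix.fromBlocks W.mat 0 0 W'.mat).map f *ᵥ Sum.elim (fun _ => 0) y -
          f 1 • Sum.elim (fun _ => 0) y := by
      rw [Matrix.fromBlocks_map, Matrix.fromBlocks_mulVec]
      ext (i | i) <;> simp [opMat, Matrix.mulVec, dotProduct]
    exact this
  have h3 : (Sum.elim x x' : W.ι ⊕ W'.ι → ℂ) =
      (e ∘ₗ LinearMap.inl _ _ _) x + (e ∘ₗ LinearMap.inr _ _ _) x' := by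
    ext (i | i) <;> simp [e]
  rw [h3]
  exact add_mem (h1 hx) (h2 hx')

theorem eq_zero_of_orthogonal_of_mem {ι : Type*} [Fintype ι] {N : Submodule ℂ (ι → ℂ)}
    {x : ι → ℂ} (h : ∀ m ∈ N, star m ⬝ᵥ x = 0) (hx : x ∈ N) : x = 0 :=
  dotProduct_star_self_eq_zero.1 (h x hx)

/-- The orthogonal complement of the augmentation space consists of the invariant vectors. -/
theorem orthogonal_augmentation_iff {W : UnitaryRep A} {z : W.ι → ℂ} :
    (∀ m ∈ augmentation W, star m ⬝ᵥ z = 0) ↔ ∀ f, opMat W f *ᵥ z = f 1 • z := by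
  constructor
  · intro h f
    rw [← sub_eq_zero]
    refine eq_zero_of_orthogonal_of_mem (N := ⊤) (fun x _ => ?_) trivial
    rw [dotProduct_sub, star_dotProduct_opMat, dotProduct_smul]
    have := h _ (Submodule.subset_span ⟨dualStar f, x, rfl⟩)
    rw [dualStar_one, star_sub, star_smul, star_star, sub_dotProduct, smul_dotProduct] at this
    exact this
  · intro h m hm
    induction hm using Submodule.span_induction with
    | mem m hm =>
      obtain ⟨f, x, rfl⟩ := hm
      have e := opMat_dualStar W f
      rw [star_sub, star_smul, sub_dotProduct, Matrix.star_mulVec, ← e, smul_dotProduct,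
        ← Matrix.dotProduct_mulVec, h, dualStar_one, dotProduct_smul, sub_self]
    | zero => simp
    | add x y _ _ h h' => rw [star_add, add_dotProduct, h, h', add_zero]
    | smul c x _ h => rw [star_smul, smul_dotProduct, h, smul_zero]

/-- Suppose `y` maps to `1`, and let `z` be its component orthogonal to the kernel. Each `opMat W f
z - f(1) z` lies in the kernel, because `1` is invariant, and is orthogonal to it, hence vanishes.
So `z` is invariant and therefore orthogonal to the augmentation space, in particular to `y`. Then
`z ⬝ z = 0`, which contradicts that `z` also maps to `1`. -/
theorem one_notMem_augmentation [Nontrivial A] {W : UnitaryRep A} {P : W.ι → Unit → A}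
    (hP : IsRow W P) {y : W.ι → ℂ} (hy : y ∈ augmentation W) : ∑ l, y l • P l () ≠ 1 := by
  intro h1
  obtain ⟨n, hn, hyn⟩ := exists_orthogonal_decomposition (rowKer W P) y
  set z := y - n with hz
  have hPz : ∑ l, z l • P l () = 1 := by
    simp [hz, sub_smul, h1, hn ()]
  have inv : ∀ f : A →ₗ[ℂ] ℂ, opMat W f *ᵥ z = f 1 • z := by
    intro f
    rw [← sub_eq_zero]
    refine eq_zero_of_orthogonal_of_mem (N := rowKer W P) (fun m hm => ?_) fun _ => ?_
    · rw [dotProduct_sub, star_dotProduct_opMat, dotProduct_smul, hyn m hm,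
        hyn _ (hP.opMat_mem_rowKer _ hm)]
      simp
    · simp only [Pi.sub_apply, sub_smul, Finset.sum_sub_distrib, Pi.smul_apply, smul_assoc,
        ← Finset.smul_sum]
      rw [← hP.dualAct, hPz, dualAct_one, sub_self]
  have hz0 : z = 0 := by
    refine dotProduct_star_self_eq_zero.1 ?_
    have e : star z ⬝ᵥ z = star y ⬝ᵥ z - star n ⬝ᵥ z := by rw [← sub_dotProduct, ← star_sub]
    rw [e, orthogonal_augmentation_iff.2 inv y hy, hyn n hn, sub_zero]
  simp [hz0] at hPz

theorem isRow_row (W : UnitaryRep A) (k : W.ι) : IsRow W fun l (_ : Unit) => W.mat k l :=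
  fun l _ => W.comul_mat k l

theorem nontrivial_of_hopf : Nontrivial A :=
  ⟨1, 0, fun h => by simpa using congrArg (Coalgebra.counit (R := ℂ)) h⟩

/-- The augmentation space of the algebra. -/
def algAugmentation (A : Type*) [Ring A] [HopfAlgebra ℂ A] : Submodule ℂ A :=
  Submodule.span ℂ {y | ∃ (f : A →ₗ[ℂ] ℂ) (a : A), y = dualAct f a - f 1 • a}

/-- A finite sum of matrix coefficients lives in the direct sum of the corresponding
representations. Thus the question about `A` is moved into one finite-dimensional Hilbert space. -/
theorem exists_row_of_mem_algAugmentation (hA : Submodule.span ℂ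
    {a : A | ∃ (u : UnitaryRep A) (i j : u.ι), a = u.mat i j} = ⊤) {a : A}
    (ha : a ∈ algAugmentation A) : ∃ (W : UnitaryRep A) (P : W.ι → Unit → A) (_ : IsRow W P),
      ∃ y ∈ augmentation W, ∑ l, y l • P l () = a := by
  have hz : ∃ (W : UnitaryRep A) (P : W.ι → Unit → A) (_ : IsRow W P),
      ∃ y ∈ augmentation W, ∑ l, y l • P l () = 0 :=
    ⟨UnitaryRep.trivial, _, isRow_row _ (), 0, zero_mem _, by simp⟩
  have hadd : ∀ a b, (∃ (W : UnitaryRep A) (P : W.ι → Unit → A) (_ : IsRow W P),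
      ∃ y ∈ augmentation W, ∑ l, y l • P l () = a) →
      (∃ (W : UnitaryRep A) (P : W.ι → Unit → A) (_ : IsRow W P),
      ∃ y ∈ augmentation W, ∑ l, y l • P l () = b) →
      ∃ (W : UnitaryRep A) (P : W.ι → Unit → A) (_ : IsRow W P),
      ∃ y ∈ augmentation W, ∑ l, y l • P l () = a + b := by
    rintro _ _ ⟨W, P, hP, y, hy, rfl⟩ ⟨W', P', hP', y', hy', rfl⟩
    refine ⟨W.sum W', Sum.elim P P', hP.sum hP', (Sum.elim y y' : W.ι ⊕ W'.ι → ℂ),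
      elim_mem_augmentation hy hy', ?_⟩
    exact (Fintype.sum_sum_type _).trans rfl
  have hsmul : ∀ (c : ℂ) a, (∃ (W : UnitaryRep A) (P : W.ι → Unit → A) (_ : IsRow W P),
      ∃ y ∈ augmentation W, ∑ l, y l • P l () = a) →
      ∃ (W : UnitaryRep A) (P : W.ι → Unit → A) (_ : IsRow W P),
      ∃ y ∈ augmentation W, ∑ l, y l • P l () = c • a := by
    rintro c _ ⟨W, P, hP, y, hy, rfl⟩
    exact ⟨W, P, hP, c • y, Submodule.smul_mem _ c hy, by simp [mul_smul, Finset.smul_sum]⟩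
  induction ha using Submodule.span_induction with
  | mem a ha =>
    obtain ⟨f, a, rfl⟩ := ha
    have ha : a ∈ Submodule.span ℂ {a : A | ∃ (u : UnitaryRep A) (i j : u.ι), a = u.mat i j} := by
      rw [hA]; trivial
    induction ha using Submodule.span_induction with
    | mem a ha =>
      obtain ⟨u, k, l, rfl⟩ := ha
      refine ⟨u, _, isRow_row u k, _, Submodule.subset_span ⟨f, Pi.single l 1, rfl⟩, ?_⟩
      have h := (isRow_row u k).dualAct f (Pi.single l 1) ()
      simp only [Pi.sub_apply, sub_smul, Finset.sum_sub_distrib, Pi.smul_apply, smul_assoc,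
        ← Finset.smul_sum]
      rw [← h]
      simp [Pi.single_apply]
    | zero => simpa using hz
    | add x y _ _ hx hy =>
      convert! hadd _ _ hx hy using 10
      simp only [map_add, smul_add]
      abel_nf
    | smul c x _ hx =>
      convert! hsmul c _ hx using 10
      simp only [map_smul, smul_sub, smul_comm c]
  | zero => exact hz
  | add x y _ _ hx hy => exact hadd _ _ hx hy
  | smul c x _ hx => exact hsmul c _ hx

/-- The invariant functional of a compact matrix quantum group. -/
theorem exists_haar (hA : Submodule.span ℂ
    {a : A | ∃ (u : UnitaryRep A) (i j : u.ι), a = u.mat i j} = ⊤) :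
    ∃ h : A →ₗ[ℂ] ℂ, h 1 = 1 ∧ ∀ a, TensorProduct.lid ℂ A
      (TensorProduct.map h LinearMap.id (Coalgebra.comul (R := ℂ) a)) = h a • 1 := by
  have : Nontrivial A := nontrivial_of_hopf
  have h1 : (1 : A) ∉ algAugmentation A := by
    intro h
    obtain ⟨W, P, hP, y, hy, e⟩ := exists_row_of_mem_algAugmentation hA h
    exact one_notMem_augmentation hP hy e
  -- The invariant functional is any functional that vanishes on the augmentation space but not at
  -- `1`, rescaled.
  obtain ⟨g, hg, hg'⟩ := Submodule.exists_le_ker_of_notMem h1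
  refine ⟨(g 1)⁻¹ • g, by simp [hg], fun a => ?_⟩
  -- Tested against all functionals `f`, invariance says that `g` vanishes on every `dualAct f a - f
  -- 1 • a`.
  rw [← sub_eq_zero, ← Module.forall_dual_apply_eq_zero_iff ℂ]
  intro f
  have h2 : g (dualAct f a - f 1 • a) = 0 := hg' (Submodule.subset_span ⟨f, a, rfl⟩)
  have h3 : ∀ t : A ⊗[ℂ] A, f (TensorProduct.lid ℂ A (TensorProduct.map ((g 1)⁻¹ • g)
      LinearMap.id t)) = (g 1)⁻¹ * g (TensorProduct.rid ℂ A (TensorProduct.map LinearMap.id f t)) := by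
    intro t
    induction t with
    | zero => simp
    | add x y hx hy => simp only [map_add, hx, hy, mul_add]
    | tmul x y => simp; ring
  rw [map_sub, h3]
  rw [map_sub, map_smul, sub_eq_zero] at h2
  have h4 : g (TensorProduct.rid ℂ A (TensorProduct.map LinearMap.id f
    (Coalgebra.comul (R := ℂ) a))) = f 1 • g a := h2
  rw [h4]
  simp
  ring

/-- The families that can be realized form a submodule, direct sums of representations providing the
additions. It contains all families with a single nonzero entry equal to a matrix coefficient, and
these span. -/
theorem exists_row_pi (hA : Submodule.span ℂ
    {a : A | ∃ (u : UnitaryRep A) (i j : u.ι), a = u.mat i j} = ⊤) {κ : Type} [Fintype κ]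
    (a : κ → A) : ∃ (W : UnitaryRep A) (P : W.ι → κ → A) (_ : IsRow W P) (x : W.ι → ℂ),
      ∀ i, ∑ l, x l • P l i = a i := by
  classical
  let R : Submodule ℂ (κ → A) :=
    { carrier := {a | ∃ (W : UnitaryRep A) (P : W.ι → κ → A) (_ : IsRow W P) (x : W.ι → ℂ),
        ∀ i, ∑ l, x l • P l i = a i}
      add_mem' := by
        rintro a b ⟨W, P, hP, x, hx⟩ ⟨W', P', hP', x', hx'⟩
        refine ⟨W.sum W', Sum.elim P P', hP.sum hP', (Sum.elim x x' : W.ι ⊕ W'.ι → ℂ), fun i => ?_⟩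
        rw [Pi.add_apply, ← hx, ← hx']
        exact (Fintype.sum_sum_type _).trans rfl
      zero_mem' := ⟨UnitaryRep.trivial, 0, fun l i => by simp, 0, by simp⟩
      smul_mem' := by
        rintro c a ⟨W, P, hP, x, hx⟩
        exact ⟨W, P, hP, c • x, fun i => by simp [mul_smul, ← Finset.smul_sum, hx]⟩ }
  have hR : ∀ a, a ∈ R := by
    intro a
    rw [← Finset.univ_sum_single a]
    refine sum_mem fun k _ => ?_
    have ha : a k ∈ Submodule.span ℂ {a : A | ∃ (u : UnitaryRep A) (i j : u.ι), a = u.mat i j} := by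
      rw [hA]; trivial
    have : Submodule.span ℂ {a : A | ∃ (u : UnitaryRep A) (i j : u.ι), a = u.mat i j} ≤
        R.comap (LinearMap.single ℂ (fun _ : κ => A) k) := by
      refine Submodule.span_le.2 ?_
      rintro _ ⟨u, i, j, rfl⟩
      refine ⟨u, fun l => Pi.single k (u.mat i l), fun l m => ?_, Pi.single j 1, fun m => ?_⟩
      · by_cases h : m = k
        · subst h; simp [u.comul_mat]
        · simp [h]
      · simp [Pi.single_apply]
    exact this ha
  exact hR a

theorem exists_row_family (hA : Submodule.span ℂ
    {a : A | ∃ (u : UnitaryRep A) (i j : u.ι), a = u.mat i j} = ⊤) {κ σ : Type} [Fintype κ]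
    [Fintype σ] (a : σ → κ → A) : ∃ (W : UnitaryRep A) (P : W.ι → κ → A) (_ : IsRow W P)
      (x : σ → W.ι → ℂ), ∀ s i, ∑ l, x s l • P l i = a s i := by
  classical
  have : ∀ S : Finset σ, ∃ (W : UnitaryRep A) (P : W.ι → κ → A) (_ : IsRow W P)
      (x : σ → W.ι → ℂ), ∀ s ∈ S, ∀ i, ∑ l, x s l • P l i = a s i := by
    intro S
    induction S using Finset.induction_on with
    | empty => exact ⟨UnitaryRep.trivial, 0, fun l i => by simp, 0, by simp⟩
    | insert t S ht ih =>
      obtain ⟨W, P, hP, x, hx⟩ := ih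
      obtain ⟨W', P', hP', x', hx'⟩ := exists_row_pi hA (a t)
      refine ⟨W.sum W', Sum.elim P P', hP.sum hP', fun s => (if s = t then Sum.elim 0 x' else
        Sum.elim (x s) 0 : W.ι ⊕ W'.ι → ℂ), fun s hs i => ?_⟩
      refine (Fintype.sum_sum_type _).trans ?_
      by_cases h : s = t
      · subst h
        simp [hx']
      · simp [h, hx s (Finset.mem_of_mem_insert_of_ne hs h)]
  obtain ⟨W, P, hP, x, hx⟩ := this Finset.univ
  exact ⟨W, P, hP, x, fun s i => hx s (Finset.mem_univ s) i⟩

/-- Every corepresentation embeds into a unitary one. -/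
theorem IsCorep.exists_embedding (hA : Submodule.span ℂ
    {a : A | ∃ (u : UnitaryRep A) (i j : u.ι), a = u.mat i j} = ⊤) {ι : Type} [Fintype ι]
    [DecidableEq ι] {z : Matrix ι ι A} (hz : IsCorep z) :
    ∃ (W : UnitaryRep A) (F : Matrix W.ι ι ℂ), Function.Injective F.mulVec ∧
      W.mat * F.map (algebraMap ℂ A) = F.map (algebraMap ℂ A) * z := by
  obtain ⟨W, P, hP, x, hx⟩ := exists_row_family hA (fun j i => z i j)
  -- Among the vectors of `W` with prescribed image, those orthogonal to the kernel are unique. This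
  -- uniqueness is what makes `F` an intertwiner.
  choose n hn hF using fun j => exists_orthogonal_decomposition (rowKer W P) (x j)
  set F : Matrix W.ι ι ℂ := Matrix.of fun l j => (x j - n j) l with hFdef
  have hPF : ∀ j i, ∑ l, F l j • P l i = z i j := by
    intro j i
    simp [hFdef, sub_smul, hx, hn j i]
  refine ⟨W, F, ?_, ?_⟩
  · refine (injective_iff_map_eq_zero F.mulVecLin).2 fun y hy => ?_
    ext i
    -- Once `∑ j, y j • z i j` vanishes, the counit recovers the coordinate `y i`.
    have h1 : ∑ j, y j • z i j = 0 := by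
      simp_rw [← hPF, Finset.smul_sum, smul_smul]
      rw [Finset.sum_comm]
      simp_rw [← Finset.sum_smul]
      refine Finset.sum_eq_zero fun l _ => ?_
      have : ∑ j, F l j * y j = 0 := congrFun hy l
      simp_rw [mul_comm (y _), this, zero_smul]
    have := congrArg (Coalgebra.counit (R := ℂ)) h1
    simpa [hz.counit] using this
  · ext l j
    rw [← sub_eq_zero, ← Module.forall_dual_apply_eq_zero_iff ℂ]
    intro f
    -- The difference of the two sides lies in the kernel and is orthogonal to it.
    have h0 : opMat W f *ᵥ (fun m => F m j) - (fun m => ∑ i, f (z i j) * F m i) = 0 := by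
      refine eq_zero_of_orthogonal_of_mem (N := rowKer W P) (fun m hm => ?_) fun k => ?_
      · have o : ∀ m ∈ rowKer W P, ∀ i, star m ⬝ᵥ (fun m => F m i) = 0 := fun m hm i => hF i m hm
        rw [dotProduct_sub, star_dotProduct_opMat, o _ (hP.opMat_mem_rowKer _ hm), zero_sub,
          neg_eq_zero]
        have : (fun m => ∑ i, f (z i j) * F m i) = ∑ i, f (z i j) • (fun m => F m i) := by
          ext; simp
        rw [this, dotProduct_sum]
        simp [dotProduct_smul, o m hm]
      · simp only [Pi.sub_apply, sub_smul, Finset.sum_sub_distrib]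
        rw [← hP.dualAct, hPF]
        simp_rw [Finset.sum_smul, mul_smul]
        rw [Finset.sum_comm]
        simp_rw [← Finset.smul_sum, hPF]
        simp [dualAct, hz.comul]
    have := congrFun h0 l
    simpa [Matrix.mul_apply, Matrix.mulVec, dotProduct, opMat, ← Algebra.commutes,
      ← Algebra.smul_def, mul_comm] using this

/-- Embed the contragredient into a unitary representation by `F`. The pulled back inner product `Fᴴ
F` is invariant under the contragredient, and its transpose intertwines `u` with `u^cc`. -/
theorem exists_posDef_isContraMor (hA : IsCompactMatrixQuantumGroup A) (u : UnitaryRep A) :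
    ∃ C : Matrix u.ι u.ι ℂ, C.PosDef ∧ IsContraMor u C := by
  have hz := isCorep_contra hA.comul_star u
  obtain ⟨W, F, hF, e⟩ := hz.exists_embedding hA.span_coeff
  refine ⟨(Fᴴ * F)ᵀ, (Matrix.PosDef.conjTranspose_mul_self F hF).transpose, ?_⟩
  have e1 : (contra u.mat)ᴴ = u.matᵀ := by
    ext i j
    simp [u.antipode_apply]
  have e2 : u.matᵀ * (Fᴴ * F).map (algebraMap ℂ A) * contra u.mat =
      (Fᴴ * F).map (algebraMap ℂ A) := by
    rw [← e1, Matrix.map_mul, ← map_algebraMap_conjTranspose, Matrix.mul_assoc, Matrix.mul_assoc,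
      ← e, ← Matrix.mul_assoc, ← Matrix.conjTranspose_mul, ← e, Matrix.conjTranspose_mul,
      Matrix.mul_assoc, ← Matrix.mul_assoc W.matᴴ, W.unitary_left, Matrix.one_mul]
  have e3 : u.matᵀ * (Fᴴ * F).map (algebraMap ℂ A) =
      (Fᴴ * F).map (algebraMap ℂ A) * (contra (contra u.mat))ᵀ := by
    calc _ = u.matᵀ * (Fᴴ * F).map (algebraMap ℂ A) *
          (contra u.mat * (contra u.mat).map (HopfAlgebra.antipode ℂ)) := by
          rw [hz.mul_antipode, Matrix.mul_one]
      _ = _ := by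
          rw [← Matrix.mul_assoc, e2]
          rfl
  unfold IsContraMor
  ext i j
  have := congrFun (congrFun e3 j) i
  simp only [Matrix.mul_apply, Matrix.map_apply, Matrix.transpose_apply, Algebra.commutes] at this ⊢
  exact this

end Haar

/-! ### Existence of the canonical intertwiner -/

open scoped MatrixOrder in
-- Write `C = B* B` and apply the arithmetic–geometric inequality to the columns of `B`. The bound
-- makes the set of admissible pairs bounded.
theorem norm_apply_le_trace {n : Type*} [Fintype n] [DecidableEq n] {C : Matrix n n ℂ}
    (hC : C.PosSemidef) (i j : n) : ‖C i j‖ ≤ C.trace.re := by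
  obtain ⟨B, rfl⟩ := CStarAlgebra.nonneg_iff_eq_star_mul_self.mp hC.nonneg
  have e : ∀ a, ((star B * B) a a).re = ∑ k, ‖B k a‖ ^ 2 := by
    intro a
    simp [Matrix.mul_apply, Matrix.star_apply, ← Complex.normSq_eq_norm_sq, Complex.normSq_apply]
  have t : ∀ a b, ∑ k, ‖B k a‖ ^ 2 ≤ (star B * B).trace.re ∧
      (a ≠ b → ∑ k, ‖B k a‖ ^ 2 + ∑ k, ‖B k b‖ ^ 2 ≤ (star B * B).trace.re) := by
    intro a b
    have hn : ∀ c, 0 ≤ ∑ k, ‖B k c‖ ^ 2 := fun c => Finset.sum_nonneg fun k _ => by positivity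
    simp only [Matrix.trace, Matrix.diag_apply, Complex.re_sum, e]
    exact ⟨Finset.single_le_sum (f := fun a => ∑ k, ‖B k a‖ ^ 2) (fun c _ => hn c)
      (Finset.mem_univ a), fun hab => Finset.add_le_sum (f := fun a => ∑ k, ‖B k a‖ ^ 2)
        (fun c _ => hn c) (Finset.mem_univ a) (Finset.mem_univ b) hab⟩
  have h1 : ‖(star B * B) i j‖ ≤ ∑ k, (‖B k i‖ ^ 2 + ‖B k j‖ ^ 2) / 2 := by
    rw [Matrix.mul_apply]
    refine (norm_sum_le _ _).trans (Finset.sum_le_sum fun k _ => ?_)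
    rw [norm_mul, Matrix.star_apply, norm_star]
    nlinarith [sq_nonneg (‖B k i‖ - ‖B k j‖)]
  rw [← Finset.sum_div, Finset.sum_add_distrib] at h1
  have := (t i j).1
  have := (t j i).1
  linarith

section Existence

variable {A : Type*} [Ring A] [StarRing A] [HopfAlgebra ℂ A] [StarModule ℂ A]

theorem map_algebraMap_smul {m n : Type*} (c : ℂ) (f : Matrix m n ℂ) :
    (c • f).map (algebraMap ℂ A) = c • f.map (algebraMap ℂ A) := by
  ext i j
  simp only [Matrix.map_apply, Matrix.smul_apply, smul_eq_mul, map_mul, Algebra.smul_def]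

theorem IsMor.smul {u v : UnitaryRep A} {f : Matrix v.ι u.ι ℂ} (hf : IsMor u v f) (c : ℂ) :
    IsMor u v (c • f) := by
  unfold IsMor at *
  rw [map_algebraMap_smul, Matrix.smul_mul, hf, Matrix.mul_smul]

/-- The pairs `(C, C⁻¹)` of positive intertwiners between `u` and its second contragredient,
with a bound on the traces. -/
def positivePairs (u : UnitaryRep A) (M : ℝ) : Set (Matrix u.ι u.ι ℂ × Matrix u.ι u.ι ℂ) :=
  {p | p.1.PosSemidef ∧ p.2.PosSemidef ∧ p.1 * p.2 = 1 ∧ IsContraMor u p.1 ∧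
    p.1.trace.re + p.2.trace.re ≤ M}

/-- The space of intertwiners between `u` and its second contragredient. -/
def contraMor (u : UnitaryRep A) : Submodule ℂ (Matrix u.ι u.ι ℂ) where
  carrier := {C | IsContraMor u C}
  add_mem' {a b} ha hb := by
    simp only [Set.mem_ofPred_eq, IsContraMor] at *
    rw [Matrix.map_add _ (map_add _), Matrix.add_mul, Matrix.mul_add, ha, hb]
  zero_mem' := by simp [IsContraMor]
  smul_mem' c a ha := by
    simp only [Set.mem_ofPred_eq, IsContraMor] at *
    rw [map_algebraMap_smul, Matrix.smul_mul, ha, Matrix.mul_smul]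

theorem isClosed_posSemidef {n : Type*} [Fintype n] :
    IsClosed {C : Matrix n n ℂ | C.PosSemidef} := by
  simp only [Matrix.posSemidef_iff_dotProduct_mulVec, Set.ofPred_and, Set.ofPred_forall]
  refine IsClosed.inter (isClosed_eq continuous_id.matrix_conjTranspose continuous_id)
    (isClosed_iInter fun x => ?_)
  exact isClosed_le continuous_const
    (continuous_const.dotProduct (continuous_id.matrix_mulVec continuous_const))

/-- Keeping the inverse as a second coordinate makes invertibility a closed condition, while the
bound on both traces prevents degeneration. -/
theorem isCompact_positivePairs (u : UnitaryRep A) (M : ℝ) : IsCompact (positivePairs u M) := by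
  let B : Set (Matrix u.ι u.ι ℂ) :=
    Set.pi Set.univ fun _ => Set.pi Set.univ fun _ => Metric.closedBall 0 M
  have hB : IsCompact B :=
    isCompact_univ_pi fun _ => isCompact_univ_pi fun _ => isCompact_closedBall 0 M
  refine (hB.prod hB).of_isClosed_subset ?_ ?_
  · refine IsClosed.inter (isClosed_posSemidef.preimage continuous_fst) (IsClosed.inter
      (isClosed_posSemidef.preimage continuous_snd) (IsClosed.inter ?_ (IsClosed.inter ?_ ?_)))
    · exact isClosed_eq (continuous_fst.matrix_mul continuous_snd) continuous_const
    · exact (Submodule.closed_of_finiteDimensional (contraMor u)).preimage continuous_fst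
    · exact isClosed_le ((Complex.continuous_re.comp continuous_fst.matrix_trace).add
        (Complex.continuous_re.comp continuous_snd.matrix_trace)) continuous_const
  · rintro ⟨C, D⟩ ⟨h1, h2, -, -, h5⟩
    have p1 := (Complex.nonneg_iff.1 h1.trace_nonneg).1
    have p2 := (Complex.nonneg_iff.1 h2.trace_nonneg).1
    simp only at h5 h1 h2
    refine ⟨fun i _ j _ => ?_, fun i _ j _ => ?_⟩
    · rw [mem_closedBall_zero_iff]
      linarith [norm_apply_le_trace h1 i j]
    · rw [mem_closedBall_zero_iff]
      linarith [norm_apply_le_trace h2 i j]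

/-- The bound `M` is the value at some admissible `C₀`. Competitors outside the compact set then
exceed `M`, so a minimum over the set is a global one. -/
theorem exists_minimal_positivePair (hA : IsCompactMatrixQuantumGroup A) (u : UnitaryRep A) :
    ∃ C : Matrix u.ι u.ι ℂ, C.PosDef ∧ IsContraMor u C ∧ ∀ D : Matrix u.ι u.ι ℂ, D.PosDef →
      IsContraMor u D → C.trace.re + C⁻¹.trace.re ≤ D.trace.re + D⁻¹.trace.re := by
  obtain ⟨C₀, h0, h0'⟩ := exists_posDef_isContraMor hA u
  set M := C₀.trace.re + C₀⁻¹.trace.re with hM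
  have mem : ∀ D : Matrix u.ι u.ι ℂ, D.PosDef → IsContraMor u D →
      D.trace.re + D⁻¹.trace.re ≤ M → (D, D⁻¹) ∈ positivePairs u M := fun D hD hD' h =>
    ⟨hD.posSemidef, hD.inv.posSemidef,
      Matrix.mul_nonsing_inv _ ((Matrix.isUnit_iff_isUnit_det _).1 hD.isUnit), hD', h⟩
  obtain ⟨⟨C, C'⟩, ⟨h1, h2, h3, h4, h5⟩, hmin⟩ :=
    (isCompact_positivePairs u M).exists_isMinOn ⟨_, mem C₀ h0 h0' le_rfl⟩
      (f := fun p => p.1.trace.re + p.2.trace.re)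
      ((Complex.continuous_re.comp continuous_fst.matrix_trace).add
        (Complex.continuous_re.comp continuous_snd.matrix_trace)).continuousOn
  simp only at h1 h2 h3 h4 h5
  have hC' : C⁻¹ = C' := Matrix.inv_eq_right_inv h3
  refine ⟨C, h1.posDef_iff_isUnit.2 (IsUnit.of_mul_eq_one _ h3), h4, fun D hD hD' => ?_⟩
  rw [hC']
  by_cases h : D.trace.re + D⁻¹.trace.re ≤ M
  · exact hmin (mem D hD hD' h)
  · linarith

-- This is the first variation along `Tᴴ C T` with `T = 1 + t f`, which stays among the admissible
-- intertwiners because `T` commutes with `u`. Only `t > 0` is used; replacing `f` by its multiples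
-- gives the remaining directions.
open Filter Topology in
theorem trace_nonneg_of_minimal {u : UnitaryRep A} {C : Matrix u.ι u.ι ℂ} (hC : C.PosDef)
    (hC' : IsContraMor u C) (hmin : ∀ D : Matrix u.ι u.ι ℂ, D.PosDef →
      IsContraMor u D → C.trace.re + C⁻¹.trace.re ≤ D.trace.re + D⁻¹.trace.re)
    {f : Matrix u.ι u.ι ℂ} (hf : IsMor u u f) :
    0 ≤ ((C * f).trace - (C⁻¹ * f).trace).re := by
  let T : ℝ → Matrix u.ι u.ι ℂ := fun t => 1 + (t : ℂ) • f
  have hT : Continuous T := by fun_prop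
  have hT0 : T 0 = 1 := by simp [T]
  have hd : ∀ᶠ t in 𝓝 (0 : ℝ), (T t).det ≠ 0 :=
    hT.matrix_det.continuousAt.eventually_ne (by simp [hT0])
  have hinv : ContinuousAt (fun t => (T t)⁻¹) 0 := by
    have : ContinuousAt (Inv.inv : Matrix u.ι u.ι ℂ → _) (T 0) := by
      apply continuousAt_matrix_inv
      rw [hT0, Matrix.det_one, Ring.inverse_eq_inv']
      exact continuousAt_inv₀ one_ne_zero
    exact this.comp (f := T) hT.continuousAt
  -- The trace of `E t` is the difference quotient of `tr C + tr C⁻¹`, written so that it makes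
  -- sense and is continuous at `t = 0`.
  let E : ℝ → Matrix u.ι u.ι ℂ := fun t => C * f + fᴴ * C + (t : ℂ) • (fᴴ * C * f) -
    f * (T t)⁻¹ * C⁻¹ * ((T t)⁻¹)ᴴ - C⁻¹ * (f * (T t)⁻¹)ᴴ
  have hE : ContinuousAt (fun t => (E t).trace.re) 0 := by
    have hS : ContinuousAt (fun t => ((T t)⁻¹)ᴴ) 0 :=
      (continuous_id.matrix_conjTranspose).continuousAt.comp hinv
    have hm : ∀ {X Y : ℝ → Matrix u.ι u.ι ℂ}, ContinuousAt X 0 → ContinuousAt Y 0 →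
        ContinuousAt (fun t => X t * Y t) 0 := fun hX hY => hX.mul hY
    have hE' : ContinuousAt E 0 := by
      refine ((?_ : ContinuousAt (fun t : ℝ => C * f + fᴴ * C + (t : ℂ) • (fᴴ * C * f)) 0).sub
        (hm (hm (hm continuousAt_const hinv) continuousAt_const) hS)).sub
        (hm continuousAt_const
          ((continuous_id.matrix_conjTranspose).continuousAt.comp (hm continuousAt_const hinv)))
      exact Continuous.continuousAt (by fun_prop)
    exact Complex.continuous_re.continuousAt.comp
      ((continuous_id.matrix_trace).continuousAt.comp hE')
  have key : ∀ᶠ t in 𝓝[>] (0 : ℝ), 0 ≤ (E t).trace.re := by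
    filter_upwards [hd.filter_mono nhdsWithin_le_nhds, self_mem_nhdsWithin] with t ht ht0
    have ht0 : (0 : ℝ) < t := ht0
    have hu : IsUnit (T t).det := isUnit_iff_ne_zero.2 ht
    have hTm : IsMor u u (T t) := isMor_one.add (hf.smul t)
    have hD : ((T t)ᴴ * C * T t).PosDef :=
      hC.conjTranspose_mul_mul_same (Matrix.mulVec_injective_iff_isUnit.2
        ((Matrix.isUnit_iff_isUnit_det _).2 hu))
    have hD' : IsContraMor u ((T t)ᴴ * C * T t) :=
      (hTm.conjTranspose.mul_isContraMor hC').mul_isMor hTm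
    have h := hmin _ hD hD'
    have e1 : ((T t)ᴴ * C * T t) = C + (t : ℂ) • (C * f + fᴴ * C + (t : ℂ) • (fᴴ * C * f)) := by
      simp only [T, Matrix.conjTranspose_add, Matrix.conjTranspose_one, Matrix.conjTranspose_smul,
        Complex.star_def, Complex.conj_ofReal, Matrix.add_mul, Matrix.mul_add, Matrix.one_mul,
        Matrix.mul_one, Matrix.smul_mul, Matrix.mul_smul, smul_add]
      abel
    have g1 : (T t)⁻¹ = 1 - (t : ℂ) • (f * (T t)⁻¹) := by
      have : T t * (T t)⁻¹ = 1 := Matrix.mul_nonsing_inv _ hu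
      conv_lhs at this => lhs; simp only [T]
      rw [Matrix.add_mul, Matrix.one_mul, Matrix.smul_mul] at this
      exact eq_sub_of_add_eq this
    have e2 : ((T t)ᴴ * C * T t)⁻¹ = C⁻¹ - (t : ℂ) • (f * (T t)⁻¹ * C⁻¹ * ((T t)⁻¹)ᴴ +
        C⁻¹ * (f * (T t)⁻¹)ᴴ) := by
      rw [Matrix.mul_inv_rev, Matrix.mul_inv_rev, ← Matrix.conjTranspose_nonsing_inv]
      have g2 : ((T t)⁻¹)ᴴ = 1 - (t : ℂ) • (f * (T t)⁻¹)ᴴ := by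
        conv_lhs => rw [g1]
        simp
      calc (T t)⁻¹ * (C⁻¹ * ((T t)⁻¹)ᴴ) = (1 - (t : ℂ) • (f * (T t)⁻¹)) * (C⁻¹ * ((T t)⁻¹)ᴴ) := by
            rw [← g1]
        _ = C⁻¹ * ((T t)⁻¹)ᴴ - (t : ℂ) • (f * (T t)⁻¹ * C⁻¹ * ((T t)⁻¹)ᴴ) := by
            rw [Matrix.sub_mul, Matrix.one_mul, Matrix.smul_mul, Matrix.mul_assoc (f * (T t)⁻¹)]
        _ = C⁻¹ * (1 - (t : ℂ) • (f * (T t)⁻¹)ᴴ) -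
            (t : ℂ) • (f * (T t)⁻¹ * C⁻¹ * ((T t)⁻¹)ᴴ) := by rw [← g2]
        _ = _ := by
            rw [Matrix.mul_sub, Matrix.mul_one, Matrix.mul_smul, smul_add]
            abel
    rw [e2, e1] at h
    have hs : ((t : ℂ) • (E t)).trace.re = t * (E t).trace.re := by
      rw [Matrix.trace_smul, smul_eq_mul, Complex.re_ofReal_mul]
    have hs' : 0 ≤ ((t : ℂ) • (E t)).trace.re := by
      simp only [E, smul_sub, smul_add, Matrix.trace_sub, Matrix.trace_add, Complex.add_re,
        Complex.sub_re] at h ⊢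
      linarith
    rw [hs] at hs'
    exact nonneg_of_mul_nonneg_right hs' ht0
  have hlim : 0 ≤ (E 0).trace.re :=
    ge_of_tendsto (hE.tendsto.mono_left nhdsWithin_le_nhds) key
  have e0 : (E 0).trace.re = 2 * ((C * f).trace - (C⁻¹ * f).trace).re := by
    have c1 : (fᴴ * C).trace = star (C * f).trace := by
      rw [← Matrix.trace_conjTranspose, Matrix.conjTranspose_mul, hC.isHermitian.eq]
    have c2 : (C⁻¹ * fᴴ).trace = star (C⁻¹ * f).trace := by
      rw [← Matrix.trace_conjTranspose, Matrix.conjTranspose_mul, hC.inv.isHermitian.eq,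
        Matrix.trace_mul_comm]
    simp only [E, hT0, inv_one, Complex.ofReal_zero, zero_smul, add_zero, Matrix.mul_one,
      Matrix.conjTranspose_one, Matrix.trace_sub, Matrix.trace_add, c1, c2,
      Matrix.trace_mul_comm f, Complex.sub_re, Complex.add_re, Complex.star_def, Complex.conj_re]
    ring
  linarith

/-- Applied to `f`, `-f`, `i f` and `-i f`, the variational inequality makes both the real and the
imaginary part of `tr(C f) - tr(C⁻¹ f)` vanish. -/
theorem exists_isCanonicalIntertwiner (hA : IsCompactMatrixQuantumGroup A) (u : UnitaryRep A) :
    ∃ C, IsCanonicalIntertwiner u C := by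
  obtain ⟨C, hC, hC', hmin⟩ := exists_minimal_positivePair hA u
  refine ⟨C, hC, hC', fun f hf => ?_⟩
  have p := fun c : ℂ => trace_nonneg_of_minimal hC hC' hmin (IsMor.smul (u := u) (v := u) hf c)
  simp only [Matrix.mul_smul, Matrix.trace_smul, smul_eq_mul] at p
  have p1 := p 1
  have p2 := p (-1)
  have p3 := p Complex.I
  have p4 := p (-Complex.I)
  simp at p1 p2 p3 p4
  apply Complex.ext <;> linarith

theorem existsUnique_isCanonicalIntertwiner (hA : IsCompactMatrixQuantumGroup A)
    (u : UnitaryRep A) : ∃! C, IsCanonicalIntertwiner u C := by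
  obtain ⟨C, hC⟩ := exists_isCanonicalIntertwiner hA u
  exact ⟨C, hC, fun D hD => hD.unique hC⟩

theorem canonicalC_spec (hA : IsCompactMatrixQuantumGroup A) (u : UnitaryRep A) :
    IsCanonicalIntertwiner u (canonicalC u) := by
  have h := exists_isCanonicalIntertwiner hA u
  rw [canonicalC, dif_pos h]
  exact h.choose_spec

end Existence

/-! ### Homogeneous components and parity -/

section GradedBasics

variable {Ω : Type*} [Ring Ω] [Algebra ℂ Ω] [DGStarAlgebra Ω]

theorem gr_induction {p : Ω → Prop} (x : Ω) (hom : ∀ n, ∀ y ∈ gr Ω n, p y)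
    (add : ∀ y z, p y → p z → p (y + z)) : p x :=
  DirectSum.Decomposition.inductionOn (gr Ω) (hom 0 0 (zero_mem _)) (fun {i} y => hom i y y.2)
    add x

theorem one_mem_gr : (1 : Ω) ∈ gr Ω 0 := SetLike.GradedOne.one_mem

theorem mul_mem_gr {m n : ℕ} {x y : Ω} (hx : x ∈ gr Ω m) (hy : y ∈ gr Ω n) :
    x * y ∈ gr Ω (m + n) := SetLike.GradedMul.mul_mem hx hy

theorem dif_mem {n : ℕ} {x : Ω} (hx : x ∈ gr Ω n) : dif x ∈ gr Ω (n + 1) :=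
  DGStarAlgebra.d_mem hx

theorem dif_dif (x : Ω) : dif (dif x) = 0 := DGStarAlgebra.d_d x

theorem leibniz {n : ℕ} {x : Ω} (hx : x ∈ gr Ω n) (y : Ω) :
    dif (x * y) = dif x * y + (-1 : ℂ) ^ n • (x * dif y) := DGStarAlgebra.leibniz hx y

theorem dif_one : dif (1 : Ω) = 0 := by
  have := leibniz (one_mem_gr (Ω := Ω)) 1
  simpa using this

/-- The projection onto the component of degree `n`. -/
def grProj (n : ℕ) : Ω →ₗ[ℂ] Ω := GradedAlgebra.proj (gr Ω) n

theorem grProj_mem (n : ℕ) (x : Ω) : grProj n x ∈ gr Ω n := by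
  rw [grProj, GradedAlgebra.proj_apply]
  exact SetLike.coe_mem _

theorem grProj_of_mem {n : ℕ} {x : Ω} (hx : x ∈ gr Ω n) : grProj n x = x := by
  rw [grProj, GradedAlgebra.proj_apply, DirectSum.decompose_of_mem_same _ hx]

theorem grProj_of_mem_ne {m n : ℕ} {x : Ω} (hx : x ∈ gr Ω m) (h : m ≠ n) : grProj n x = 0 := by
  rw [grProj, GradedAlgebra.proj_apply, DirectSum.decompose_of_mem_ne _ hx h]

theorem grProj_of_mem_ite {m n : ℕ} {x : Ω} (hx : x ∈ gr Ω m) :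
    grProj n x = if m = n then x else 0 := by
  split_ifs with h
  · subst h; exact grProj_of_mem hx
  · exact grProj_of_mem_ne hx h

/-- The bound is stated for all larger `M`, so that finitely many elements can be summed over one
range. -/
theorem exists_sum_grProj (x : Ω) : ∃ N, ∀ M, N ≤ M → x = ∑ n ∈ Finset.range M, grProj n x := by
  induction x using gr_induction with
  | hom n y hy =>
    refine ⟨n + 1, fun M hM => ?_⟩
    rw [Finset.sum_eq_single n]
    · exact (grProj_of_mem hy).symm
    · intro b _ hb; exact grProj_of_mem_ne hy hb.symm
    · intro h; exact absurd (Finset.mem_range.2 (by omega)) h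
  | add y z hy hz =>
    obtain ⟨N, hN⟩ := hy
    obtain ⟨N', hN'⟩ := hz
    refine ⟨max N N', fun M hM => ?_⟩
    simp only [map_add, Finset.sum_add_distrib]
    rw [← hN M (by omega), ← hN' M (by omega)]

theorem parity_of_mem {n : ℕ} {x : Ω} (hx : x ∈ gr Ω n) : parity x = (-1 : ℂ) ^ n • x := by
  simp only [parity, LinearMap.comp_apply, LinearEquiv.coe_coe,
    DirectSum.decomposeLinearEquiv_apply]
  rw [DirectSum.decompose_of_mem (gr Ω) hx]
  change DirectSum.toModule ℂ ℕ Ω _ (DirectSum.lof ℂ ℕ (fun n => gr Ω n) n ⟨x, hx⟩) = _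
  rw [DirectSum.toModule_lof]
  simp

theorem parity_mem {n : ℕ} {x : Ω} (hx : x ∈ gr Ω n) : parity x ∈ gr Ω n := by
  rw [parity_of_mem hx]; exact Submodule.smul_mem _ _ hx

theorem neg_one_pow_mul_self (n : ℕ) : (-1 : ℂ) ^ n * (-1 : ℂ) ^ n = 1 := by
  rw [← mul_pow]; simp

theorem parity_parity (x : Ω) : parity (parity x) = x := by
  induction x using gr_induction with
  | hom n y hy =>
    rw [parity_of_mem hy, map_smul, parity_of_mem hy, smul_smul, neg_one_pow_mul_self, one_smul]
  | add y z hy hz => rw [map_add, map_add, hy, hz]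

theorem parity_mul (x y : Ω) : parity (x * y) = parity x * parity y := by
  induction x using gr_induction with
  | hom n x hx =>
    induction y using gr_induction with
    | hom m y hy =>
      rw [parity_of_mem hx, parity_of_mem hy, parity_of_mem (mul_mem_gr hx hy),
        smul_mul_smul_comm, pow_add]
    | add y z hy hz => rw [mul_add, map_add, map_add, mul_add, hy, hz]
  | add y z hy hz => rw [add_mul, map_add, map_add, add_mul, hy, hz]

end GradedBasics

/-! ### The graded tensor product and its total degree -/

section GradedTensor

variable {Ω : Type*} [Ring Ω] [Algebra ℂ Ω] [DGStarAlgebra Ω]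
variable {Γ : Type*} [Ring Γ] [Algebra ℂ Γ] [DGStarAlgebra Γ]

variable (Ω Γ) in
/-- The graded tensor product of two graded-differential algebras. -/
abbrev GTensor : Type _ := GradedTensorProduct ℂ (gr Ω) (gr Γ)

variable (Ω Γ) in
/-- The tensor product, as a module, is identified with the graded tensor product. -/
abbrev ofT : Ω ⊗[ℂ] Γ ≃ₗ[ℂ] GTensor Ω Γ := GradedTensorProduct.of ℂ (gr Ω) (gr Γ)

theorem ofT_mul {p q : ℕ} (w : Ω) {ϑ : Γ} (hϑ : ϑ ∈ gr Γ q) {w' : Ω} (hw : w' ∈ gr Ω p) (ϑ' : Γ) :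
    ofT Ω Γ (w ⊗ₜ ϑ) * ofT Ω Γ (w' ⊗ₜ ϑ') =
      (-1 : ℂ) ^ (q * p) • ofT Ω Γ ((w * w') ⊗ₜ (ϑ * ϑ')) := by
  have h := GradedTensorProduct.tmul_coe_mul_coe_tmul (R := ℂ) (gr Ω) (gr Γ) w
    (⟨ϑ, hϑ⟩ : gr Γ q) (⟨w', hw⟩ : gr Ω p) ϑ'
  refine h.trans ?_
  rcases Nat.even_or_odd (q * p) with h' | h' <;>
    simp [h'.neg_one_pow]

/-- No sign arises when the left factor has degree 0 in `Γ`. This lets computations with horizontal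
forms take place in the ordinary tensor product. -/
theorem ofT_mul_of_zero (w : Ω) {ϑ : Γ} (hϑ : ϑ ∈ gr Γ 0) (t : Ω ⊗[ℂ] Γ) :
    ofT Ω Γ (w ⊗ₜ ϑ) * ofT Ω Γ t = ofT Ω Γ ((w ⊗ₜ ϑ) * t) := by
  induction t with
  | zero => simp
  | add x y hx hy => rw [map_add, mul_add, mul_add, hx, hy, map_add]
  | tmul w' ϑ' =>
    induction w' using gr_induction with
    | hom n y hy =>
      rw [ofT_mul w hϑ hy, zero_mul, pow_zero, one_smul, Algebra.TensorProduct.tmul_mul_tmul]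
    | add y z hy hz => simp only [TensorProduct.add_tmul, map_add, mul_add] at *; rw [hy, hz]

variable {Ω'' : Type*} [Ring Ω''] [Algebra ℂ Ω'']

theorem ofT_toTensor (f : Ω'' →ₐ[ℂ] GTensor Ω Γ) (x : Ω'') : ofT Ω Γ (toTensor f x) = f x := by
  simp [toTensor, ofT]

variable (Ω Γ) in
/-- The component of total degree `n` of a tensor product. -/
def totalGr (n : ℕ) : Submodule ℂ (Ω ⊗[ℂ] Γ) :=
  Submodule.span ℂ {t | ∃ p q, p + q = n ∧ ∃ w ∈ gr Ω p, ∃ ϑ ∈ gr Γ q, t = w ⊗ₜ ϑ}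

theorem tmul_mem_totalGr {p q n : ℕ} (h : p + q = n) {w : Ω} (hw : w ∈ gr Ω p) {ϑ : Γ}
    (hϑ : ϑ ∈ gr Γ q) : w ⊗ₜ ϑ ∈ totalGr Ω Γ n :=
  Submodule.subset_span ⟨p, q, h, w, hw, ϑ, hϑ, rfl⟩

theorem mul_mem_totalGr {m n : ℕ} {s t : Ω ⊗[ℂ] Γ} (hs : s ∈ totalGr Ω Γ m)
    (ht : t ∈ totalGr Ω Γ n) :
    (ofT Ω Γ).symm (ofT Ω Γ s * ofT Ω Γ t) ∈ totalGr Ω Γ (m + n) := by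
  refine Submodule.span_induction ?_ (by simp) ?_ ?_ hs
  · rintro _ ⟨p, q, h, w, hw, ϑ, hϑ, rfl⟩
    refine Submodule.span_induction ?_ (by simp) ?_ ?_ ht
    · rintro _ ⟨p', q', h', w', hw', ϑ', hϑ', rfl⟩
      rw [ofT_mul w hϑ hw', map_smul, LinearEquiv.symm_apply_apply]
      exact Submodule.smul_mem _ _ (tmul_mem_totalGr (by omega) (mul_mem_gr hw hw')
        (mul_mem_gr hϑ hϑ'))
    · intro x y _ _ hx hy; rw [map_add, mul_add, map_add]; exact add_mem hx hy
    · intro c x _ hx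
      rw [map_smul, mul_smul_comm, map_smul]; exact Submodule.smul_mem _ _ hx
  · intro x y _ _ hx hy; rw [map_add, add_mul, map_add]; exact add_mem hx hy
  · intro c x _ hx
    rw [map_smul, smul_mul_assoc, map_smul]; exact Submodule.smul_mem _ _ hx

theorem tensorDif_tmul {n : ℕ} {w : Ω} (hw : w ∈ gr Ω n) (ϑ : Γ) :
    tensorDif (w ⊗ₜ[ℂ] ϑ) = dif w ⊗ₜ ϑ + (-1 : ℂ) ^ n • (w ⊗ₜ dif ϑ) := by
  simp [tensorDif, parity_of_mem hw, TensorProduct.smul_tmul']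

theorem tensorDif_mem_totalGr {n : ℕ} {t : Ω ⊗[ℂ] Γ} (ht : t ∈ totalGr Ω Γ n) :
    tensorDif t ∈ totalGr Ω Γ (n + 1) := by
  refine Submodule.span_induction ?_ (by simp) ?_ ?_ ht
  · rintro _ ⟨p, q, h, w, hw, ϑ, hϑ, rfl⟩
    rw [tensorDif_tmul hw]
    exact add_mem (tmul_mem_totalGr (by omega) (dif_mem hw) hϑ) (Submodule.smul_mem _ _
      (tmul_mem_totalGr (by omega) hw (dif_mem hϑ)))
  · intro x y _ _ hx hy; rw [map_add]; exact add_mem hx hy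
  · intro c x _ hx; rw [map_smul]; exact Submodule.smul_mem _ _ hx

variable (Ω Γ) in
/-- The projection onto the component of total degree `n`. -/
def totalProj (n : ℕ) : Ω ⊗[ℂ] Γ →ₗ[ℂ] Ω ⊗[ℂ] Γ :=
  ∑ p ∈ Finset.HasAntidiagonal.antidiagonal n, TensorProduct.map (grProj p.1) (grProj p.2)

theorem totalProj_of_mem {m n : ℕ} {t : Ω ⊗[ℂ] Γ} (ht : t ∈ totalGr Ω Γ m) :
    totalProj Ω Γ n t = if m = n then t else 0 := by
  refine Submodule.span_induction ?_ (by simp) ?_ ?_ ht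
  · rintro _ ⟨p, q, h, w, hw, ϑ, hϑ, rfl⟩
    simp only [totalProj, LinearMap.sum_apply, TensorProduct.map_tmul, grProj_of_mem_ite hw,
      grProj_of_mem_ite hϑ]
    split_ifs with hm
    · rw [Finset.sum_eq_single (p, q)]
      · simp
      · rintro ⟨a, b⟩ _ hne
        by_cases ha : p = a
        · have : q ≠ b := by rintro rfl; exact hne (by rw [ha])
          simp [this]
        · simp [ha]
      · intro hh; exact absurd (Finset.HasAntidiagonal.mem_antidiagonal.2 (by simpa using h.trans hm)) hh
    · refine Finset.sum_eq_zero ?_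
      rintro ⟨a, b⟩ hab
      rw [Finset.HasAntidiagonal.mem_antidiagonal] at hab
      by_cases ha : p = a
      · have : q ≠ b := by rintro rfl; simp only at hab; omega
        simp [this]
      · simp [ha]
  · intro x y _ _ hx hy; rw [map_add, hx, hy]; split_ifs <;> simp
  · intro c x _ hx; rw [map_smul, hx]; split_ifs <;> simp

end GradedTensor

/-! ### Extended coactions on differential forms -/

section Coaction

variable {A : Type*} [Ring A] [StarRing A] [HopfAlgebra ℂ A] {Γ : Type*} [Ring Γ]
  [Algebra ℂ Γ] [DGStarAlgebra Γ] (G : GroupCalculus A Γ)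

namespace GroupCalculus

theorem incl_mem (a : A) : G.incl a ∈ gr Γ 0 := by
  rw [← G.range_incl]; exact ⟨a, rfl⟩

theorem exists_incl {ϑ : Γ} (h : ϑ ∈ gr Γ 0) : ∃ a, G.incl a = ϑ := by
  rw [← G.range_incl] at h; exact h

theorem incl_proj (ϑ : Γ) : G.incl (G.proj ϑ) = grProj 0 ϑ := by
  have h : ∀ x : gr Γ 0, G.incl (G.inclEquiv.symm x) = x := by
    intro x
    conv_rhs => rw [← G.inclEquiv.apply_symm_apply x]
    rfl
  simp only [proj, LinearMap.comp_apply, LinearEquiv.coe_coe,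
    DirectSum.decomposeLinearEquiv_apply]
  rw [h]
  rw [grProj, GradedAlgebra.proj_apply]
  rfl

theorem proj_incl (a : A) : G.proj (G.incl a) = a :=
  G.incl_injective (by rw [incl_proj, grProj_of_mem (G.incl_mem a)])

theorem proj_of_mem {n : ℕ} {ϑ : Γ} (h : ϑ ∈ gr Γ n) (hn : n ≠ 0) : G.proj ϑ = 0 :=
  G.incl_injective (by rw [incl_proj, grProj_of_mem_ne h hn, map_zero])

theorem proj_dif (ϑ : Γ) : G.proj (dif ϑ) = 0 := by
  induction ϑ using gr_induction with
  | hom n y hy => exact G.proj_of_mem (dif_mem hy) (by omega)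
  | add y z hy hz => rw [map_add, map_add, hy, hz, add_zero]

theorem proj_grProj (n : ℕ) (ϑ : Γ) : G.proj (grProj n ϑ) = if n = 0 then G.proj ϑ else 0 := by
  split_ifs with h
  · subst h; rw [← G.incl_proj, proj_incl]
  · exact G.proj_of_mem (grProj_mem n ϑ) h

theorem proj_mul (x y : Γ) : G.proj (x * y) = G.proj x * G.proj y := by
  induction x using gr_induction with
  | hom n x hx =>
    induction y using gr_induction with
    | hom m y hy =>
      by_cases hn : n = 0
      · by_cases hm : m = 0
        · subst hn hm
          obtain ⟨a, rfl⟩ := G.exists_incl hx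
          obtain ⟨b, rfl⟩ := G.exists_incl hy
          rw [← map_mul, proj_incl, proj_incl, proj_incl]
        · rw [G.proj_of_mem hy hm, G.proj_of_mem (mul_mem_gr hx hy) (by omega), mul_zero]
      · rw [G.proj_of_mem hx hn, G.proj_of_mem (mul_mem_gr hx hy) (by omega), zero_mul]
    | add y z hy hz => rw [mul_add, map_add, map_add, mul_add, hy, hz]
  | add y z hy hz => rw [add_mul, map_add, map_add, add_mul, hy, hz]

theorem proj_one : G.proj 1 = 1 := by rw [← map_one G.incl, proj_incl]

/-- The projection onto the component of degree `0`, as an algebra homomorphism. -/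
def projAlg : Γ →ₐ[ℂ] A := AlgHom.ofLinearMap G.proj G.proj_one G.proj_mul

end GroupCalculus

variable {Ω : Type*} [Ring Ω] [Algebra ℂ Ω] [DGStarAlgebra Ω]

variable (Ω) in
/-- The homomorphism `id ⊗ p_*`. -/
def idProj : GTensor Ω Γ →ₐ[ℂ] Ω ⊗[ℂ] A :=
  GradedTensorProduct.lift (gr Ω) (gr Γ) Algebra.TensorProduct.includeLeft
    (Algebra.TensorProduct.includeRight.comp G.projAlg) (by
      intro i j a b
      by_cases hj : j = 0
      · subst hj; simp
      · have : G.projAlg (b : Γ) = 0 := G.proj_of_mem b.2 hj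
        simp [this])

theorem idProj_ofT (t : Ω ⊗[ℂ] Γ) :
    idProj G Ω (ofT Ω Γ t) = TensorProduct.map LinearMap.id G.proj t := by
  induction t with
  | zero => simp
  | add x y hx hy => rw [map_add, map_add, map_add, hx, hy]
  | tmul w ϑ =>
    refine (GradedTensorProduct.lift_tmul (gr Ω) (gr Γ) _ _ _ w ϑ).trans ?_
    simp [GroupCalculus.projAlg]

variable {B : Type*} [Ring B] [Algebra ℂ B]

/-- The homomorphism `f` is a differential extension of the coaction `F` to the algebra `Ω` of
forms generated by `B`. -/
structure HasCoaction (incl : B →ₐ[ℂ] Ω) (F : B →ₐ[ℂ] B ⊗[ℂ] A) (f : Ω →ₐ[ℂ] GTensor Ω Γ) :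
    Prop where
  incl_mem : ∀ b, incl b ∈ gr Ω 0
  generates : Algebra.adjoin ℂ (Set.range incl ∪ Set.range fun b => dif (incl b)) = ⊤
  f_incl : ∀ b, toTensor f (incl b) = TensorProduct.map incl.toLinearMap G.incl.toLinearMap (F b)
  f_d : ∀ w, toTensor f (dif w) = tensorDif (toTensor f w)
  coassoc : ∀ b, TensorProduct.assoc ℂ B A A
      (TensorProduct.map F.toLinearMap LinearMap.id (F b)) =
    TensorProduct.map LinearMap.id Coalgebra.comul (F b)
  counit : ∀ b, TensorProduct.rid ℂ B (TensorProduct.map LinearMap.id Coalgebra.counit (F b)) = b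

/-- The coaction of `A` on forms induced by `f`. -/
def coact (f : Ω →ₐ[ℂ] GTensor Ω Γ) : Ω →ₐ[ℂ] Ω ⊗[ℂ] A := (idProj G Ω).comp f

theorem coact_apply (f : Ω →ₐ[ℂ] GTensor Ω Γ) (x : Ω) :
    coact G f x = TensorProduct.map LinearMap.id G.proj (toTensor f x) := by
  rw [← idProj_ofT, ofT_toTensor]; rfl

theorem map_proj_tensorDif (t : Ω ⊗[ℂ] Γ) :
    TensorProduct.map LinearMap.id G.proj (tensorDif t) =
      TensorProduct.map dif LinearMap.id (TensorProduct.map LinearMap.id G.proj t) := by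
  induction t with
  | zero => simp
  | add x y hx hy => simp only [map_add, hx, hy]
  | tmul w ϑ => simp [tensorDif, G.proj_dif]

theorem map_proj_totalProj (n : ℕ) (t : Ω ⊗[ℂ] Γ) :
    TensorProduct.map LinearMap.id G.proj (totalProj Ω Γ n t) =
      TensorProduct.map (grProj n) LinearMap.id (TensorProduct.map LinearMap.id G.proj t) := by
  induction t with
  | zero => simp
  | add x y hx hy => simp only [map_add, hx, hy]
  | tmul w ϑ =>
    simp only [totalProj, LinearMap.sum_apply, TensorProduct.map_tmul, map_sum, LinearMap.id_apply,
      G.proj_grProj]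
    rw [Finset.sum_eq_single (n, 0)]
    · simp
    · rintro ⟨a, b⟩ hab hne
      rw [Finset.HasAntidiagonal.mem_antidiagonal] at hab
      have : b ≠ 0 := by rintro rfl; exact hne (by simpa using hab)
      simp [this]
    · intro h; exact absurd (Finset.HasAntidiagonal.mem_antidiagonal.2 (by simp)) h

theorem totalProj_map_incl (n : ℕ) (t : Ω ⊗[ℂ] A) :
    totalProj Ω Γ n (TensorProduct.map LinearMap.id G.incl.toLinearMap t) =
      TensorProduct.map LinearMap.id G.incl.toLinearMap
        (TensorProduct.map (grProj n) LinearMap.id t) := by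
  induction t with
  | zero => simp
  | add x y hx hy => simp only [map_add, hx, hy]
  | tmul w a =>
    simp only [totalProj, LinearMap.sum_apply, TensorProduct.map_tmul, LinearMap.id_apply,
      AlgHom.toLinearMap_apply, grProj_of_mem_ite (G.incl_mem a)]
    rw [Finset.sum_eq_single (n, 0)]
    · simp
    · rintro ⟨a, b⟩ hab hne
      rw [Finset.HasAntidiagonal.mem_antidiagonal] at hab
      have : b ≠ 0 := by rintro rfl; exact hne (by simpa using hab)
      simp [this.symm]
    · intro h; exact absurd (Finset.HasAntidiagonal.mem_antidiagonal.2 (by simp)) h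

namespace HasCoaction

variable {G} {incl : B →ₐ[ℂ] Ω} {F : B →ₐ[ℂ] B ⊗[ℂ] A} {f : Ω →ₐ[ℂ] GTensor Ω Γ}
  (h : HasCoaction G incl F f)

include h

theorem algHom_ext {C : Type*} [Ring C] [Algebra ℂ C] {g g' : Ω →ₐ[ℂ] C}
    (h0 : ∀ b, g (incl b) = g' (incl b)) (h1 : ∀ b, g (dif (incl b)) = g' (dif (incl b))) :
    g = g' := by
  apply AlgHom.ext_of_adjoin_eq_top h.generates
  rintro _ (⟨b, rfl⟩ | ⟨b, rfl⟩)
  · exact h0 b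
  · exact h1 b

theorem toTensor_incl_mem (b : B) : toTensor f (incl b) ∈ totalGr Ω Γ 0 := by
  rw [h.f_incl]
  induction F b with
  | zero => simp
  | add x y hx hy => rw [map_add]; exact add_mem hx hy
  | tmul b a =>
    rw [TensorProduct.map_tmul]
    exact tmul_mem_totalGr (zero_add 0) (h.incl_mem b) (G.incl_mem a)

/-- On generators the extension preserves the total degree, and products preserve it as well. All
homogeneous components are treated at once because the induction over the generated algebra meets
inhomogeneous factors. -/
theorem toTensor_grProj_mem (x : Ω) : ∀ n, toTensor f (grProj n x) ∈ totalGr Ω Γ n := by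
  have hx : x ∈ Algebra.adjoin ℂ (Set.range incl ∪ Set.range fun b => dif (incl b)) := by
    rw [h.generates]; trivial
  have key : ∀ {m : ℕ} {y : Ω}, y ∈ gr Ω m → toTensor f y ∈ totalGr Ω Γ m →
      ∀ n, toTensor f (grProj n y) ∈ totalGr Ω Γ n := by
    intro m y hy hy' n
    rw [grProj_of_mem_ite hy]
    split_ifs with hmn
    · exact hmn ▸ hy'
    · simp
  induction hx using Algebra.adjoin_induction with
  | mem x hx =>
    rcases hx with ⟨b, rfl⟩ | ⟨b, rfl⟩
    · exact key (h.incl_mem b) (h.toTensor_incl_mem b)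
    · refine key (dif_mem (h.incl_mem b)) ?_
      rw [h.f_d]
      exact tensorDif_mem_totalGr (h.toTensor_incl_mem b)
  | algebraMap r =>
    rw [← incl.commutes r]
    exact key (h.incl_mem _) (h.toTensor_incl_mem _)
  | add x y _ _ hx hy => intro n; rw [map_add, map_add]; exact add_mem (hx n) (hy n)
  | mul x y _ _ hx hy =>
    obtain ⟨N, hN⟩ := exists_sum_grProj x
    obtain ⟨N', hN'⟩ := exists_sum_grProj y
    rw [hN N le_rfl, hN' N' le_rfl, Finset.sum_mul_sum]
    intro n
    simp only [map_sum]
    refine sum_mem fun i _ => sum_mem fun j _ => ?_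
    refine key (mul_mem_gr (grProj_mem i x) (grProj_mem j y)) ?_ n
    have : toTensor f (grProj i x * grProj j y) =
        (ofT Ω Γ).symm (ofT Ω Γ (toTensor f (grProj i x)) * ofT Ω Γ (toTensor f (grProj j y))) := by
      rw [ofT_toTensor, ofT_toTensor, ← map_mul]; rfl
    rw [this]
    exact mul_mem_totalGr (hx i) (hy j)

theorem totalProj_toTensor (n : ℕ) (x : Ω) :
    totalProj Ω Γ n (toTensor f x) = toTensor f (grProj n x) := by
  induction x using gr_induction with
  | hom m y hy =>
    have := h.toTensor_grProj_mem y m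
    rw [grProj_of_mem hy] at this
    rw [totalProj_of_mem this, grProj_of_mem_ite hy]
    split_ifs <;> simp
  | add y z hy hz => simp only [map_add, hy, hz]

theorem coact_incl (b : B) :
    coact G f (incl b) = TensorProduct.map incl.toLinearMap LinearMap.id (F b) := by
  rw [coact_apply, h.f_incl]
  induction F b with
  | zero => simp
  | add x y hx hy => simp only [map_add, hx, hy]
  | tmul b a => simp [G.proj_incl]

theorem coact_dif (x : Ω) :
    coact G f (dif x) = TensorProduct.map dif LinearMap.id (coact G f x) := by
  rw [coact_apply, h.f_d, map_proj_tensorDif, ← coact_apply]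

theorem coact_grProj (n : ℕ) (x : Ω) :
    coact G f (grProj n x) = TensorProduct.map (grProj n) LinearMap.id (coact G f x) := by
  rw [coact_apply, ← h.totalProj_toTensor, map_proj_totalProj, ← coact_apply]

/-- Both sides are algebra homomorphisms. They agree on `B` by coassociativity of `F`, and on `d B`
because the coaction commutes with `d`. -/
theorem coact_coassoc (x : Ω) : TensorProduct.assoc ℂ Ω A A
      (TensorProduct.map (coact G f).toLinearMap LinearMap.id (coact G f x)) =
    TensorProduct.map LinearMap.id Coalgebra.comul (coact G f x) := by
  have e1 : ∀ b, TensorProduct.assoc ℂ Ω A A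
      (TensorProduct.map (coact G f).toLinearMap LinearMap.id (coact G f (incl b))) =
      TensorProduct.map LinearMap.id Coalgebra.comul (coact G f (incl b)) := by
    intro b
    rw [h.coact_incl]
    have e2 : ∀ t : B ⊗[ℂ] A, TensorProduct.assoc ℂ Ω A A
        (TensorProduct.map (coact G f).toLinearMap LinearMap.id
          (TensorProduct.map incl.toLinearMap LinearMap.id t)) =
        TensorProduct.map incl.toLinearMap LinearMap.id (TensorProduct.assoc ℂ B A A
          (TensorProduct.map F.toLinearMap LinearMap.id t)) := by
      intro t
      induction t with
      | zero => simp
      | add x y hx hy => simp only [map_add, hx, hy]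
      | tmul b a =>
        simp only [TensorProduct.map_tmul, AlgHom.toLinearMap_apply, LinearMap.id_apply,
          h.coact_incl]
        induction F b with
        | zero => simp
        | add x y hx hy => simp only [map_add, TensorProduct.add_tmul, hx, hy]
        | tmul b c => simp
    rw [e2, h.coassoc, ← LinearMap.comp_apply, ← LinearMap.comp_apply, ← TensorProduct.map_comp,
      ← TensorProduct.map_comp]
    rfl
  have e3 : ∀ t : Ω ⊗[ℂ] A, TensorProduct.assoc ℂ Ω A A
      (TensorProduct.map (coact G f).toLinearMap LinearMap.id
        (TensorProduct.map dif LinearMap.id t)) =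
      TensorProduct.map dif LinearMap.id (TensorProduct.assoc ℂ Ω A A
        (TensorProduct.map (coact G f).toLinearMap LinearMap.id t)) := by
    intro t
    induction t with
    | zero => simp
    | add x y hx hy => simp only [map_add, hx, hy]
    | tmul b a =>
      simp only [TensorProduct.map_tmul, AlgHom.toLinearMap_apply, LinearMap.id_apply,
        h.coact_dif]
      induction coact G f b with
      | zero => simp
      | add x y hx hy => simp only [map_add, TensorProduct.add_tmul, hx, hy]
      | tmul b c => simp
  have e4 : (Algebra.TensorProduct.assoc ℂ ℂ ℂ Ω A A).toAlgHom.comp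
      ((Algebra.TensorProduct.map (coact G f) (AlgHom.id ℂ A)).comp (coact G f)) =
      (Algebra.TensorProduct.map (AlgHom.id ℂ Ω) (Bialgebra.comulAlgHom ℂ A)).comp
        (coact G f) := by
    refine h.algHom_ext (fun b => e1 b) (fun b => ?_)
    have e5 := e3 (coact G f (incl b))
    rw [← h.coact_dif] at e5
    refine e5.trans ?_
    rw [e1]
    change _ = TensorProduct.map LinearMap.id Coalgebra.comul (coact G f (dif (incl b)))
    rw [h.coact_dif, ← LinearMap.comp_apply, ← LinearMap.comp_apply, ← TensorProduct.map_comp,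
      ← TensorProduct.map_comp]
    rfl
  exact DFunLike.congr_fun e4 x

theorem coact_counit (x : Ω) :
    TensorProduct.rid ℂ Ω (TensorProduct.map LinearMap.id Coalgebra.counit (coact G f x)) = x := by
  have e0 : ∀ b, TensorProduct.rid ℂ Ω
      (TensorProduct.map LinearMap.id Coalgebra.counit (coact G f (incl b))) = incl b := by
    intro b
    rw [h.coact_incl]
    conv_rhs => rw [← h.counit b]
    induction F b with
    | zero => simp
    | add x y hx hy => simp only [map_add, hx, hy]
    | tmul b a => simp
  have e4 : (Algebra.TensorProduct.rid ℂ ℂ Ω).toAlgHom.comp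
      ((Algebra.TensorProduct.map (AlgHom.id ℂ Ω) (Bialgebra.counitAlgHom ℂ A)).comp
        (coact G f)) = AlgHom.id ℂ Ω := by
    refine h.algHom_ext (fun b => e0 b) (fun b => ?_)
    change TensorProduct.rid ℂ Ω
      (TensorProduct.map LinearMap.id Coalgebra.counit (coact G f (dif (incl b)))) = dif (incl b)
    conv_rhs => rw [← e0 b]
    rw [h.coact_dif]
    induction coact G f (incl b) with
    | zero => simp
    | add x y hx hy => simp only [map_add, hx, hy]
    | tmul b a => simp
  exact DFunLike.congr_fun e4 x

end HasCoaction

namespace GroupCalculus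

/-- The coproduct on `Γ` is an extended coaction of the same kind as the one on `Ω(P)`, so the
results above apply to both. -/
theorem hasCoaction : HasCoaction G G.incl (Bialgebra.comulAlgHom ℂ A) G.comulHat where
  incl_mem := G.incl_mem
  generates := G.generates
  f_incl := G.comulHat_incl
  f_d := G.comulHat_d
  coassoc a := by
    simpa [LinearMap.lTensor, LinearMap.rTensor] using Coalgebra.coassoc_apply (R := ℂ) a
  counit a := by
    have := Coalgebra.lTensor_counit_comul (R := ℂ) a
    rw [LinearMap.lTensor] at this
    simp [this]

/-- The right coaction of `A` on the forms on the group. -/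
abbrev coactR : Γ →ₐ[ℂ] Γ ⊗[ℂ] A := coact G G.comulHat

end GroupCalculus

/-- The right coaction of `A` on the right factor of a graded tensor product. -/
def coactRight : Ω ⊗[ℂ] Γ →ₗ[ℂ] (Ω ⊗[ℂ] Γ) ⊗[ℂ] A :=
  (TensorProduct.assoc ℂ Ω Γ A).symm.toLinearMap ∘ₗ
    TensorProduct.map LinearMap.id G.coactR.toLinearMap

theorem coactRight_tensorDif (t : Ω ⊗[ℂ] Γ) : coactRight G (tensorDif t) =
    TensorProduct.map tensorDif LinearMap.id (coactRight G t) := by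
  induction t with
  | zero => simp
  | add x y hx hy => simp only [map_add, hx, hy]
  | tmul w ϑ =>
    simp only [coactRight, LinearMap.comp_apply, LinearEquiv.coe_coe, tensorDif,
      LinearMap.add_apply, TensorProduct.map_tmul, LinearMap.id_apply, map_add,
      AlgHom.toLinearMap_apply, G.hasCoaction.coact_dif]
    induction G.coactR ϑ with
    | zero => simp
    | add x y hx hy => 
      simp only [map_add, TensorProduct.tmul_add] at *
      rw [← hx, ← hy]; abel
    | tmul b c => simp [TensorProduct.add_tmul]

/-- This is the compatibility required by `GradedTensorProduct.lift`. It holds because the coaction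
preserves the degree in `Γ` and contributes a factor in `A` that carries no sign. -/
theorem anticommute_coactR {i j : ℕ} {w : Ω} (hw : w ∈ gr Ω i) {ϑ : Γ} (hϑ : ϑ ∈ gr Γ j) :
    (ofT Ω Γ (w ⊗ₜ 1) ⊗ₜ[ℂ] (1 : A)) * (Algebra.TensorProduct.map
      (GradedTensorProduct.includeRight (gr Ω) (gr Γ)) (AlgHom.id ℂ A)) (G.coactR ϑ) =
    (-1 : ℤˣ) ^ (j * i) • ((Algebra.TensorProduct.map
      (GradedTensorProduct.includeRight (gr Ω) (gr Γ)) (AlgHom.id ℂ A)) (G.coactR ϑ) *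
      (ofT Ω Γ (w ⊗ₜ 1) ⊗ₜ[ℂ] (1 : A))) := by
  have e : G.coactR ϑ = TensorProduct.map (grProj j) LinearMap.id (G.coactR ϑ) := by
    rw [← G.hasCoaction.coact_grProj, grProj_of_mem hϑ]
  rw [e]
  induction G.coactR ϑ with
  | zero => simp
  | add x y hx hy => simp only [map_add, mul_add, add_mul, smul_add, hx, hy]
  | tmul η a =>
    have hη := grProj_mem j η
    have h1 : ofT Ω Γ (w ⊗ₜ 1) * ofT Ω Γ (1 ⊗ₜ grProj j η) = ofT Ω Γ (w ⊗ₜ grProj j η) := by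
      rw [ofT_mul w one_mem_gr one_mem_gr]; simp
    have h2 : ofT Ω Γ (1 ⊗ₜ grProj j η) * ofT Ω Γ (w ⊗ₜ 1) =
        (-1 : ℂ) ^ (j * i) • ofT Ω Γ (w ⊗ₜ grProj j η) := by
      rw [ofT_mul 1 hη hw]; simp
    simp only [TensorProduct.map_tmul, LinearMap.id_apply, Algebra.TensorProduct.map_tmul,
      AlgHom.id_apply]
    have h3 : GradedTensorProduct.includeRight (gr Ω) (gr Γ) (grProj j η) =
      ofT Ω Γ (1 ⊗ₜ grProj j η) := rfl
    rw [h3, Algebra.TensorProduct.tmul_mul_tmul, Algebra.TensorProduct.tmul_mul_tmul, h1, h2]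
    rcases Nat.even_or_odd (j * i) with h' | h' <;> simp [h'.neg_one_pow, TensorProduct.neg_tmul]

variable (Ω) in
/-- The right coaction of `A` on the right factor, as an algebra homomorphism. -/
def coactRightAlg : GTensor Ω Γ →ₐ[ℂ] GTensor Ω Γ ⊗[ℂ] A :=
  GradedTensorProduct.lift (gr Ω) (gr Γ)
    (Algebra.TensorProduct.includeLeft.comp (GradedTensorProduct.includeLeft (gr Ω) (gr Γ)))
    ((Algebra.TensorProduct.map (GradedTensorProduct.includeRight (gr Ω) (gr Γ))
      (AlgHom.id ℂ A)).comp G.coactR)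
    (fun _ _ a b => anticommute_coactR G a.2 b.2)

theorem coactRightAlg_ofT (t : Ω ⊗[ℂ] Γ) : coactRightAlg G Ω (ofT Ω Γ t) =
    TensorProduct.map (ofT Ω Γ).toLinearMap LinearMap.id (coactRight G t) := by
  induction t with
  | zero => simp
  | add x y hx hy => simp only [map_add, hx, hy]
  | tmul w ϑ =>
    refine (GradedTensorProduct.lift_tmul (gr Ω) (gr Γ) _ _ _ w ϑ).trans ?_
    change (ofT Ω Γ (w ⊗ₜ 1) ⊗ₜ[ℂ] (1 : A)) * (Algebra.TensorProduct.map
      (GradedTensorProduct.includeRight (gr Ω) (gr Γ)) (AlgHom.id ℂ A)) (G.coactR ϑ) =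
      TensorProduct.map (ofT Ω Γ).toLinearMap LinearMap.id
        ((TensorProduct.assoc ℂ Ω Γ A).symm (w ⊗ₜ G.coactR ϑ))
    induction G.coactR ϑ with
    | zero => simp
    | add x y hx hy => simp only [map_add, TensorProduct.tmul_add, mul_add, hx, hy]
    | tmul η a =>
      have h1 : ofT Ω Γ (w ⊗ₜ 1) * ofT Ω Γ (1 ⊗ₜ η) = ofT Ω Γ (w ⊗ₜ η) := by
        rw [ofT_mul w one_mem_gr one_mem_gr]; simp
      have h3 : GradedTensorProduct.includeRight (gr Ω) (gr Γ) η = ofT Ω Γ (1 ⊗ₜ η) := rfl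
      rw [Algebra.TensorProduct.map_tmul, h3, Algebra.TensorProduct.tmul_mul_tmul, h1]
      simp

namespace HasCoaction

variable {G} {incl : B →ₐ[ℂ] Ω} {F : B →ₐ[ℂ] B ⊗[ℂ] A} {f : Ω →ₐ[ℂ] GTensor Ω Γ}
  (h : HasCoaction G incl F f)

include h

/-- The identity `(F^ ⊗ id) F^∧ = (id ⊗ (id ⊗ p_*)φ^) F^`. -/
theorem map_toTensor_coact (x : Ω) :
    TensorProduct.map (toTensor f) LinearMap.id (coact G f x) = coactRight G (toTensor f x) := by
  have inj : Function.Injective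
      (TensorProduct.map (ofT Ω Γ).toLinearMap (LinearMap.id : A →ₗ[ℂ] A)) :=
    (TensorProduct.congr (ofT Ω Γ) (LinearEquiv.refl ℂ A)).injective
  have e0 : ∀ y, Algebra.TensorProduct.map f (AlgHom.id ℂ A) (coact G f y) =
      TensorProduct.map (ofT Ω Γ).toLinearMap LinearMap.id
        (TensorProduct.map (toTensor f) LinearMap.id (coact G f y)) := by
    intro y
    rw [← LinearMap.comp_apply, ← TensorProduct.map_comp]
    rfl
  have e1 : ∀ y, coactRightAlg G Ω (f y) = TensorProduct.map (ofT Ω Γ).toLinearMap LinearMap.id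
      (coactRight G (toTensor f y)) := by
    intro y; rw [← coactRightAlg_ofT, ofT_toTensor]
  have e2 : ∀ b, TensorProduct.map (toTensor f) LinearMap.id (coact G f (incl b)) =
      coactRight G (toTensor f (incl b)) := by
    intro b
    rw [h.coact_incl, h.f_incl]
    have e3 : ∀ t : B ⊗[ℂ] A, TensorProduct.map (toTensor f) LinearMap.id
        (TensorProduct.map incl.toLinearMap LinearMap.id t) =
        (TensorProduct.assoc ℂ Ω Γ A).symm (TensorProduct.map incl.toLinearMap
          (TensorProduct.map G.incl.toLinearMap LinearMap.id) (TensorProduct.assoc ℂ B A A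
            (TensorProduct.map F.toLinearMap LinearMap.id t))) := by
      intro t
      induction t with
      | zero => simp
      | add x y hx hy => simp only [map_add, hx, hy]
      | tmul b a =>
        simp only [TensorProduct.map_tmul, AlgHom.toLinearMap_apply, LinearMap.id_apply,
          h.f_incl]
        induction F b with
        | zero => simp
        | add x y hx hy => simp only [map_add, TensorProduct.add_tmul, hx, hy]
        | tmul b c => simp
    rw [e3, h.coassoc]
    induction F b with
    | zero => simp
    | add x y hx hy => simp only [map_add, hx, hy]
    | tmul b a =>
      simp only [TensorProduct.map_tmul, AlgHom.toLinearMap_apply, LinearMap.id_apply, coactRight,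
        LinearMap.comp_apply, LinearEquiv.coe_coe, G.hasCoaction.coact_incl]
      rfl
  have e4 : (Algebra.TensorProduct.map f (AlgHom.id ℂ A)).comp (coact G f) =
      (coactRightAlg G Ω).comp f := by
    refine h.algHom_ext (fun b => ?_) (fun b => ?_)
    · rw [AlgHom.comp_apply, AlgHom.comp_apply, e0, e1, e2]
    · rw [AlgHom.comp_apply, AlgHom.comp_apply, e0, e1, h.coact_dif, h.f_d, coactRight_tensorDif,
        ← e2]
      congr 1
      rw [← LinearMap.comp_apply, ← LinearMap.comp_apply, ← TensorProduct.map_comp,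
        ← TensorProduct.map_comp]
      congr 2
      exact LinearMap.ext h.f_d
  apply inj
  have := DFunLike.congr_fun e4 x
  rwa [AlgHom.comp_apply, AlgHom.comp_apply, e0, e1] at this

end HasCoaction

end Coaction

/-! ### Horizontal forms, forms on the base, and intertwiners -/

namespace BundleCalculus

variable {A : Type*} [Ring A] [StarRing A] [HopfAlgebra ℂ A] [StarModule ℂ A]
  {Γ : Type*} [Ring Γ] [Algebra ℂ Γ] [DGStarAlgebra Γ] {G : GroupCalculus A Γ}
  {V : Type*} [Ring V] [StarRing V] [Algebra ℂ V] [StarModule ℂ V]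
  {B : Type*} [Ring B] [StarRing B] [Algebra ℂ B] [StarModule ℂ B] {P : Bundle A V B}
  {Ω : Type*} [Ring Ω] [Algebra ℂ Ω] [DGStarAlgebra Ω] (S : BundleCalculus G P Ω)

theorem hasCoaction : HasCoaction G S.incl (P.F : B →ₐ[ℂ] B ⊗[ℂ] A) S.FHat where
  incl_mem b := by rw [← S.range_incl]; exact ⟨b, rfl⟩
  generates := S.generates
  f_incl := S.FHat_incl
  f_d := S.FHat_d
  coassoc b := P.coassoc b
  counit b := P.counit b

theorem incl_mem (b : B) : S.incl b ∈ gr Ω 0 := S.hasCoaction.incl_mem b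

theorem exists_incl {x : Ω} (hx : x ∈ gr Ω 0) : ∃ b, S.incl b = x := by
  rw [← S.range_incl] at hx; exact hx

theorem Fwedge_eq_coact (x : Ω) : S.Fwedge x = coact G S.FHat x := (coact_apply G S.FHat x).symm

theorem Fwedge_mul (x y : Ω) : S.Fwedge (x * y) = S.Fwedge x * S.Fwedge y := by
  simp only [Fwedge_eq_coact, map_mul]

theorem Fwedge_one : S.Fwedge 1 = 1 ⊗ₜ 1 := by
  simp only [Fwedge_eq_coact, map_one]; rfl

theorem Fwedge_incl (b : B) :
    S.Fwedge (S.incl b) = TensorProduct.map S.incl.toLinearMap LinearMap.id (P.F b) := by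
  rw [Fwedge_eq_coact, S.hasCoaction.coact_incl]; rfl

theorem Fwedge_grProj (n : ℕ) (x : Ω) :
    S.Fwedge (grProj n x) = TensorProduct.map (grProj n) LinearMap.id (S.Fwedge x) := by
  simp only [Fwedge_eq_coact, S.hasCoaction.coact_grProj]

theorem Fwedge_coassoc (x : Ω) : TensorProduct.assoc ℂ Ω A A
      (TensorProduct.map S.Fwedge LinearMap.id (S.Fwedge x)) =
    TensorProduct.map LinearMap.id Coalgebra.comul (S.Fwedge x) := by
  have e : S.Fwedge = (coact G S.FHat).toLinearMap := LinearMap.ext S.Fwedge_eq_coact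
  rw [e]
  exact S.hasCoaction.coact_coassoc x

theorem Fwedge_counit (x : Ω) :
    TensorProduct.rid ℂ Ω (TensorProduct.map LinearMap.id Coalgebra.counit (S.Fwedge x)) = x := by
  rw [Fwedge_eq_coact]; exact S.hasCoaction.coact_counit x

/-- If `F^ x` comes from some `t` in `Ω ⊗ A`, applying `id ⊗ p_*` identifies `t` with `F^∧ x`. -/
theorem mem_hor_iff {x : Ω} : x ∈ S.hor ↔
    toTensor S.FHat x = TensorProduct.map LinearMap.id G.incl.toLinearMap (S.Fwedge x) := by
  refine ⟨?_, fun h => ⟨_, h.symm⟩⟩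
  rintro ⟨t, ht⟩
  have : S.Fwedge x = t := by
    rw [Fwedge, LinearMap.comp_apply, ← ht, ← LinearMap.comp_apply, ← TensorProduct.map_comp]
    have : G.proj ∘ₗ G.incl.toLinearMap = LinearMap.id := LinearMap.ext G.proj_incl
    rw [this, LinearMap.id_comp, TensorProduct.map_id]; rfl
  rw [this, ht]

/-- A horizontal left factor has degree 0 in `Γ`, so the graded and the ordinary products coincide.
-/
theorem toTensor_mul {x : Ω} (hx : x ∈ S.hor) (y : Ω) :
    toTensor S.FHat (x * y) = toTensor S.FHat x * toTensor S.FHat y := by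
  apply (ofT Ω Γ).injective
  rw [ofT_toTensor, map_mul, ← ofT_toTensor S.FHat x, ← ofT_toTensor S.FHat y, S.mem_hor_iff.1 hx]
  induction S.Fwedge x with
  | zero => simp
  | add s t hs ht => simp only [map_add, add_mul, hs, ht]
  | tmul w a => exact ofT_mul_of_zero w (G.incl_mem a) _

theorem map_incl_mul (s t : Ω ⊗[ℂ] A) :
    TensorProduct.map (LinearMap.id : Ω →ₗ[ℂ] Ω) G.incl.toLinearMap (s * t) =
      TensorProduct.map LinearMap.id G.incl.toLinearMap s *
        TensorProduct.map LinearMap.id G.incl.toLinearMap t :=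
  map_mul (Algebra.TensorProduct.map (AlgHom.id ℂ Ω) G.incl) s t

theorem mul_mem_hor {x y : Ω} (hx : x ∈ S.hor) (hy : y ∈ S.hor) : x * y ∈ S.hor := by
  rw [mem_hor_iff, S.toTensor_mul hx, S.mem_hor_iff.1 hx, S.mem_hor_iff.1 hy, Fwedge_mul,
    map_incl_mul]

theorem incl_mem_hor (b : B) : S.incl b ∈ S.hor := by
  rw [mem_hor_iff, S.FHat_incl, S.Fwedge_incl, ← LinearMap.comp_apply, ← TensorProduct.map_comp]
  rfl

theorem mem_hor_of_mem_gr_zero {x : Ω} (hx : x ∈ gr Ω 0) : x ∈ S.hor := by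
  obtain ⟨b, rfl⟩ := S.exists_incl hx
  exact S.incl_mem_hor b

theorem one_mem_hor : (1 : Ω) ∈ S.hor := S.mem_hor_of_mem_gr_zero one_mem_gr

theorem grProj_mem_hor {x : Ω} (hx : x ∈ S.hor) (n : ℕ) : grProj n x ∈ S.hor := by
  rw [mem_hor_iff, ← S.hasCoaction.totalProj_toTensor, S.mem_hor_iff.1 hx, totalProj_map_incl,
    Fwedge_grProj]

/-- Evaluation of a functional in the right factor. -/
def slice (θ : A →ₗ[ℂ] ℂ) : Ω ⊗[ℂ] A →ₗ[ℂ] Ω :=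
  (TensorProduct.rid ℂ Ω).toLinearMap ∘ₗ TensorProduct.map LinearMap.id θ

omit [StarRing A] [StarModule ℂ A] [DGStarAlgebra Ω] in
@[simp] theorem slice_tmul (θ : A →ₗ[ℂ] ℂ) (x : Ω) (a : A) :
    slice θ (x ⊗ₜ[ℂ] a) = θ a • x := by simp [slice]

/-- Apply the functional to the last leg of `HasCoaction.map_toTensor_coact`. For horizontal `x` the
`Γ`-leg remains of degree 0, since the coaction maps `A` to `A ⊗ A`. -/
theorem slice_mem_hor {x : Ω} (hx : x ∈ S.hor) (θ : A →ₗ[ℂ] ℂ) :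
    slice θ (S.Fwedge x) ∈ S.hor := by
  have e : toTensor S.FHat (slice θ (S.Fwedge x)) =
      TensorProduct.rid ℂ _ (TensorProduct.map LinearMap.id θ
        (TensorProduct.map (toTensor S.FHat) LinearMap.id (S.Fwedge x))) := by
    induction S.Fwedge x with
    | zero => simp
    | add s t hs ht => simp only [map_add, hs, ht]
    | tmul w a => simp
  rw [Fwedge_eq_coact, S.hasCoaction.map_toTensor_coact, S.mem_hor_iff.1 hx,
    ← Fwedge_eq_coact] at e
  change toTensor S.FHat _ ∈
    LinearMap.range (TensorProduct.map (LinearMap.id : Ω →ₗ[ℂ] Ω) G.incl.toLinearMap)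
  rw [e]
  induction S.Fwedge x with
  | zero => simp
  | add s t hs ht => simp only [map_add]; exact add_mem hs ht
  | tmul w a =>
    simp only [TensorProduct.map_tmul, coactRight, LinearMap.comp_apply, LinearEquiv.coe_coe,
      AlgHom.toLinearMap_apply, G.hasCoaction.coact_incl, LinearMap.id_apply]
    change TensorProduct.rid ℂ _ (TensorProduct.map LinearMap.id θ
      ((TensorProduct.assoc ℂ Ω Γ A).symm (w ⊗ₜ TensorProduct.map G.incl.toLinearMap LinearMap.id
        (Coalgebra.comul a)))) ∈
      LinearMap.range (TensorProduct.map (LinearMap.id : Ω →ₗ[ℂ] Ω) G.incl.toLinearMap)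
    induction Coalgebra.comul (R := ℂ) a with
    | zero => simp
    | add s t hs ht => simp only [map_add, TensorProduct.tmul_add]; exact add_mem hs ht
    | tmul b c => exact ⟨θ c • (w ⊗ₜ b), by simp⟩

theorem slice_mem_gr {n : ℕ} {x : Ω} (hx : x ∈ gr Ω n) (θ : A →ₗ[ℂ] ℂ) :
    slice θ (S.Fwedge x) ∈ gr Ω n := by
  rw [← grProj_of_mem hx, Fwedge_grProj]
  induction S.Fwedge x with
  | zero => simp
  | add s t hs ht => simp only [map_add]; exact add_mem hs ht
  | tmul w a =>
    simp only [TensorProduct.map_tmul, slice_tmul]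
    exact Submodule.smul_mem _ _ (grProj_mem n w)

theorem mem_base_iff {x : Ω} : x ∈ S.base ↔ x ∈ S.hor ∧ S.Fwedge x = x ⊗ₜ 1 := by
  constructor
  · intro h
    have h' : toTensor S.FHat x = x ⊗ₜ 1 := h
    refine ⟨⟨x ⊗ₜ 1, by simp [h']⟩, ?_⟩
    rw [Fwedge, LinearMap.comp_apply, h']
    simp [G.proj_one]
  · rintro ⟨h, h'⟩
    change toTensor S.FHat x = x ⊗ₜ 1
    rw [S.mem_hor_iff.1 h, h']; simp

theorem base_le_hor : S.base ≤ S.hor := fun _ h => (S.mem_base_iff.1 h).1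

theorem one_mem_base : (1 : Ω) ∈ S.base := S.mem_base_iff.2 ⟨S.one_mem_hor, S.Fwedge_one⟩

theorem mul_mem_base {x y : Ω} (hx : x ∈ S.base) (hy : y ∈ S.base) : x * y ∈ S.base := by
  rw [mem_base_iff] at *
  refine ⟨S.mul_mem_hor hx.1 hy.1, ?_⟩
  rw [Fwedge_mul, hx.2, hy.2]; simp

theorem grProj_mem_base {x : Ω} (hx : x ∈ S.base) (n : ℕ) : grProj n x ∈ S.base := by
  rw [mem_base_iff] at *
  refine ⟨S.grProj_mem_hor hx.1 n, ?_⟩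
  rw [Fwedge_grProj, hx.2]; simp

theorem dif_mem_base {x : Ω} (hx : x ∈ S.base) : dif x ∈ S.base := by
  have h : toTensor S.FHat x = x ⊗ₜ 1 := hx
  change toTensor S.FHat (dif x) = dif x ⊗ₜ 1
  rw [S.FHat_d, h]
  simp [tensorDif, dif_one]

theorem base_induction {p : Ω → Prop} {x : Ω} (hx : x ∈ S.base)
    (hom : ∀ n, ∀ y ∈ gr Ω n, y ∈ S.base → p y) (zero : p 0)
    (add : ∀ y z, p y → p z → p (y + z)) : p x := by
  obtain ⟨N, hN⟩ := exists_sum_grProj x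
  rw [hN N le_rfl]
  refine Finset.sum_induction _ p add zero fun n _ => ?_
  exact hom n _ (grProj_mem n x) (S.grProj_mem_base hx n)

theorem parity_mem_base {x : Ω} (hx : x ∈ S.base) : parity x ∈ S.base := by
  refine S.base_induction (p := fun x => parity x ∈ S.base) hx ?_ (by simp) ?_
  · intro n y hy h; rw [parity_of_mem hy]; exact Submodule.smul_mem _ _ h
  · intro y z hy hz; rw [map_add]; exact add_mem hy hz

/-- Tensoring `B → Ω` with `A` stays injective over a field, so invariance of the form is invariance
in `B`. Coefficients of degree 0 thus come from `V`, the scalars in the definition of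
`IsLeftLinear`. -/
theorem mem_base_zero_iff {x : Ω} : (x ∈ S.base ∧ x ∈ gr Ω 0) ↔ ∃ f : V, x = S.incl (P.i f) := by
  have inj : Function.Injective (TensorProduct.map S.incl.toLinearMap
      (LinearMap.id : A →ₗ[ℂ] A)) :=
    Module.Flat.rTensor_preserves_injective_linearMap (M := A) S.incl.toLinearMap S.incl_injective
  constructor
  · rintro ⟨h, h0⟩
    obtain ⟨b, rfl⟩ := S.exists_incl h0
    have := (S.mem_base_iff.1 h).2
    rw [Fwedge_incl] at this
    obtain ⟨f, hf⟩ := (P.range_i b).2 (inj (by rw [this]; simp))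
    exact ⟨f, by rw [hf]⟩
  · rintro ⟨f, rfl⟩
    refine ⟨S.mem_base_iff.2 ⟨S.incl_mem_hor _, ?_⟩, S.incl_mem _⟩
    rw [Fwedge_incl, (P.range_i _).1 ⟨f, rfl⟩]; simp

/-! ### Intertwiners -/

variable {ι : Type} [Fintype ι] {w : Matrix ι ι A}

theorem mem_intertwiners_of_toTensor {φ : ι → Ω}
    (h : ∀ j, toTensor S.FHat (φ j) = ∑ i, φ i ⊗ₜ G.incl (w i j)) : φ ∈ S.intertwiners w := by
  intro j
  refine ⟨⟨∑ i, φ i ⊗ₜ w i j, ?_⟩, ?_⟩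
  · rw [h]; simp
  · rw [Fwedge, LinearMap.comp_apply, h]; simp [G.proj_incl]

variable {S}

theorem toTensor_of_mem {φ : ι → Ω} (h : φ ∈ S.intertwiners w) (j : ι) :
    toTensor S.FHat (φ j) = ∑ i, φ i ⊗ₜ G.incl (w i j) := by
  rw [S.mem_hor_iff.1 (h j).1, (h j).2]; simp

theorem base_mul_mem_intertwiners {α : Ω} (hα : α ∈ S.base) {φ : ι → Ω}
    (h : φ ∈ S.intertwiners w) : (fun i => α * φ i) ∈ S.intertwiners w := by
  intro j
  refine ⟨S.mul_mem_hor (S.base_le_hor hα) (h j).1, ?_⟩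
  rw [Fwedge_mul, (S.mem_base_iff.1 hα).2, (h j).2, Finset.mul_sum]
  simp

theorem mul_base_mem_intertwiners {α : Ω} (hα : α ∈ S.base) {φ : ι → Ω}
    (h : φ ∈ S.intertwiners w) : (fun i => φ i * α) ∈ S.intertwiners w := by
  intro j
  refine ⟨S.mul_mem_hor (h j).1 (S.base_le_hor hα), ?_⟩
  rw [Fwedge_mul, (S.mem_base_iff.1 hα).2, (h j).2, Finset.sum_mul]
  simp

theorem grProj_mem_intertwiners (n : ℕ) {φ : ι → Ω} (h : φ ∈ S.intertwiners w) :
    (fun i => grProj n (φ i)) ∈ S.intertwiners w := by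
  intro j
  refine ⟨S.grProj_mem_hor (h j).1 n, ?_⟩
  rw [Fwedge_grProj, (h j).2]
  simp

theorem exists_sum_grProj_pi (φ : ι → Ω) :
    ∃ N, φ = ∑ n ∈ Finset.range N, fun i => grProj n (φ i) := by
  choose N hN using fun i => exists_sum_grProj (φ i)
  refine ⟨Finset.univ.sup N, funext fun i => ?_⟩
  rw [Finset.sum_apply]
  exact hN i _ (Finset.le_sup (Finset.mem_univ i))

/-- Reduction to homogeneous intertwiners. -/
theorem intertwiners_induction {p : (ι → Ω) → Prop} {φ : ι → Ω} (h : φ ∈ S.intertwiners w)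
    (hom : ∀ n, ∀ ψ ∈ S.intertwiners w, (∀ i, ψ i ∈ gr Ω n) → p ψ) (zero : p 0)
    (add : ∀ ψ ψ', p ψ → p ψ' → p (ψ + ψ')) : p φ := by
  obtain ⟨N, hN⟩ := exists_sum_grProj_pi φ
  rw [hN]
  exact Finset.sum_induction _ p add zero fun n _ =>
    hom n _ (grProj_mem_intertwiners n h) fun i => grProj_mem n _

theorem mul_mem_intertwiners {κ : Type} [Fintype κ] {w' : Matrix κ κ A} {φ : ι → Ω} {ψ : κ → Ω}
    (h : φ ∈ S.intertwiners w) (h' : ψ ∈ S.intertwiners w') {W : Matrix (ι × κ) (ι × κ) A}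
    (hW : ∀ i j, W i j = w i.1 j.1 * w' i.2 j.2) :
    (fun i : ι × κ => φ i.1 * ψ i.2) ∈ S.intertwiners W := by
  intro j
  refine ⟨S.mul_mem_hor (h _).1 (h' _).1, ?_⟩
  rw [Fwedge_mul, (h _).2, (h' _).2, Finset.sum_mul_sum, Fintype.sum_prod_type]
  simp [hW]

theorem pairPlus_mem_base (u : UnitaryRep A) {φ ψ : u.ι → Ω} (h : φ ∈ S.H u)
    (h' : ψ ∈ S.HDual u) : pairPlus u φ ψ ∈ S.base := by
  rw [mem_base_iff]
  refine ⟨sum_mem fun i _ => S.mul_mem_hor (h i).1 (h' i).1, ?_⟩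
  simp only [pairPlus, map_sum, Fwedge_mul, (h _).2, (h' _).2, Finset.sum_mul_sum,
    Algebra.TensorProduct.tmul_mul_tmul, contra_apply]
  rw [Finset.sum_comm, TensorProduct.sum_tmul]
  refine Finset.sum_congr rfl fun k _ => ?_
  rw [Finset.sum_comm]
  simp only [← TensorProduct.tmul_sum, u.isCorep.sum_mul_antipode, TensorProduct.tmul_ite]
  simp

theorem sum_comm_four {M ι κ ι' κ' : Type*} [AddCommMonoid M] [Fintype ι] [Fintype κ] [Fintype ι']
    [Fintype κ'] (f : ι → κ → ι' → κ' → M) :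
    ∑ i, ∑ j, ∑ k, ∑ l, f i j k l = ∑ k, ∑ l, ∑ i, ∑ j, f i j k l := by
  have e1 : ∀ i j, ∑ k, ∑ l, f i j k l = ∑ q : ι' × κ', f i j q.1 q.2 := fun i j =>
    (Fintype.sum_prod_type' (f i j)).symm
  have e2 : ∀ k l, ∑ i, ∑ j, f i j k l = ∑ q : ι × κ, f q.1 q.2 k l := fun k l =>
    (Fintype.sum_prod_type' fun i j => f i j k l).symm
  simp_rw [e1, e2]
  rw [← Fintype.sum_prod_type' (fun i j => ∑ q : ι' × κ', f i j q.1 q.2),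
    ← Fintype.sum_prod_type' (fun k l => ∑ q : ι × κ, f q.1 q.2 k l), Finset.sum_comm]

/-- In the order `κ(u) · u` the plain contraction is not invariant. The weight `C_u⁻¹` compensates
for this by `IsContraMor.sum_antipode_mul`. -/
theorem pairMinus_mem_base (hA : IsCompactMatrixQuantumGroup A) (u : UnitaryRep A)
    {φ ψ : u.ι → Ω} (h : φ ∈ S.H u) (h' : ψ ∈ S.HDual u) : pairMinus u ψ φ ∈ S.base := by
  rw [mem_base_iff]
  refine ⟨sum_mem fun i _ => sum_mem fun j _ =>
    Submodule.smul_mem _ _ (S.mul_mem_hor (h' i).1 (h j).1), ?_⟩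
  have hC := canonicalC_spec hA u
  simp only [pairMinus, map_sum, map_smul, Fwedge_mul, (h _).2, (h' _).2, Finset.sum_mul_sum,
    Algebra.TensorProduct.tmul_mul_tmul, contra_apply, Finset.smul_sum]
  rw [sum_comm_four, TensorProduct.sum_tmul]
  refine Finset.sum_congr rfl fun k _ => ?_
  rw [TensorProduct.sum_tmul]
  refine Finset.sum_congr rfl fun l _ => ?_
  have e := IsContraMor.sum_antipode_mul hA.comul_star hC.intertwines hC.posDef.isUnit k l
  simp only [← TensorProduct.tmul_smul, ← TensorProduct.tmul_sum]
  rw [e, Algebra.algebraMap_eq_smul_one, TensorProduct.tmul_smul, TensorProduct.smul_tmul']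

end BundleCalculus

/-! ### Averaging with the invariant functional; existence of dual families -/

section Averaging

variable {A : Type*} [Ring A] [StarRing A] [HopfAlgebra ℂ A]

/-- The functional `a ↦ h(κ(a) b)`. -/
def antipodeFunctional (h : A →ₗ[ℂ] ℂ) (b : A) : A →ₗ[ℂ] ℂ :=
  h ∘ₗ LinearMap.mulRight ℂ b ∘ₗ HopfAlgebra.antipode ℂ

theorem antipodeFunctional_apply (h : A →ₗ[ℂ] ℂ) (a b : A) :
    antipodeFunctional h b a = h (HopfAlgebra.antipode ℂ a * b) := rfl

/-- On a coefficient `a = v i j`, insert the invariance of `h` applied to `κ(v p j) w k l`, expand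
the coproduct, and cancel `v · κ(v)`. This identity makes averages of horizontal forms transform by
`w`. -/
theorem antipodeFunctional_comul [StarModule ℂ A] (hA : IsCompactMatrixQuantumGroup A)
    {h : A →ₗ[ℂ] ℂ}
    (hh : ∀ a, TensorProduct.lid ℂ A
      (TensorProduct.map h LinearMap.id (Coalgebra.comul (R := ℂ) a)) = h a • 1)
    {ι : Type} [Fintype ι] [DecidableEq ι] {w : Matrix ι ι A} (hw : IsCorep w) (k l : ι) (a : A) :
    TensorProduct.rid ℂ A (TensorProduct.map LinearMap.id (antipodeFunctional h (w k l))
      (Coalgebra.comul (R := ℂ) a)) = ∑ m, antipodeFunctional h (w k m) a • w m l := by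
  have ha : a ∈ Submodule.span ℂ {a : A | ∃ (u : UnitaryRep A) (i j : u.ι), a = u.mat i j} := by
    rw [hA.span_coeff]; trivial
  induction ha using Submodule.span_induction with
  | zero => simp
  | add x y _ _ hx hy => simp only [map_add, hx, hy, add_smul, Finset.sum_add_distrib]
  | smul c x _ hx => simp only [map_smul, hx, Finset.smul_sum, smul_assoc]
  | mem x hx =>
    obtain ⟨v, i, j, rfl⟩ := hx
    have hv := isCorep_contra hA.comul_star v
    have e1 : ∀ p, h (HopfAlgebra.antipode ℂ (v.mat p j) * w k l) • (1 : A) =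
        ∑ q, ∑ m, h (HopfAlgebra.antipode ℂ (v.mat q j) * w k m) •
          (HopfAlgebra.antipode ℂ (v.mat p q) * w m l) := by
      intro p
      have := hv.comul j p
      simp only [contra_apply] at this
      rw [← hh, Bialgebra.comul_mul, this, hw.comul, Finset.sum_mul_sum]
      simp
    have e2 : ∀ p, h (HopfAlgebra.antipode ℂ (v.mat p j) * w k l) • v.mat i p =
        v.mat i p * h (HopfAlgebra.antipode ℂ (v.mat p j) * w k l) • (1 : A) := by
      intro p; simp
    simp only [v.comul_mat, map_sum, TensorProduct.map_tmul, TensorProduct.rid_tmul,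
      LinearMap.id_apply, antipodeFunctional_apply]
    simp only [e2, e1, Finset.mul_sum, mul_smul_comm, ← mul_assoc]
    rw [Finset.sum_comm]
    simp only [Finset.sum_comm (s := (Finset.univ : Finset v.ι)) (t := (Finset.univ : Finset ι)),
      ← Finset.smul_sum, ← Finset.sum_mul, v.isCorep.sum_mul_antipode]
    simp

end Averaging

namespace BundleCalculus

variable {A : Type*} [Ring A] [StarRing A] [HopfAlgebra ℂ A] [StarModule ℂ A]
  {Γ : Type*} [Ring Γ] [Algebra ℂ Γ] [DGStarAlgebra Γ] {G : GroupCalculus A Γ}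
  {V : Type*} [Ring V] [StarRing V] [Algebra ℂ V] [StarModule ℂ V]
  {B : Type*} [Ring B] [StarRing B] [Algebra ℂ B] [StarModule ℂ B] {P : Bundle A V B}
  {Ω : Type*} [Ring Ω] [Algebra ℂ Ω] [DGStarAlgebra Ω] (S : BundleCalculus G P Ω)

omit [StarRing A] [StarModule ℂ A] [DGStarAlgebra Ω] in
theorem slice_tmul_one_mul (θ : A →ₗ[ℂ] ℂ) (x : Ω) (t : Ω ⊗[ℂ] A) :
    slice θ ((x ⊗ₜ 1) * t) = x * slice θ t := by
  induction t with
  | zero => simp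
  | add s t hs ht => simp only [mul_add, map_add, hs, ht]
  | tmul w a => simp

omit [StarRing A] [StarModule ℂ A] [DGStarAlgebra Ω] in
theorem slice_mul_tmul_one (θ : A →ₗ[ℂ] ℂ) (x : Ω) (t : Ω ⊗[ℂ] A) :
    slice θ (t * (x ⊗ₜ 1)) = slice θ t * x := by
  induction t with
  | zero => simp
  | add s t hs ht => simp only [add_mul, map_add, hs, ht]
  | tmul w a => simp

theorem Fwedge_slice (θ : A →ₗ[ℂ] ℂ) (x : Ω) : S.Fwedge (slice θ (S.Fwedge x)) =
    TensorProduct.map LinearMap.id ((TensorProduct.rid ℂ A).toLinearMap ∘ₗ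
      TensorProduct.map LinearMap.id θ ∘ₗ Coalgebra.comul) (S.Fwedge x) := by
  have e : ∀ t : Ω ⊗[ℂ] A, S.Fwedge (slice θ t) = TensorProduct.map LinearMap.id
      ((TensorProduct.rid ℂ A).toLinearMap ∘ₗ TensorProduct.map LinearMap.id θ)
      (TensorProduct.assoc ℂ Ω A A (TensorProduct.map S.Fwedge LinearMap.id t)) := by
    intro t
    induction t with
    | zero => simp
    | add s t hs ht => simp only [map_add, hs, ht]
    | tmul w a =>
      simp only [slice_tmul, map_smul, TensorProduct.map_tmul, LinearMap.id_apply]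
      induction S.Fwedge w with
      | zero => simp
      | add s t hs ht => simp only [map_add, TensorProduct.add_tmul, smul_add, hs, ht]
      | tmul w b => simp
  rw [e, Fwedge_coassoc, ← LinearMap.comp_apply, ← TensorProduct.map_comp]
  rfl

variable (hA : IsCompactMatrixQuantumGroup A)

include hA

/-- Averaging a horizontal form gives an intertwiner. -/
theorem slice_mem_intertwiners {h : A →ₗ[ℂ] ℂ}
    (hh : ∀ a, TensorProduct.lid ℂ A
      (TensorProduct.map h LinearMap.id (Coalgebra.comul (R := ℂ) a)) = h a • 1)
    {ι : Type} [Fintype ι] [DecidableEq ι] {w : Matrix ι ι A} (hw : IsCorep w) (k : ι) {x : Ω}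
    (hx : x ∈ S.hor) :
    (fun l => slice (antipodeFunctional h (w k l)) (S.Fwedge x)) ∈ S.intertwiners w := by
  intro l
  refine ⟨S.slice_mem_hor hx _, ?_⟩
  rw [Fwedge_slice]
  induction S.Fwedge x with
  | zero => simp
  | add s t hs ht => simp only [map_add, TensorProduct.add_tmul, Finset.sum_add_distrib, hs, ht]
  | tmul y a =>
    simp only [TensorProduct.map_tmul, LinearMap.comp_apply, LinearMap.id_apply,
      LinearEquiv.coe_coe, antipodeFunctional_comul hA hh hw, slice_tmul, TensorProduct.tmul_sum,
      TensorProduct.tmul_smul, TensorProduct.smul_tmul']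

omit hA in
theorem exists_sum_mul_Fwedge (t : B ⊗[ℂ] A) : ∃ (K : Type) (_ : Fintype K) (q b : K → Ω),
    (∀ k, q k ∈ gr Ω 0) ∧ (∀ k, b k ∈ gr Ω 0) ∧ ∑ k, (q k ⊗ₜ[ℂ] (1 : A)) * S.Fwedge (b k) =
      TensorProduct.map S.incl.toLinearMap LinearMap.id t := by
  have ht : t ∈ Submodule.span ℂ {x : B ⊗[ℂ] A | ∃ q b : B, x = (q ⊗ₜ 1) * P.F b} := by
    rw [P.free]; trivial
  induction ht using Submodule.span_induction with
  | zero => exact ⟨Empty, inferInstance, Empty.elim, Empty.elim, by simp, by simp, by simp⟩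
  | mem x hx =>
    obtain ⟨q, b, rfl⟩ := hx
    refine ⟨Unit, inferInstance, fun _ => S.incl q, fun _ => S.incl b, fun _ => S.incl_mem q,
      fun _ => S.incl_mem b, ?_⟩
    have := map_mul (Algebra.TensorProduct.map S.incl (AlgHom.id ℂ A)) (q ⊗ₜ 1) (P.F b)
    rw [Algebra.TensorProduct.map_tmul, map_one] at this
    simp only [Finset.univ_unique, Finset.sum_const, Finset.card_singleton, one_smul, Fwedge_incl]
    exact this.symm
  | add x y _ _ hx hy =>
    obtain ⟨K, _, q, b, h1, h2, h3⟩ := hx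
    obtain ⟨K', _, q', b', h1', h2', h3'⟩ := hy
    refine ⟨K ⊕ K', inferInstance, Sum.elim q q', Sum.elim b b', ?_, ?_, ?_⟩
    · rintro (k | k) <;> simp [h1, h1']
    · rintro (k | k) <;> simp [h2, h2']
    · simp [h3, h3']
  | smul c x _ hx =>
    obtain ⟨K, _, q, b, h1, h2, h3⟩ := hx
    refine ⟨K, inferInstance, fun k => c • q k, b, fun k => Submodule.smul_mem _ _ (h1 k), h2, ?_⟩
    rw [map_smul, ← h3, Finset.smul_sum]
    exact Finset.sum_congr rfl fun k _ => by rw [← TensorProduct.smul_tmul', smul_mul_assoc]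

/-- A finite family representing the element induced by the contraction map. -/
structure DualFamily (u : UnitaryRep A) (K : Type) [Fintype K] where
  ν : K → u.ι → Ω
  μ : K → u.ι → Ω
  ν_mem : ∀ k, ν k ∈ S.HDual u
  ν_gr : ∀ k i, ν k i ∈ gr Ω 0
  μ_mem : ∀ k, μ k ∈ S.H u
  μ_gr : ∀ k i, μ k i ∈ gr Ω 0
  sum_mul : ∀ i j, ∑ k, ν k i * μ k j = if i = j then 1 else 0

omit hA in
-- Apply `F^∧` to `∑ q_s μ_s(j) = δ` and multiply by `κ(u j l)`. This moves the coaction of `μ_s` to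
-- the right-hand side, so that the `q_s` can be averaged while the relation is kept under control.
theorem sum_slice_mul (u : UnitaryRep A) {K : Type} [Fintype K] (q : K → Ω) (μ : K → u.ι → Ω)
    (hμ : ∀ s, μ s ∈ S.H u) (m : u.ι) (hq : ∀ l, ∑ s, q s * μ s l = if m = l then 1 else 0)
    (θ : A →ₗ[ℂ] ℂ) (l : u.ι) : ∑ s, slice θ (S.Fwedge (q s)) * μ s l =
      θ (HopfAlgebra.antipode ℂ (u.mat m l)) • 1 := by
  have e1 : ∀ s, μ s l ⊗ₜ[ℂ] (1 : A) =
      ∑ j, S.Fwedge (μ s j) * (1 ⊗ₜ HopfAlgebra.antipode ℂ (u.mat j l)) := by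
    intro s
    simp only [((hμ s) _).2, Finset.sum_mul, Algebra.TensorProduct.tmul_mul_tmul, mul_one]
    rw [Finset.sum_comm]
    simp [← TensorProduct.tmul_sum, u.isCorep.sum_mul_antipode, TensorProduct.tmul_ite]
  have e2 : ∑ s, S.Fwedge (q s) * (μ s l ⊗ₜ[ℂ] (1 : A)) =
      1 ⊗ₜ HopfAlgebra.antipode ℂ (u.mat m l) := by
    simp only [e1, Finset.mul_sum, ← mul_assoc, ← Fwedge_mul]
    rw [Finset.sum_comm]
    simp only [← Finset.sum_mul, ← map_sum, hq]
    rw [Finset.sum_eq_single m]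
    · simp [Fwedge_one]
    · intro b _ hb; simp [hb.symm]
    · simp
  have e3 := congrArg (slice (Ω := Ω) θ) e2
  simpa only [map_sum, slice_mul_tmul_one, slice_tmul] using e3

/-- Freeness writes each `1 ⊗ u m k` as a finite sum `∑ q F(b)`. Averaging the `b` produces the
intertwiners `μ`, averaging the `q` afterwards produces the `ν`, and the antipode identities, summed
over `k` and then over `m`, give the duality relation. -/
theorem exists_dualFamily (u : UnitaryRep A) :
    ∃ (K : Type) (_ : Fintype K), Nonempty (S.DualFamily u K) := by
  obtain ⟨h, h1, hh⟩ := exists_haar hA.span_coeff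
  choose K hK q b hq hb hqb using fun m k : u.ι => S.exists_sum_mul_Fwedge (1 ⊗ₜ u.mat m k)
  let μ : (Σ m : u.ι, Σ k : u.ι, K m k) → u.ι → Ω := fun s l =>
    slice (antipodeFunctional h (u.mat s.2.1 l)) (S.Fwedge (b s.1 s.2.1 s.2.2))
  let ν : (Σ m : u.ι, Σ k : u.ι, K m k) → u.ι → Ω := fun s l =>
    slice (antipodeFunctional h (contra u.mat s.1 l)) (S.Fwedge (q s.1 s.2.1 s.2.2))
  have hμ : ∀ s, μ s ∈ S.H u := fun s =>
    S.slice_mem_intertwiners hA hh u.isCorep _ (S.mem_hor_of_mem_gr_zero (hb _ _ _))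
  have hw := isCorep_contra hA.comul_star u
  -- For fixed `k` the sum is `h(κ(u m k) u k l)`; summed over `k` it becomes `h(1)` or `0`.
  have e1 : ∀ m l, ∑ s : (Σ k : u.ι, K m k), q m s.1 s.2 * μ ⟨m, s⟩ l =
      if m = l then 1 else 0 := by
    intro m l
    have : ∀ k, ∑ r, q m k r * μ ⟨m, k, r⟩ l =
        h (HopfAlgebra.antipode ℂ (u.mat m k) * u.mat k l) • 1 := by
      intro k
      have := congrArg (slice (Ω := Ω) (antipodeFunctional h (u.mat k l))) (hqb m k)
      simp only [map_sum, slice_tmul_one_mul, TensorProduct.map_tmul, slice_tmul,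
        AlgHom.toLinearMap_apply, map_one, LinearMap.id_apply, antipodeFunctional_apply] at this
      exact this
    rw [Fintype.sum_sigma]
    simp only [this, ← Finset.sum_smul, ← map_sum, u.isCorep.sum_antipode_mul]
    split_ifs <;> simp [h1]
  refine ⟨_, inferInstance, ⟨⟨ν, μ, fun s => ?_, fun s l => ?_, hμ, fun s l => ?_,
    fun p l => ?_⟩⟩⟩
  · exact S.slice_mem_intertwiners hA hh hw _ (S.mem_hor_of_mem_gr_zero (hq _ _ _))
  · exact S.slice_mem_gr (hq _ _ _) _
  · exact S.slice_mem_gr (hb _ _ _) _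
  · rw [Fintype.sum_sigma]
    have e2 : ∀ m, ∑ s : (Σ k : u.ι, K m k), ν ⟨m, s⟩ p * μ ⟨m, s⟩ l =
        h (HopfAlgebra.antipode ℂ (contra u.mat l m) * contra u.mat m p) • 1 := fun m =>
      S.sum_slice_mul u (fun s : Σ k : u.ι, K m k => q m s.1 s.2) (fun s => μ ⟨m, s⟩)
        (fun s => hμ ⟨m, s⟩) m (e1 m) (antipodeFunctional h (contra u.mat m p)) l
    simp only [e2, ← Finset.sum_smul, ← map_sum, hw.sum_antipode_mul]
    simp only [eq_comm (a := l)]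
    split_ifs <;> simp [h1]

/-- Horizontal forms are spanned by the values of homogeneous intertwiners. -/
theorem hor_le_span : S.hor ≤ Submodule.span ℂ {x | ∃ (u : UnitaryRep A) (φ : u.ι → Ω) (n : ℕ)
    (j : u.ι), φ ∈ S.H u ∧ (∀ i, φ i ∈ gr Ω n) ∧ x = φ j} := by
  obtain ⟨h, h1, hh⟩ := exists_haar hA.span_coeff
  set N := Submodule.span ℂ {x | ∃ (u : UnitaryRep A) (φ : u.ι → Ω) (n : ℕ)
    (j : u.ι), φ ∈ S.H u ∧ (∀ i, φ i ∈ gr Ω n) ∧ x = φ j} with hN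
  have hφ : ∀ (u : UnitaryRep A) (φ : u.ι → Ω), φ ∈ S.H u → ∀ j, φ j ∈ N := by
    intro u φ h j
    refine intertwiners_induction (p := fun φ => φ j ∈ N) h ?_ (zero_mem _) ?_
    · intro n ψ hψ hn
      exact Submodule.subset_span ⟨u, ψ, n, j, hψ, hn, rfl⟩
    · intro ψ ψ' hψ hψ'; exact add_mem hψ hψ'
  have hy : ∀ y ∈ S.hor, ∀ a, slice (antipodeFunctional h a) (S.Fwedge y) ∈ N := by
    intro y hy a
    have ha : a ∈ Submodule.span ℂ {a : A | ∃ (u : UnitaryRep A) (i j : u.ι), a = u.mat i j} := by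
      rw [hA.span_coeff]; trivial
    have hadd : ∀ a b, antipodeFunctional h (a + b) =
        antipodeFunctional h a + antipodeFunctional h b := by
      intro a b; ext c; simp [antipodeFunctional_apply, mul_add]
    have hsmul : ∀ (c : ℂ) b, antipodeFunctional h (c • b) = c • antipodeFunctional h b := by
      intro a b; ext c; simp [antipodeFunctional_apply]
    have hs_add : ∀ (θ θ' : A →ₗ[ℂ] ℂ) (t : Ω ⊗[ℂ] A),
        slice (θ + θ') t = slice θ t + slice θ' t := by
      intro θ θ' t; simp [slice, TensorProduct.map_add_right]
    have hs_smul : ∀ (c : ℂ) (θ : A →ₗ[ℂ] ℂ) (t : Ω ⊗[ℂ] A),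
        slice (c • θ) t = c • slice θ t := by
      intro c θ t; simp [slice, TensorProduct.map_smul_right]
    induction ha using Submodule.span_induction with
    | zero =>
      have := hsmul 0 0
      rw [zero_smul, zero_smul] at this
      rw [this]; simp [slice]
    | add x z _ _ hx hz => rw [hadd, hs_add]; exact add_mem hx hz
    | smul c x _ hx => rw [hsmul, hs_smul]; exact Submodule.smul_mem _ _ hx
    | mem x hx =>
      obtain ⟨u, i, j, rfl⟩ := hx
      exact hφ u _ (S.slice_mem_intertwiners hA hh u.isCorep i hy) j
  intro x hx
  let κm : A ⊗[ℂ] A →ₗ[ℂ] A :=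
    LinearMap.mul' ℂ A ∘ₗ TensorProduct.map (HopfAlgebra.antipode ℂ) LinearMap.id
  -- `E` maps `y ⊗ a` to an average of `y`, while the antipode axiom and `h 1 = 1` make it a left
  -- inverse of `F^∧`. It therefore exhibits `x` as a sum of averages.
  let E : (Ω ⊗[ℂ] A) →ₗ[ℂ] Ω := slice h ∘ₗ TensorProduct.map LinearMap.id κm ∘ₗ
    (TensorProduct.assoc ℂ Ω A A).toLinearMap ∘ₗ TensorProduct.map S.Fwedge LinearMap.id
  have hE : ∀ y a, E (y ⊗ₜ a) = slice (antipodeFunctional h a) (S.Fwedge y) := by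
    intro y a
    simp only [E, κm, LinearMap.comp_apply, TensorProduct.map_tmul, LinearMap.id_apply,
      LinearEquiv.coe_coe]
    induction S.Fwedge y with
    | zero => simp
    | add s t hs ht => simp only [map_add, TensorProduct.add_tmul, hs, ht]
    | tmul w b => simp [antipodeFunctional_apply]
  have hEx : E (S.Fwedge x) = x := by
    have e : κm ∘ₗ Coalgebra.comul = Algebra.linearMap ℂ A ∘ₗ Coalgebra.counit :=
      HopfAlgebra.mul_antipode_rTensor_comul
    simp only [E, LinearMap.comp_apply, LinearEquiv.coe_coe, Fwedge_coassoc]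
    rw [← LinearMap.comp_apply (TensorProduct.map _ _) (TensorProduct.map _ _),
      ← TensorProduct.map_comp, e]
    conv_rhs => rw [← S.Fwedge_counit x]
    induction S.Fwedge x with
    | zero => simp
    | add s t hs ht => simp only [map_add, hs, ht]
    | tmul w b => simp [Algebra.algebraMap_eq_smul_one, h1]
  classical
  -- The averages are known to lie in `N` only for horizontal `y`. Along a basis of `A` the left
  -- legs of `F^∧ x` are slices of `x`, hence horizontal.
  let b := Module.Basis.ofVectorSpace ℂ A
  rw [← hEx, ← (TensorProduct.equivFinsuppOfBasisRight (M := Ω) b).symm_apply_apply (S.Fwedge x),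
    TensorProduct.equivFinsuppOfBasisRight_symm_apply, Finsupp.sum, map_sum]
  refine sum_mem fun i _ => ?_
  rw [hE]
  refine hy _ ?_ _
  rw [TensorProduct.equivFinsuppOfBasisRight_apply]
  exact S.slice_mem_hor hx _

omit hA

/-- Linear maps agreeing on the values of homogeneous intertwiners agree on horizontal forms. -/
theorem hor_induction (hA : IsCompactMatrixQuantumGroup A) {p : Ω → Prop} {x : Ω} (hx : x ∈ S.hor)
    (mem : ∀ (u : UnitaryRep A) (φ : u.ι → Ω) (n : ℕ), φ ∈ S.H u → (∀ i, φ i ∈ gr Ω n) →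
      ∀ j, p (φ j)) (zero : p 0) (add : ∀ y z, p y → p z → p (y + z))
    (smul : ∀ (c : ℂ) y, p y → p (c • y)) : p x := by
  refine Submodule.span_induction ?_ zero (fun y z _ _ => add y z) (fun c y _ => smul c y)
    (S.hor_le_span hA hx)
  rintro _ ⟨u, φ, n, j, h, hn, rfl⟩
  exact mem u φ n h hn j

/-! ### Expansions and the trace along a dual family -/

section Pairing

variable {S} {u : UnitaryRep A} {K : Type} [Fintype K]

omit [StarModule ℂ A] [DGStarAlgebra Ω] in
theorem pairPlus_mul_left (α : Ω) (x y : u.ι → Ω) :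
    pairPlus u (fun i => α * x i) y = α * pairPlus u x y := by
  simp [pairPlus, Finset.mul_sum, mul_assoc]

omit [StarModule ℂ A] [DGStarAlgebra Ω] in
theorem pairPlus_mul_right (α : Ω) (x y : u.ι → Ω) :
    pairPlus u x (fun i => y i * α) = pairPlus u x y * α := by
  simp [pairPlus, Finset.sum_mul, mul_assoc]

omit [StarModule ℂ A] [DGStarAlgebra Ω] in
theorem pairPlus_mul_middle (α : Ω) (x y : u.ι → Ω) :
    pairPlus u (fun i => x i * α) y = pairPlus u x (fun i => α * y i) := by
  simp [pairPlus, mul_assoc]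

omit [StarModule ℂ A] [DGStarAlgebra Ω] in
theorem pairMinus_mul_left (α : Ω) (x y : u.ι → Ω) :
    pairMinus u (fun i => α * x i) y = α * pairMinus u x y := by
  simp [pairMinus, Finset.mul_sum, mul_assoc]

omit [StarModule ℂ A] [DGStarAlgebra Ω] in
theorem pairMinus_mul_right (α : Ω) (x y : u.ι → Ω) :
    pairMinus u x (fun i => y i * α) = pairMinus u x y * α := by
  simp [pairMinus, Finset.sum_mul, mul_assoc]

omit [StarModule ℂ A] [DGStarAlgebra Ω] in
theorem pairMinus_mul_middle (α : Ω) (x y : u.ι → Ω) :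
    pairMinus u (fun i => x i * α) y = pairMinus u x (fun i => α * y i) := by
  simp [pairMinus, mul_assoc]

variable (u) in
/-- The pairing `⟨ , ⟩⁻` as a bilinear map. -/
def pairMinusHom : (u.ι → Ω) →ₗ[ℂ] (u.ι → Ω) →ₗ[ℂ] Ω :=
  LinearMap.mk₂ ℂ (pairMinus u)
    (fun x y z => by simp [pairMinus, add_mul, Finset.sum_add_distrib])
    (fun c x y => by
      simp only [pairMinus, Pi.smul_apply, smul_mul_assoc, Finset.smul_sum, smul_comm c])
    (fun x y z => by simp [pairMinus, mul_add, Finset.sum_add_distrib])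
    (fun c x y => by
      simp only [pairMinus, Pi.smul_apply, mul_smul_comm, Finset.smul_sum, smul_comm c])

omit [StarModule ℂ A] [DGStarAlgebra Ω] in
theorem pairMinusHom_apply (x y : u.ι → Ω) : pairMinusHom u x y = pairMinus u x y := rfl

theorem pairMinus_mem_gr {m n : ℕ} {x y : u.ι → Ω} (hx : ∀ i, x i ∈ gr Ω m)
    (hy : ∀ i, y i ∈ gr Ω n) : pairMinus u x y ∈ gr Ω (m + n) :=
  sum_mem fun i _ => sum_mem fun j _ => Submodule.smul_mem _ _ (mul_mem_gr (hx i) (hy j))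

theorem pairPlus_mem_gr {m n : ℕ} {x y : u.ι → Ω} (hx : ∀ i, x i ∈ gr Ω m)
    (hy : ∀ i, y i ∈ gr Ω n) : pairPlus u x y ∈ gr Ω (m + n) :=
  sum_mem fun i _ => mul_mem_gr (hx i) (hy i)

namespace DualFamily

variable (E : S.DualFamily u K)

/-- The duality relation alone gives this expansion, for arbitrary tuples of forms. For `x` in `H u`
the coefficients lie on the base, so `μ_k` generate `H u` as a left module. -/
theorem expand (x : u.ι → Ω) : x = ∑ k, fun j => pairPlus u x (E.ν k) * E.μ k j := by
  funext j
  rw [Finset.sum_apply]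
  simp only [pairPlus, Finset.sum_mul, mul_assoc]
  rw [Finset.sum_comm]
  simp [← Finset.mul_sum, E.sum_mul]

theorem expand_dual (y : u.ι → Ω) : y = ∑ k, fun i => E.ν k i * pairPlus u (E.μ k) y := by
  funext j
  rw [Finset.sum_apply]
  simp only [pairPlus, Finset.mul_sum, ← mul_assoc]
  rw [Finset.sum_comm]
  simp [← Finset.sum_mul, E.sum_mul]

/-- The trace of an operator along a dual family. -/
def tr (T : (u.ι → Ω) → (u.ι → Ω)) : Ω := ∑ k, pairMinus u (E.ν k) (T (E.μ k))

/-- The dual family given by a list. -/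
def ofList {L : List ((u.ι → Ω) × (u.ι → Ω))} (h : S.IsDualFamily u L) :
    S.DualFamily u (Fin L.length) where
  ν k := L[k].1
  μ k := L[k].2
  ν_mem k := (h.1 _ (List.getElem_mem k.2)).1
  ν_gr k := (h.1 _ (List.getElem_mem k.2)).2.1
  μ_mem k := (h.1 _ (List.getElem_mem k.2)).2.2.1
  μ_gr k := (h.1 _ (List.getElem_mem k.2)).2.2.2
  sum_mul i j := by
    rw [← h.2 i j]
    exact Fin.sum_univ_fun_getElem L fun p => p.1 i * p.2 j

theorem tr_ofList {L : List ((u.ι → Ω) × (u.ι → Ω))} (h : S.IsDualFamily u L)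
    (T : (u.ι → Ω) → (u.ι → Ω)) : (ofList h).tr T = traceAlong u L T :=
  Fin.sum_univ_fun_getElem L fun p => pairMinus u p.1 (T p.2)

include E in
theorem exists_isDualFamily : ∃ L, S.IsDualFamily u L := by
  refine ⟨(Finset.univ : Finset K).toList.map fun k => (E.ν k, E.μ k), ?_, ?_⟩
  · intro p hp
    obtain ⟨k, _, rfl⟩ := List.mem_map.1 hp
    exact ⟨E.ν_mem k, E.ν_gr k, E.μ_mem k, E.μ_gr k⟩
  · intro i j
    rw [List.map_map, ← E.sum_mul i j]
    exact Finset.sum_map_toList _ _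

/-- Expand each `μ_k` of one family in the other. The coefficients lie in `V`, pass through `T` and
then through the pairing, and recombine on the left by `expand_dual`. -/
theorem tr_eq_tr {K' : Type} [Fintype K'] (E' : S.DualFamily u K') {T : (u.ι → Ω) → (u.ι → Ω)}
    (hT : S.IsLeftLinear u T) : E.tr T = E'.tr T := by
  -- Additivity of `T` is available only inside `E_u`. The induction runs over nonempty sets; the
  -- empty case rests on `T 0 = 0`, obtained separately.
  have hsum : ∀ (s : Finset K') (x : K' → u.ι → Ω), (∀ k, x k ∈ S.H u) →
      (∀ k i, x k i ∈ gr Ω 0) → s.Nonempty → T (∑ k ∈ s, x k) = ∑ k ∈ s, T (x k) := by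
    intro s x h1 h2 hs
    induction hs using Finset.Nonempty.cons_induction with
    | singleton a => simp
    | cons a s ha hs ih =>
      rw [Finset.sum_cons, Finset.sum_cons, hT.1 _ _ (h1 a) (h2 a) (sum_mem fun k _ => h1 k) _, ih]
      intro i; rw [Finset.sum_apply]; exact sum_mem fun k _ => h2 k i
  have hbase : ∀ k l, ∃ f, pairPlus u (E.μ k) (E'.ν l) = S.incl (P.i f) := fun k l =>
    S.mem_base_zero_iff.1 ⟨pairPlus_mem_base u (E.μ_mem k) (E'.ν_mem l),
      pairPlus_mem_gr (E.μ_gr k) (E'.ν_gr l)⟩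
  choose f hf using hbase
  have hT0 : T 0 = 0 := by
    have := hT.1 0 0 (zero_mem _) (by simp) (zero_mem _) (by simp)
    simpa using this
  have e1 : ∀ k, T (E.μ k) = ∑ l, fun i => pairPlus u (E.μ k) (E'.ν l) * T (E'.μ l) i := by
    intro k
    conv_lhs => rw [E'.expand (E.μ k)]
    have hmem : ∀ l, (fun j => pairPlus u (E.μ k) (E'.ν l) * E'.μ l j) ∈ S.H u := fun l =>
      base_mul_mem_intertwiners (pairPlus_mem_base u (E.μ_mem k) (E'.ν_mem l)) (E'.μ_mem l)
    rcases (Finset.univ : Finset K').eq_empty_or_nonempty with h0 | hne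
    · simp [h0, hT0]
    · rw [hsum _ _ hmem _ hne]
      · refine Finset.sum_congr rfl fun l _ => ?_
        simp only [hf]
        exact hT.2 _ _ (E'.μ_mem l) (E'.μ_gr l)
      · intro l i
        exact mul_mem_gr (m := 0) (n := 0) (pairPlus_mem_gr (E.μ_gr k) (E'.ν_gr l)) (E'.μ_gr l i)
  simp only [tr, e1]
  simp only [← pairMinusHom_apply, map_sum]
  simp only [pairMinusHom_apply, ← pairMinus_mul_middle]
  rw [Finset.sum_comm]
  refine Finset.sum_congr rfl fun l _ => ?_
  conv_rhs => rw [E.expand_dual (E'.ν l)]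
  simp only [← pairMinusHom_apply, map_sum, LinearMap.sum_apply]

end DualFamily

variable (S)

theorem exists_isDualFamily (hA : IsCompactMatrixQuantumGroup A) (u : UnitaryRep A) :
    ∃ L, S.IsDualFamily u L := by
  obtain ⟨K, _, ⟨E⟩⟩ := S.exists_dualFamily hA u
  exact E.exists_isDualFamily

theorem trM_eq_tr (E : S.DualFamily u K) {T : (u.ι → Ω) → (u.ι → Ω)}
    (hT : S.IsLeftLinear u T) : S.trM u T = E.tr T := by
  have h := E.exists_isDualFamily
  rw [trM, dif_pos h, ← DualFamily.tr_ofList h.choose_spec]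
  exact DualFamily.tr_eq_tr _ _ hT

theorem trM_eq_traceAlong {L : List ((u.ι → Ω) × (u.ι → Ω))} (hL : S.IsDualFamily u L)
    {T : (u.ι → Ω) → (u.ι → Ω)} (hT : S.IsLeftLinear u T) :
    S.trM u T = traceAlong u L T := by
  rw [S.trM_eq_tr (DualFamily.ofList hL) hT, DualFamily.tr_ofList]

end Pairing

end BundleCalculus

/-! ### The adjoint action and `π` on matrix coefficients -/

theorem IsCorep.ad_apply {A : Type*} [Ring A] [StarRing A] [HopfAlgebra ℂ A] {ι : Type} [Fintype ι]
    [DecidableEq ι] {w : Matrix ι ι A} (hw : IsCorep w) (i j : ι) :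
    ad A (w i j) = ∑ p, ∑ q, w p q ⊗ₜ[ℂ] (HopfAlgebra.antipode ℂ (w i p) * w q j) := by
  simp only [ad, LinearMap.comp_apply, hw.comul, map_sum, TensorProduct.map_tmul,
    LinearMap.id_apply, TensorProduct.tmul_sum, LinearEquiv.coe_coe,
    TensorProduct.leftComm_tmul, LinearMap.mul'_apply]

section

variable {A : Type*} [Ring A] [StarRing A] [HopfAlgebra ℂ A] {Γ : Type*} [Ring Γ]
  [Algebra ℂ Γ] [DGStarAlgebra Γ] (G : GroupCalculus A Γ)

theorem GroupCalculus.piMap_one : G.piMap 1 = 0 := by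
  simp only [GroupCalculus.piMap, LinearMap.comp_apply, Bialgebra.comul_one,
    Algebra.TensorProduct.one_def, TensorProduct.map_tmul, LinearMap.mul'_apply]
  simp [dif_one]

theorem GroupCalculus.piInv_one : G.piInv 1 = 0 := Subtype.ext G.piMap_one

theorem IsCorep.piMap_apply {ι : Type} [Fintype ι] [DecidableEq ι] {w : Matrix ι ι A}
    (hw : IsCorep w) (i j : ι) : G.piMap (w i j) =
      ∑ p, G.incl (HopfAlgebra.antipode ℂ (w i p)) * dif (G.incl (w p j)) := by
  simp [GroupCalculus.piMap, hw.comul]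

/-- This is the Maurer–Cartan relation `w π(w) = dw`: the factors `w κ(w)` cancel. -/
theorem IsCorep.sum_mul_piMap {ι : Type} [Fintype ι] [DecidableEq ι] {w : Matrix ι ι A}
    (hw : IsCorep w) (k j : ι) :
    ∑ i, G.incl (w k i) * G.piMap (w i j) = dif (G.incl (w k j)) := by
  simp only [hw.piMap_apply, Finset.mul_sum, ← mul_assoc, ← map_mul]
  rw [Finset.sum_comm]
  simp only [← Finset.sum_mul, ← map_sum, hw.sum_mul_antipode]
  simp [apply_ite G.incl]

theorem GroupCalculus.piMap_mem_gr (a : A) : G.piMap a ∈ gr Γ 1 := by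
  simp only [GroupCalculus.piMap, LinearMap.comp_apply]
  induction Coalgebra.comul (R := ℂ) a with
  | zero => simp
  | add s t hs ht => simp only [map_add]; exact add_mem hs ht
  | tmul b c => exact mul_mem_gr (m := 0) (n := 1) (G.incl_mem _) (dif_mem (G.incl_mem _))

end

/-! ### Connections and covariant derivatives -/

namespace BundleCalculus

variable {A : Type*} [Ring A] [StarRing A] [HopfAlgebra ℂ A] [StarModule ℂ A]
  {Γ : Type*} [Ring Γ] [Algebra ℂ Γ] [DGStarAlgebra Γ] {G : GroupCalculus A Γ}
  {V : Type*} [Ring V] [StarRing V] [Algebra ℂ V] [StarModule ℂ V]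
  {B : Type*} [Ring B] [StarRing B] [Algebra ℂ B] [StarModule ℂ B] {P : Bundle A V B}
  {Ω : Type*} [Ring Ω] [Algebra ℂ Ω] [DGStarAlgebra Ω] {S : BundleCalculus G P Ω}

namespace Connection

variable (ω : S.Connection)

/-- The composition of a connection with the projection `π`. -/
def ωπ : A →ₗ[ℂ] Ω := ω.ω ∘ₗ G.piInv

theorem ωπ_apply (a : A) : ω.ωπ a = ω.ω (G.piInv a) := rfl

theorem ωπ_one : ω.ωπ 1 = 0 := by rw [ωπ_apply, G.piInv_one, map_zero]

theorem mulRight_tmul (g : A →ₗ[ℂ] Ω) (x : Ω) (a : A) : mulRight g (x ⊗ₜ a) = x * g a := by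
  simp [mulRight]

variable {ι : Type} [Fintype ι] {w : Matrix ι ι A}

theorem D_apply_of_mem {φ : ι → Ω} (h : φ ∈ S.intertwiners w) {n : ℕ} (hn : ∀ i, φ i ∈ gr Ω n)
    (j : ι) : ω.D (φ j) = dif (φ j) - (-1 : ℂ) ^ n • ∑ i, φ i * ω.ωπ (w i j) := by
  simp only [D, LinearMap.sub_apply, LinearMap.comp_apply, parity_of_mem (hn j), map_smul,
    (h j).2, map_sum, mulRight_tmul]
  rfl

theorem D_mem_gr {n : ℕ} {x : Ω} (hx : x ∈ gr Ω n) : ω.D x ∈ gr Ω (n + 1) := by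
  simp only [D, LinearMap.sub_apply, LinearMap.comp_apply]
  refine sub_mem (dif_mem hx) ?_
  rw [← grProj_of_mem (parity_mem hx), Fwedge_grProj]
  induction S.Fwedge (parity x) with
  | zero => simp
  | add s t hs ht => simp only [map_add]; exact add_mem hs ht
  | tmul b c =>
    rw [TensorProduct.map_tmul, mulRight_tmul]
    exact mul_mem_gr (grProj_mem n b) (ω.mem_gr _)

theorem D_parity (x : Ω) : ω.D (parity x) = - parity (ω.D x) := by
  induction x using gr_induction with
  | hom n x hx => rw [parity_of_mem hx, parity_of_mem (ω.D_mem_gr hx), map_smul, pow_succ]; simp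
  | add x z hx hz => rw [map_add, map_add, map_add, map_add, hx, hz]; abel

theorem D_of_mem_base {α : Ω} (hα : α ∈ S.base) : ω.D α = dif α := by
  have h : S.Fwedge (parity α) = parity α ⊗ₜ 1 := (S.mem_base_iff.1 (S.parity_mem_base hα)).2
  have h1 := ω.ωπ_one
  rw [ωπ] at h1
  simp only [D, LinearMap.sub_apply, LinearMap.comp_apply, h, mulRight_tmul] at *
  rw [h1]; simp

variable [DecidableEq ι]

/-- Multiplication by `w` on the left cancels the `κ(w)` of the adjoint action and turns the
inhomogeneous term into `dw`. -/
theorem sum_mul_toTensor_ωπ (hw : IsCorep w) (k j : ι) :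
    ∑ i, ((1 : Ω) ⊗ₜ[ℂ] G.incl (w k i)) * toTensor S.FHat (ω.ωπ (w i j)) =
      ∑ q, ω.ωπ (w k q) ⊗ₜ G.incl (w q j) + 1 ⊗ₜ dif (G.incl (w k j)) := by
  have e1 : ∀ i, toTensor S.FHat (ω.ωπ (w i j)) =
      ∑ p, ∑ q, ω.ωπ (w p q) ⊗ₜ G.incl (HopfAlgebra.antipode ℂ (w i p) * w q j) +
        1 ⊗ₜ G.piMap (w i j) := by
    intro i
    rw [ωπ_apply, ω.FHat_ω, hw.ad_apply]
    simp only [map_sum, TensorProduct.map_tmul]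
    rfl
  simp only [e1, mul_add, Finset.sum_add_distrib, Finset.mul_sum,
    Algebra.TensorProduct.tmul_mul_tmul, one_mul, ← map_mul, ← mul_assoc]
  congr 1
  · rw [Finset.sum_comm]
    have e2 : ∀ p, ∑ i, ∑ q, ω.ωπ (w p q) ⊗ₜ[ℂ]
        G.incl (w k i * HopfAlgebra.antipode ℂ (w i p) * w q j) =
        if k = p then ∑ q, ω.ωπ (w p q) ⊗ₜ[ℂ] G.incl (w q j) else 0 := by
      intro p
      rw [Finset.sum_comm]
      simp only [← TensorProduct.tmul_sum, ← map_sum, ← Finset.sum_mul, hw.sum_mul_antipode]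
      split_ifs <;> simp
    simp only [e2]
    simp
  · rw [← TensorProduct.tmul_sum, hw.sum_mul_piMap]

/-- The covariant derivative preserves spaces of intertwiners. -/
theorem D_mem_intertwiners (hw : IsCorep w) {φ : ι → Ω} (h : φ ∈ S.intertwiners w) :
    (fun j => ω.D (φ j)) ∈ S.intertwiners w := by
  refine intertwiners_induction (p := fun φ => (fun j => ω.D (φ j)) ∈ S.intertwiners w) h ?_ ?_ ?_
  · intro n φ h hn
    refine S.mem_intertwiners_of_toTensor fun j => ?_
    have e1 : toTensor S.FHat (dif (φ j)) = ∑ k, (dif (φ k) ⊗ₜ G.incl (w k j) +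
        (-1 : ℂ) ^ n • (φ k ⊗ₜ dif (G.incl (w k j)))) := by
      rw [S.FHat_d, toTensor_of_mem h, map_sum]
      exact Finset.sum_congr rfl fun k _ => tensorDif_tmul (hn k) _
    have e2 : ∑ i, toTensor S.FHat (φ i * ω.ωπ (w i j)) =
        ∑ k, (∑ q, (φ k * ω.ωπ (w k q)) ⊗ₜ G.incl (w q j) + φ k ⊗ₜ dif (G.incl (w k j))) := by
      simp only [S.toTensor_mul (h _).1, toTensor_of_mem h, Finset.sum_mul]
      rw [Finset.sum_comm]
      refine Finset.sum_congr rfl fun k _ => ?_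
      have e3 := congrArg (fun t => (φ k ⊗ₜ[ℂ] (1 : Γ)) * t) (ω.sum_mul_toTensor_ωπ hw k j)
      simp only [Finset.mul_sum, mul_add, ← mul_assoc, Algebra.TensorProduct.tmul_mul_tmul,
        one_mul, mul_one] at e3
      exact e3
    -- The terms `φ ⊗ dw` coming from `d` and from the connection cancel; only covariant terms of
    -- degree 0 in `Γ` remain.
    simp only [ω.D_apply_of_mem h hn, map_sub, map_smul, map_sum, e1, e2]
    simp only [Finset.sum_add_distrib, smul_add, TensorProduct.sub_tmul, Finset.sum_sub_distrib,
      TensorProduct.sum_tmul, ← TensorProduct.smul_tmul', Finset.smul_sum]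
    rw [Finset.sum_comm (f := fun k q => (-1 : ℂ) ^ n • (φ k * ω.ωπ (w k q)) ⊗ₜ[ℂ] G.incl (w q j))]
    abel
  · simp only [Pi.zero_apply, map_zero]; exact zero_mem _
  · intro ψ ψ' hψ hψ'
    simp only [Pi.add_apply, map_add]; exact add_mem hψ hψ'

omit [DecidableEq ι]

variable (hA : IsCompactMatrixQuantumGroup A)

include hA

theorem D_mem_hor {x : Ω} (hx : x ∈ S.hor) : ω.D x ∈ S.hor := by
  refine S.hor_induction (p := fun x => ω.D x ∈ S.hor) hA hx ?_ (by simp) ?_ ?_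
  · intro u φ n h _ j
    exact (ω.D_mem_intertwiners u.isCorep h j).1
  · intro y z hy hz; rw [map_add]; exact add_mem hy hz
  · intro c y hy; rw [map_smul]; exact Submodule.smul_mem _ _ hy

theorem dif_sub_D_mem_vertOne {x : Ω} (hx : x ∈ S.hor) : dif x - ω.D x ∈ ω.vertOne := by
  refine S.hor_induction (p := fun x => dif x - ω.D x ∈ ω.vertOne) hA hx ?_ (by simp) ?_ ?_
  · intro u φ n h hn j
    rw [ω.D_apply_of_mem h hn, sub_sub_cancel]
    exact Submodule.smul_mem _ _ (sum_mem fun i _ => Submodule.mul_mem_mul (h i).1 ⟨_, rfl⟩)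
  · intro y z hy hz; rw [map_add, map_add, add_sub_add_comm]; exact add_mem hy hz
  · intro c y hy; rw [map_smul, map_smul, ← smul_sub]; exact Submodule.smul_mem _ _ hy

/-- The covariant derivative of a regular connection is a graded derivation on horizontal
forms. -/
theorem D_mul (hω : ω.IsRegular) {x y : Ω} (hx : x ∈ S.hor) (hy : y ∈ S.hor) :
    ω.D (x * y) = ω.D x * y + parity x * ω.D y := by
  refine S.hor_induction (p := fun x => ω.D (x * y) = ω.D x * y + parity x * ω.D y) hA hx
    ?_ (by simp) ?_ ?_
  · intro u φ n h hn j
    refine S.hor_induction (p := fun y => ω.D (φ j * y) = ω.D (φ j) * y + parity (φ j) * ω.D y)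
      hA hy ?_ (by simp) ?_ ?_
    · intro v ψ m h' hm l
      -- By `π(a) ∘ c = π(a c) - ε(a) π(c)`, moving the connection form across `ψ` produces the
      -- connection term of the product and a counit correction. The latter is exactly the
      -- connection term of `D ψ`.
      have hreg : ∀ i, ω.ωπ (u.mat i j) * ψ l = (-1 : ℂ) ^ m • ∑ k, ψ k *
          (ω.ωπ (u.mat i j * v.mat k l) - (if i = j then 1 else 0 : ℂ) • ω.ωπ (v.mat k l)) := by
        intro i
        rw [ωπ_apply, hω (u.mat i j) m (ψ l) (h' l).1 (hm l), (h' l).2]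
        simp only [map_sum, mulRight_tmul, LinearMap.comp_apply, LinearMap.sub_apply,
          LinearMap.mulLeft_apply, LinearMap.smul_apply, LinearMap.id_apply, u.counit_mat,
          map_sub, map_smul, ωπ_apply]
      have hprod := ω.D_apply_of_mem (φ := fun i : u.ι × v.ι => φ i.1 * ψ i.2)
        (w := fun i j : u.ι × v.ι => u.mat i.1 j.1 * v.mat i.2 j.2) (n := n + m)
        (mul_mem_intertwiners h h' fun _ _ => rfl) (fun i => mul_mem_gr (hn _) (hm _)) (j, l)
      simp only at hprod
      rw [hprod, ω.D_apply_of_mem h hn, ω.D_apply_of_mem h' hm, parity_of_mem (hn j),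
        leibniz (hn j), sub_mul, smul_mul_assoc, Finset.sum_mul]
      simp only [mul_assoc, hreg, Fintype.sum_prod_type]
      have e1 : ∑ i, φ i * ((-1 : ℂ) ^ m • ∑ k, ψ k *
          (ω.ωπ (u.mat i j * v.mat k l) - (if i = j then 1 else 0 : ℂ) • ω.ωπ (v.mat k l))) =
          (-1 : ℂ) ^ m • (∑ i, ∑ k, φ i * (ψ k * ω.ωπ (u.mat i j * v.mat k l)) -
            φ j * ∑ k, ψ k * ω.ωπ (v.mat k l)) := by
        simp only [mul_sub, Finset.sum_sub_distrib, mul_smul_comm, smul_sub, Finset.mul_sum,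
          Finset.smul_sum, ite_smul, one_smul, zero_smul, mul_ite, mul_zero]
        congr 1
        rw [Finset.sum_comm]
        simp
      rw [e1, pow_add]
      simp only [smul_sub, mul_sub, mul_smul_comm, smul_mul_assoc, smul_smul,
        mul_comm ((-1 : ℂ) ^ m)]
      abel
    · intro y z hy hz
      rw [mul_add, map_add, map_add, mul_add, mul_add, hy, hz]; abel
    · intro c y hy
      rw [mul_smul_comm, map_smul, map_smul, mul_smul_comm, mul_smul_comm, hy, smul_add]
  · intro x z hx hz
    rw [add_mul, map_add, map_add, map_add, add_mul, add_mul, hx, hz]; abel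
  · intro c x hx
    rw [smul_mul_assoc, map_smul, map_smul, map_smul, smul_mul_assoc, smul_mul_assoc, hx, smul_add]

omit hA

variable (S) in
/-- The map `φ ⊗ ϑ ↦ ∑ k, φ_k ⊗ c_k ϑ`, where `F^∧(φ) = ∑ k, φ_k ⊗ c_k`. -/
def twistMap (g : A →ₗ[ℂ] A) : Ω ⊗[ℂ] Γ →ₗ[ℂ] Ω ⊗[ℂ] Γ :=
  TensorProduct.map LinearMap.id (LinearMap.mul' ℂ Γ ∘ₗ
      TensorProduct.map (G.incl.toLinearMap ∘ₗ g) LinearMap.id) ∘ₗ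
    (TensorProduct.assoc ℂ Ω A Γ).toLinearMap ∘ₗ TensorProduct.map S.Fwedge LinearMap.id

theorem twistMap_tmul (g : A →ₗ[ℂ] A) (φ : Ω) (ϑ : Γ) : twistMap S g (φ ⊗ₜ ϑ) =
    TensorProduct.map LinearMap.id (LinearMap.mulRight ℂ ϑ ∘ₗ G.incl.toLinearMap ∘ₗ g)
      (S.Fwedge φ) := by
  simp only [twistMap, LinearMap.comp_apply, TensorProduct.map_tmul, LinearEquiv.coe_coe,
    LinearMap.id_apply]
  induction S.Fwedge φ with
  | zero => simp
  | add s t hs ht => simp only [map_add, TensorProduct.add_tmul, hs, ht]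
  | tmul b c => simp

/-- The antipode cancels consecutive legs of the coaction. So the twist by the identity is
injective. -/
theorem twistMap_twistMap (t : Ω ⊗[ℂ] Γ) :
    twistMap S (HopfAlgebra.antipode ℂ) (twistMap S LinearMap.id t) = t := by
  induction t with
  | zero => simp
  | add s t hs ht => simp only [map_add, hs, ht]
  | tmul φ ϑ =>
    let κm : A ⊗[ℂ] A →ₗ[ℂ] A :=
      LinearMap.mul' ℂ A ∘ₗ TensorProduct.map (HopfAlgebra.antipode ℂ) LinearMap.id
    have e : κm ∘ₗ Coalgebra.comul = Algebra.linearMap ℂ A ∘ₗ Coalgebra.counit :=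
      HopfAlgebra.mul_antipode_rTensor_comul
    have e1 : ∀ s : Ω ⊗[ℂ] A, twistMap S (HopfAlgebra.antipode ℂ) (TensorProduct.map LinearMap.id
        (LinearMap.mulRight ℂ ϑ ∘ₗ G.incl.toLinearMap ∘ₗ LinearMap.id) s) =
        TensorProduct.map LinearMap.id (LinearMap.mulRight ℂ ϑ ∘ₗ G.incl.toLinearMap ∘ₗ κm)
          (TensorProduct.assoc ℂ Ω A A (TensorProduct.map S.Fwedge LinearMap.id s)) := by
      intro s
      induction s with
      | zero => simp
      | add s t hs ht => simp only [map_add, hs, ht]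
      | tmul w a =>
        simp only [TensorProduct.map_tmul, twistMap_tmul, LinearMap.id_apply]
        induction S.Fwedge w with
        | zero => simp
        | add s t hs ht => simp only [map_add, TensorProduct.add_tmul, hs, ht]
        | tmul b c => simp [κm, mul_assoc]
    rw [twistMap_tmul, e1, Fwedge_coassoc, ← LinearMap.comp_apply, ← TensorProduct.map_comp,
      LinearMap.comp_assoc, LinearMap.comp_assoc, e]
    conv_rhs => rw [← S.Fwedge_counit φ]
    induction S.Fwedge φ with
    | zero => simp
    | add s t hs ht => simp only [map_add, TensorProduct.add_tmul, hs, ht]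
    | tmul b c => simp [Algebra.algebraMap_eq_smul_one, TensorProduct.smul_tmul']

/-- The part of `F^(∑ φ ω(ϑ))` of degree 1 in `Γ` is the twist of `∑ φ ⊗ ϑ`. A horizontal form has
no such part, and the twist is injective, so the tensor itself vanishes. -/
theorem disjoint_hor_vertOne : Disjoint S.hor ω.vertOne := by
  rw [Submodule.disjoint_def]
  intro x hx hv
  -- The tensor `y` is carried along with `x`, because the argument shows that `y`, and not merely
  -- its image in `Ω`, is zero.
  have key : ∃ y : Ω ⊗[ℂ] G.inv, x = LinearMap.mul' ℂ Ω (TensorProduct.map LinearMap.id ω.ω y) ∧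
      TensorProduct.map LinearMap.id (grProj 1) (toTensor S.FHat x) =
        twistMap S LinearMap.id (TensorProduct.map LinearMap.id G.inv.subtype y) := by
    refine Submodule.mul_induction_on hv ?_ ?_
    · rintro φ hφ _ ⟨ϑ, rfl⟩
      refine ⟨φ ⊗ₜ ϑ, by simp, ?_⟩
      obtain ⟨_, a, rfl⟩ := ϑ
      have e : toTensor S.FHat (ω.ω (G.piInv a)) = TensorProduct.map (ω.ω ∘ₗ G.piInv)
        G.incl.toLinearMap (ad A a) + 1 ⊗ₜ (G.piInv a : Γ) := ω.FHat_ω a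
      change TensorProduct.map LinearMap.id (grProj 1)
        (toTensor S.FHat (φ * ω.ω (G.piInv a))) =
        twistMap S LinearMap.id (TensorProduct.map LinearMap.id G.inv.subtype (φ ⊗ₜ G.piInv a))
      rw [S.toTensor_mul hφ, S.mem_hor_iff.1 hφ, e, TensorProduct.map_tmul, twistMap_tmul,
        mul_add, map_add]
      have e1 : ∀ (s t : Ω ⊗[ℂ] A), TensorProduct.map LinearMap.id (grProj 1)
          (TensorProduct.map (LinearMap.id : Ω →ₗ[ℂ] Ω) G.incl.toLinearMap s *
            TensorProduct.map LinearMap.id G.incl.toLinearMap t) = 0 := by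
        intro s t
        rw [← map_incl_mul, ← LinearMap.comp_apply, ← TensorProduct.map_comp]
        have : grProj 1 ∘ₗ G.incl.toLinearMap = 0 :=
          LinearMap.ext fun a => grProj_of_mem_ne (G.incl_mem a) (by omega)
        rw [this, TensorProduct.map_zero_right]; rfl
      have e2 : TensorProduct.map (ω.ω ∘ₗ G.piInv) G.incl.toLinearMap (ad A a) =
          TensorProduct.map LinearMap.id G.incl.toLinearMap
            (TensorProduct.map (ω.ω ∘ₗ G.piInv) LinearMap.id (ad A a)) := by
        conv_rhs => rw [← LinearMap.comp_apply, ← TensorProduct.map_comp]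
        rfl
      rw [e2, e1, zero_add]
      induction S.Fwedge φ with
      | zero => simp
      | add s t hs ht => simp only [map_add, add_mul, hs, ht]
      | tmul b c =>
        simp only [TensorProduct.map_tmul, LinearMap.id_apply, Algebra.TensorProduct.tmul_mul_tmul,
          mul_one, AlgHom.toLinearMap_apply, LinearMap.comp_apply, LinearMap.mulRight_apply,
          Submodule.subtype_apply]
        rw [grProj_of_mem]
        exact mul_mem_gr (m := 0) (n := 1) (G.incl_mem c) (G.piMap_mem_gr a)
    · rintro x z ⟨y, h1, h2⟩ ⟨y', h1', h2'⟩
      exact ⟨y + y', by simp only [map_add, ← h1, ← h1'], by simp only [map_add, h2, h2']⟩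
  obtain ⟨y, h1, h2⟩ := key
  have h3 : TensorProduct.map LinearMap.id (grProj 1) (toTensor S.FHat x) = 0 := by
    rw [S.mem_hor_iff.1 hx, ← LinearMap.comp_apply, ← TensorProduct.map_comp]
    have : grProj 1 ∘ₗ G.incl.toLinearMap = 0 :=
      LinearMap.ext fun a => grProj_of_mem_ne (G.incl_mem a) (by omega)
    rw [this, TensorProduct.map_zero_right]; rfl
  have h4 := congrArg (twistMap S (HopfAlgebra.antipode ℂ)) h2
  rw [twistMap_twistMap, h3, map_zero] at h4
  have inj : Function.Injective (TensorProduct.map (LinearMap.id : Ω →ₗ[ℂ] Ω) G.inv.subtype) :=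
    Module.Flat.lTensor_preserves_injective_linearMap (M := Ω) G.inv.subtype
      (Submodule.subtype_injective _)
  have h5 : y = 0 := inj (by rw [← h4, map_zero])
  rw [h1, h5]; simp

end Connection

end BundleCalculus

/-! ### Bimodules, their graded endomorphisms and traces -/

namespace BundleCalculus

variable {A : Type*} [Ring A] [StarRing A] [HopfAlgebra ℂ A] [StarModule ℂ A]
  {Γ : Type*} [Ring Γ] [Algebra ℂ Γ] [DGStarAlgebra Γ] {G : GroupCalculus A Γ}
  {V : Type*} [Ring V] [StarRing V] [Algebra ℂ V] [StarModule ℂ V]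
  {B : Type*} [Ring B] [StarRing B] [Algebra ℂ B] [StarModule ℂ B] {P : Bundle A V B}
  {Ω : Type*} [Ring Ω] [Algebra ℂ Ω] [DGStarAlgebra Ω] (S : BundleCalculus G P Ω)

instance instAddCommGroupH (u : UnitaryRep A) : AddCommGroup (S.H u) := Submodule.addCommGroup _

/-- The differential of forms on the base. -/
def baseDif : S.base →ₗ[ℂ] S.base := dif.restrict fun _ => S.dif_mem_base

theorem baseDif_baseDif (α : S.base) : S.baseDif (S.baseDif α) = 0 := Subtype.ext (dif_dif _)

variable (u : UnitaryRep A)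

/-- The left multiplication by forms on the base. -/
def lmul : S.base →ₗ[ℂ] Module.End ℂ (S.H u) :=
  LinearMap.mk₂ ℂ (fun α x => ⟨fun i => α * x.1 i, base_mul_mem_intertwiners α.2 x.2⟩)
    (fun _ _ _ => Subtype.ext (funext fun _ => add_mul _ _ _))
    (fun _ _ _ => Subtype.ext (funext fun _ => smul_mul_assoc _ _ _))
    (fun _ _ _ => Subtype.ext (funext fun _ => mul_add _ _ _))
    (fun _ _ _ => Subtype.ext (funext fun _ => mul_smul_comm _ _ _))

/-- The right multiplication by forms on the base. -/
def rmul : S.base →ₗ[ℂ] Module.End ℂ (S.H u) :=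
  LinearMap.mk₂ ℂ (fun α x => ⟨fun i => x.1 i * α, mul_base_mem_intertwiners α.2 x.2⟩)
    (fun _ _ _ => Subtype.ext (funext fun _ => mul_add _ _ _))
    (fun _ _ _ => Subtype.ext (funext fun _ => mul_smul_comm _ _ _))
    (fun _ _ _ => Subtype.ext (funext fun _ => add_mul _ _ _))
    (fun _ _ _ => Subtype.ext (funext fun _ => smul_mul_assoc _ _ _))

theorem parity_mem_intertwiners {ι : Type} [Fintype ι] {w : Matrix ι ι A} {φ : ι → Ω}
    (h : φ ∈ S.intertwiners w) : (fun i => parity (φ i)) ∈ S.intertwiners w := by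
  refine intertwiners_induction (p := fun φ => (fun i => parity (φ i)) ∈ S.intertwiners w) h
    ?_ ?_ ?_
  · intro n ψ hψ hn
    have : (fun i => parity (ψ i)) = (-1 : ℂ) ^ n • ψ := funext fun i => parity_of_mem (hn i)
    rw [this]; exact Submodule.smul_mem _ _ hψ
  · simp only [Pi.zero_apply, map_zero]; exact zero_mem _
  · intro ψ ψ' hψ hψ'; simp only [Pi.add_apply, map_add]; exact add_mem hψ hψ'

/-- The parity operator on a bimodule of vector bundle valued forms. -/
def parityH : Module.End ℂ (S.H u) where
  toFun x := ⟨fun i => parity (x.1 i), S.parity_mem_intertwiners x.2⟩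
  map_add' _ _ := Subtype.ext (funext fun _ => map_add _ _ _)
  map_smul' _ _ := Subtype.ext (funext fun _ => map_smul _ _ _)

variable {S u}

theorem H_induction {p : S.H u → Prop} (x : S.H u)
    (hom : ∀ n, ∀ y : S.H u, (∀ i, y.1 i ∈ gr Ω n) → p y) (zero : p 0)
    (add : ∀ y z, p y → p z → p (y + z)) : p x := by
  have : ∃ h : x.1 ∈ S.H u, p ⟨x.1, h⟩ := by
    refine intertwiners_induction (p := fun φ => ∃ h : φ ∈ S.H u, p ⟨φ, h⟩) x.2 ?_
      ⟨zero_mem _, zero⟩ ?_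
    · intro n ψ hψ hn; exact ⟨hψ, hom n _ hn⟩
    · rintro y z ⟨h, hy⟩ ⟨h', hz⟩; exact ⟨add_mem h h', add _ _ hy hz⟩
  exact this.2

/-- `T` is an endomorphism of graded `Ω(M)`-bimodules of degree `n`. -/
structure IsBimodEnd (n : ℕ) (T : Module.End ℂ (S.H u)) : Prop where
  degree : ∀ p (x : S.H u), (∀ i, x.1 i ∈ gr Ω p) → ∀ i, (T x).1 i ∈ gr Ω (p + n)
  left : ∀ p (α : S.base), (α : Ω) ∈ gr Ω p → ∀ x,
    T (S.lmul u α x) = (-1 : ℂ) ^ (n * p) • S.lmul u α (T x)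
  right : ∀ (α : S.base) x, T (S.rmul u α x) = S.rmul u α (T x)

namespace IsBimodEnd

variable {m n : ℕ} {T T' : Module.End ℂ (S.H u)}

theorem zero (n : ℕ) : IsBimodEnd n (0 : Module.End ℂ (S.H u)) where
  degree p x _ i := zero_mem _
  left p α _ x := by simp
  right α x := by simp

theorem one : IsBimodEnd 0 (1 : Module.End ℂ (S.H u)) where
  degree p x h i := h i
  left p α _ x := by simp
  right α x := by simp

theorem add (h : IsBimodEnd n T) (h' : IsBimodEnd n T') : IsBimodEnd n (T + T') where
  degree p x hx i := add_mem (h.degree p x hx i) (h'.degree p x hx i)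
  left p α hα x := by
    simp only [LinearMap.add_apply, h.left p α hα, h'.left p α hα, map_add, smul_add]
  right α x := by simp only [LinearMap.add_apply, h.right, h'.right, map_add]

theorem smul (c : ℂ) (h : IsBimodEnd n T) : IsBimodEnd n (c • T) where
  degree p x hx i := Submodule.smul_mem _ c (h.degree p x hx i)
  left p α hα x := by
    simp only [LinearMap.smul_apply, h.left p α hα, map_smul, smul_comm c]
  right α x := by simp only [LinearMap.smul_apply, h.right, map_smul]

theorem neg (h : IsBimodEnd n T) : IsBimodEnd n (-T) := by
  rw [← neg_one_smul ℂ T]; exact h.smul (-1)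

theorem sub (h : IsBimodEnd n T) (h' : IsBimodEnd n T') : IsBimodEnd n (T - T') := by
  rw [sub_eq_add_neg]; exact h.add h'.neg

theorem sum {K : Type*} (s : Finset K) {T : K → Module.End ℂ (S.H u)}
    (h : ∀ k ∈ s, IsBimodEnd n (T k)) : IsBimodEnd n (∑ k ∈ s, T k) :=
  Finset.sum_induction _ (IsBimodEnd n) (fun _ _ => add) (zero n) h

theorem mul (h : IsBimodEnd m T) (h' : IsBimodEnd n T') : IsBimodEnd (m + n) (T * T') where
  degree p x hx i := by
    have := h.degree _ _ (h'.degree p x hx) i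
    rwa [add_assoc, add_comm n m] at this
  left p α hα x := by
    rw [Module.End.mul_apply, Module.End.mul_apply, h'.left p α hα, map_smul, h.left p α hα,
      smul_smul, ← pow_add]
    congr 2; ring
  right α x := by rw [Module.End.mul_apply, Module.End.mul_apply, h'.right, h.right]

theorem pow (h : IsBimodEnd n T) (k : ℕ) : IsBimodEnd (n * k) (T ^ k) := by
  induction k with
  | zero => simpa using one
  | succ k ih => rw [pow_succ]; exact ih.mul h

end IsBimodEnd

theorem isBimodEnd_lmul {n : ℕ} {z : Ω} (hz : z ∈ S.center n) :
    IsBimodEnd n (S.lmul u ⟨z, hz.2.1⟩) where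
  degree p x hx i := by rw [add_comm]; exact mul_mem_gr hz.1 (hx i)
  left p α hα x := by
    refine Subtype.ext (funext fun i => ?_)
    have := hz.2.2 p α hα α.2
    change z * (α * x.1 i) = (-1 : ℂ) ^ (n * p) • (α * (z * x.1 i))
    rw [← mul_assoc, this, smul_mul_assoc, mul_assoc]
  right α x := Subtype.ext (funext fun i => (mul_assoc _ _ _).symm)

namespace DualFamily

variable {K : Type} [Fintype K] (E : S.DualFamily u K)

/-- The trace of an endomorphism. -/
def trH : Module.End ℂ (S.H u) →ₗ[ℂ] Ω :=
  ∑ k, pairMinusHom u (E.ν k) ∘ₗ (S.H u).subtype ∘ₗ LinearMap.applyₗ ⟨E.μ k, E.μ_mem k⟩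

theorem trH_apply (T : Module.End ℂ (S.H u)) :
    E.trH T = ∑ k, pairMinus u (E.ν k) (T ⟨E.μ k, E.μ_mem k⟩).1 := by
  simp only [trH, LinearMap.sum_apply]; rfl

/-- The elements `μ_k`. -/
abbrev m (k : K) : S.H u := ⟨E.μ k, E.μ_mem k⟩

theorem m_gr (k : K) (i : u.ι) : (E.m k).1 i ∈ gr Ω 0 := E.μ_gr k i

/-- The coefficients `⟨x, ν_k⟩⁺`. -/
def coef (x : S.H u) (k : K) : S.base :=
  ⟨pairPlus u x.1 (E.ν k), pairPlus_mem_base u x.2 (E.ν_mem k)⟩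

theorem expand_H (x : S.H u) : x = ∑ k, S.lmul u (E.coef x k) (E.m k) := by
  refine Subtype.ext ?_
  rw [AddSubmonoidClass.coe_finsetSum]
  exact E.expand x.1

theorem apply_eq_sum {n p : ℕ} {T : Module.End ℂ (S.H u)} (hT : IsBimodEnd n T) {x : S.H u}
    (hx : ∀ i, x.1 i ∈ gr Ω p) :
    T x = (-1 : ℂ) ^ (n * p) • ∑ l, S.lmul u (E.coef x l) (T (E.m l)) := by
  conv_lhs => rw [E.expand_H x]
  rw [map_sum, Finset.smul_sum]
  exact Finset.sum_congr rfl fun l _ => hT.left p _ (pairPlus_mem_gr hx (E.ν_gr l)) _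

/-- Expand every `x k` over the `μ_l`, pull the coefficients through `T` with a sign, and absorb
them in the left argument of the pairing. Centrality of the trace, the trace formula and invariance
of the trace all come from this. -/
theorem sum_pairMinus {n p : ℕ} {T : Module.End ℂ (S.H u)} (hT : IsBimodEnd n T) {L : Type*}
    [Fintype L] (x : L → S.H u) (hx : ∀ k i, (x k).1 i ∈ gr Ω p) (y : L → u.ι → Ω) :
    ∑ k, pairMinus u (y k) (T (x k)).1 = (-1 : ℂ) ^ (n * p) • ∑ l,
      pairMinus u (∑ k, fun i => y k i * pairPlus u (x k).1 (E.ν l)) (T (E.m l)).1 := by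
  have e : ∀ k, (T (x k)).1 = (-1 : ℂ) ^ (n * p) • ∑ l, fun i =>
      pairPlus u (x k).1 (E.ν l) * (T (E.m l)).1 i := by
    intro k
    rw [E.apply_eq_sum hT (hx k), Submodule.coe_smul, AddSubmonoidClass.coe_finsetSum]
    rfl
  simp only [e, ← pairMinusHom_apply, map_smul, map_sum, LinearMap.sum_apply, ← Finset.smul_sum]
  rw [Finset.sum_comm]
  simp only [pairMinusHom_apply, ← pairMinus_mul_middle]

/-- Evaluate `∑ ⟨ν_k, T(μ_k α)⟩⁻` twice. Right linearity gives `tr(T) α`; expanding `μ_k α` and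
recombining the left arguments into `α ν_l` gives `± α tr(T)`. -/
theorem trH_mem_center (hA : IsCompactMatrixQuantumGroup A) {n : ℕ} {T : Module.End ℂ (S.H u)}
    (hT : IsBimodEnd n T) : E.trH T ∈ S.center n := by
  refine ⟨?_, ?_, ?_⟩
  · rw [trH_apply]
    refine sum_mem fun k _ => ?_
    have := pairMinus_mem_gr (E.ν_gr k) (hT.degree 0 _ (E.m_gr k))
    simpa using this
  · rw [trH_apply]
    exact sum_mem fun k _ => pairMinus_mem_base hA u (T _).2 (E.ν_mem k)
  · intro p α hα hαb
    have e1 := E.sum_pairMinus hT (fun k => S.rmul u ⟨α, hαb⟩ (E.m k)) (p := p)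
      (fun k i => by
        have := mul_mem_gr (E.μ_gr k i) hα
        rwa [zero_add] at this) E.ν
    have e2 : ∀ l, (∑ k, fun i => E.ν k i *
        pairPlus u (S.rmul u ⟨α, hαb⟩ (E.m k)).1 (E.ν l)) = fun i => α * E.ν l i := by
      intro l
      conv_rhs => rw [E.expand_dual (fun i => α * E.ν l i)]
      refine Finset.sum_congr rfl fun k _ => ?_
      funext i
      rw [← pairPlus_mul_middle]; rfl
    simp only [e2, hT.right] at e1
    rw [trH_apply, Finset.sum_mul, Finset.mul_sum]
    simp only [← pairMinus_mul_right, ← pairMinus_mul_left]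
    exact e1

end DualFamily

/-- A graded connection on the bimodule `H_u` satisfying the trace formula
`d tr(T) = tr(D T) - (-1)^∂T tr(T D)`. -/
structure IsTraceConnection {K : Type} [Fintype K] (E : S.DualFamily u K)
    (D : Module.End ℂ (S.H u)) : Prop where
  degree : ∀ p (x : S.H u), (∀ i, x.1 i ∈ gr Ω p) → ∀ i, (D x).1 i ∈ gr Ω (p + 1)
  left : ∀ p (α : S.base), (α : Ω) ∈ gr Ω p → ∀ x,
    D (S.lmul u α x) = S.lmul u (S.baseDif α) x + (-1 : ℂ) ^ p • S.lmul u α (D x)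
  right : ∀ (α : S.base) x,
    D (S.rmul u α x) = S.rmul u α (D x) + S.rmul u (S.baseDif α) (S.parityH u x)
  trace : ∀ n T, IsBimodEnd n T →
    dif (E.trH T) = E.trH (D * T) - (-1 : ℂ) ^ n • E.trH (T * D)

namespace IsTraceConnection

variable {K : Type} [Fintype K] {E : S.DualFamily u K} {D D' : Module.End ℂ (S.H u)}

/-- The terms with `d α` cancel, so connections form an affine space over the bimodule endomorphisms
of degree 1. -/
theorem sub (h : IsTraceConnection E D) (h' : IsTraceConnection E D') :
    IsBimodEnd 1 (D - D') where
  degree p x hx i := sub_mem (h.degree p x hx i) (h'.degree p x hx i)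
  left p α hα x := by
    rw [LinearMap.sub_apply, h.left p α hα, h'.left p α hα, LinearMap.sub_apply, map_sub, smul_sub,
      one_mul]
    abel
  right α x := by
    rw [LinearMap.sub_apply, h.right, h'.right, LinearMap.sub_apply, map_sub]
    abel

theorem parity (h : IsTraceConnection E D) (x : S.H u) :
    D (S.parityH u x) = - S.parityH u (D x) := by
  refine H_induction (p := fun x => D (S.parityH u x) = - S.parityH u (D x)) x ?_ (by simp) ?_
  · intro n y hy
    have e1 : S.parityH u y = (-1 : ℂ) ^ n • y :=
      Subtype.ext (funext fun i => parity_of_mem (hy i))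
    have e2 : S.parityH u (D y) = (-1 : ℂ) ^ (n + 1) • D y :=
      Subtype.ext (funext fun i => parity_of_mem (h.degree n y hy i))
    rw [e1, e2, map_smul, pow_succ, mul_neg_one, neg_smul, neg_neg]
  · intro y z hy hz; rw [map_add, map_add, map_add, map_add, hy, hz]; abel

/-- Curvature is tensorial on both sides: `d² = 0` and the two cross terms with `d α` have opposite
signs. -/
theorem sq (h : IsTraceConnection E D) : IsBimodEnd 2 (D * D) where
  degree p x hx i := h.degree _ _ (h.degree p x hx) i
  left p α hα x := by
    have h1 : ((S.baseDif α : S.base) : Ω) ∈ gr Ω (p + 1) := dif_mem hα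
    rw [Module.End.mul_apply, h.left p α hα, map_add, h.left _ _ h1, map_smul, h.left p α hα,
      S.baseDif_baseDif]
    simp only [map_zero, LinearMap.zero_apply, zero_add, smul_add, smul_smul, pow_succ,
      neg_one_pow_mul_self, Module.End.mul_apply]
    have : (-1 : ℂ) ^ (2 * p) = 1 := by rw [pow_mul]; simp
    rw [this, mul_neg_one, neg_smul, one_smul, neg_add_cancel_left]
  right α x := by
    rw [Module.End.mul_apply, h.right, map_add, h.right, h.right, S.baseDif_baseDif, h.parity]
    simp

end IsTraceConnection

namespace Connection

variable (ω : S.Connection)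

/-- The covariant derivative on the bimodule `H_u`. -/
def DH (u : UnitaryRep A) : Module.End ℂ (S.H u) :=
  (ω.Drep u).restrict fun _ h => ω.D_mem_intertwiners u.isCorep h

theorem DH_pow_apply (k : ℕ) (x : S.H u) : ((ω.DH u ^ k) x).1 = (ω.Drep u ^ k) x.1 := by
  induction k with
  | zero => rfl
  | succ k ih => rw [pow_succ', pow_succ', Module.End.mul_apply, Module.End.mul_apply, ← ih]; rfl

variable (hA : IsCompactMatrixQuantumGroup A)

include hA

theorem D_pairMinus (hω : ω.IsRegular) {x y : u.ι → Ω} (hx : ∀ i, x i ∈ S.hor)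
    (hy : ∀ i, y i ∈ S.hor) : ω.D (pairMinus u x y) =
      pairMinus u (fun i => ω.D (x i)) y + pairMinus u (fun i => QPB.parity (x i))
        (fun i => ω.D (y i)) := by
  simp only [pairMinus, map_sum, map_smul, ω.D_mul hA hω (hx _) (hy _), smul_add,
    Finset.sum_add_distrib]

/-- Only the trace formula needs an argument. Differentiating `∑ ⟨ν_k, T μ_k⟩⁻` leaves a term with
`D ν_k`; differentiating the duality relation exchanges it for one with `T D μ_k`. -/
theorem isTraceConnection (hω : ω.IsRegular) {K : Type} [Fintype K] (E : S.DualFamily u K) :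
    IsTraceConnection E (ω.DH u) where
  degree p x hx i := ω.D_mem_gr (hx i)
  left p α hα x := by
    refine Subtype.ext (funext fun i => ?_)
    change ω.D (α * x.1 i) = dif (α : Ω) * x.1 i + (-1 : ℂ) ^ p • (α * ω.D (x.1 i))
    rw [ω.D_mul hA hω (S.base_le_hor α.2) (x.2 i).1, ω.D_of_mem_base α.2, parity_of_mem hα,
      smul_mul_assoc]
  right α x := by
    refine Subtype.ext (funext fun i => ?_)
    change ω.D (x.1 i * α) = ω.D (x.1 i) * α + QPB.parity (x.1 i) * dif (α : Ω)
    rw [ω.D_mul hA hω (x.2 i).1 (S.base_le_hor α.2), ω.D_of_mem_base α.2]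
  trace n T hT := by
    have hν : ∀ k i, QPB.parity (E.ν k i) = E.ν k i := fun k i => by
      rw [parity_of_mem (E.ν_gr k i)]; simp
    have e1 : dif (E.trH T) = ∑ k, pairMinus u (fun i => ω.D (E.ν k i)) (T (E.m k)).1 +
        E.trH (ω.DH u * T) := by
      rw [← ω.D_of_mem_base (E.trH_mem_center hA hT).2.1, E.trH_apply, map_sum, E.trH_apply,
        ← Finset.sum_add_distrib]
      refine Finset.sum_congr rfl fun k _ => ?_
      rw [ω.D_pairMinus hA hω (fun i => (E.ν_mem k i).1) (fun i => ((T _).2 i).1)]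
      simp only [hν]
      rfl
    have e2 := E.sum_pairMinus hT E.m E.m_gr fun k i => ω.D (E.ν k i)
    have e3 := E.sum_pairMinus hT (fun k => ω.DH u (E.m k)) (p := 1)
      (fun k i => ω.D_mem_gr (E.μ_gr k i)) E.ν
    -- This is `D` applied to `∑ k, ν_k(e_i*) μ_k(e_j) = δ_ij`, whose right-hand side is constant.
    have e4 : ∀ l, (∑ k, fun i => E.ν k i * pairPlus u (ω.DH u (E.m k)).1 (E.ν l)) =
        - ∑ k, fun i => ω.D (E.ν k i) * pairPlus u (E.m k).1 (E.ν l) := by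
      intro l
      rw [eq_neg_iff_add_eq_zero, ← Finset.sum_add_distrib]
      funext i
      rw [Finset.sum_apply]
      simp only [Pi.add_apply, pairPlus, Finset.mul_sum, ← mul_assoc, ← Finset.sum_add_distrib,
        ← add_mul]
      rw [Finset.sum_comm]
      refine Finset.sum_eq_zero fun j _ => ?_
      rw [← Finset.sum_mul]
      have e5 : ∑ k, (E.ν k i * (ω.DH u (E.m k)).1 j + ω.D (E.ν k i) * E.μ k j) =
          ω.D (∑ k, E.ν k i * E.μ k j) := by
        rw [map_sum]
        refine Finset.sum_congr rfl fun k _ => ?_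
        rw [ω.D_mul hA hω (E.ν_mem k i).1 (E.μ_mem k j).1, hν, add_comm]; rfl
      rw [e5, E.sum_mul]
      split_ifs
      · rw [ω.D_of_mem_base S.one_mem_base, dif_one, zero_mul]
      · simp
    have e6 : E.trH (T * ω.DH u) = ∑ k, pairMinus u (E.ν k) (T (ω.DH u (E.m k))).1 :=
      E.trH_apply _
    rw [e1, e2, e6, e3]
    simp only [e4, mul_zero, pow_zero, one_smul, mul_one, smul_smul, neg_one_pow_mul_self,
      ← pairMinusHom_apply, map_neg, LinearMap.neg_apply, Finset.sum_neg_distrib]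
    abel

end Connection

end BundleCalculus

/-! ### Anticommutator identities for the transgression -/

section RingIdentities

variable {R : Type*} [Ring R]

theorem sq_sub_sq_sub_sq (a b : R) :
    b * b - a * a - (b - a) * (b - a) = a * (b - a) + (b - a) * a := by noncomm_ring

theorem anticommutator_sub (a b r : R) :
    (b - a) * r + r * (b - a) = (b * r + r * b) - (a * r + r * a) := by noncomm_ring

theorem anticommutator_step {p m : R} (h : p * m = m * p) (q c : R) :
    (p * q + q * p) * (p * p) + m * (c * p + p * c) =
      p * (q * (p * p) + m * c) + (q * (p * p) + m * c) * p := by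
  have e : p * (m * c) = m * (p * c) := by rw [← mul_assoc, h, mul_assoc]
  simp only [mul_add, add_mul, mul_assoc, e]
  abel

end RingIdentities

/-! ### Formal series in the graded centre -/

namespace BundleCalculus

variable {A : Type*} [Ring A] [StarRing A] [HopfAlgebra ℂ A] [StarModule ℂ A]
  {Γ : Type*} [Ring Γ] [Algebra ℂ Γ] [DGStarAlgebra Γ] {G : GroupCalculus A Γ}
  {V : Type*} [Ring V] [StarRing V] [Algebra ℂ V] [StarModule ℂ V]
  {B : Type*} [Ring B] [StarRing B] [Algebra ℂ B] [StarModule ℂ B] {P : Bundle A V B}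
  {Ω : Type*} [Ring Ω] [Algebra ℂ Ω] [DGStarAlgebra Ω] {S : BundleCalculus G P Ω}

/-- Differentiate `z α = ± α z`; the terms with `d α` cancel by centrality of `z`. -/
theorem dif_mem_center {n : ℕ} {z : Ω} (hz : z ∈ S.center n) : dif z ∈ S.center (n + 1) := by
  refine ⟨dif_mem hz.1, S.dif_mem_base hz.2.1, fun m α hα hαb => ?_⟩
  have h1 := congrArg (dif (Ω := Ω)) (hz.2.2 m α hα hαb)
  rw [map_smul, leibniz hz.1, leibniz hα, hz.2.2 (m + 1) (dif α) (dif_mem hα) (S.dif_mem_base hαb),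
    smul_smul, smul_add, smul_smul, ← pow_add, ← pow_add] at h1
  have e1 : (-1 : ℂ) ^ (n + n * (m + 1)) = (-1 : ℂ) ^ (n * m) := by
    rw [show n + n * (m + 1) = n * m + 2 * n by ring, pow_add, pow_mul]; simp
  rw [e1, add_comm] at h1
  rw [add_left_cancel h1]
  congr 2; ring

theorem mem_Z {z : ℕ → Ω} : z ∈ S.Z ↔ ∀ n, z n ∈ S.center n := by
  simp [Z, Submodule.mem_pi]

theorem dSeries_zero (z : ℕ → Ω) : dSeries z 0 = 0 := rfl

theorem dSeries_succ (z : ℕ → Ω) (n : ℕ) : dSeries z (n + 1) = dif (z n) := rfl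

theorem dSeries_mem_Z {z : ℕ → Ω} (hz : z ∈ S.Z) : dSeries z ∈ S.Z := by
  rw [mem_Z] at *
  rintro (_ | n)
  · exact zero_mem _
  · exact dif_mem_center (hz n)

theorem mem_cocycles {z : ℕ → Ω} : z ∈ S.cocycles ↔ z ∈ S.Z ∧ ∀ n, dif (z n) = 0 := by
  refine and_congr_right fun _ => ⟨fun h n => congrFun h (n + 1), fun h => funext fun n => ?_⟩
  rcases n with _ | n
  · rfl
  · exact h n

/-- A component of a central series, as a form on the base. -/
def baseOf {z : ℕ → Ω} (hz : z ∈ S.Z) (n : ℕ) : S.base := ⟨z n, (mem_Z.1 hz n).2.1⟩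

/-! ### Chern–Weil theory for trace connections -/

section Transgression

variable {u : UnitaryRep A} {K : Type} [Fintype K] {E : S.DualFamily u K}
  {D D' : Module.End ℂ (S.H u)}

theorem IsTraceConnection.mul_lmul (h : IsTraceConnection E D) {m : ℕ} {z : S.base}
    (hz : (z : Ω) ∈ gr Ω m) :
    D * S.lmul u z = S.lmul u (S.baseDif z) + (-1 : ℂ) ^ m • (S.lmul u z * D) :=
  LinearMap.ext fun x => h.left m z hz x

theorem IsTraceConnection.isBimodEnd_pow (h : IsTraceConnection E D) (k : ℕ) :
    IsBimodEnd (2 * k) (D ^ (2 * k)) := by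
  rw [pow_mul, pow_two]; exact h.sq.pow k

theorem IsTraceConnection.isBimodEnd_lmul_pow (h : IsTraceConnection E D) {m : ℕ} {z : S.base}
    (hz : (z : Ω) ∈ S.center m) (k : ℕ) :
    IsBimodEnd (m + 2 * k) (S.lmul u z * D ^ (2 * k)) :=
  (isBimodEnd_lmul hz).mul (h.isBimodEnd_pow k)

/-- `D` commutes with its powers, so the graded commutator of `D` with `z D^(2k)` reduces to `dz
D^(2k)`. -/
theorem IsTraceConnection.dif_trH (h : IsTraceConnection E D) {m : ℕ} {z : S.base}
    (hz : (z : Ω) ∈ S.center m) (k : ℕ) :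
    dif (E.trH (S.lmul u z * D ^ (2 * k))) = E.trH (S.lmul u (S.baseDif z) * D ^ (2 * k)) := by
  have e1 : (-1 : ℂ) ^ (m + 2 * k) = (-1 : ℂ) ^ m := by
    rw [pow_add, pow_mul]; simp
  rw [h.trace _ _ (h.isBimodEnd_lmul_pow hz k), ← mul_assoc, h.mul_lmul hz.1, e1, add_mul,
    map_add, smul_mul_assoc, map_smul, mul_assoc, mul_assoc, ← pow_succ, ← pow_succ',
    add_sub_cancel_right]

/-- For closed `z` the graded commutator of `D` with `z Q` equals, up to sign, `z` times the
anticommutator, because `Q` is odd. The trace formula then makes it exact. -/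
theorem IsTraceConnection.trH_anticommutator (h : IsTraceConnection E D) {m k : ℕ} {z : S.base}
    (hz : (z : Ω) ∈ S.center m) (hd : dif (z : Ω) = 0) {Q : Module.End ℂ (S.H u)}
    (hQ : IsBimodEnd (2 * k + 1) Q) :
    E.trH (S.lmul u z * (D * Q + Q * D)) = (-1 : ℂ) ^ m • dif (E.trH (S.lmul u z * Q)) := by
  have e0 : S.baseDif z = 0 := Subtype.ext hd
  have e1 : (-1 : ℂ) ^ (m + (2 * k + 1)) = -(-1 : ℂ) ^ m := by
    rw [pow_add, pow_succ, pow_mul]; simp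
  rw [h.trace _ _ ((isBimodEnd_lmul hz).mul hQ)]
  change _ = (-1 : ℂ) ^ m • (E.trH (D * (S.lmul u z * Q)) -
    (-1 : ℂ) ^ (m + (2 * k + 1)) • E.trH (S.lmul u z * Q * D))
  rw [← mul_assoc D, h.mul_lmul hz.1, e0, map_zero,
    zero_add, smul_mul_assoc, map_smul, e1, neg_smul, sub_neg_eq_add, ← smul_add, smul_smul,
    neg_one_pow_mul_self, one_smul, mul_add, map_add, mul_assoc, mul_assoc]

open Polynomial in
/-- The polynomial `D + t A`. -/
def pathPoly (D D' : Module.End ℂ (S.H u)) : (Module.End ℂ (S.H u))[X] :=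
  C D + C (D' - D) * X

open Polynomial in
/-- A polynomial `Q` such that the derivative of `(D + t A)^(2k)` is the anticommutator of `Q`
and `D + t A`. -/
def transgressionPoly (D D' : Module.End ℂ (S.H u)) : ℕ → (Module.End ℂ (S.H u))[X]
  | 0 => 0
  | k + 1 => transgressionPoly D D' k * pathPoly D D' ^ 2 + pathPoly D D' ^ (2 * k) * C (D' - D)

open Polynomial in
theorem derivative_pathPoly_pow (k : ℕ) : derivative (pathPoly D D' ^ (2 * k)) =
    pathPoly D D' * transgressionPoly D D' k + transgressionPoly D D' k * pathPoly D D' := by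
  have e : derivative (pathPoly D D') = C (D' - D) := by simp [pathPoly]
  induction k with
  | zero => simp [transgressionPoly]
  | succ k ih =>
    rw [mul_add, pow_add, mul_one, derivative_mul, ih, pow_two, derivative_mul, e,
      transgressionPoly, pow_two]
    have hc : pathPoly D D' * pathPoly D D' ^ (2 * k) = pathPoly D D' ^ (2 * k) * pathPoly D D' :=
      (Commute.refl (pathPoly D D')).pow_right (2 * k)
    exact anticommutator_step (R := (Module.End ℂ (S.H u))[X]) hc _ _

open Polynomial in
theorem coeff_mul_isBimodEnd {m n : ℕ} {p q : (Module.End ℂ (S.H u))[X]}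
    (hp : ∀ j, IsBimodEnd m (p.coeff j)) (hq : ∀ j, IsBimodEnd n (q.coeff j)) (j : ℕ) :
    IsBimodEnd (m + n) ((p * q).coeff j) := by
  rw [coeff_mul]
  exact IsBimodEnd.sum _ fun k _ => (hp _).mul (hq _)

open Polynomial in
theorem coeff_C_isBimodEnd {m : ℕ} {T : Module.End ℂ (S.H u)} (hT : IsBimodEnd m T) (j : ℕ) :
    IsBimodEnd m ((C T).coeff j) := by
  rw [coeff_C]; split_ifs
  · exact hT
  · exact IsBimodEnd.zero m

-- `D` itself is not linear over the base, but the square of `D + t A`, with `A = D' - D`, has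
-- linear coefficients: `D²`, `A²` and the mixed term `D A + A D = D'² - D² - A²`.
open Polynomial in
theorem coeff_pathPoly_sq (h : IsTraceConnection E D) (h' : IsTraceConnection E D') (j : ℕ) :
    IsBimodEnd 2 ((pathPoly D D' ^ 2).coeff j) := by
  have hA := h'.sub h
  have e : pathPoly D D' ^ 2 = C (D * D) + C (D' * D' - D * D - (D' - D) * (D' - D)) * X +
      C ((D' - D) * (D' - D)) * X ^ 2 := by
    have e1 : D' * D' - D * D - (D' - D) * (D' - D) = D * (D' - D) + (D' - D) * D :=
      sq_sub_sq_sub_sq D D'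
    rw [e1, pathPoly, pow_two, add_mul, mul_add, mul_add, mul_assoc _ X (C D), X_mul,
      mul_assoc _ X (C (D' - D) * X), X_mul]
    simp only [C_add, C_mul, add_mul, ← mul_assoc, pow_two]
    abel
  rw [e]
  simp only [coeff_add, coeff_C_mul, coeff_X, coeff_X_pow]
  refine ((coeff_C_isBimodEnd h.sq j).add ?_).add ?_
  · split_ifs
    · rw [mul_one]; exact (h'.sq.sub h.sq).sub (hA.mul hA)
    · rw [mul_zero]; exact IsBimodEnd.zero 2
  · split_ifs
    · rw [mul_one]; exact hA.mul hA
    · rw [mul_zero]; exact IsBimodEnd.zero 2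

open Polynomial in
theorem coeff_pathPoly_pow (h : IsTraceConnection E D) (h' : IsTraceConnection E D') (k j : ℕ) :
    IsBimodEnd (2 * k) ((pathPoly D D' ^ (2 * k)).coeff j) := by
  induction k generalizing j with
  | zero => exact coeff_C_isBimodEnd IsBimodEnd.one j
  | succ k ih => rw [mul_add, pow_add]; exact coeff_mul_isBimodEnd ih (coeff_pathPoly_sq h h') j

theorem coeff_transgressionPoly (h : IsTraceConnection E D) (h' : IsTraceConnection E D')
    (k j : ℕ) : IsBimodEnd (2 * k + 1) ((transgressionPoly D D' (k + 1)).coeff j) := by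
  induction k generalizing j with
  | zero =>
    simp only [transgressionPoly, zero_mul, zero_add, mul_zero, pow_zero, one_mul]
    exact coeff_C_isBimodEnd (h'.sub h) j
  | succ k ih =>
    rw [transgressionPoly, Polynomial.coeff_add]
    exact (coeff_mul_isBimodEnd ih (coeff_pathPoly_sq h h') j).add
      (coeff_mul_isBimodEnd (coeff_pathPoly_pow h h' (k + 1)) (coeff_C_isBimodEnd (h'.sub h)) j)

-- Compare coefficients in the derivative formula. The anticommutator with `D + t A` splits into one
-- of `D` with the coefficient `j` of `Q` and one of `A` with the preceding coefficient. The first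
-- is exact under the trace, the second contributes nothing.
open Polynomial in
theorem trH_coeff_pathPoly (h : IsTraceConnection E D) (h' : IsTraceConnection E D') {m : ℕ}
    {z : S.base} (hz : (z : Ω) ∈ S.center m) (hd : dif (z : Ω) = 0) (k j : ℕ) :
    ((j : ℂ) + 1) • E.trH (S.lmul u z * (pathPoly D D' ^ (2 * (k + 1))).coeff (j + 1)) =
      (-1 : ℂ) ^ m • dif (E.trH (S.lmul u z * (transgressionPoly D D' (k + 1)).coeff j)) := by
  have hq := coeff_transgressionPoly h h' k
  have e1 := congrArg (fun p => p.coeff j) (derivative_pathPoly_pow (D := D) (D' := D') (k + 1))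
  simp only [coeff_derivative, coeff_add] at e1
  generalize transgressionPoly D D' (k + 1) = Q at *
  have e2 : (pathPoly D D' ^ (2 * (k + 1))).coeff (j + 1) * ((j : Module.End ℂ (S.H u)) + 1) =
      ((j : ℂ) + 1) • (pathPoly D D' ^ (2 * (k + 1))).coeff (j + 1) := by
    rw [mul_add, mul_one, add_smul, one_smul, ← nsmul_eq_mul', Nat.cast_smul_eq_nsmul]
  have e3 : (pathPoly D D' * Q).coeff j + (Q * pathPoly D D').coeff j =
      (D * Q.coeff j + Q.coeff j * D) + ((D' - D) * (Q * X).coeff j + (Q * X).coeff j * (D' - D)) := by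
    rw [pathPoly, add_mul, mul_add, coeff_add, coeff_add, coeff_C_mul, coeff_mul_C, mul_assoc, X_mul,
      coeff_C_mul, ← X_mul (p := C (D' - D)), ← mul_assoc, coeff_mul_C]
    abel
  -- The anticommutator with `D' - D` is a difference of two anticommutators, and both have the same
  -- trace `± d tr(z R)`.
  have e4 : E.trH (S.lmul u z * ((D' - D) * (Q * X).coeff j + (Q * X).coeff j * (D' - D))) = 0 := by
    have hqX : IsBimodEnd (2 * k + 1) ((Q * X).coeff j) := by
      rcases j with _ | j
      · rw [coeff_mul_X_zero]; exact IsBimodEnd.zero _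
      · rw [coeff_mul_X]; exact hq j
    generalize (Q * X).coeff j = R at *
    have e5 : (D' - D) * R + R * (D' - D) = (D' * R + R * D') - (D * R + R * D) :=
      anticommutator_sub D D' R
    rw [e5, mul_sub, map_sub, h.trH_anticommutator hz hd hqX, h'.trH_anticommutator hz hd hqX,
      sub_self]
  rw [← map_smul, ← mul_smul_comm, ← e2, e1, e3, mul_add, map_add, e4, add_zero,
    h.trH_anticommutator hz hd (hq j)]

open Polynomial in
/-- The transgression formula. -/
theorem exists_transgression (hA : IsCompactMatrixQuantumGroup A) (h : IsTraceConnection E D)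
    (h' : IsTraceConnection E D') {m : ℕ}
    {z : S.base} (hz : (z : Ω) ∈ S.center m) (hd : dif (z : Ω) = 0) (k : ℕ) :
    ∃ c ∈ S.center (m + 2 * k - 1), dif c =
      E.trH (S.lmul u z * D' ^ (2 * k)) - E.trH (S.lmul u z * D ^ (2 * k)) := by
  -- For `k = 0` both traces agree. Zero lies in every component, so the truncated degree `m - 1`
  -- does no harm.
  rcases k with _ | k
  · exact ⟨0, zero_mem _, by simp⟩
  set p := pathPoly D D' ^ (2 * (k + 1)) with hp
  have e0 : p.coeff 0 = D ^ (2 * (k + 1)) := by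
    have := map_pow (constantCoeff (R := Module.End ℂ (S.H u))) (pathPoly D D') (2 * (k + 1))
    simp only [constantCoeff_apply] at this
    rw [hp, this]; simp [pathPoly]
  -- Evaluation at `t = 1` is multiplicative although the coefficients do not commute, since `1` is
  -- central; it sums the coefficients.
  have e1 : D' ^ (2 * (k + 1)) = ∑ j ∈ Finset.range (p.natDegree + 1), p.coeff j := by
    let ev := eval₂RingHom' (RingHom.id (Module.End ℂ (S.H u))) 1 fun a => Commute.one_right _
    have h1 : ev p = D' ^ (2 * (k + 1)) := by
      rw [hp, map_pow]
      congr 1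
      change eval₂ _ _ _ = _
      simp only [pathPoly, eval₂_add, eval₂_mul_X, eval₂_C, RingHom.id_apply, mul_one,
        add_sub_cancel]
    rw [← h1]
    change eval₂ _ _ _ = _
    rw [eval₂_eq_sum_range]
    simp
  -- The witness is the integral of the transgression polynomial over `[0, 1]`, coefficient by
  -- coefficient, which explains the factors `1/(j + 1)`.
  refine ⟨∑ j ∈ Finset.range p.natDegree, ((-1 : ℂ) ^ m * ((j : ℂ) + 1)⁻¹) •
    E.trH (S.lmul u z * (transgressionPoly D D' (k + 1)).coeff j), ?_, ?_⟩
  · refine sum_mem fun j _ => Submodule.smul_mem _ _ ?_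
    exact E.trH_mem_center hA ((isBimodEnd_lmul hz).mul (coeff_transgressionPoly h h' k j))
  · rw [e1, Finset.sum_range_succ', mul_add, map_add, ← e0, add_sub_cancel_right, map_sum,
      Finset.mul_sum, map_sum]
    refine Finset.sum_congr rfl fun j _ => ?_
    have := trH_coeff_pathPoly h h' hz hd k j
    have hj : ((j : ℂ) + 1) ≠ 0 := by exact_mod_cast Nat.succ_ne_zero j
    rw [map_smul, mul_comm, mul_smul, ← this, smul_smul, inv_mul_cancel₀ hj, one_smul]

variable (E) in
/-- The series `∑ k, (2πi)^(-k) (k!)⁻¹ tr(z D^(2k))` for an abstract connection `D`. -/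
def chH (D : Module.End ℂ (S.H u)) {z : ℕ → Ω} (hz : z ∈ S.Z) : ℕ → Ω := fun n =>
  ∑ k ∈ Finset.range (n / 2 + 1),
    ((2 * (Real.pi : ℂ) * Complex.I) ^ k * (k.factorial : ℂ))⁻¹ •
      E.trH (S.lmul u (baseOf hz (n - 2 * k)) * D ^ (2 * k))

theorem chH_mem_Z (hA : IsCompactMatrixQuantumGroup A) (h : IsTraceConnection E D) {z : ℕ → Ω}
    (hz : z ∈ S.Z) : chH E D hz ∈ S.Z := by
  rw [mem_Z]
  intro n
  refine sum_mem fun k hk => Submodule.smul_mem _ _ ?_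
  have := E.trH_mem_center hA (h.isBimodEnd_lmul_pow (z := baseOf hz (n - 2 * k)) (mem_Z.1 hz (n - 2 * k)) k)
  rwa [Nat.sub_add_cancel] at this
  rw [Finset.mem_range] at hk
  omega

theorem dSeries_chH (h : IsTraceConnection E D) {z : ℕ → Ω}
    (hz : z ∈ S.Z) : dSeries (chH E D hz) = chH E D (dSeries_mem_Z hz) := by
  have h0 : baseOf (dSeries_mem_Z hz) 0 = 0 := rfl
  funext n
  rcases n with _ | n
  · simp [dSeries_zero, chH, h0]
  · rw [dSeries_succ, chH, map_sum, chH]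
    have e : ∀ k, 2 * k ≤ n → baseOf (dSeries_mem_Z hz) (n + 1 - 2 * k) =
        S.baseDif (baseOf hz (n - 2 * k)) := by
      intro k hk
      refine Subtype.ext ?_
      change dSeries z (n + 1 - 2 * k) = dif (z (n - 2 * k))
      rw [show n + 1 - 2 * k = (n - 2 * k) + 1 by omega]; rfl
    -- For odd `n` the larger range has one more index, `2k = n + 1`. It meets the component of
    -- degree 0 of `dz`, which is zero.
    have hsub : Finset.range (n / 2 + 1) ⊆ Finset.range ((n + 1) / 2 + 1) :=
      Finset.range_subset_range.2 (by omega)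
    rw [← Finset.sum_subset hsub]
    · refine Finset.sum_congr rfl fun k hk => ?_
      rw [Finset.mem_range] at hk
      rw [map_smul, e k (by omega), h.dif_trH (mem_Z.1 hz _)]
    · intro k hk hk'
      rw [Finset.mem_range] at hk hk'
      rw [show n + 1 - 2 * k = 0 by omega, h0]
      simp

theorem chH_sub_mem_coboundaries (hA : IsCompactMatrixQuantumGroup A)
    (h : IsTraceConnection E D) (h' : IsTraceConnection E D') {z : ℕ → Ω} (hz : z ∈ S.cocycles) :
    chH E D' hz.1 - chH E D hz.1 ∈ S.coboundaries := by
  have hd := (mem_cocycles.1 hz).2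
  choose c hc hc' using fun n k => exists_transgression hA h h'
    (z := baseOf hz.1 n) (mem_Z.1 hz.1 n) (hd n) k
  -- Transgression lowers the total degree by one, so component `n` collects the forms belonging to
  -- `n + 1`. In this range `2k ≤ n + 1`, and the truncated subtraction is exact.
  refine ⟨fun n => ∑ k ∈ Finset.range ((n + 1) / 2 + 1),
    ((2 * (Real.pi : ℂ) * Complex.I) ^ k * (k.factorial : ℂ))⁻¹ • c (n + 1 - 2 * k) k, ?_, ?_⟩
  · rw [SetLike.mem_coe, mem_Z]
    intro n
    refine sum_mem fun k hk => Submodule.smul_mem _ _ ?_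
    rw [Finset.mem_range] at hk
    have := hc (n + 1 - 2 * k) k
    rwa [show n + 1 - 2 * k + 2 * k - 1 = n by omega] at this
  · funext n
    rcases n with _ | n
    · simp [dSeries_zero, chH]
    · rw [dSeries_succ, map_sum, Pi.sub_apply, chH, chH, ← Finset.sum_sub_distrib]
      refine Finset.sum_congr rfl fun k _ => ?_
      rw [map_smul, hc', smul_sub]

end Transgression

/-! ### Comparison of the canonical trace with traces of endomorphisms -/

section TraceOfOperators

variable {u : UnitaryRep A} {K : Type} [Fintype K] (E : S.DualFamily u K)

theorem isLeftLinear_of_isBimodEnd {n : ℕ} {T : Module.End ℂ (S.H u)} (hT : IsBimodEnd n T)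
    {T' : (u.ι → Ω) → (u.ι → Ω)} (h : ∀ x : S.H u, T' x.1 = (T x : u.ι → Ω)) : S.IsLeftLinear u T' := by
  constructor
  · intro μ μ' hμ _ hμ' _
    have := h (⟨μ, hμ⟩ + ⟨μ', hμ'⟩)
    rw [map_add] at this
    rw [h ⟨μ, hμ⟩, h ⟨μ', hμ'⟩]; exact this
  · intro f μ hμ _
    have hf := S.mem_base_zero_iff.2 ⟨f, rfl⟩
    have := h (S.lmul u ⟨_, hf.1⟩ ⟨μ, hμ⟩)
    rw [hT.left 0 _ hf.2, mul_zero, pow_zero, one_smul] at this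
    rw [h ⟨μ, hμ⟩]; exact this

theorem trM_eq_trH {n : ℕ} {T : Module.End ℂ (S.H u)} (hT : IsBimodEnd n T)
    {T' : (u.ι → Ω) → (u.ι → Ω)} (h : ∀ x : S.H u, T' x.1 = (T x).1) :
    S.trM u T' = E.trH T := by
  rw [S.trM_eq_tr E (isLeftLinear_of_isBimodEnd hT h), DualFamily.tr, E.trH_apply]
  simp only [← h]

theorem Connection.ch_eq_chH (hA : IsCompactMatrixQuantumGroup A) (ω : S.Connection)
    (hω : ω.IsRegular) {z : ℕ → Ω} (hz : z ∈ S.Z) : ω.ch u z = chH E (ω.DH u) hz := by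
  funext n
  unfold Connection.ch Connection.chSeries chH
  refine Finset.sum_congr rfl fun k _ => ?_
  congr 1
  refine trM_eq_trH E ((ω.isTraceConnection hA hω E).isBimodEnd_lmul_pow (mem_Z.1 hz _) k) ?_
  intro x
  change _ = fun i => z (n - 2 * k) * ((ω.DH u ^ (2 * k)) x).1 i
  rw [ω.DH_pow_apply]

end TraceOfOperators

end BundleCalculus

/-! ### Pairings and dual families of sums, products and the trivial representation -/

section Pairings

variable {A : Type*} [Ring A] [StarRing A] [HopfAlgebra ℂ A] [StarModule ℂ A] {u v : UnitaryRep A}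
  (hA : IsCompactMatrixQuantumGroup A)

include hA

theorem canonicalC_sum_inv : (canonicalC (u.sum v))⁻¹ =
    Matrix.fromBlocks (canonicalC u)⁻¹ 0 0 (canonicalC v)⁻¹ := by
  have hC := canonicalC_spec hA u
  have hD := canonicalC_spec hA v
  have h : canonicalC (u.sum v) = Matrix.fromBlocks (canonicalC u) 0 0 (canonicalC v) :=
    (canonicalC_spec hA (u.sum v)).unique (hC.sum hD)
  rw [h]
  exact fromBlocks_diag_inv hC.posDef.isUnit hD.posDef.isUnit

theorem canonicalC_prod_inv (i j : u.ι × v.ι) : (canonicalC (u.prod v))⁻¹ i j =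
    (canonicalC u)⁻¹ i.1 j.1 * (canonicalC v)⁻¹ i.2 j.2 := by
  have hC := canonicalC_spec hA u
  have hD := canonicalC_spec hA v
  have h : canonicalC (u.prod v) = Matrix.kronecker (canonicalC u) (canonicalC v) :=
    (canonicalC_spec hA (u.prod v)).unique (IsCanonicalIntertwiner.prod hA.comul_star hC hD)
  rw [h]
  exact congrFun (congrFun (Matrix.inv_kronecker (canonicalC u) (canonicalC v)) i) j

theorem canonicalC_trivial_inv : (canonicalC (UnitaryRep.trivial : UnitaryRep A))⁻¹ = 1 := by
  rw [(canonicalC_spec hA UnitaryRep.trivial).unique isCanonicalIntertwiner_trivial, inv_one]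

end Pairings

namespace BundleCalculus

variable {A : Type*} [Ring A] [StarRing A] [HopfAlgebra ℂ A] [StarModule ℂ A]
  {Γ : Type*} [Ring Γ] [Algebra ℂ Γ] [DGStarAlgebra Γ] {G : GroupCalculus A Γ}
  {V : Type*} [Ring V] [StarRing V] [Algebra ℂ V] [StarModule ℂ V]
  {B : Type*} [Ring B] [StarRing B] [Algebra ℂ B] [StarModule ℂ B] {P : Bundle A V B}
  {Ω : Type*} [Ring Ω] [Algebra ℂ Ω] [DGStarAlgebra Ω] {S : BundleCalculus G P Ω}
  {u v : UnitaryRep A}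

section Pairings

omit [StarModule ℂ A] [DGStarAlgebra Ω] in
theorem pairPlus_sum (x y : u.ι ⊕ v.ι → Ω) : pairPlus (u.sum v) x y =
    pairPlus u (fun i => x (Sum.inl i)) (fun i => y (Sum.inl i)) +
      pairPlus v (fun i => x (Sum.inr i)) (fun i => y (Sum.inr i)) :=
  Fintype.sum_sum_type (fun i : u.ι ⊕ v.ι => x i * y i)

omit [DGStarAlgebra Ω] in
theorem pairMinus_sum (hA : IsCompactMatrixQuantumGroup A) (y x : u.ι ⊕ v.ι → Ω) :
    pairMinus (u.sum v) y x =
    pairMinus u (fun i => y (Sum.inl i)) (fun i => x (Sum.inl i)) +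
      pairMinus v (fun i => y (Sum.inr i)) (fun i => x (Sum.inr i)) := by
  have h : pairMinus (u.sum v) y x = ∑ i : u.ι ⊕ v.ι, ∑ j : u.ι ⊕ v.ι,
      Matrix.fromBlocks (canonicalC u)⁻¹ 0 0 (canonicalC v)⁻¹ j i • (y i * x j) := by
    rw [← canonicalC_sum_inv hA]; rfl
  rw [h]
  simp [Fintype.sum_sum_type, pairMinus]

omit [StarModule ℂ A] [DGStarAlgebra Ω] in
theorem pairPlus_prod (x : u.ι × v.ι → Ω) (z : v.ι → Ω) (y : u.ι → Ω) :
    pairPlus (u.prod v) x (fun p : u.ι × v.ι => z p.2 * y p.1) =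
      pairPlus u (fun i => pairPlus v (fun j => x (i, j)) z) y := by
  refine (Fintype.sum_prod_type fun i : u.ι × v.ι => x i * (z i.2 * y i.1)).trans ?_
  simp [pairPlus, Finset.sum_mul, mul_assoc]

-- The inverse canonical intertwiner factorizes, and the dual factors stand in the opposite order.
-- So the pairing of `u` sits inside that of `v`.
omit [DGStarAlgebra Ω] in
theorem pairMinus_prod (hA : IsCompactMatrixQuantumGroup A) (z : v.ι → Ω) (y : u.ι → Ω)
    (x : u.ι × v.ι → Ω) :
    pairMinus (u.prod v) (fun p : u.ι × v.ι => z p.2 * y p.1) x =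
      pairMinus v z (fun j => pairMinus u y (fun i => x (i, j))) := by
  have h : pairMinus (u.prod v) (fun p : u.ι × v.ι => z p.2 * y p.1) x =
      ∑ i : u.ι × v.ι, ∑ j : u.ι × v.ι,
      ((canonicalC u)⁻¹ j.1 i.1 * (canonicalC v)⁻¹ j.2 i.2) • (z i.2 * y i.1 * x j) := by
    simp only [← canonicalC_prod_inv hA]; rfl
  rw [h]
  simp only [Fintype.sum_prod_type, pairMinus, Finset.mul_sum, Finset.smul_sum]
  rw [Finset.sum_comm]
  refine Finset.sum_congr rfl fun i _ => ?_
  refine (Finset.sum_congr rfl fun j _ => Finset.sum_comm).trans ?_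
  rw [Finset.sum_comm]
  refine Finset.sum_congr rfl fun j _ => Finset.sum_congr rfl fun k _ =>
    Finset.sum_congr rfl fun l _ => ?_
  rw [mul_smul_comm, smul_smul, mul_comm, mul_assoc]

omit [DGStarAlgebra Ω] in
theorem pairMinus_trivial (hA : IsCompactMatrixQuantumGroup A) (y x : Unit → Ω) :
    pairMinus (UnitaryRep.trivial : UnitaryRep A) y x = y () * x () := by
  have h : pairMinus (UnitaryRep.trivial : UnitaryRep A) y x =
      ∑ i : Unit, ∑ j : Unit, (1 : Matrix Unit Unit ℂ) j i • (y i * x j) := by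
    exact congrArg (fun M : Matrix Unit Unit ℂ => ∑ i : Unit, ∑ j : Unit, M j i • (y i * x j))
      (canonicalC_trivial_inv (A := A) hA)
  rw [h]; simp

end Pairings

section Intertwiners

variable {ι κ : Type} [Fintype ι] [Fintype κ] {a : Matrix ι ι A} {b : Matrix κ κ A}

theorem sumElim_mem_intertwiners {x : ι → Ω} {y : κ → Ω} (hx : x ∈ S.intertwiners a)
    (hy : y ∈ S.intertwiners b) :
    Sum.elim x y ∈ S.intertwiners (Matrix.fromBlocks a 0 0 b) := by
  rintro (j | j)
  · refine ⟨(hx j).1, ?_⟩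
    rw [Fintype.sum_sum_type]; simpa using (hx j).2
  · refine ⟨(hy j).1, ?_⟩
    rw [Fintype.sum_sum_type]; simpa using (hy j).2

theorem inl_mem_intertwiners {x : ι ⊕ κ → Ω}
    (hx : x ∈ S.intertwiners (Matrix.fromBlocks a 0 0 b)) :
    (fun i => x (Sum.inl i)) ∈ S.intertwiners a := by
  intro j
  refine ⟨(hx (Sum.inl j)).1, ?_⟩
  have := (hx (Sum.inl j)).2
  rw [Fintype.sum_sum_type] at this; simpa using this

theorem inr_mem_intertwiners {x : ι ⊕ κ → Ω}
    (hx : x ∈ S.intertwiners (Matrix.fromBlocks a 0 0 b)) :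
    (fun i => x (Sum.inr i)) ∈ S.intertwiners b := by
  intro j
  refine ⟨(hx (Sum.inr j)).1, ?_⟩
  have := (hx (Sum.inr j)).2
  rw [Fintype.sum_sum_type] at this; simpa using this

/-- Contraction of the second factor on the right. -/
theorem contract_right_mem {c : Matrix κ κ A} [DecidableEq κ] {W : Matrix (ι × κ) (ι × κ) A}
    (hW : ∀ i j, W i j = a i.1 j.1 * b i.2 j.2)
    (hbc : ∀ p q, ∑ j, b p j * c q j = if p = q then 1 else 0)
    {x : ι × κ → Ω} (hx : x ∈ S.intertwiners W) {y : κ → Ω} (hy : y ∈ S.intertwiners c) :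
    (fun i => ∑ j, x (i, j) * y j) ∈ S.intertwiners a := by
  intro i
  refine ⟨sum_mem fun j _ => S.mul_mem_hor (hx _).1 (hy _).1, ?_⟩
  have e : ∀ j, S.Fwedge (x (i, j) * y j) = ∑ k, ∑ p, ∑ q,
      (x (k, p) * y q) ⊗ₜ[ℂ] (a k i * (b p j * c q j)) := by
    intro j
    rw [Fwedge_mul, (hx _).2, (hy _).2, Finset.sum_mul_sum, Fintype.sum_prod_type]
    simp [hW, mul_assoc]
  simp only [map_sum, e, TensorProduct.sum_tmul]
  rw [Finset.sum_comm]
  refine Finset.sum_congr rfl fun k _ => ?_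
  rw [Finset.sum_comm]
  refine Finset.sum_congr rfl fun p _ => ?_
  rw [Finset.sum_comm]
  simp only [← TensorProduct.tmul_sum, ← Finset.mul_sum, hbc]
  simp [TensorProduct.tmul_ite]

/-- Contraction of the second factor on the left. -/
theorem contract_left_mem {c : Matrix κ κ A} [DecidableEq κ] {W : Matrix (ι × κ) (ι × κ) A}
    (hW : ∀ i j, W i j = b i.2 j.2 * a i.1 j.1)
    (hbc : ∀ p q, ∑ j, c p j * b q j = if p = q then 1 else 0)
    {x : ι × κ → Ω} (hx : x ∈ S.intertwiners W) {y : κ → Ω} (hy : y ∈ S.intertwiners c) :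
    (fun i => ∑ j, y j * x (i, j)) ∈ S.intertwiners a := by
  intro i
  refine ⟨sum_mem fun j _ => S.mul_mem_hor (hy _).1 (hx _).1, ?_⟩
  have e : ∀ j, S.Fwedge (y j * x (i, j)) = ∑ q, ∑ k, ∑ p,
      (y q * x (k, p)) ⊗ₜ[ℂ] (c q j * b p j * a k i) := by
    intro j
    rw [Fwedge_mul, (hx _).2, (hy _).2, Finset.sum_mul_sum]
    refine Finset.sum_congr rfl fun q _ => ?_
    rw [Fintype.sum_prod_type]
    simp [hW, mul_assoc]
  simp only [map_sum, e, TensorProduct.sum_tmul]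
  have e2 : ∀ q k p, ∑ j, (y q * x (k, p)) ⊗ₜ[ℂ] (c q j * b p j * a k i) =
      if q = p then (y q * x (k, p)) ⊗ₜ[ℂ] a k i else 0 := by
    intro q k p
    rw [← TensorProduct.tmul_sum, ← Finset.sum_mul, hbc]
    split_ifs <;> simp
  rw [Finset.sum_comm]
  have e3 : ∀ q, ∑ j, ∑ k, ∑ p, (y q * x (k, p)) ⊗ₜ[ℂ] (c q j * b p j * a k i) =
      ∑ k, (y q * x (k, q)) ⊗ₜ[ℂ] a k i := by
    intro q
    rw [Finset.sum_comm]
    refine Finset.sum_congr rfl fun k _ => ?_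
    rw [Finset.sum_comm]
    simp [e2]
  simp only [e3]
  exact Finset.sum_comm

theorem contra_fromBlocks (a : Matrix ι ι A) (b : Matrix κ κ A) :
    contra (Matrix.fromBlocks a 0 0 b) = Matrix.fromBlocks (contra a) 0 0 (contra b) := by
  ext (i | i) (j | j) <;> simp

end Intertwiners

theorem tensor_mem {φ : u.ι → Ω} {ψ : v.ι → Ω} (h : φ ∈ S.H u) (h' : ψ ∈ S.H v) :
    tensor φ ψ ∈ S.H (u.prod v) :=
  mul_mem_intertwiners (w := u.mat) (w' := v.mat) h h' fun _ _ => rfl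

/-- The product of intertwiners with values in the dual bimodules. -/
def cotensor (ψ : v.ι → Ω) (φ : u.ι → Ω) : (u.prod v).ι → Ω :=
  fun i : u.ι × v.ι => ψ i.2 * φ i.1

theorem cotensor_mem {φ : u.ι → Ω} {ψ : v.ι → Ω} (h : φ ∈ S.HDual u) (h' : ψ ∈ S.HDual v) :
    cotensor ψ φ ∈ S.HDual (u.prod v) := by
  intro (j : u.ι × v.ι)
  refine ⟨S.mul_mem_hor (h' _).1 (h _).1, ?_⟩
  refine (S.Fwedge_mul _ _).trans ?_
  rw [(h _).2, (h' _).2, Finset.sum_mul_sum, Finset.sum_comm]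
  refine Eq.trans ?_ (Fintype.sum_prod_type (fun i : u.ι × v.ι =>
    (ψ i.2 * φ i.1) ⊗ₜ[ℂ] contra (u.prod v).mat i j)).symm
  simp [contra_prod u v]

theorem contract_mem {x : u.ι × v.ι → Ω} (hx : x ∈ S.H (u.prod v)) {y : v.ι → Ω}
    (hy : y ∈ S.HDual v) : (fun i => pairPlus v (fun j => x (i, j)) y) ∈ S.H u := by
  refine contract_right_mem (a := u.mat) (b := v.mat) (W := (u.prod v).mat) (fun _ _ => rfl) ?_
    hx hy
  intro p q
  simpa using v.isCorep.sum_mul_antipode p q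

theorem contract_dual_mem {x : u.ι × v.ι → Ω} (hx : x ∈ S.HDual (u.prod v)) {y : v.ι → Ω}
    (hy : y ∈ S.H v) : (fun i => pairPlus v y (fun j => x (i, j))) ∈ S.HDual u := by
  refine contract_left_mem (a := contra u.mat) (b := contra v.mat) (W := contra (u.prod v).mat)
    (contra_prod u v) ?_ hx hy
  intro p q
  simpa using v.isCorep.sum_mul_antipode p q

namespace DualFamily

variable {K K' : Type} [Fintype K] [Fintype K'] (E : S.DualFamily u K) (E' : S.DualFamily v K')

/-- The dual family of a direct sum. -/
def sum : S.DualFamily (u.sum v) (K ⊕ K') where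
  ν := Sum.elim (fun k => Sum.elim (E.ν k) 0) fun k => Sum.elim 0 (E'.ν k)
  μ := Sum.elim (fun k => Sum.elim (E.μ k) 0) fun k => Sum.elim 0 (E'.μ k)
  ν_mem k := by
    change _ ∈ S.intertwiners (contra (Matrix.fromBlocks u.mat 0 0 v.mat))
    rw [contra_fromBlocks]
    rcases k with k | k
    · exact sumElim_mem_intertwiners (E.ν_mem k) (zero_mem _)
    · exact sumElim_mem_intertwiners (zero_mem _) (E'.ν_mem k)
  ν_gr := by
    rintro (k | k) (i | i)
    exacts [E.ν_gr k i, zero_mem _, zero_mem _, E'.ν_gr k i]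
  μ_mem k := by
    rcases k with k | k
    · exact sumElim_mem_intertwiners (E.μ_mem k) (zero_mem _)
    · exact sumElim_mem_intertwiners (zero_mem _) (E'.μ_mem k)
  μ_gr := by
    rintro (k | k) (i | i)
    exacts [E.μ_gr k i, zero_mem _, zero_mem _, E'.μ_gr k i]
  sum_mul := by
    have h : ∀ i j : u.ι ⊕ v.ι, ∑ k : K ⊕ K',
        (Sum.elim (fun k => Sum.elim (E.ν k) 0) (fun k => Sum.elim 0 (E'.ν k)) k :
          u.ι ⊕ v.ι → Ω) i *
        (Sum.elim (fun k => Sum.elim (E.μ k) 0) (fun k => Sum.elim 0 (E'.μ k)) k :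
          u.ι ⊕ v.ι → Ω) j = if i = j then 1 else 0 := by
      rintro (i | i) (j | j) <;> simp [Fintype.sum_sum_type, E.sum_mul, E'.sum_mul]
    exact h

/-- The dual family of a product. -/
def prod : S.DualFamily (u.prod v) (K × K') where
  ν k := cotensor (E'.ν k.2) (E.ν k.1)
  μ k := tensor (E.μ k.1) (E'.μ k.2)
  ν_mem k := cotensor_mem (E.ν_mem k.1) (E'.ν_mem k.2)
  ν_gr k i := mul_mem_gr (m := 0) (n := 0) (E'.ν_gr _ _) (E.ν_gr _ _)
  μ_mem k := tensor_mem (E.μ_mem k.1) (E'.μ_mem k.2)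
  μ_gr k i := mul_mem_gr (m := 0) (n := 0) (E.μ_gr _ _) (E'.μ_gr _ _)
  sum_mul := by
    have h : ∀ i j : u.ι × v.ι, ∑ k : K × K',
        E'.ν k.2 i.2 * E.ν k.1 i.1 * (E.μ k.1 j.1 * E'.μ k.2 j.2) = if i = j then 1 else 0 := by
      rintro ⟨i, j⟩ ⟨i', j'⟩
      rw [Fintype.sum_prod_type, Finset.sum_comm]
      have : ∀ l k, E'.ν l j * E.ν k i * (E.μ k i' * E'.μ l j') =
          E'.ν l j * (E.ν k i * E.μ k i') * E'.μ l j' := by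
        intros; simp only [mul_assoc]
      simp only [this, ← Finset.sum_mul, ← Finset.mul_sum, E.sum_mul, Prod.mk.injEq]
      by_cases h : i = i' <;> simp [h, E'.sum_mul]
    exact h

variable (S) in
/-- The dual family of the trivial representation. -/
def trivial : S.DualFamily (UnitaryRep.trivial : UnitaryRep A) Unit where
  ν _ _ := 1
  μ _ _ := 1
  ν_mem _ := by
    change (fun _ : Unit => (1 : Ω)) ∈ S.intertwiners (contra (1 : Matrix Unit Unit A))
    intro j
    refine ⟨S.one_mem_hor, ?_⟩
    simp [Fwedge_one]
  ν_gr _ _ := one_mem_gr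
  μ_mem _ := by
    change (fun _ : Unit => (1 : Ω)) ∈ S.intertwiners (1 : Matrix Unit Unit A)
    intro j
    refine ⟨S.one_mem_hor, ?_⟩
    simp [Fwedge_one]
  μ_gr _ _ := one_mem_gr
  sum_mul := by
    have h : ∀ i j : Unit, ∑ _k : Unit, (1 : Ω) * 1 = if i = j then 1 else 0 := by simp
    exact h

end DualFamily

end BundleCalculus

/-! ### Reindexing and weights of the exponential series -/

section Sums

variable {M : Type*} [AddCommMonoid M]

/-- Two ways of summing over the quadruples `(p, s, j, l)` with `p + s + 2 j + 2 l = n`. -/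
theorem sum_quadruples (n : ℕ) (f : ℕ → ℕ → ℕ → ℕ → M) :
    ∑ k ∈ Finset.range (n / 2 + 1), ∑ q ∈ Finset.HasAntidiagonal.antidiagonal (n - 2 * k),
        ∑ r ∈ Finset.HasAntidiagonal.antidiagonal k, f q.1 q.2 r.1 r.2 =
      ∑ l ∈ Finset.range (n / 2 + 1), ∑ q ∈ Finset.HasAntidiagonal.antidiagonal (n - 2 * l),
        ∑ j ∈ Finset.range (q.1 / 2 + 1), f (q.1 - 2 * j) q.2 j l := by
  simp only [Finset.sum_sigma']
  refine Finset.sum_bij' (fun x _ => ⟨x.2.2.2, (x.2.1.1 + 2 * x.2.2.1, x.2.1.2), x.2.2.1⟩)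
    (fun x _ => ⟨x.1 + x.2.2, (x.2.1.1 - 2 * x.2.2, x.2.1.2), (x.2.2, x.1)⟩) ?_ ?_ ?_ ?_ ?_
  · rintro ⟨k, ⟨q1, q2⟩, r1, r2⟩ h
    simp only [Finset.mem_sigma, Finset.mem_range, Finset.HasAntidiagonal.mem_antidiagonal] at h ⊢
    omega
  · rintro ⟨k, ⟨q1, q2⟩, j⟩ h
    simp only [Finset.mem_sigma, Finset.mem_range, Finset.HasAntidiagonal.mem_antidiagonal] at h ⊢
    omega
  · rintro ⟨k, ⟨q1, q2⟩, r1, r2⟩ h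
    simp only [Finset.mem_sigma, Finset.mem_range, Finset.HasAntidiagonal.mem_antidiagonal] at h
    obtain ⟨_, _, rfl⟩ := h
    simp [add_comm]
  · rintro ⟨k, ⟨q1, q2⟩, j⟩ h
    simp only [Finset.mem_sigma, Finset.mem_range, Finset.HasAntidiagonal.mem_antidiagonal] at h
    have : q1 - 2 * j + 2 * j = q1 := by omega
    simp [this]
  · rintro ⟨k, ⟨q1, q2⟩, r1, r2⟩ h
    simp

end Sums

/-- The coefficients `(2πi)^(-k) (k!)⁻¹`. -/
def chWeight (k : ℕ) : ℂ := ((2 * (Real.pi : ℂ) * Complex.I) ^ k * (k.factorial : ℂ))⁻¹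

/-- The factorial weights convert binomial expansions of `D^(2k)` into products of series, as for
the exponential function. -/
theorem chWeight_mul_choose (j l : ℕ) :
    chWeight (j + l) * ((j + l).choose j : ℂ) = chWeight l * chWeight j := by
  have h := congrArg (Nat.cast (R := ℂ)) (Nat.add_choose_mul_factorial_mul_factorial j l)
  have h1 : (j.factorial : ℂ) ≠ 0 := by exact_mod_cast j.factorial_ne_zero
  have h2 : (l.factorial : ℂ) ≠ 0 := by exact_mod_cast l.factorial_ne_zero
  have h3 : ((j + l).factorial : ℂ) ≠ 0 := by exact_mod_cast (j + l).factorial_ne_zero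
  have h4 : (2 * (Real.pi : ℂ) * Complex.I) ≠ 0 := by simp [Real.pi_ne_zero]
  push_cast at h
  unfold chWeight
  rw [pow_add]
  field_simp
  rw [Nat.choose_symm_add]
  linear_combination h

/-! ### Even powers of the covariant derivative -/

namespace BundleCalculus

variable {A : Type*} [Ring A] [StarRing A] [HopfAlgebra ℂ A] [StarModule ℂ A]
  {Γ : Type*} [Ring Γ] [Algebra ℂ Γ] [DGStarAlgebra Γ] {G : GroupCalculus A Γ}
  {V : Type*} [Ring V] [StarRing V] [Algebra ℂ V] [StarModule ℂ V]
  {B : Type*} [Ring B] [StarRing B] [Algebra ℂ B] [StarModule ℂ B] {P : Bundle A V B}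
  {Ω : Type*} [Ring Ω] [Algebra ℂ Ω] [DGStarAlgebra Ω] {S : BundleCalculus G P Ω}
  {u v : UnitaryRep A} (hA : IsCompactMatrixQuantumGroup A)

theorem parity_mem_hor {x : Ω} (hx : x ∈ S.hor) : parity x ∈ S.hor := by
  obtain ⟨N, hN⟩ := exists_sum_grProj x
  rw [hN N le_rfl, map_sum]
  refine sum_mem fun n _ => ?_
  rw [parity_of_mem (grProj_mem n x)]
  exact Submodule.smul_mem _ _ (S.grProj_mem_hor hx n)

namespace Connection

variable (ω : S.Connection)

theorem Drep_pow_apply (n : ℕ) (φ : u.ι → Ω) (i : u.ι) :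
    (ω.Drep u ^ n) φ i = (ω.D ^ n) (φ i) := by
  induction n with
  | zero => rfl
  | succ n ih => rw [pow_succ', pow_succ', Module.End.mul_apply, Module.End.mul_apply, ← ih]; rfl

theorem D_sq_mem_gr {n : ℕ} (k : ℕ) {x : Ω} (hx : x ∈ gr Ω n) :
    (ω.D ^ (2 * k)) x ∈ gr Ω (n + 2 * k) := by
  induction k with
  | zero => exact hx
  | succ k ih =>
    rw [mul_add, mul_one, add_comm (2 * k) 2, pow_add, pow_two, add_comm 2, ← add_assoc]
    exact ω.D_mem_gr (ω.D_mem_gr ih)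

include hA

theorem D_pow_mem_hor (n : ℕ) {x : Ω} (hx : x ∈ S.hor) : (ω.D ^ n) x ∈ S.hor := by
  induction n with
  | zero => exact hx
  | succ n ih => rw [pow_succ']; exact ω.D_mem_hor hA ih

variable {ω} (hω : ω.IsRegular)

include hω

/-- The two mixed terms `D(x) D(y)` cancel because `D` anticommutes with parity, which leaves the
Leibniz rule without signs. -/
theorem D_sq_mul {x y : Ω} (hx : x ∈ S.hor) (hy : y ∈ S.hor) :
    (ω.D ^ 2) (x * y) = (ω.D ^ 2) x * y + x * (ω.D ^ 2) y := by
  simp only [pow_two, Module.End.mul_apply]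
  rw [ω.D_mul hA hω hx hy, map_add, ω.D_mul hA hω (ω.D_mem_hor hA hx) hy,
    ω.D_mul hA hω (parity_mem_hor hx) (ω.D_mem_hor hA hy), D_parity, parity_parity]
  simp only [neg_mul]
  abel

theorem D_pow_mul (k : ℕ) {x y : Ω} (hx : x ∈ S.hor) (hy : y ∈ S.hor) :
    (ω.D ^ (2 * k)) (x * y) = ∑ r ∈ Finset.HasAntidiagonal.antidiagonal k,
      (k.choose r.1) • ((ω.D ^ (2 * r.1)) x * (ω.D ^ (2 * r.2)) y) := by
  induction k with
  | zero => simp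
  | succ k ih =>
    rw [Finset.sum_antidiagonal_choose_succ_nsmul
      (fun i j => (ω.D ^ (2 * i)) x * (ω.D ^ (2 * j)) y) k, mul_add, mul_one, add_comm,
      pow_add, Module.End.mul_apply, ih, map_sum, ← Finset.sum_add_distrib]
    refine Finset.sum_congr rfl fun r hr => ?_
    rw [Nat.choose_symm_of_eq_add (Finset.HasAntidiagonal.mem_antidiagonal.1 hr).symm, map_nsmul, D_sq_mul hA hω (ω.D_pow_mem_hor hA _ hx) (ω.D_pow_mem_hor hA _ hy),
      ← smul_add, add_comm]
    simp only [mul_add, mul_one, add_comm _ 2, pow_add, Module.End.mul_apply]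

end Connection

end BundleCalculus

/-! ### Additivity and multiplicativity of `ch` -/

namespace BundleCalculus

variable {A : Type*} [Ring A] [StarRing A] [HopfAlgebra ℂ A] [StarModule ℂ A]
  {Γ : Type*} [Ring Γ] [Algebra ℂ Γ] [DGStarAlgebra Γ] {G : GroupCalculus A Γ}
  {V : Type*} [Ring V] [StarRing V] [Algebra ℂ V] [StarModule ℂ V]
  {B : Type*} [Ring B] [StarRing B] [Algebra ℂ B] [StarModule ℂ B] {P : Bundle A V B}
  {Ω : Type*} [Ring Ω] [Algebra ℂ Ω] [DGStarAlgebra Ω] {S : BundleCalculus G P Ω}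
  {u v : UnitaryRep A} (hA : IsCompactMatrixQuantumGroup A)

theorem center_comm_of_mem_gr_zero {n : ℕ} {z α : Ω} (hz : z ∈ S.center n) (hα : α ∈ S.base)
    (h : α ∈ gr Ω 0) : z * α = α * z := by
  simpa using hz.2.2 0 α h hα

theorem parity_pow_of_mem {p : ℕ} (n : ℕ) {x : Ω} (hx : x ∈ gr Ω p) :
    (parity ^ n : Module.End ℂ Ω) x = (-1 : ℂ) ^ (n * p) • x := by
  induction n with
  | zero => simp
  | succ n ih =>
    rw [pow_succ', Module.End.mul_apply, ih, map_smul, parity_of_mem hx, smul_smul, ← pow_add]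
    congr 2; ring

theorem parity_pow_mul (n : ℕ) (x y : Ω) : (parity ^ n : Module.End ℂ Ω) (x * y) =
    (parity ^ n : Module.End ℂ Ω) x * (parity ^ n : Module.End ℂ Ω) y := by
  induction n with
  | zero => simp
  | succ n ih => simp only [pow_succ', Module.End.mul_apply, ih, parity_mul]

/-- Elements of the graded centre commute with forms on the base up to parity. -/
theorem center_mul_base {n : ℕ} {z α : Ω} (hz : z ∈ S.center n) (hα : α ∈ S.base) :
    (parity ^ n : Module.End ℂ Ω) α * z = z * α := by
  refine S.base_induction (p := fun α => (parity ^ n : Module.End ℂ Ω) α * z = z * α) hα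
    ?_ (by simp) ?_
  · intro m α hm hα
    rw [parity_pow_of_mem n hm, hz.2.2 m α hm hα, smul_mul_assoc]
  · intro α β h h'
    rw [map_add, add_mul, h, h', mul_add]

theorem mul_mem_center {m n : ℕ} {z w : Ω} (hz : z ∈ S.center m) (hw : w ∈ S.center n) :
    z * w ∈ S.center (m + n) := by
  refine ⟨mul_mem_gr hz.1 hw.1, S.mul_mem_base hz.2.1 hw.2.1, fun p α hα hαb => ?_⟩
  rw [mul_assoc, hw.2.2 p α hα hαb, mul_smul_comm, ← mul_assoc, hz.2.2 p α hα hαb, smul_mul_assoc,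
    smul_smul, ← pow_add, mul_assoc]
  congr 2; ring

theorem mulSeries_mem_Z {a b : ℕ → Ω} (ha : a ∈ S.Z) (hb : b ∈ S.Z) : mulSeries a b ∈ S.Z := by
  rw [mem_Z] at *
  intro n
  refine sum_mem fun q hq => ?_
  rw [← Finset.HasAntidiagonal.mem_antidiagonal.1 hq]
  exact mul_mem_center (ha _) (hb _)

section Trace

variable {K K' : Type} [Fintype K] [Fintype K'] (E : S.DualFamily u K) (E' : S.DualFamily v K')
  (ω : S.Connection)

/-- The map `z ↦ tr(z D^(2k))`. -/
def DualFamily.chTr (k : ℕ) : Ω →ₗ[ℂ] Ω :=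
  ∑ l, pairMinusHom u (E.ν l) ∘ₗ
    LinearMap.pi fun i => LinearMap.mulRight ℂ ((ω.D ^ (2 * k)) (E.μ l i))

theorem DualFamily.chTr_apply (k : ℕ) (z : Ω) : E.chTr ω k z =
    ∑ l, pairMinus u (E.ν l) fun i => z * (ω.D ^ (2 * k)) (E.μ l i) := by
  simp only [chTr, LinearMap.sum_apply]; rfl

include hA in
theorem DualFamily.chTr_sum (k : ℕ) (z : Ω) :
    (E.sum E').chTr ω k z = E.chTr ω k z + E'.chTr ω k z := by
  have e : ∀ k, pairMinus u (fun _ => (0 : Ω)) k = 0 := fun k => by simp [pairMinus]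
  have e' : ∀ k, pairMinus v (fun _ => (0 : Ω)) k = 0 := fun k => by simp [pairMinus]
  rw [chTr_apply, chTr_apply, chTr_apply, Fintype.sum_sum_type]
  congr 1
  · refine Finset.sum_congr rfl fun l _ => (pairMinus_sum hA _ _).trans ?_
    exact (congrArg _ (e' _)).trans (add_zero _)
  · refine Finset.sum_congr rfl fun l _ => (pairMinus_sum hA _ _).trans ?_
    exact (congrArg (· + _) (e _)).trans (zero_add _)

include hA in
theorem DualFamily.chTr_trivial (k : ℕ) (z : Ω) :
    (DualFamily.trivial S).chTr ω k z = if k = 0 then z else 0 := by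
  have e : (ω.D ^ (2 * k)) (1 : Ω) = if k = 0 then 1 else 0 := by
    rcases k with _ | k
    · simp
    · rw [if_neg k.succ_ne_zero, mul_add, mul_one, pow_succ, Module.End.mul_apply,
        ω.D_of_mem_base S.one_mem_base, dif_one, map_zero]
  rw [chTr_apply, Finset.univ_unique, Finset.sum_singleton]
  refine (pairMinus_trivial hA _ _).trans ?_
  change (1 : Ω) * (z * (ω.D ^ (2 * k)) (1 : Ω)) = _
  rw [e]; split_ifs <;> simp

variable {ω} (hω : ω.IsRegular)

include hA hω

/-- Through `chTr` each component of the series becomes a linear expression in `z`, defined on all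
forms. Hence it can be composed with itself and distributed over sums. -/
theorem Connection.ch_apply {z : ℕ → Ω} (hz : z ∈ S.Z) (n : ℕ) : ω.ch u z n =
    ∑ k ∈ Finset.range (n / 2 + 1), chWeight k • E.chTr ω k (z (n - 2 * k)) := by
  rw [ω.ch_eq_chH E hA hω hz]
  refine Finset.sum_congr rfl fun k _ => ?_
  rw [E.chTr_apply, E.trH_apply]
  unfold chWeight
  refine congrArg _ (Finset.sum_congr rfl fun l _ => congrArg _ (funext fun i => ?_))
  change z (n - 2 * k) * ((ω.DH u ^ (2 * k)) _).1 i = _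
  rw [ω.DH_pow_apply, ω.Drep_pow_apply]

theorem Connection.ch_sum {z : ℕ → Ω} (hz : z ∈ S.Z) :
    ω.ch (u.sum v) z = ω.ch u z + ω.ch v z := by
  obtain ⟨K, _, ⟨E⟩⟩ := S.exists_dualFamily hA u
  obtain ⟨K', _, ⟨E'⟩⟩ := S.exists_dualFamily hA v
  funext n
  rw [Pi.add_apply, ch_apply hA (E.sum E') hω hz, ch_apply hA E hω hz, ch_apply hA E' hω hz]
  simp only [DualFamily.chTr_sum hA, smul_add, Finset.sum_add_distrib]

theorem Connection.ch_trivial {z : ℕ → Ω} (hz : z ∈ S.Z) :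
    ω.ch UnitaryRep.trivial z = z := by
  funext n
  rw [ch_apply hA (DualFamily.trivial S) hω hz]
  simp only [DualFamily.chTr_trivial hA]
  rw [Finset.sum_eq_single 0]
  · simp [chWeight]
  · intro k _ hk; simp [hk]
  · simp

omit hω

/-- The maps `ch^u` take values in `Z(M)`. -/
theorem Connection.ch_mem_Z (hω : ω.IsRegular) {z : ℕ → Ω} (hz : z ∈ S.Z) : ω.ch u z ∈ S.Z := by
  obtain ⟨K, _, ⟨E⟩⟩ := S.exists_dualFamily hA u
  rw [ω.ch_eq_chH E hA hω hz]
  exact chH_mem_Z hA (ω.isTraceConnection hA hω E) hz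

theorem Connection.dSeries_ch (hω : ω.IsRegular) {z : ℕ → Ω} (hz : z ∈ S.Z) :
    dSeries (ω.ch u z) = ω.ch u (dSeries z) := by
  obtain ⟨K, _, ⟨E⟩⟩ := S.exists_dualFamily hA u
  rw [ω.ch_eq_chH E hA hω hz, ω.ch_eq_chH E hA hω (dSeries_mem_Z hz)]
  exact dSeries_chH (ω.isTraceConnection hA hω E) hz

theorem Connection.ch_sub_mem_coboundaries {ω' : S.Connection} (hω : ω.IsRegular)
    (hω' : ω'.IsRegular) {z : ℕ → Ω} (hz : z ∈ S.cocycles) :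
    ω.ch u z - ω'.ch u z ∈ S.coboundaries := by
  obtain ⟨K, _, ⟨E⟩⟩ := S.exists_dualFamily hA u
  rw [ω.ch_eq_chH E hA hω hz.1, ω'.ch_eq_chH E hA hω' hz.1]
  exact chH_sub_mem_coboundaries hA (ω'.isTraceConnection hA hω' E) (ω.isTraceConnection hA hω E) hz

end Trace

section TensorOperator

variable {K K' : Type} [Fintype K] [Fintype K'] (E : S.DualFamily u K) (E' : S.DualFamily v K')

omit [StarModule ℂ A] [DGStarAlgebra Ω] in
theorem sum_apply_prod {L : Type*} (s : Finset L) (f : L → (u.prod v).ι → Ω) (i : u.ι × v.ι) :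
    (∑ c ∈ s, f c) i = ∑ c ∈ s, f c i :=
  Finset.sum_apply (show (u.prod v).ι from i) s f

theorem tensor_expand (x : u.ι × v.ι → Ω) : x = ∑ l, fun i : u.ι × v.ι =>
    pairPlus v (fun j => x (i.1, j)) (E'.ν l) * E'.μ l i.2 := by
  funext i
  rw [Finset.sum_apply]
  have := congrFun (E'.expand fun j => x (i.1, j)) i.2
  rwa [Finset.sum_apply] at this

/-- The operator `a ⊗ b`, computed with a dual family. -/
def tensorOperator (a b : ℕ → Ω) (m : ℕ) : (u.ι × v.ι → Ω) →ₗ[ℂ] (u.ι × v.ι → Ω) :=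
  LinearMap.pi fun i => ∑ q ∈ Finset.HasAntidiagonal.antidiagonal m, ∑ l,
    LinearMap.mulRight ℂ (b q.2 * E'.μ l i.2) ∘ₗ LinearMap.mulLeft ℂ (a q.1) ∘ₗ
      (parity ^ q.2 : Module.End ℂ Ω) ∘ₗ
      ∑ j, LinearMap.mulRight ℂ (E'.ν l j) ∘ₗ LinearMap.proj (i.1, j)

theorem tensorOperator_apply (a b : ℕ → Ω) (m : ℕ) (x : u.ι × v.ι → Ω) (i : u.ι × v.ι) :
    tensorOperator E' a b m x i = ∑ q ∈ Finset.HasAntidiagonal.antidiagonal m, ∑ l,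
      a q.1 * (parity ^ q.2 : Module.End ℂ Ω) (pairPlus v (fun j => x (i.1, j)) (E'.ν l)) *
        (b q.2 * E'.μ l i.2) := by
  simp only [tensorOperator, pairPlus, LinearMap.pi_apply, LinearMap.sum_apply,
    LinearMap.comp_apply, LinearMap.mulRight_apply, LinearMap.mulLeft_apply, LinearMap.proj_apply]

/-- Expand `ψ` in the dual family. Graded centrality moves the coefficients `⟨ψ, ν_l⟩⁺` past `b`,
and the power of parity built into the operator absorbs the resulting sign. -/
theorem isTensorOperator_tensorOperator (a : ℕ → Ω) {b : ℕ → Ω} (hb : b ∈ S.Z) :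
    S.IsTensorOperator u v a b (tensorOperator E' a b) := by
  intro m p φ ψ _ hp hψ
  refine funext fun i : u.ι × v.ι => (tensorOperator_apply E' a b m _ i).trans ?_
  refine Eq.trans ?_ (sum_apply_prod _ _ i).symm
  refine Finset.sum_congr rfl fun q _ => ?_
  change _ = (-1 : ℂ) ^ (q.2 * p) • (a q.1 * φ i.1 * (b q.2 * ψ i.2))
  have e : ∀ l, a q.1 * (parity ^ q.2 : Module.End ℂ Ω)
      (pairPlus v (fun j => φ i.1 * ψ j) (E'.ν l)) * (b q.2 * E'.μ l i.2) =
      (-1 : ℂ) ^ (q.2 * p) •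
        (a q.1 * φ i.1 * (b q.2 * (pairPlus v ψ (E'.ν l) * E'.μ l i.2))) := by
    intro l
    rw [pairPlus_mul_left, parity_pow_mul, parity_pow_of_mem _ (hp _), ← mul_assoc (b q.2),
      ← center_mul_base (mem_Z.1 hb q.2) (pairPlus_mem_base v hψ (E'.ν_mem l))]
    simp only [mul_assoc, smul_mul_assoc, mul_smul_comm]
  refine (Finset.sum_congr rfl fun l _ => e l).trans ?_
  rw [← Finset.smul_sum, ← Finset.mul_sum, ← Finset.mul_sum]
  have := congrFun (E'.expand ψ) i.2
  rw [Finset.sum_apply] at this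
  rw [← this]

variable {a b : ℕ → Ω} {T : ℕ → ((u.prod v).ι → Ω) →ₗ[ℂ] ((u.prod v).ι → Ω)}

-- A tensor operator is prescribed only on products, but every element of `H (u.prod v)` is a sum of
-- products with second factors `μ_l`. The scalar reaches the first factor and commutes with `a`.
include E' in
theorem IsTensorOperator.apply_mul (hT : S.IsTensorOperator u v a b T) (ha : a ∈ S.Z) {α : Ω}
    (hα : α ∈ S.base) (hα0 : α ∈ gr Ω 0) {p : ℕ} {x : u.ι × v.ι → Ω} (hx : x ∈ S.H (u.prod v))
    (hp : ∀ i, x i ∈ gr Ω p) (m : ℕ) :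
    T m (fun i => α * x i) = fun i => α * T m x i := by
  let y : K' → u.ι → Ω := fun l i => pairPlus v (fun j => x (i, j)) (E'.ν l)
  have hy : ∀ l, y l ∈ S.H u := fun l => contract_mem hx (E'.ν_mem l)
  have hyp : ∀ l i, y l i ∈ gr Ω p := fun l i => pairPlus_mem_gr (fun j => hp _) (E'.ν_gr l)
  have e1 : x = ∑ l, (tensor (y l) (E'.μ l) : (u.prod v).ι → Ω) := tensor_expand E' x
  have e2 : (fun i => α * x i) =
      ∑ l, (tensor (fun i => α * y l i) (E'.μ l) : (u.prod v).ι → Ω) := by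
    have := congrArg (fun z : u.ι × v.ι → Ω => fun i => α * z i) (tensor_expand E' x)
    refine this.trans (funext fun i : u.ι × v.ι => ?_)
    refine Eq.trans ?_ (sum_apply_prod _ _ i).symm
    refine (congrArg (α * ·) (Finset.sum_apply i _ _)).trans ?_
    refine (Finset.mul_sum _ _ _).trans ?_
    exact Finset.sum_congr rfl fun l _ =>
      (mul_assoc α (pairPlus v (fun j => x (i.1, j)) (E'.ν l)) (E'.μ l i.2)).symm
  have e3 : T m (fun i => α * x i) =
      ∑ l, T m (tensor (fun i => α * y l i) (E'.μ l) : (u.prod v).ι → Ω) :=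
    (congrArg (T m) e2).trans (map_sum _ _ _)
  have e4 : T m x = ∑ l, T m (tensor (y l) (E'.μ l) : (u.prod v).ι → Ω) :=
    (congrArg (T m) e1).trans (map_sum _ _ _)
  rw [e3, e4]
  funext i
  rw [Finset.sum_apply, Finset.sum_apply, Finset.mul_sum]
  refine Finset.sum_congr rfl fun l _ => ?_
  rw [hT m p (y l) _ (hy l) (hyp l) (E'.μ_mem l),
    hT m p (fun i => α * y l i) _ (base_mul_mem_intertwiners hα (hy l))
      (fun i => by have := mul_mem_gr hα0 (hyp l i); rwa [zero_add] at this) (E'.μ_mem l)]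
  rw [Finset.sum_apply, Finset.sum_apply, Finset.mul_sum]
  refine Finset.sum_congr rfl fun q _ => ?_
  change (-1 : ℂ) ^ (q.2 * p) • (a q.1 * (α * y l (i : u.ι × v.ι).1) * (b q.2 * E'.μ l (i : u.ι × v.ι).2)) =
    α * ((-1 : ℂ) ^ (q.2 * p) • (a q.1 * y l (i : u.ι × v.ι).1 * (b q.2 * E'.μ l (i : u.ι × v.ι).2)))
  rw [mul_smul_comm, ← mul_assoc (a q.1),
    center_comm_of_mem_gr_zero (mem_Z.1 ha q.1) hα hα0]
  simp only [mul_assoc]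

variable {ω : S.Connection} (hω : ω.IsRegular)

include hA hω

theorem IsTensorOperator.isLeftLinear (hT : S.IsTensorOperator u v a b T) (ha : a ∈ S.Z)
    (m k : ℕ) : S.IsLeftLinear (u.prod v) fun μ => T m ((ω.Drep (u.prod v) ^ (2 * k)) μ) := by
  obtain ⟨K', _, ⟨E'⟩⟩ := S.exists_dualFamily hA v
  obtain ⟨K'', _, ⟨E''⟩⟩ := S.exists_dualFamily hA (u.prod v)
  refine ⟨fun μ μ' _ _ _ _ => by
    beta_reduce; rw [map_add, map_add], fun f μ hμ h0 => ?_⟩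
  have hf := S.mem_base_zero_iff.2 ⟨f, rfl⟩
  have hb := (ω.isTraceConnection hA hω E'').isBimodEnd_pow k
  have h1 := congrArg Subtype.val (hb.left 0 ⟨_, hf.1⟩ hf.2 ⟨μ, hμ⟩)
  rw [mul_zero, pow_zero, one_smul, ω.DH_pow_apply] at h1
  have h2 : (ω.Drep (u.prod v) ^ (2 * k)) (fun i => S.incl (P.i f) * μ i) =
      fun i => S.incl (P.i f) * ((ω.DH (u.prod v) ^ (2 * k)) ⟨μ, hμ⟩).1 i := h1
  have h3 := hT.apply_mul E' ha hf.1 hf.2 ((ω.DH (u.prod v) ^ (2 * k)) ⟨μ, hμ⟩).2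
    (p := 0 + 2 * k) (fun i => hb.degree 0 ⟨μ, hμ⟩ h0 i) m
  beta_reduce
  rw [h2]
  refine h3.trans ?_
  rw [ω.DH_pow_apply]

/-- Take the product dual family and the binomial formula for `D^(2k)`. The pairings nest, so the
inner sum is a trace over `u` that becomes a coefficient in the trace over `v`. -/
theorem IsTensorOperator.trM (hT : S.IsTensorOperator u v a b T) (ha : a ∈ S.Z) (m k : ℕ) :
    (S.trM (u.prod v) fun μ => T m ((ω.Drep (u.prod v) ^ (2 * k)) μ)) =
      ∑ q ∈ Finset.HasAntidiagonal.antidiagonal m, ∑ r ∈ Finset.HasAntidiagonal.antidiagonal k,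
        k.choose r.1 • E'.chTr ω r.2 (E.chTr ω r.1 (a q.1) * b q.2) := by
  rw [S.trM_eq_tr (E.prod E') (hT.isLeftLinear hA hω ha m k), DualFamily.tr]
  have e1 : ∀ l : K × K', (ω.Drep (u.prod v) ^ (2 * k)) ((E.prod E').μ l) =
      ∑ r ∈ Finset.HasAntidiagonal.antidiagonal k, k.choose r.1 •
        (tensor (fun i => (ω.D ^ (2 * r.1)) (E.μ l.1 i)) (fun j => (ω.D ^ (2 * r.2)) (E'.μ l.2 j)) :
          (u.prod v).ι → Ω) := by
    intro l
    funext i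
    rw [ω.Drep_pow_apply, Finset.sum_apply]
    exact Connection.D_pow_mul hA hω k (E.μ_mem l.1 _).1 (E'.μ_mem l.2 _).1
  have hmem : ∀ {w : UnitaryRep A} {φ : w.ι → Ω} (n : ℕ), φ ∈ S.H w →
      (fun i => (ω.D ^ n) (φ i)) ∈ S.H w := by
    intro w φ n hφ
    have h := ((ω.DH w ^ n) ⟨φ, hφ⟩).2
    rw [ω.DH_pow_apply] at h
    have e : (ω.Drep w ^ n) φ = fun i => (ω.D ^ n) (φ i) :=
      funext fun i => ω.Drep_pow_apply n φ i
    rwa [e] at h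
  have e2 : ∀ l : K × K', T m ((ω.Drep (u.prod v) ^ (2 * k)) ((E.prod E').μ l)) =
      ∑ r ∈ Finset.HasAntidiagonal.antidiagonal k, k.choose r.1 •
        ∑ q ∈ Finset.HasAntidiagonal.antidiagonal m,
        (tensor (fun i => a q.1 * (ω.D ^ (2 * r.1)) (E.μ l.1 i))
          (fun j => b q.2 * (ω.D ^ (2 * r.2)) (E'.μ l.2 j)) : (u.prod v).ι → Ω) := by
    intro l
    rw [e1, map_sum]
    refine Finset.sum_congr rfl fun r _ => ?_
    rw [map_nsmul, hT m (0 + 2 * r.1) _ _ (hmem _ (E.μ_mem l.1))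
      (fun i => ω.D_sq_mem_gr r.1 (E.μ_gr l.1 i)) (hmem _ (E'.μ_mem l.2))]
    refine congrArg _ (Finset.sum_congr rfl fun q _ => ?_)
    -- Even powers of `D` applied to elements of degree 0 have even degree, so no sign survives.
    have : (-1 : ℂ) ^ (q.2 * (0 + 2 * r.1)) = 1 := by
      rw [zero_add, mul_left_comm, pow_mul]; simp
    rw [this, one_smul]
  have e3 : ∀ (q r : ℕ × ℕ) (l : K × K'), pairMinus (u.prod v) ((E.prod E').ν l)
      (tensor (fun i => a q.1 * (ω.D ^ (2 * r.1)) (E.μ l.1 i))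
          (fun j => b q.2 * (ω.D ^ (2 * r.2)) (E'.μ l.2 j)) : (u.prod v).ι → Ω) =
      pairMinus v (E'.ν l.2) fun j => pairMinus u (E.ν l.1)
        (fun i => a q.1 * (ω.D ^ (2 * r.1)) (E.μ l.1 i)) * b q.2 *
          (ω.D ^ (2 * r.2)) (E'.μ l.2 j) := by
    intro q r l
    refine (pairMinus_prod hA _ _ _).trans ?_
    refine congrArg _ (funext fun j => ?_)
    rw [mul_assoc, ← pairMinus_mul_right]
    rfl
  have e4 : ∀ (q r : ℕ × ℕ), ∑ l : K × K', pairMinus (u.prod v) ((E.prod E').ν l)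
      (tensor (fun i => a q.1 * (ω.D ^ (2 * r.1)) (E.μ l.1 i))
          (fun j => b q.2 * (ω.D ^ (2 * r.2)) (E'.μ l.2 j)) : (u.prod v).ι → Ω) =
      E'.chTr ω r.2 (E.chTr ω r.1 (a q.1) * b q.2) := by
    intro q r
    simp only [e3]
    rw [Fintype.sum_prod_type, E.chTr_apply, Finset.sum_mul, map_sum]
    simp only [E'.chTr_apply]
  simp only [e2, ← pairMinusHom_apply, map_sum, map_nsmul]
  simp only [pairMinusHom_apply]
  rw [Finset.sum_comm]
  simp only [← Finset.smul_sum, Finset.sum_comm (s := (Finset.univ : Finset (K × K')))]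
  simp only [e4]
  simp only [Finset.smul_sum]
  exact Finset.sum_comm

/-- The Chern character of a product of representations. -/
theorem IsTensorOperator.chSeries (hT : S.IsTensorOperator u v a b T) (ha : a ∈ S.Z)
    (hb : b ∈ S.Z) : ω.chSeries (u.prod v) (fun n => T n) =
      ω.ch v (mulSeries (ω.ch u a) b) := by
  obtain ⟨K, _, ⟨E⟩⟩ := S.exists_dualFamily hA u
  obtain ⟨K', _, ⟨E'⟩⟩ := S.exists_dualFamily hA v
  funext n
  rw [Connection.ch_apply hA E' hω (mulSeries_mem_Z (Connection.ch_mem_Z hA hω ha) hb)]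
  have e1 : ∀ l m, chWeight l • E'.chTr ω l (mulSeries (ω.ch u a) b m) =
      ∑ q ∈ Finset.HasAntidiagonal.antidiagonal m, ∑ j ∈ Finset.range (q.1 / 2 + 1),
        (chWeight l * chWeight j) • E'.chTr ω l (E.chTr ω j (a (q.1 - 2 * j)) * b q.2) := by
    intro l m
    rw [mulSeries, map_sum, Finset.smul_sum]
    refine Finset.sum_congr rfl fun q _ => ?_
    rw [Connection.ch_apply hA E hω ha, Finset.sum_mul, map_sum, Finset.smul_sum]
    refine Finset.sum_congr rfl fun j _ => ?_
    rw [smul_mul_assoc, map_smul, smul_smul]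
  simp only [e1]
  -- The two nested expansions range over the same quadruples, counted by the degrees of `a` and `b`
  -- and the two curvature exponents.
  rw [← sum_quadruples n fun p s j l =>
    (chWeight l * chWeight j) • E'.chTr ω l (E.chTr ω j (a p) * b s)]
  refine Finset.sum_congr rfl fun k _ => ?_
  rw [hT.trM hA E E' hω ha, Finset.smul_sum]
  refine Finset.sum_congr rfl fun q _ => ?_
  rw [Finset.smul_sum]
  refine Finset.sum_congr rfl fun r hr => ?_
  rw [← Finset.HasAntidiagonal.mem_antidiagonal.1 hr, ← chWeight_mul_choose, mul_smul,
    Nat.cast_smul_eq_nsmul]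
  rfl

/-- `ch^(u × v) = ch^v ch^u` on `Z(M)`. -/
theorem Connection.ch_prod (ha : a ∈ S.Z) : ω.ch (u.prod v) a = ω.ch v (ω.ch u a) := by
  -- With `b = 1` the tensor operator is left multiplication by `a`, so the product formula
  -- specializes to the composition law.
  have h1 : Pi.single 0 1 ∈ S.Z := by
    rw [mem_Z]
    rintro (_ | n)
    · exact ⟨one_mem_gr, S.one_mem_base, fun m α _ _ => by simp⟩
    · exact zero_mem _
  let T : ℕ → ((u.prod v).ι → Ω) →ₗ[ℂ] ((u.prod v).ι → Ω) := fun n =>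
    LinearMap.pi fun i => LinearMap.mulLeft ℂ (a n) ∘ₗ LinearMap.proj i
  have hT : S.IsTensorOperator u v a (Pi.single 0 1) T := by
    intro m p φ ψ _ _ _
    rw [Finset.sum_eq_single (m, 0)]
    · funext i
      simp [T, tensor, mul_assoc]
    · rintro ⟨q1, q2⟩ hq hne
      rw [Finset.HasAntidiagonal.mem_antidiagonal] at hq
      have hq2 : q2 ≠ 0 := by rintro rfl; simp_all
      funext i
      simp [tensor, hq2]
    · intro h; simp at h
  have h2 : mulSeries (ω.ch u a) (Pi.single 0 1) = ω.ch u a := by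
    funext n
    rw [mulSeries, Finset.sum_eq_single (n, 0)]
    · simp
    · rintro ⟨q1, q2⟩ hq hne
      rw [Finset.HasAntidiagonal.mem_antidiagonal] at hq
      have hq2 : q2 ≠ 0 := by rintro rfl; simp_all
      simp [hq2]
    · intro h; simp at h
  rw [← h2, ← hT.chSeries hA hω ha h1]
  rfl

end TensorOperator

end BundleCalculus

/-! ### Transposable isomorphisms form an equivalence relation -/

namespace BundleCalculus

variable {A : Type*} [Ring A] [StarRing A] [HopfAlgebra ℂ A] [StarModule ℂ A]
  {Γ : Type*} [Ring Γ] [Algebra ℂ Γ] [DGStarAlgebra Γ] {G : GroupCalculus A Γ}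
  {V : Type*} [Ring V] [StarRing V] [Algebra ℂ V] [StarModule ℂ V]
  {B : Type*} [Ring B] [StarRing B] [Algebra ℂ B] [StarModule ℂ B] {P : Bundle A V B}
  {Ω : Type*} [Ring Ω] [Algebra ℂ Ω] [DGStarAlgebra Ω] {S : BundleCalculus G P Ω}
  {u v w : UnitaryRep A} (hA : IsCompactMatrixQuantumGroup A)

section TransposableIso

/-- The projection onto the homogeneous component of degree `n`. -/
def grProjH (n : ℕ) : Module.End ℂ (S.H u) where
  toFun x := ⟨fun i => grProj n (x.1 i), grProj_mem_intertwiners n x.2⟩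
  map_add' _ _ := Subtype.ext (funext fun _ => map_add _ _ _)
  map_smul' _ _ := Subtype.ext (funext fun _ => map_smul _ _ _)

theorem grProjH_of_mem {n : ℕ} {x : S.H u} (hx : ∀ i, x.1 i ∈ gr Ω n) : grProjH n x = x :=
  Subtype.ext (funext fun i => grProj_of_mem (hx i))

theorem grProjH_of_mem_ne {m n : ℕ} {x : S.H u} (hx : ∀ i, x.1 i ∈ gr Ω m) (h : m ≠ n) :
    grProjH n x = 0 :=
  Subtype.ext (funext fun i => grProj_of_mem_ne (hx i) h)

theorem map_grProjH {J : S.H u →ₗ[ℂ] S.H v}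
    (hJ : ∀ (n : ℕ) (x : S.H u), (∀ i, x.1 i ∈ gr Ω n) → ∀ j, (J x).1 j ∈ gr Ω n) (n : ℕ)
    (x : S.H u) : J (grProjH n x) = grProjH n (J x) := by
  refine H_induction (p := fun x => J (grProjH n x) = grProjH n (J x)) x ?_ (by simp) ?_
  · intro m y hy
    by_cases h : m = n
    · subst h
      rw [grProjH_of_mem hy, grProjH_of_mem (hJ m y hy)]
    · rw [grProjH_of_mem_ne hy h, grProjH_of_mem_ne (hJ m y hy) h, map_zero]
  · intro y z hy hz; simp only [map_add, hy, hz]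

theorem pairPlus_ext {K : Type} [Fintype K] (E : S.DualFamily u K) {y z : u.ι → Ω}
    (h : ∀ x : S.H u, pairPlus u x.1 y = pairPlus u x.1 z) : y = z := by
  rw [E.expand_dual y, E.expand_dual z]
  simp only [h (E.m _)]

theorem pairPlus_sum_left {L : Type*} (s : Finset L) (x : L → u.ι → Ω) (y : u.ι → Ω) :
    pairPlus u (∑ l ∈ s, x l) y = ∑ l ∈ s, pairPlus u (x l) y := by
  simp only [pairPlus, Finset.sum_apply, Finset.sum_mul]
  exact Finset.sum_comm

theorem pairPlus_sum_right {L : Type*} (s : Finset L) (x : u.ι → Ω) (y : L → u.ι → Ω) :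
    pairPlus u x (∑ l ∈ s, y l) = ∑ l ∈ s, pairPlus u x (y l) := by
  simp only [pairPlus, Finset.sum_apply, Finset.mul_sum]
  exact Finset.sum_comm

variable {J : S.H u ≃ₗ[ℂ] S.H v}

theorem isTransposableIso_of
    (degree : ∀ (n : ℕ) (x : S.H u), (∀ i, x.1 i ∈ gr Ω n) → ∀ j, (J x).1 j ∈ gr Ω n)
    (left : ∀ α x, J (S.lmul u α x) = S.lmul v α (J x))
    (right : ∀ α x, J (S.rmul u α x) = S.rmul v α (J x))
    (transposable : ∀ φ : S.HDual v, ∃ ψ : S.HDual u, ∀ x : S.H u,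
      pairMinus v φ.1 (J x).1 = pairMinus u ψ.1 x.1 ∧
        pairPlus v (J x).1 φ.1 = pairPlus u x.1 ψ.1) : S.IsTransposableIso J where
  degree := degree
  left α hα x y h j := by
    have e : y = S.lmul u ⟨α, hα⟩ x := Subtype.ext (funext h)
    rw [e, left]; rfl
  right α hα x y h j := by
    have e : y = S.rmul u ⟨α, hα⟩ x := Subtype.ext (funext h)
    rw [e, right]; rfl
  transposable := by
    choose J' hJ' using transposable
    exact ⟨J', hJ'⟩

namespace IsTransposableIso

theorem map_lmul (h : S.IsTransposableIso J) (α : S.base) (x : S.H u) :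
    J (S.lmul u α x) = S.lmul v α (J x) :=
  Subtype.ext (funext fun j => h.left α α.2 x _ (fun _ => rfl) j)

theorem map_rmul (h : S.IsTransposableIso J) (α : S.base) (x : S.H u) :
    J (S.rmul u α x) = S.rmul v α (J x) :=
  Subtype.ext (funext fun j => h.right α α.2 x _ (fun _ => rfl) j)

theorem symm_lmul (h : S.IsTransposableIso J) (α : S.base) (x : S.H v) :
    J.symm (S.lmul v α x) = S.lmul u α (J.symm x) := by
  rw [LinearEquiv.symm_apply_eq, h.map_lmul, LinearEquiv.apply_symm_apply]

theorem symm_rmul (h : S.IsTransposableIso J) (α : S.base) (x : S.H v) :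
    J.symm (S.rmul v α x) = S.rmul u α (J.symm x) := by
  rw [LinearEquiv.symm_apply_eq, h.map_rmul, LinearEquiv.apply_symm_apply]

/-- `J` commutes with the projections onto homogeneous components, hence so does its inverse. -/
theorem symm_degree (h : S.IsTransposableIso J) (n : ℕ) (y : S.H v)
    (hy : ∀ i, y.1 i ∈ gr Ω n) (j : u.ι) : (J.symm y).1 j ∈ gr Ω n := by
  have e : grProjH n (J.symm y) = J.symm y := J.injective <| by
    have := map_grProjH (J := J.toLinearMap) h.degree n (J.symm y)
    refine this.trans ?_
    rw [LinearEquiv.coe_coe, LinearEquiv.apply_symm_apply, grProjH_of_mem hy]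
  rw [← e]
  exact grProj_mem n _

include hA

/-- The transpose of `J⁻¹` sends `ψ` to `φ = ∑ ν_l ⟨J⁻¹ μ_l, ψ⟩⁺`, as the expansion over `v`
dictates for `⟨ , ⟩⁺`. Nondegeneracy of that pairing shows `J' φ = ψ`, and the identity for `⟨ , ⟩⁻`
follows from the one for `J`. -/
theorem symm (h : S.IsTransposableIso J) : S.IsTransposableIso J.symm := by
  obtain ⟨K, _, ⟨E⟩⟩ := S.exists_dualFamily hA u
  obtain ⟨K', _, ⟨E'⟩⟩ := S.exists_dualFamily hA v
  obtain ⟨J', hJ'⟩ := h.transposable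
  refine isTransposableIso_of h.symm_degree h.symm_lmul h.symm_rmul fun ψ => ?_
  have hmem : ∀ l, (fun i => E'.ν l i * pairPlus u (J.symm (E'.m l)).1 ψ.1) ∈ S.HDual v :=
    fun l => mul_base_mem_intertwiners (pairPlus_mem_base u (J.symm (E'.m l)).2 ψ.2) (E'.ν_mem l)
  let φ : S.HDual v := ⟨∑ l, fun i => E'.ν l i * pairPlus u (J.symm (E'.m l)).1 ψ.1,
    sum_mem fun l _ => hmem l⟩
  have h1 : ∀ y : S.H v, pairPlus u (J.symm y).1 ψ.1 = pairPlus v y.1 φ.1 := by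
    intro y
    conv_lhs => rw [E'.expand_H y]
    rw [map_sum, AddSubmonoidClass.coe_finsetSum, pairPlus_sum_left, pairPlus_sum_right]
    refine Finset.sum_congr rfl fun l _ => ?_
    rw [h.symm_lmul, pairPlus_mul_right]
    exact pairPlus_mul_left _ _ _
  have h2 : (J' φ).1 = ψ.1 := pairPlus_ext E fun x => by
    rw [← (hJ' φ x).2, ← h1, LinearEquiv.symm_apply_apply]
  refine ⟨φ, fun y => ⟨?_, h1 y⟩⟩
  have := (hJ' φ (J.symm y)).1
  rw [LinearEquiv.apply_symm_apply, h2] at this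
  exact this.symm

end IsTransposableIso

theorem BundleEquiv.refl (u : UnitaryRep A) : S.BundleEquiv u u :=
  ⟨LinearEquiv.refl ℂ _, isTransposableIso_of (fun _ _ h => h) (fun _ _ => rfl) (fun _ _ => rfl)
    fun φ => ⟨φ, fun _ => ⟨rfl, rfl⟩⟩⟩

include hA in
theorem BundleEquiv.symm (h : S.BundleEquiv u v) : S.BundleEquiv v u := by
  obtain ⟨J, hJ⟩ := h
  exact ⟨J.symm, hJ.symm hA⟩

theorem BundleEquiv.trans (h : S.BundleEquiv u v) (h' : S.BundleEquiv v w) :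
    S.BundleEquiv u w := by
  obtain ⟨J, hJ⟩ := h
  obtain ⟨K, hK⟩ := h'
  obtain ⟨J', hJ'⟩ := hJ.transposable
  obtain ⟨K', hK'⟩ := hK.transposable
  refine ⟨J.trans K, isTransposableIso_of (fun n x hx => hK.degree n _ (hJ.degree n x hx))
    (fun α x => ?_) (fun α x => ?_) fun φ => ⟨J' (K' φ), fun x => ⟨?_, ?_⟩⟩⟩
  · rw [LinearEquiv.trans_apply, hJ.map_lmul, hK.map_lmul]; rfl
  · rw [LinearEquiv.trans_apply, hJ.map_rmul, hK.map_rmul]; rfl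
  · exact (hK' φ (J x)).1.trans (hJ' (K' φ) x).1
  · exact (hK' φ (J x)).2.trans (hJ' (K' φ) x).2

end TransposableIso

/-! ### Equivalent representations have equivalent bimodules -/

section Equivalent

/-- Composition with a scalar matrix. -/
theorem comp_mem_intertwiners {ι κ : Type} [Fintype ι] [Fintype κ] {a : Matrix ι ι A}
    {b : Matrix κ κ A} {M : Matrix ι κ ℂ}
    (hM : a * M.map (algebraMap ℂ A) = M.map (algebraMap ℂ A) * b) {x : ι → Ω}
    (hx : x ∈ S.intertwiners a) : (fun j => ∑ i, M i j • x i) ∈ S.intertwiners b := by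
  intro j
  refine ⟨sum_mem fun i _ => Submodule.smul_mem _ _ (hx i).1, ?_⟩
  have e : ∀ k, ∑ i, M i j • a k i = ∑ i, M k i • b i j := by
    intro k
    have := congrFun (congrFun hM k) j
    simpa [Matrix.mul_apply, Algebra.smul_def, ← Algebra.commutes (R := ℂ)] using this
  simp only [map_sum, map_smul, (hx _).2, Finset.smul_sum, TensorProduct.sum_tmul,
    ← TensorProduct.smul_tmul']
  rw [Finset.sum_comm]
  rw [Finset.sum_comm (f := fun i k => M k i • x k ⊗ₜ[ℂ] b i j)]
  refine Finset.sum_congr rfl fun k _ => ?_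
  simp only [← TensorProduct.tmul_smul, ← TensorProduct.tmul_sum, e]

theorem IsMor.contra {g : Matrix u.ι v.ι ℂ} (hg : IsMor v u g) :
    QPB.contra v.mat * gᵀ.map (algebraMap ℂ A) = gᵀ.map (algebraMap ℂ A) * QPB.contra u.mat := by
  ext l i
  have := congrArg (HopfAlgebra.antipode ℂ) (congrFun (congrFun hg i) l)
  simp only [Matrix.mul_apply, Matrix.map_apply, ← Algebra.commutes (R := ℂ) (A := A),
    ← Algebra.smul_def, map_sum, map_smul] at this
  simp only [Matrix.mul_apply, Matrix.map_apply, Matrix.transpose_apply,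
    ← Algebra.commutes (R := ℂ) (A := A), ← Algebra.smul_def, contra_apply]
  exact this

/-- Composition of intertwiners with a morphism. -/
def compMor {g : Matrix u.ι v.ι ℂ} (hg : IsMor v u g) : S.H u →ₗ[ℂ] S.H v where
  toFun x := ⟨fun j => ∑ i, g i j • x.1 i, comp_mem_intertwiners hg.symm x.2⟩
  map_add' x y := Subtype.ext (funext fun j => by
    simp only [Submodule.coe_add, Pi.add_apply, smul_add, Finset.sum_add_distrib])
  map_smul' c x := Subtype.ext (funext fun j => by
    simp only [SetLike.val_smul, Pi.smul_apply, smul_comm _ c, Finset.smul_sum, RingHom.id_apply])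

theorem compMor_compMor {g : Matrix u.ι v.ι ℂ} (hg : IsMor v u g) {f : Matrix v.ι u.ι ℂ}
    (hf : IsMor u v f) (h : g * f = 1) (x : S.H u) : compMor hf (compMor hg x) = x := by
  refine Subtype.ext (funext fun k => ?_)
  change ∑ j, f j k • ∑ i, g i j • x.1 i = x.1 k
  have e : ∀ i, ∑ j, (f j k * g i j) = if i = k then 1 else 0 := by
    intro i
    have := congrFun (congrFun h i) k
    rw [Matrix.mul_apply, Matrix.one_apply] at this
    rw [← this]
    exact Finset.sum_congr rfl fun j _ => mul_comm _ _
  simp only [Finset.smul_sum, smul_smul]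
  rw [Finset.sum_comm]
  simp only [← Finset.sum_smul, e]
  simp

-- The isomorphism is composition with the inverse intertwiner `g`, and its transpose is composition
-- with the transposed matrix of `g`. For `⟨ , ⟩⁺` this is immediate; for `⟨ , ⟩⁻` it needs `g C_v⁻¹
-- = C_u⁻¹ g`.
include hA in
theorem BundleEquiv.of_equivalent (h : u.Equivalent v) : S.BundleEquiv u v := by
  obtain ⟨f, g, hfg, hgf, hf⟩ := h
  replace hf : IsMor u v f := hf
  have hg : IsMor v u g := by
    have e1 : f.map (algebraMap ℂ A) * g.map (algebraMap ℂ A) = 1 := by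
      rw [← Matrix.map_mul, hfg]; simp
    have e2 : g.map (algebraMap ℂ A) * f.map (algebraMap ℂ A) = 1 := by
      rw [← Matrix.map_mul, hgf]; simp
    unfold IsMor at *
    calc _ = g.map (algebraMap ℂ A) * (v.mat * f.map (algebraMap ℂ A)) *
          g.map (algebraMap ℂ A) := by
          rw [Matrix.mul_assoc, Matrix.mul_assoc, e1, Matrix.mul_one]
      _ = _ := by rw [← hf, ← Matrix.mul_assoc, e2, Matrix.one_mul]
  refine ⟨LinearEquiv.ofLinearMap (compMor hg) (compMor hf) (LinearMap.ext (compMor_compMor hf hg hfg))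
    (LinearMap.ext (compMor_compMor hg hf hgf)), isTransposableIso_of ?_ ?_ ?_ ?_⟩
  · intro n x hx j
    exact sum_mem fun i _ => Submodule.smul_mem _ _ (hx i)
  · intro α x
    refine Subtype.ext (funext fun j => ?_)
    change ∑ i, g i j • (α.1 * x.1 i) = α.1 * ∑ i, g i j • x.1 i
    simp only [Finset.mul_sum, mul_smul_comm]
  · intro α x
    refine Subtype.ext (funext fun j => ?_)
    change ∑ i, g i j • (x.1 i * α.1) = (∑ i, g i j • x.1 i) * α.1
    simp only [Finset.sum_mul, smul_mul_assoc]
  · intro φ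
    refine ⟨⟨fun i => ∑ j, gᵀ j i • φ.1 j, comp_mem_intertwiners (IsMor.contra hg) φ.2⟩,
      fun x => ⟨?_, ?_⟩⟩
    · change pairMinus v φ.1 (fun j => ∑ i, g i j • x.1 i) =
        pairMinus u (fun i => ∑ j, g i j • φ.1 j) x.1
      have hu := canonicalC_spec hA u
      have hv := canonicalC_spec hA v
      -- Naturality of the canonical intertwiners is what makes one transpose serve both pairings.
      have hn := IsCanonicalIntertwiner.naturality hv hu hg
      have hdu := (Matrix.isUnit_iff_isUnit_det _).1 hu.posDef.isUnit
      have hdv := (Matrix.isUnit_iff_isUnit_det _).1 hv.posDef.isUnit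
      have e : g * (canonicalC v)⁻¹ = (canonicalC u)⁻¹ * g := by
        calc _ = (canonicalC u)⁻¹ * (canonicalC u * g) * (canonicalC v)⁻¹ := by
              rw [← Matrix.mul_assoc, Matrix.nonsing_inv_mul _ hdu, Matrix.one_mul]
          _ = _ := by
              rw [hn, Matrix.mul_assoc, Matrix.mul_assoc, Matrix.mul_nonsing_inv _ hdv,
                Matrix.mul_one]
      have e' : ∀ i j, ∑ m, (canonicalC v)⁻¹ m j * g i m = ∑ m, (canonicalC u)⁻¹ i m * g m j := by
        intro i j
        have := congrFun (congrFun e i) j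
        rw [Matrix.mul_apply, Matrix.mul_apply] at this
        rw [← this]
        exact Finset.sum_congr rfl fun _ _ => mul_comm _ _
      simp only [pairMinus, Finset.mul_sum, Finset.sum_mul, Finset.smul_sum, mul_smul_comm,
        smul_mul_assoc, smul_smul]
      have l1 : ∀ j, ∑ m, ∑ i, ((canonicalC v)⁻¹ m j * g i m) • (φ.1 j * x.1 i) =
          ∑ i, (∑ m, (canonicalC u)⁻¹ i m * g m j) • (φ.1 j * x.1 i) := by
        intro j
        rw [Finset.sum_comm]
        simp only [← Finset.sum_smul, e']
      simp only [l1, Finset.sum_smul]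
      rw [Finset.sum_comm]
      refine Eq.trans ?_ Finset.sum_comm
      exact Finset.sum_congr rfl fun i _ => Finset.sum_comm
    · change pairPlus v (fun j => ∑ i, g i j • x.1 i) φ.1 =
        pairPlus u x.1 (fun i => ∑ j, g i j • φ.1 j)
      simp only [pairPlus, Finset.mul_sum, Finset.sum_mul, mul_smul_comm, smul_mul_assoc]
      exact Finset.sum_comm

end Equivalent

end BundleCalculus

/-! ### Compatibility of the equivalence with sums and products -/

namespace BundleCalculus

variable {A : Type*} [Ring A] [StarRing A] [HopfAlgebra ℂ A] [StarModule ℂ A]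
  {Γ : Type*} [Ring Γ] [Algebra ℂ Γ] [DGStarAlgebra Γ] {G : GroupCalculus A Γ}
  {V : Type*} [Ring V] [StarRing V] [Algebra ℂ V] [StarModule ℂ V]
  {B : Type*} [Ring B] [StarRing B] [Algebra ℂ B] [StarModule ℂ B] {P : Bundle A V B}
  {Ω : Type*} [Ring Ω] [Algebra ℂ Ω] [DGStarAlgebra Ω] {S : BundleCalculus G P Ω}
  {u v u' v' : UnitaryRep A} (hA : IsCompactMatrixQuantumGroup A)

section Sum

/-- The decomposition of the bimodule of a direct sum. -/
def sumEquiv (u v : UnitaryRep A) : S.H (u.sum v) ≃ₗ[ℂ] S.H u × S.H v where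
  toFun x := (⟨fun i => x.1 (Sum.inl i : u.ι ⊕ v.ι), inl_mem_intertwiners x.2⟩,
    ⟨fun i => x.1 (Sum.inr i : u.ι ⊕ v.ι), inr_mem_intertwiners x.2⟩)
  invFun x := ⟨(Sum.elim x.1.1 x.2.1 : u.ι ⊕ v.ι → Ω), sumElim_mem_intertwiners x.1.2 x.2.2⟩
  map_add' _ _ := rfl
  map_smul' _ _ := rfl
  left_inv x := Subtype.ext (funext fun i : u.ι ⊕ v.ι => by rcases i with i | i <;> rfl)
  right_inv _ := rfl

include hA in
theorem BundleEquiv.sum (h : S.BundleEquiv u u') (h' : S.BundleEquiv v v') :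
    S.BundleEquiv (u.sum v) (u'.sum v') := by
  obtain ⟨J, hJ⟩ := h
  obtain ⟨L, hL⟩ := h'
  obtain ⟨J', hJ'⟩ := hJ.transposable
  obtain ⟨L', hL'⟩ := hL.transposable
  refine ⟨(sumEquiv u v).trans ((J.prodCongr L).trans (sumEquiv u' v').symm),
    isTransposableIso_of ?_ ?_ ?_ ?_⟩
  · intro n x hx (j : u'.ι ⊕ v'.ι)
    rcases j with j | j
    · exact hJ.degree n (sumEquiv u v x).1 (fun i => hx (Sum.inl i : u.ι ⊕ v.ι)) j
    · exact hL.degree n (sumEquiv u v x).2 (fun i => hx (Sum.inr i : u.ι ⊕ v.ι)) j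
  · intro α x
    refine Subtype.ext (funext fun j : u'.ι ⊕ v'.ι => ?_)
    rcases j with j | j
    · exact congrArg (fun y : S.H u' => y.1 j) (hJ.map_lmul α (sumEquiv u v x).1)
    · exact congrArg (fun y : S.H v' => y.1 j) (hL.map_lmul α (sumEquiv u v x).2)
  · intro α x
    refine Subtype.ext (funext fun j : u'.ι ⊕ v'.ι => ?_)
    rcases j with j | j
    · exact congrArg (fun y : S.H u' => y.1 j) (hJ.map_rmul α (sumEquiv u v x).1)
    · exact congrArg (fun y : S.H v' => y.1 j) (hL.map_rmul α (sumEquiv u v x).2)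
  · intro φ
    have hφ : (φ.1 : u'.ι ⊕ v'.ι → Ω) ∈
        S.intertwiners (Matrix.fromBlocks (contra u'.mat) 0 0 (contra v'.mat)) := by
      rw [← contra_fromBlocks]; exact φ.2
    let φ₁ : S.HDual u' := ⟨_, inl_mem_intertwiners hφ⟩
    let φ₂ : S.HDual v' := ⟨_, inr_mem_intertwiners hφ⟩
    have hψ : (Sum.elim (J' φ₁).1 (L' φ₂).1 : u.ι ⊕ v.ι → Ω) ∈
        S.intertwiners (contra (Matrix.fromBlocks u.mat 0 0 v.mat)) := by
      rw [contra_fromBlocks]; exact sumElim_mem_intertwiners (J' φ₁).2 (L' φ₂).2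
    refine ⟨⟨_, hψ⟩, fun x => ⟨?_, ?_⟩⟩
    · refine (pairMinus_sum hA _ _).trans (Eq.trans ?_ (pairMinus_sum hA _ _).symm)
      exact congrArg₂ (· + ·) (hJ' φ₁ (sumEquiv u v x).1).1 (hL' φ₂ (sumEquiv u v x).2).1
    · refine (pairPlus_sum _ _).trans (Eq.trans ?_ (pairPlus_sum _ _).symm)
      exact congrArg₂ (· + ·) (hJ' φ₁ (sumEquiv u v x).1).2 (hL' φ₂ (sumEquiv u v x).2).2

end Sum

section Prod

/-- The product of intertwiners as a bilinear map. -/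
def tensorH (u v : UnitaryRep A) : S.H u →ₗ[ℂ] S.H v →ₗ[ℂ] S.H (u.prod v) :=
  LinearMap.mk₂ ℂ (fun x y => ⟨tensor x.1 y.1, tensor_mem x.2 y.2⟩)
    (fun _ _ _ => Subtype.ext (funext fun _ => add_mul _ _ _))
    (fun _ _ _ => Subtype.ext (funext fun _ => smul_mul_assoc _ _ _))
    (fun _ _ _ => Subtype.ext (funext fun _ => mul_add _ _ _))
    (fun _ _ _ => Subtype.ext (funext fun _ => mul_smul_comm _ _ _))

theorem tensorH_rmul (α : S.base) (x : S.H u) (y : S.H v) :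
    tensorH u v (S.rmul u α x) y = tensorH u v x (S.lmul v α y) :=
  Subtype.ext (funext fun _ => mul_assoc _ _ _)

theorem lmul_tensorH (α : S.base) (x : S.H u) (y : S.H v) :
    S.lmul _ α (tensorH u v x y) = tensorH u v (S.lmul u α x) y :=
  Subtype.ext (funext fun _ => (mul_assoc _ _ _).symm)

theorem rmul_tensorH (α : S.base) (x : S.H u) (y : S.H v) :
    S.rmul _ α (tensorH u v x y) = tensorH u v x (S.rmul v α y) :=
  Subtype.ext (funext fun _ => mul_assoc _ _ _)

theorem pairPlus_tensor (x : u.ι → Ω) (y : v.ι → Ω) (z : v.ι → Ω) (t : u.ι → Ω) :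
    pairPlus (u.prod v) (tensor x y) (cotensor z t) =
      pairPlus u (fun i => x i * pairPlus v y z) t := by
  refine (pairPlus_prod (u := u) (v := v) (fun i => x i.1 * y i.2) z t).trans ?_
  simp only [pairPlus_mul_left]

include hA in
theorem pairMinus_tensor (x : u.ι → Ω) (y : v.ι → Ω) (z : v.ι → Ω) (t : u.ι → Ω) :
    pairMinus (u.prod v) (cotensor z t) (tensor x y) =
      pairMinus v z (fun j => pairMinus u t x * y j) := by
  refine (pairMinus_prod (u := u) (v := v) hA z t (fun i => x i.1 * y i.2)).trans ?_
  simp only [pairMinus_mul_right]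

variable {K' : Type} [Fintype K'] (E' : S.DualFamily v K')

namespace DualFamily

/-- The components of an element of the bimodule of a product. -/
def component (u : UnitaryRep A) (l : K') : S.H (u.prod v) →ₗ[ℂ] S.H u where
  toFun x := ⟨fun i => pairPlus v (fun j => x.1 ((i, j) : u.ι × v.ι)) (E'.ν l),
    contract_mem x.2 (E'.ν_mem l)⟩
  map_add' x y := Subtype.ext (funext fun i => by
    change pairPlus v (fun j => x.1 ((i, j) : u.ι × v.ι) + y.1 ((i, j) : u.ι × v.ι)) _ =
      pairPlus v _ _ + pairPlus v _ _
    simp only [pairPlus, add_mul, Finset.sum_add_distrib])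
  map_smul' c x := Subtype.ext (funext fun i => by
    change pairPlus v (fun j => c • x.1 ((i, j) : u.ι × v.ι)) _ = c • pairPlus v _ _
    simp only [pairPlus, smul_mul_assoc, Finset.smul_sum])

theorem sum_tensorH_component (x : S.H (u.prod v)) :
    ∑ l, tensorH u v (E'.component u l x) (E'.m l) = x := by
  refine Subtype.ext ?_
  rw [AddSubmonoidClass.coe_finsetSum]
  exact (tensor_expand E' x.1).symm

theorem component_tensorH (l : K') (x : S.H u) (y : S.H v) :
    E'.component u l (tensorH u v x y) = S.rmul u (E'.coef y l) x := by
  refine Subtype.ext (funext fun i => ?_)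
  exact pairPlus_mul_left (u := v) (x.1 i) y.1 (E'.ν l)

/-- The product of bimodule homomorphisms. -/
def tensorMap (J : S.H u →ₗ[ℂ] S.H u') (L : S.H v →ₗ[ℂ] S.H v') :
    S.H (u.prod v) →ₗ[ℂ] S.H (u'.prod v') :=
  ∑ l, (tensorH u' v').flip (L (E'.m l)) ∘ₗ J ∘ₗ E'.component u l

theorem tensorMap_apply (J : S.H u →ₗ[ℂ] S.H u') (L : S.H v →ₗ[ℂ] S.H v')
    (x : S.H (u.prod v)) : E'.tensorMap J L x =
      ∑ l, tensorH u' v' (J (E'.component u l x)) (L (E'.m l)) := by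
  simp only [tensorMap, LinearMap.sum_apply]; rfl

theorem tensorMap_tensorH {J : S.H u →ₗ[ℂ] S.H u'} {L : S.H v →ₗ[ℂ] S.H v'}
    (hJ : ∀ α x, J (S.rmul u α x) = S.rmul u' α (J x))
    (hL : ∀ α x, L (S.lmul v α x) = S.lmul v' α (L x)) (x : S.H u) (y : S.H v) :
    E'.tensorMap J L (tensorH u v x y) = tensorH u' v' (J x) (L y) := by
  rw [tensorMap_apply]
  simp only [component_tensorH, hJ, tensorH_rmul, ← hL]
  rw [← map_sum, ← map_sum, ← E'.expand_H]

end DualFamily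

-- `J ⊗ L` is defined by components along a dual family of `v`. Since `J` is right linear and `L`
-- left linear, it is multiplicative on products, which span; all properties are checked there.
include hA in
theorem BundleEquiv.prod (h : S.BundleEquiv u u') (h' : S.BundleEquiv v v') :
    S.BundleEquiv (u.prod v) (u'.prod v') := by
  obtain ⟨J, hJ⟩ := h
  obtain ⟨L, hL⟩ := h'
  obtain ⟨J', hJ'⟩ := hJ.transposable
  obtain ⟨L', hL'⟩ := hL.transposable
  obtain ⟨K, _, ⟨E⟩⟩ := S.exists_dualFamily hA v
  obtain ⟨K', _, ⟨E'⟩⟩ := S.exists_dualFamily hA v'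
  let T : S.H (u.prod v) →ₗ[ℂ] S.H (u'.prod v') := E.tensorMap J.toLinearMap L.toLinearMap
  let T' : S.H (u'.prod v') →ₗ[ℂ] S.H (u.prod v) :=
    E'.tensorMap J.symm.toLinearMap L.symm.toLinearMap
  have hT : ∀ x y, T (tensorH u v x y) = tensorH u' v' (J x) (L y) :=
    E.tensorMap_tensorH hJ.map_rmul hL.map_lmul
  have hT' : ∀ x y, T' (tensorH u' v' x y) = tensorH u v (J.symm x) (L.symm y) :=
    E'.tensorMap_tensorH hJ.symm_rmul hL.symm_lmul
  have ind : ∀ {p : S.H (u.prod v) → Prop}, (∀ x y, p (tensorH u v x y)) → p 0 →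
      (∀ x y, p x → p y → p (x + y)) → ∀ x, p x := by
    intro p h1 h2 h3 x
    rw [← E.sum_tensorH_component x]
    exact Finset.sum_induction _ p h3 h2 fun l _ => h1 _ _
  have hTT' : ∀ x, T' (T x) = x := by
    refine ind (p := fun x => T' (T x) = x) (fun x y => ?_) (by simp) fun x y h h' => ?_
    · rw [hT, hT', LinearEquiv.symm_apply_apply, LinearEquiv.symm_apply_apply]
    · rw [map_add, map_add, h, h']
  have hT'T : ∀ x, T (T' x) = x := by
    intro x
    rw [← E'.sum_tensorH_component x, map_sum, map_sum]
    refine Finset.sum_congr rfl fun l _ => ?_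
    rw [hT', hT, LinearEquiv.apply_symm_apply, LinearEquiv.apply_symm_apply]
  refine ⟨LinearEquiv.ofLinearMap T T' (LinearMap.ext hT'T) (LinearMap.ext hTT'),
    isTransposableIso_of ?_ ?_ ?_ ?_⟩
  · intro n x hx j
    change (T x).1 j ∈ _
    have e : T x = ∑ l, tensorH u' v' (J (E.component u l x)) (L (E.m l)) := E.tensorMap_apply _ _ x
    rw [e, AddSubmonoidClass.coe_finsetSum, Finset.sum_apply]
    refine sum_mem fun l _ => ?_
    exact mul_mem_gr (m := n) (n := 0)
      (hJ.degree n _ (fun i => pairPlus_mem_gr (fun _ => hx _) (E.ν_gr l)) _)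
      (hL.degree 0 _ (E.m_gr l) _)
  · intro α x
    refine ind (p := fun x => T (S.lmul _ α x) = S.lmul _ α (T x)) (fun x y => ?_) (by simp)
      (fun x y h h' => ?_) x
    · rw [lmul_tensorH, hT, hT, hJ.map_lmul, lmul_tensorH]
    · rw [map_add, map_add, map_add, map_add, h, h']
  · intro α x
    refine ind (p := fun x => T (S.rmul _ α x) = S.rmul _ α (T x)) (fun x y => ?_) (by simp)
      (fun x y h h' => ?_) x
    · rw [rmul_tensorH, hT, hT, hL.map_rmul, rmul_tensorH]
    · rw [map_add, map_add, map_add, map_add, h, h']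
  · intro φ
    let n : K' → S.HDual v' := fun l => ⟨E'.ν l, E'.ν_mem l⟩
    let c : K' → S.HDual u' := fun l =>
      ⟨fun i => pairPlus v' (E'.μ l) (fun j => φ.1 ((i, j) : u'.ι × v'.ι)),
        contract_dual_mem φ.2 (E'.μ_mem l)⟩
    have hφ : φ.1 = ∑ l, (cotensor (n l).1 (c l).1 : (u'.prod v').ι → Ω) := by
      funext (i : u'.ι × v'.ι)
      refine Eq.trans ?_ (sum_apply_prod _ _ i).symm
      have := congrFun (E'.expand_dual fun j => φ.1 ((i.1, j) : u'.ι × v'.ι)) i.2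
      rwa [Finset.sum_apply] at this
    refine ⟨⟨∑ l, (cotensor (L' (n l)).1 (J' (c l)).1 : (u.prod v).ι → Ω), sum_mem fun l _ =>
      cotensor_mem (J' (c l)).2 (L' (n l)).2⟩, fun x => ?_⟩
    change pairMinus _ φ.1 (T x).1 = _ ∧ pairPlus _ (T x).1 φ.1 = _
    rw [hφ]
    refine ind (p := fun x => pairMinus _ (∑ l, (cotensor (n l).1 (c l).1 : (u'.prod v').ι → Ω))
      (T x).1 = pairMinus _ (∑ l, (cotensor (L' (n l)).1 (J' (c l)).1 : (u.prod v).ι → Ω)) x.1 ∧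
      pairPlus _ (T x).1 (∑ l, (cotensor (n l).1 (c l).1 : (u'.prod v').ι → Ω)) =
        pairPlus _ x.1 (∑ l, (cotensor (L' (n l)).1 (J' (c l)).1 : (u.prod v).ι → Ω)))
      (fun x y => ?_) ?_ (fun x y h h' => ?_) x
    · rw [hT]
      constructor
      · simp only [← pairMinusHom_apply, map_sum, LinearMap.sum_apply]
        refine Finset.sum_congr rfl fun l _ => ?_
        refine (pairMinus_tensor hA _ _ _ _).trans (Eq.trans ?_ (pairMinus_tensor hA _ _ _ _).symm)
        -- The inner pairing, over `u`, is transposed first. Its value is a form on the base and is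
        -- carried through `L` by left linearity before the outer pairing is transposed.
        let β : S.base := ⟨_, pairMinus_mem_base hA u' (J x).2 (c l).2⟩
        have e1 : pairMinus u (J' (c l)).1 x.1 = β.1 := ((hJ' (c l) x).1).symm
        rw [e1]
        have e2 := (hL' (n l) (S.lmul v β y)).1
        rw [hL.map_lmul] at e2
        exact e2
      · rw [pairPlus_sum_right, pairPlus_sum_right]
        refine Finset.sum_congr rfl fun l _ => ?_
        refine (pairPlus_tensor _ _ _ _).trans (Eq.trans ?_ (pairPlus_tensor _ _ _ _).symm)
        -- For `⟨ , ⟩⁺` the pairing over `v` is the inner one, and right linearity of `J` carries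
        -- its value.
        let β : S.base := ⟨_, pairPlus_mem_base v' (L y).2 (n l).2⟩
        have e1 : pairPlus v y.1 (L' (n l)).1 = β.1 := ((hL' (n l) y).2).symm
        rw [e1]
        have e2 := (hJ' (c l) (S.rmul u β x)).2
        rw [hJ.map_rmul] at e2
        exact e2
    · simp [pairMinus, pairPlus]
    · have ep : ∀ {w : UnitaryRep A} (x y z : w.ι → Ω),
          pairPlus w (x + y) z = pairPlus w x z + pairPlus w y z := by
        intro w x y z; simp [pairPlus, add_mul, Finset.sum_add_distrib]
      rw [map_add, Submodule.coe_add, Submodule.coe_add, ep, ep, ← pairMinusHom_apply,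
        ← pairMinusHom_apply, map_add, map_add]
      simp only [pairMinusHom_apply]
      exact ⟨congrArg₂ (· + ·) h.1 h'.1, congrArg₂ (· + ·) h.2 h'.2⟩

end Prod

/-! ### Transport of traces and connections along transposable isomorphisms -/

section Transfer

variable {K : Type} [Fintype K] {E : S.DualFamily u K}

/-- The derivation terms cancel on both sides. Linearity of the graded commutator is what allows
invariance of the trace to be applied to it, whereas `D T` and `T D` separately are not linear. -/
theorem IsTraceConnection.graded_commutator {D T : Module.End ℂ (S.H u)}
    (h : IsTraceConnection E D) {n : ℕ} (hT : IsBimodEnd n T) :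
    IsBimodEnd (n + 1) (D * T - (-1 : ℂ) ^ n • (T * D)) where
  degree p x hx i := by
    refine sub_mem ?_ (Submodule.smul_mem _ _ ?_)
    · exact h.degree _ _ (hT.degree p x hx) i
    · have := hT.degree _ _ (h.degree p x hx) i
      rwa [add_assoc, add_comm 1] at this
  left p α hα x := by
    have h1 : ((S.baseDif α : S.base) : Ω) ∈ gr Ω (p + 1) := dif_mem hα
    simp only [LinearMap.sub_apply, LinearMap.smul_apply, Module.End.mul_apply, hT.left p α hα,
      map_smul, h.left p α hα, map_add, hT.left _ _ h1, map_sub, smul_add, smul_sub, smul_smul,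
      ← pow_add]
    have e1 : (-1 : ℂ) ^ (n + n * (p + 1)) = (-1) ^ (n * p) := by
      rw [show n + n * (p + 1) = n * p + 2 * n by ring, pow_add, pow_mul]; simp
    rw [e1, show n * p + p = (n + 1) * p by ring, show n + (p + n * p) = (n + 1) * p + n by ring]
    abel
  right α x := by
    have e : T (S.parityH u x) = (-1 : ℂ) ^ n • S.parityH u (T x) := by
      refine H_induction (p := fun x => T (S.parityH u x) = (-1 : ℂ) ^ n • S.parityH u (T x)) x
        ?_ (by simp) ?_
      · intro m y hy
        have e1 : S.parityH u y = (-1 : ℂ) ^ m • y :=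
          Subtype.ext (funext fun i => parity_of_mem (hy i))
        have e2 : S.parityH u (T y) = (-1 : ℂ) ^ (m + n) • T y :=
          Subtype.ext (funext fun i => parity_of_mem (hT.degree m y hy i))
        rw [e1, e2, map_smul, smul_smul, pow_add, mul_left_comm, neg_one_pow_mul_self, mul_one]
      · intro y z hy hz; simp only [map_add, hy, hz, smul_add]
    simp only [LinearMap.sub_apply, LinearMap.smul_apply, Module.End.mul_apply, hT.right,
      h.right, map_add, e, map_sub, map_smul, smul_add, smul_smul, neg_one_pow_mul_self, one_smul]
    abel

end Transfer

end BundleCalculus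

namespace BundleCalculus

variable {A : Type*} [Ring A] [StarRing A] [HopfAlgebra ℂ A] [StarModule ℂ A]
  {Γ : Type*} [Ring Γ] [Algebra ℂ Γ] [DGStarAlgebra Γ] {G : GroupCalculus A Γ}
  {V : Type*} [Ring V] [StarRing V] [Algebra ℂ V] [StarModule ℂ V]
  {B : Type*} [Ring B] [StarRing B] [Algebra ℂ B] [StarModule ℂ B] {P : Bundle A V B}
  {Ω : Type*} [Ring Ω] [Algebra ℂ Ω] [DGStarAlgebra Ω] {S : BundleCalculus G P Ω}
  {u v : UnitaryRep A} (hA : IsCompactMatrixQuantumGroup A)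

section Transfer

variable {K K' : Type} [Fintype K] [Fintype K'] {E : S.DualFamily u K} {E' : S.DualFamily v K'}
  {J : S.H u ≃ₗ[ℂ] S.H v}

theorem conjRingEquiv_smul (J : S.H u ≃ₗ[ℂ] S.H v) (c : ℂ) (T : Module.End ℂ (S.H u)) :
    J.conjRingEquiv (c • T) = c • J.conjRingEquiv T :=
  LinearMap.ext fun x => map_smul J c (T (J.symm x))

namespace IsTransposableIso

theorem conj_lmul (h : S.IsTransposableIso J) (α : S.base) :
    J.conjRingEquiv (S.lmul u α) = S.lmul v α :=
  LinearMap.ext fun x => (h.map_lmul α _).trans (congrArg _ (J.apply_symm_apply x))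

theorem isBimodEnd (h : S.IsTransposableIso J) {n : ℕ} {T : Module.End ℂ (S.H u)}
    (hT : IsBimodEnd n T) : IsBimodEnd n (J.conjRingEquiv T) where
  degree p x hx i := h.degree _ _ (hT.degree p _ (h.symm_degree p x hx)) i
  left p α hα x := by
    change J (T (J.symm (S.lmul v α x))) = (-1 : ℂ) ^ (n * p) • S.lmul v α (J (T (J.symm x)))
    rw [h.symm_lmul, hT.left p α hα, map_smul, h.map_lmul]
  right α x := by
    change J (T (J.symm (S.rmul v α x))) = S.rmul v α (J (T (J.symm x)))
    rw [h.symm_rmul, hT.right, h.map_rmul]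

/-- The trace is invariant under transposable isomorphisms. -/
theorem trH_conj (h : S.IsTransposableIso J) {n : ℕ} {T : Module.End ℂ (S.H u)}
    (hT : IsBimodEnd n T) : E'.trH (J.conjRingEquiv T) = E.trH T := by
  obtain ⟨J', hJ'⟩ := h.transposable
  let n' : K' → S.HDual v := fun l => ⟨E'.ν l, E'.ν_mem l⟩
  have e1 : E'.trH (J.conjRingEquiv T) =
      ∑ l, pairMinus u (J' (n' l)).1 (T (J.symm (E'.m l))).1 := by
    rw [E'.trH_apply]
    exact Finset.sum_congr rfl fun l _ => (hJ' (n' l) (T (J.symm (E'.m l)))).1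
  rw [e1, E.sum_pairMinus hT (p := 0) (fun l => J.symm (E'.m l))
    (fun l => h.symm_degree 0 _ (E'.m_gr l)) fun l => (J' (n' l)).1, E.trH_apply,
    mul_zero, pow_zero, one_smul]
  refine Finset.sum_congr rfl fun k _ => congrArg (pairMinus u · _) (pairPlus_ext E fun x => ?_)
  rw [pairPlus_sum_right]
  -- The elements `J⁻¹ μ_l` and `J' ν_l` again give expansions over `u`. The transpose for `⟨ , ⟩⁺`
  -- is used here and that for `⟨ , ⟩⁻` in the first step, so a common `J'` is essential.
  have e2 : x = ∑ l, S.lmul u ⟨_, pairPlus_mem_base u x.2 (J' (n' l)).2⟩ (J.symm (E'.m l)) := by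
    apply J.injective
    rw [map_sum]
    conv_lhs => rw [E'.expand_H (J x)]
    refine Finset.sum_congr rfl fun l _ => ?_
    rw [h.map_lmul, LinearEquiv.apply_symm_apply]
    congr 2
    exact Subtype.ext (hJ' (n' l) x).2
  conv_rhs => rw [e2]
  rw [AddSubmonoidClass.coe_finsetSum, pairPlus_sum_left]
  refine Finset.sum_congr rfl fun l _ => ?_
  rw [pairPlus_mul_right]
  exact (pairPlus_mul_left _ _ _).symm

include hA

/-- The Leibniz rules transport because `J` is linear over the base and preserves degrees. The trace
formula transports by invariance of the trace, used for `T` and for its graded commutator with `D`.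
-/
theorem isTraceConnection_conj (h : S.IsTransposableIso J) {D : Module.End ℂ (S.H v)}
    (hD : IsTraceConnection E' D) : IsTraceConnection E (J.symm.conjRingEquiv D) where
  degree p x hx i := h.symm_degree _ _ (hD.degree p _ (h.degree p x hx)) i
  left p α hα x := by
    change J.symm (D (J (S.lmul u α x))) = _ + (-1 : ℂ) ^ p • S.lmul u α (J.symm (D (J x)))
    rw [h.map_lmul, hD.left p α hα, map_add, map_smul, h.symm_lmul, h.symm_lmul,
      LinearEquiv.symm_apply_apply]
  right α x := by
    have e : S.parityH v (J x) = J (S.parityH u x) := by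
      refine H_induction (p := fun x => S.parityH v (J x) = J (S.parityH u x)) x ?_ (by simp) ?_
      · intro m y hy
        have e1 : S.parityH u y = (-1 : ℂ) ^ m • y :=
          Subtype.ext (funext fun i => parity_of_mem (hy i))
        have e2 : S.parityH v (J y) = (-1 : ℂ) ^ m • J y :=
          Subtype.ext (funext fun i => parity_of_mem (h.degree m y hy i))
        rw [e1, e2, map_smul]
      · intro y z hy hz; simp only [map_add, hy, hz]
    change J.symm (D (J (S.rmul u α x))) = S.rmul u α (J.symm (D (J x))) + _
    rw [h.map_rmul, hD.right, map_add, e, h.symm_rmul, h.symm_rmul, LinearEquiv.symm_apply_apply]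
  trace n T hT := by
    have hX := h.isBimodEnd hT
    have e1 : J.symm.conjRingEquiv (J.conjRingEquiv T) = T := J.conjRingEquiv.symm_apply_apply T
    have e2 := (h.symm hA).trH_conj (E := E') (E' := E) (hD.graded_commutator hX)
    rw [← h.trH_conj (E := E) (E' := E') hT, hD.trace n _ hX, ← map_smul, ← map_sub, ← e2, map_sub,
      conjRingEquiv_smul, map_mul, map_mul, e1, map_sub, map_smul]

theorem chH_conj (h : S.IsTransposableIso J) {D : Module.End ℂ (S.H v)}
    (hD : IsTraceConnection E' D) {z : ℕ → Ω} (hz : z ∈ S.Z) :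
    chH E (J.symm.conjRingEquiv D) hz = chH E' D hz := by
  funext n
  refine Finset.sum_congr rfl fun k _ => congrArg _ ?_
  have e : J.symm.conjRingEquiv (S.lmul v (baseOf hz (n - 2 * k)) * D ^ (2 * k)) =
      S.lmul u (baseOf hz (n - 2 * k)) * J.symm.conjRingEquiv D ^ (2 * k) := by
    rw [map_mul, map_pow, (h.symm hA).conj_lmul]
  rw [← e]
  exact (h.symm hA).trH_conj (hD.isBimodEnd_lmul_pow (z := baseOf hz (n - 2 * k))
    (mem_Z.1 hz (n - 2 * k)) k)

end IsTransposableIso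

include hA in
/-- Equivalent bundles have the same Chern character in cohomology. -/
theorem BundleEquiv.ch_sub_mem_coboundaries (h : S.BundleEquiv u v) {ω : S.Connection}
    (hω : ω.IsRegular) {z : ℕ → Ω} (hz : z ∈ S.cocycles) :
    ω.ch u z - ω.ch v z ∈ S.coboundaries := by
  obtain ⟨J, hJ⟩ := h
  obtain ⟨K, _, ⟨E⟩⟩ := S.exists_dualFamily hA u
  obtain ⟨K', _, ⟨E'⟩⟩ := S.exists_dualFamily hA v
  have hD := ω.isTraceConnection hA hω E'
  rw [ω.ch_eq_chH E hA hω hz.1, ω.ch_eq_chH E' hA hω hz.1, ← hJ.chH_conj (E := E) hA hD]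
  -- The connection transported from `H v` need not be the covariant derivative of `H u`; the
  -- transgression compares the two.
  exact chH_sub_mem_coboundaries hA (hJ.isTraceConnection_conj hA hD)
    (ω.isTraceConnection hA hω E) hz

end Transfer

/-! ### The action on cohomology -/

section Cohomology

variable {ω : S.Connection} (hω : ω.IsRegular)

include hA hω

theorem Connection.ch_add {y z : ℕ → Ω} (hy : y ∈ S.Z) (hz : z ∈ S.Z) :
    ω.ch u (y + z) = ω.ch u y + ω.ch u z := by
  obtain ⟨K, _, ⟨E⟩⟩ := S.exists_dualFamily hA u
  funext n
  rw [Pi.add_apply, ch_apply hA E hω hy, ch_apply hA E hω hz, ch_apply hA E hω (add_mem hy hz)]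
  simp only [Pi.add_apply, map_add, smul_add, Finset.sum_add_distrib]

theorem Connection.ch_smul (c : ℂ) {z : ℕ → Ω} (hz : z ∈ S.Z) :
    ω.ch u (c • z) = c • ω.ch u z := by
  obtain ⟨K, _, ⟨E⟩⟩ := S.exists_dualFamily hA u
  funext n
  rw [Pi.smul_apply, ch_apply hA E hω hz, ch_apply hA E hω (Submodule.smul_mem _ c hz)]
  simp only [Pi.smul_apply, map_smul, Finset.smul_sum, smul_comm c]

theorem Connection.ch_mem_cocycles {z : ℕ → Ω} (hz : z ∈ S.cocycles) :
    ω.ch u z ∈ S.cocycles := by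
  refine ⟨Connection.ch_mem_Z hA hω hz.1, LinearMap.mem_ker.2 ?_⟩
  have h0 : ω.ch u (0 : ℕ → Ω) = 0 := by
    have := Connection.ch_smul (u := u) hA hω 0 (zero_mem S.Z)
    simpa using this
  rw [Connection.dSeries_ch hA hω hz.1, LinearMap.mem_ker.1 hz.2, h0]

variable (u)

/-- The action of a representation on closed elements of `Z(M)`. -/
def chCocycles : S.cocycles →ₗ[ℂ] S.cocycles where
  toFun z := ⟨ω.ch u z, Connection.ch_mem_cocycles hA hω z.2⟩
  map_add' y z := Subtype.ext (Connection.ch_add hA hω y.2.1 z.2.1)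
  map_smul' c z := Subtype.ext (Connection.ch_smul hA hω c z.2.1)

/-- The action of a representation on the cohomology of `Z(M)`. -/
def chHZ : Module.End ℂ S.HZ :=
  Submodule.mapQ _ _ (chCocycles u hA hω) <| by
    rintro z ⟨y, hy, hyz⟩
    refine ⟨ω.ch u y, Connection.ch_mem_Z hA hω hy, ?_⟩
    rw [Connection.dSeries_ch hA hω hy, hyz]
    rfl

omit hA hω in
theorem cls_eq {y z : S.cocycles} (h : (y : ℕ → Ω) - z ∈ S.coboundaries) : S.cls y = S.cls z :=
  (Submodule.Quotient.eq _).2 h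

omit hA hω in
theorem HZ_hom_ext {f g : Module.End ℂ S.HZ} (h : ∀ z, f (S.cls z) = g (S.cls z)) : f = g := by
  refine LinearMap.ext fun x => ?_
  obtain ⟨z, rfl⟩ := Submodule.Quotient.mk_surjective _ x
  exact h z

theorem chHZ_sum (v : UnitaryRep A) :
    chHZ (u.sum v) hA hω = chHZ u hA hω + chHZ v hA hω :=
  HZ_hom_ext fun z => congrArg S.cls (Subtype.ext (Connection.ch_sum hA hω z.2.1) :
    chCocycles (u.sum v) hA hω z = chCocycles u hA hω z + chCocycles v hA hω z)

/-- The factor of `u` acts first, so the order of composition is reversed. Hence the opposite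
endomorphism ring and a right module. -/
theorem chHZ_prod (v : UnitaryRep A) :
    chHZ (u.prod v) hA hω = chHZ v hA hω * chHZ u hA hω :=
  HZ_hom_ext fun z => congrArg S.cls (Subtype.ext (Connection.ch_prod hA hω z.2.1) :
    chCocycles (u.prod v) hA hω z = chCocycles v hA hω (chCocycles u hA hω z))

theorem chHZ_trivial : chHZ UnitaryRep.trivial hA hω = 1 :=
  HZ_hom_ext fun z => congrArg S.cls (Subtype.ext (Connection.ch_trivial hA hω z.2.1) :
    chCocycles UnitaryRep.trivial hA hω z = z)

theorem chHZ_eq {v : UnitaryRep A} (h : S.BundleEquiv u v) : chHZ u hA hω = chHZ v hA hω :=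
  HZ_hom_ext fun z => cls_eq (h.ch_sub_mem_coboundaries hA hω z.2)

/-- The right action of the `K`-ring of bundles on the cohomology of `Z(M)`. -/
def chRingHom : S.KMP →+* (Module.End ℂ S.HZ)ᵐᵒᵖ :=
  RingQuot.lift ⟨(FreeAlgebra.lift ℤ fun u => MulOpposite.op (chHZ u hA hω)).toRingHom, by
    intro x y h
    simp only [AlgHom.toRingHom_eq_coe, RingHom.coe_coe]
    cases h with
    | rel u v h => rw [FreeAlgebra.lift_ι_apply, FreeAlgebra.lift_ι_apply, chHZ_eq u hA hω h]
    | sum u v =>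
      rw [map_add, FreeAlgebra.lift_ι_apply, FreeAlgebra.lift_ι_apply, FreeAlgebra.lift_ι_apply,
        chHZ_sum u hA hω, MulOpposite.op_add]
    | prod u v =>
      rw [map_mul, FreeAlgebra.lift_ι_apply, FreeAlgebra.lift_ι_apply, FreeAlgebra.lift_ι_apply,
        chHZ_prod u hA hω, MulOpposite.op_mul]
    | one => rw [map_one, FreeAlgebra.lift_ι_apply, chHZ_trivial hA hω, MulOpposite.op_one]⟩

theorem chRingHom_mk : chRingHom hA hω (KRing.mk _ u) = MulOpposite.op (chHZ u hA hω) := by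
  refine (RingQuot.lift_mkRingHom_apply _ _ _).trans ?_
  exact FreeAlgebra.lift_ι_apply _ _

end Cohomology

end BundleCalculus

/-! ### Homomorphisms of `K`-rings -/

section KRing

variable {A : Type*} [Ring A] [StarRing A] [HopfAlgebra ℂ A]

/-- The homomorphism of `K`-rings induced by an inclusion of equivalence relations. -/
def KRing.map {r s : UnitaryRep A → UnitaryRep A → Prop} (h : ∀ u v, r u v → s u v) :
    KRing r →+* KRing s :=
  RingQuot.lift ⟨RingQuot.mkRingHom (KRel s), fun x y hxy => RingQuot.mkRingHom_rel <| by
    cases hxy with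
    | rel u v huv => exact KRel.rel u v (h u v huv)
    | sum u v => exact KRel.sum u v
    | prod u v => exact KRel.prod u v
    | one => exact KRel.one⟩

theorem KRing.map_mkRingHom {r s : UnitaryRep A → UnitaryRep A → Prop} (h : ∀ u v, r u v → s u v)
    (x : FreeAlgebra ℤ (UnitaryRep A)) :
    KRing.map h (RingQuot.mkRingHom (KRel r) x) = RingQuot.mkRingHom (KRel s) x :=
  RingQuot.lift_mkRingHom_apply _ _ _

theorem KRing.map_surjective {r s : UnitaryRep A → UnitaryRep A → Prop}
    (h : ∀ u v, r u v → s u v) : Function.Surjective (KRing.map h) := by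
  intro y
  obtain ⟨x, rfl⟩ := RingQuot.mkRingHom_surjective _ y
  exact ⟨_, KRing.map_mkRingHom h x⟩

end KRing

end QPB

end

/-! ### The main theorem -/

open QPB in
theorem mainTheorem5
    -- the compact matrix quantum group and the calculus on it
    {A : Type*} [Ring A] [StarRing A] [HopfAlgebra ℂ A] [StarModule ℂ A]
    (hA : IsCompactMatrixQuantumGroup A)
    {Γ : Type*} [Ring Γ] [Algebra ℂ Γ] [DGStarAlgebra Γ] (G : GroupCalculus A Γ)
    -- the bundle and the calculus on it
    {V : Type*} [Ring V] [StarRing V] [Algebra ℂ V] [StarModule ℂ V]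
    {B : Type*} [Ring B] [StarRing B] [Algebra ℂ B] [StarModule ℂ B] (P : Bundle A V B)
    {Ω : Type*} [Ring Ω] [Algebra ℂ Ω] [DGStarAlgebra Ω] (S : BundleCalculus G P Ω)
    (hreg : ∃ ω : S.Connection, ω.IsRegular) :
    -- the canonical intertwiner, the trace and the covariant derivative are well defined
    (∀ u : UnitaryRep A, ∃! C, IsCanonicalIntertwiner u C) ∧
    (∀ u : UnitaryRep A, (∃ L, S.IsDualFamily u L) ∧
      ∀ L T, S.IsDualFamily u L → S.IsLeftLinear u T →
        S.trM u T = BundleCalculus.traceAlong u L T) ∧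
    (∀ ω : S.Connection, ω.IsRegular → Disjoint S.hor ω.vertOne ∧
      ∀ φ ∈ S.hor, ω.D φ ∈ S.hor ∧ dif φ - ω.D φ ∈ ω.vertOne) ∧
    -- the maps `ch^u` on `Z(M)`
    (∀ ω : S.Connection, ω.IsRegular →
      (∀ u : UnitaryRep A, ∀ a ∈ S.Z, ω.ch u a ∈ S.Z) ∧
      (∀ u v : UnitaryRep A, ∀ a ∈ S.Z, ω.ch (u.sum v) a = ω.ch u a + ω.ch v a) ∧
      (∀ u v : UnitaryRep A, ∀ a ∈ S.Z, ∀ b ∈ S.Z,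
        (∃ T, S.IsTensorOperator u v a b T) ∧
        ∀ T, S.IsTensorOperator u v a b T →
          ω.chSeries (u.prod v) (fun n => T n) =
            ω.ch v (BundleCalculus.mulSeries (ω.ch u a) b)) ∧
      (∀ u : UnitaryRep A, ∀ a ∈ S.Z,
        BundleCalculus.dSeries (ω.ch u a) = ω.ch u (BundleCalculus.dSeries a))) ∧
    -- independence of the connection on cohomology
    (∀ ω ω' : S.Connection, ω.IsRegular → ω'.IsRegular →
      ∀ u : UnitaryRep A, ∀ a ∈ S.cocycles, ω.ch u a - ω'.ch u a ∈ S.coboundaries) ∧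
    -- the equivalence of vector bundles is compatible with the operations
    (Equivalence S.BundleEquiv ∧
      (∀ u v : UnitaryRep A, u.Equivalent v → S.BundleEquiv u v) ∧
      ∀ u u' v v' : UnitaryRep A, S.BundleEquiv u u' → S.BundleEquiv v v' →
        S.BundleEquiv (u.sum v) (u'.sum v') ∧ S.BundleEquiv (u.prod v) (u'.prod v')) ∧
    -- the right `K(G)`-module structure on `HZ(M)` factors through `K(M,P)`
    ∃ p : KG A →+* S.KMP, (∀ u, p (KRing.mk _ u) = KRing.mk _ u) ∧ Function.Surjective p ∧
    ∃ chG : KG A →+* (Module.End ℂ S.HZ)ᵐᵒᵖ,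
      (∀ ω : S.Connection, ω.IsRegular → ∀ (u : UnitaryRep A) (z : S.cocycles),
        ∃ w : S.cocycles, (w : ℕ → Ω) = ω.ch u z ∧
          (chG (KRing.mk _ u)).unop (S.cls z) = S.cls w) ∧
    ∃ chM : S.KMP →+* (Module.End ℂ S.HZ)ᵐᵒᵖ,
      (∀ k, chM (p k) = chG k) ∧
      ∀ f : S.HZ → S.KMP → S.HZ, (∀ x k, f x (p k) = (chG k).unop x) →
        ∀ x k, f x k = (chM k).unop x := by
  obtain ⟨ω₀, hω₀⟩ := hreg
  have hequiv : ∀ u v : UnitaryRep A, u.Equivalent v → S.BundleEquiv u v :=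
    fun _ _ h => BundleCalculus.BundleEquiv.of_equivalent hA h
  refine ⟨existsUnique_isCanonicalIntertwiner hA, fun u => ⟨S.exists_isDualFamily hA u,
    fun L T hL hT => S.trM_eq_traceAlong hL hT⟩, fun ω hω => ⟨ω.disjoint_hor_vertOne,
    fun φ hφ => ⟨ω.D_mem_hor hA hφ, ω.dif_sub_D_mem_vertOne hA hφ⟩⟩, fun ω hω => ⟨?_, ?_, ?_, ?_⟩,
    ?_, ⟨⟨BundleCalculus.BundleEquiv.refl, BundleCalculus.BundleEquiv.symm hA,
      BundleCalculus.BundleEquiv.trans⟩, hequiv,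
      fun u u' v v' h h' => ⟨h.sum hA h', h.prod hA h'⟩⟩,
    KRing.map hequiv, fun u => KRing.map_mkRingHom hequiv _, KRing.map_surjective hequiv,
    (BundleCalculus.chRingHom hA hω₀).comp (KRing.map hequiv), ?_,
    BundleCalculus.chRingHom hA hω₀, fun k => rfl, ?_⟩
  · exact fun u a ha => BundleCalculus.Connection.ch_mem_Z hA hω ha
  · exact fun u v a ha => BundleCalculus.Connection.ch_sum hA hω ha
  · intro u v a ha b hb
    obtain ⟨K, _, ⟨E⟩⟩ := S.exists_dualFamily hA v
    exact ⟨⟨_, BundleCalculus.isTensorOperator_tensorOperator E a hb⟩,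
      fun T hT => hT.chSeries hA hω ha hb⟩
  · exact fun u a ha => BundleCalculus.Connection.dSeries_ch hA hω ha
  · exact fun ω ω' hω hω' u a ha =>
      BundleCalculus.Connection.ch_sub_mem_coboundaries hA hω hω' ha
  -- The action was built from the fixed connection `ω₀`; any other regular connection gives the
  -- same class.
  · intro ω hω u z
    refine ⟨⟨_, BundleCalculus.Connection.ch_mem_cocycles hA hω z.2⟩, rfl, ?_⟩
    rw [RingHom.comp_apply, KRing.mk, KRing.map_mkRingHom]
    refine (congrArg (fun f => f.unop (S.cls z)) (BundleCalculus.chRingHom_mk u hA hω₀)).trans ?_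
    exact BundleCalculus.cls_eq
      (BundleCalculus.Connection.ch_sub_mem_coboundaries hA hω₀ hω z.2)
  -- Every element of `K(M,P)` is in the image of `p`, so the values of `f` are forced.
  · intro f hf x k
    obtain ⟨k, rfl⟩ := KRing.map_surjective hequiv k
    exact hf x k
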